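/- **Setting.** Let $(\mathcal P,\pi)$ be a vertical plane: $\mathcal P$ is a topological space homeomorphic to $\mathbb R^2$ and $\pi:\mathcal P\to\mathbb R$ is a locally trivial topological fibration (its fibres, the vertical lines, are homeomorphic to $\mathbb R$). Let $\mathcal D\subset\mathcal P$ be a closed subset which is a topological surface with non-empty boundary $\mathcal C=\partial\mathcal D$. Let $\Sigma_{\rm top}(\mathcal C)$ be the set of points of $\mathcal C$ near which $\pi|_{\mathcal C}$ is not a homeomorphism onto its image. Assume that $\mathcal D$ is a *generic domain of weakly finite type*: $\pi|_{\mathcal C}$ is proper, $\Sigma_{\rm top}(\mathcal C)$ is finite, and no two points of $\Sigma_{\rm top}(\mathcal C)$ lie on the same vertical line. **The graph.** Call two points of $\mathcal D$ equivalent if they lie in the same connected component of a fibre of $\pi|_{\mathcal D}$; let $\tilde{\mathcal D}$ be the quotient space and $\rho:\mathcal D\to\tilde{\mathcal D}$ the quotient map. Let $G\subset\mathcal D$ be a Poincaré–Reeb graph of $\mathcal D$ (in the source), that is, the image of a continuous section of $\rho$. Its vertices are the points of $G$ whose equivalence class contains a point of $\Sigma_{\rm top}(\mathcal C)$, and its open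 edges are the connected components of the complement in $G$ of the set of vertices. To every open edge $E$ and every direction (left or right) in which $\pi(E)$ is unbounded one attaches an arrow, ending at an additional *arrowhead vertex*. An arrow carried by $E$ is *without feathers* if the equivalence classes of the points of $E$ are compact, and has *simple feathers* if they are homeomorphic to $[0,+\infty[$. (In the remaining case, where they are whole vertical lines, it has double feathers.) **Statement.** The curve $\mathcal C$ has finitely many connected components, and $G$ has finitely many open edges and finitely many connected components. Moreover: 1. The number of lines of $\mathcal C$ (connected components homeomorphic to $\mathbb R$) is $$\#\{\text{arrows without feathers}\}+\tfrac12\,\#\{\text{arrows with simple feathers}\}.$$ 2. The number of ovals of $\mathcal C$ (connected components homeomorphic to a circle) is $$b_0(G)+b_1(G)-c,$$ where $b_0(G)$ is the number of connected components of $G$, $b_1(G)$ is the number of independent cycles of $G$ (the dimension of the cycle space over $\mathbb Z/2$ of the graph enriched with its arrowhead vertices), and $c$ is the number of connected components of $G$ having an arrowhead vertex. -/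

import Mathlib

namespace PoincareReeb

open Set Topology

variable {P : Type*} [TopologicalSpace P]

/-- `(P, π)` is a vertical plane: `P` is homeomorphic to `ℝ²` and `π : P → ℝ` is a locally trivial
topological fibration, whose fibres are the vertical lines. (Since `P` is homeomorphic to `ℝ²`, the
typical fibre of such a fibration is necessarily homeomorphic to `ℝ`.) -/
def IsVerticalPlane (π : P → ℝ) : Prop :=
  Nonempty (P ≃ₜ ℝ × ℝ) ∧
    ∀ t : ℝ, ∃ e : Bundle.Trivialization ℝ π, t ∈ e.baseSet

/-- `D`, with the induced topology, is a topological surface with (possibly empty) boundary: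
every point lies in the domain of a chart with values in the closed half-plane.
(Inside a plane the Hausdorff and countability conditions are automatic.) -/
def IsSurface (D : Set P) : Prop :=
  ∀ p : D, ∃ φ : OpenPartialHomeomorph D (EuclideanHalfSpace 2), p ∈ φ.source

/-- The boundary of the surface `D`: the points that some chart of `D` sends to the boundary line
of the half-plane. -/
def boundary (D : Set P) : Set P :=
  {p | ∃ hp : p ∈ D, ∃ φ : OpenPartialHomeomorph D (EuclideanHalfSpace 2),
    (⟨p, hp⟩ : D) ∈ φ.source ∧ (φ ⟨p, hp⟩).1 0 = 0}

/-- The topological critical set of `C`: the points of `C` near which the restriction of `π` to `C`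
is not a homeomorphism onto its image. -/
def topCriticalSet (π : P → ℝ) (C : Set P) : Set P :=
  {p ∈ C | ¬ ∃ U ∈ 𝓝 p, IsEmbedding ((C ∩ U).domRestrict π)}

/-- Domains of weakly finite type. -/
structure IsWeaklyFiniteType (π : P → ℝ) (D : Set P) : Prop where
  isClosed : IsClosed D
  isSurface : IsSurface D
  boundary_nonempty : (boundary D).Nonempty
  isProperMap : IsProperMap ((boundary D).domRestrict π)
  finite_critical : (topCriticalSet π (boundary D)).Finite

/-- Genericity: no two topological critical points of the boundary lie on one vertical line. -/
def IsGenericDomain (π : P → ℝ) (D : Set P) : Prop :=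
  InjOn π (topCriticalSet π (boundary D))

/-- The connected component of `p` in the intersection of `D` with the vertical line through `p`. -/
def verticalInterval (π : P → ℝ) (D : Set P) (p : P) : Set P :=
  connectedComponentIn (D ∩ π ⁻¹' {π p}) p

/-- Vertical equivalence on `D`: lying in one connected component of one fibre of `π|_D`. -/
def verticalSetoid (π : P → ℝ) (D : Set P) : Setoid D where
  r p q := π p = π q ∧ verticalInterval π D p = verticalInterval π D q
  iseqv :=
    { refl := fun _ => ⟨rfl, rfl⟩
      symm := fun h => ⟨h.1.symm, h.2.symm⟩
      trans := fun h h' => ⟨h.1.trans h'.1, h.2.trans h'.2⟩ }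

/-- The Poincaré–Reeb set of `D` (in the target), with the quotient topology. -/
abbrev ReebSet (π : P → ℝ) (D : Set P) : Type _ := Quotient (verticalSetoid π D)

/-- `G` is (the underlying set of) a Poincaré–Reeb graph of `D` in the source: the image of a
continuous section of the collapsing map from `D` to its Poincaré–Reeb set. -/
def IsReebGraph (π : P → ℝ) (D G : Set P) : Prop :=
  ∃ s : ReebSet π D → D, Continuous s ∧
    (∀ x, Quotient.mk (verticalSetoid π D) (s x) = x) ∧
    G = range fun x => (s x : P)

/-- The set of connected components of a subset `S`, as subsets of the ambient space. -/
def components (S : Set P) : Set (Set P) := connectedComponentIn S '' S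

/-- The lines of a curve: its connected components homeomorphic to `ℝ`. -/
def lines (C : Set P) : Set (Set P) := {K ∈ components C | Nonempty (K ≃ₜ ℝ)}

/-- The ovals of a curve: its connected components homeomorphic to a circle. -/
def ovals (C : Set P) : Set (Set P) := {K ∈ components C | Nonempty (K ≃ₜ Circle)}

/-- The (non-arrowhead) vertices of `G`: the points of `G` that lie on a critical segment, that is,
on a connected component of a fibre of `π|_D` containing a topological critical point. -/
def vertices (π : P → ℝ) (D G : Set P) : Set P :=
  {p ∈ G | ∃ q ∈ topCriticalSet π (boundary D), q ∈ verticalInterval π D p}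

/-- The open edges of `G`: the connected components of the complement of the vertices. -/
def openEdges (π : P → ℝ) (D G : Set P) : Set (Set P) :=
  components (G \ vertices π D G)

/-- The two horizontal directions. -/
inductive Side
  | left
  | right

/-- The open edge `E` is unbounded in the given direction. -/
def Escapes (π : P → ℝ) (E : Set P) : Side → Prop
  | Side.left => ¬ BddBelow (π '' E)
  | Side.right => ¬ BddAbove (π '' E)

/-- The arrows of `G` (equivalently, its arrowhead vertices): one for each open edge and each
direction in which that edge is unbounded. -/
def arrows (π : P → ℝ) (D G : Set P) : Set (Set P × Side) :=
  {a | a.1 ∈ openEdges π D G ∧ Escapes π a.1 a.2}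

/-- The arrows without feathers: the vertical intervals contracted to points of the arrow-headed
edge are compact. -/
def arrowsWithoutFeathers (π : P → ℝ) (D G : Set P) : Set (Set P × Side) :=
  {a ∈ arrows π D G | ∀ p ∈ a.1, IsCompact (verticalInterval π D p)}

/-- The arrows with simple feathers: the vertical intervals contracted to points of the
arrow-headed edge are half-lines. -/
def arrowsWithSimpleFeathers (π : P → ℝ) (D G : Set P) : Set (Set P × Side) :=
  {a ∈ arrows π D G | ∀ p ∈ a.1, Nonempty (verticalInterval π D p ≃ₜ Ici (0 : ℝ))}

/-- All vertices of the enriched graph: the vertices of `G` and the arrowhead vertices. -/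
abbrev EnrichedVertex (π : P → ℝ) (D G : Set P) : Type _ := vertices π D G ⊕ arrows π D G

/-- Incidence: a vertex of `G` is an end of the open edges that have it in their closure, an
arrowhead vertex is an end of the edge that carries it. (No edge is a loop.) -/
def Incident (π : P → ℝ) (D G : Set P) : EnrichedVertex π D G → openEdges π D G → Prop
  | Sum.inl v, E => (v : P) ∈ closure (E : Set P)
  | Sum.inr a, E => a.1.1 = E

open Classical in
/-- The mod 2 boundary operator of the enriched graph: an edge is sent to the sum of its ends. -/
noncomputable def boundaryMap (π : P → ℝ) (D G : Set P) :
    (openEdges π D G →₀ ZMod 2) →ₗ[ZMod 2] (EnrichedVertex π D G → ZMod 2) :=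
  Finsupp.linearCombination (ZMod 2) fun E v => if Incident π D G v E then 1 else 0

/-- `b₀(G)`: the number of connected components of `G`. -/
noncomputable def b0 (G : Set P) : ℕ := (components G).ncard

/-- `b₁(G)`: the number of independent cycles of the graph, that is, the dimension of its
cycle space. -/
noncomputable def b1 (π : P → ℝ) (D G : Set P) : ℕ :=
  Module.finrank (ZMod 2) (LinearMap.ker (boundaryMap π D G))

/-- The connected components of `G` that have an arrowhead vertex. -/
def arrowComponents (π : P → ℝ) (D G : Set P) : Set (Set P) :=
  {K ∈ components G | ∃ a ∈ arrows π D G, a.1 ⊆ K}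

end PoincareReeb

/-! Fix `M` larger than the absolute value of the abscissa of every critical point. Where `|x| ≥ M`,
both the curve `C` and the graph `G` consist of unbroken arcs projecting homeomorphically to
half-lines. Hence arrows correspond to the points of `G` with `|x| = M`. A component of `C` is a
line exactly when it leaves the strip `|x| < M`, and it then crosses `|x| = M` exactly twice. Over a
regular abscissa every point of `C` is either the top or the bottom of its vertical interval, never
both. So twice the number of lines is the number of ends of the vertical intervals over `±M`: two
ends for an arrow without feathers, one for simple feathers, none for double feathers. This is
`Geometry.two_mul_ncard_lines`.

The ovals are counted by rank and nullity over `ZMod 2`. The space `locConst` of locally constant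
functions vanishing where `|x| ≥ M` has as dimension the number of components inside the strip. For
`C` this is the number of ovals, for `G` it is `b₀ - c`. A function `w` on `C` induces a weight on
every open edge, the sum of the values of `w` at the two ends of a vertical interval collapsed to
that edge, a missing end counting as zero (`Geometry.edgeSum`). The kernel of this linear map
consists of the functions with equal values at both ends; these are the pullbacks of functions on
`G` (`Geometry.range_lift`). The range is the cycle space (`Geometry.map_ker_boundaryMap`).
Therefore the number of ovals is `(b₀ - c) + b₁`.

That end sums are cycles is a local check at the two kinds of vertices: a leaf, where two ends merge
in one fold point, and a split, where one interval separates into two. The converse is where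
planarity is used. Given a cycle, let `w r` be the sum of the weights of all vertical intervals over
the abscissa of `r` whose top is at most as high as `r`. Between the bottom and the top of an
interval this sum grows by the weight of that interval alone. The conservation law at the vertices
makes it locally constant along `C` (`Cocycle.isStable`, proved by moving up a vertical line across
one curve point after another). Zero weight on the arrows makes it vanish far out, and also makes
the total over a whole vertical line vanish, which settles the intervals without a top.

The topological groundwork is as follows. The fibration is globally trivial, which gives
coordinates. Invariance of domain in the plane, proved with continuous logarithms and Borsuk's
odd-map argument, identifies the boundary defined by charts with `D \ interior D`. A local analysis
shows that `C` is a graph or a fold near each of its points, with `D` on a definite side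
(`geometry_of_isWeaklyFiniteType`). Connected one-manifolds with a finite atlas are classified, so
that compactness alone distinguishes ovals from lines. -/

namespace PoincareReeb

open Set Topology

/-! ### Global triviality of the fibration. -/

section GlobalTrivialization

variable {P : Type*} [TopologicalSpace P] {π : P → ℝ}

/-- The supremum `c` of the points reachable from `a` with one trivialization is itself reachable,
by gluing along a fibre just before `c`. If it were smaller than `b`, the trivialization reaching it
would cover slightly more. -/
theorem exists_trivialization_Icc (h : ∀ t : ℝ, ∃ e : Bundle.Trivialization ℝ π, t ∈ e.baseSet)
    {a b : ℝ} (hab : a ≤ b) : ∃ e : Bundle.Trivialization ℝ π, Icc a b ⊆ e.baseSet := by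
  obtain ⟨ea, hea⟩ := h a
  set s : Set ℝ := {x ∈ Icc a b | ∃ e : Bundle.Trivialization ℝ π, Icc a x ⊆ e.baseSet}
  have ha : a ∈ s := ⟨left_mem_Icc.2 hab, ea, by simp [hea]⟩
  have hsb : b ∈ upperBounds s := fun x hx => hx.1.2
  set c := sSup s
  have hsc : IsLUB s c := isLUB_csSup ⟨a, ha⟩ ⟨b, hsb⟩
  have hc : c ∈ Icc a b := ⟨hsc.1 ha, hsc.2 hsb⟩
  obtain ⟨-, ec, hec⟩ : c ∈ s := by
    rcases hc.1.eq_or_lt with heq | hlt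
    · rwa [← heq]
    refine ⟨hc, ?_⟩
    obtain ⟨ec, hc⟩ := h c
    obtain ⟨c', hc', hc'e⟩ : ∃ c' ∈ Ico a c, Ioc c' c ⊆ ec.baseSet :=
      (mem_nhdsLE_iff_exists_mem_Ico_Ioc_subset hlt).1
        (mem_nhdsWithin_of_mem_nhds <| IsOpen.mem_nhds ec.open_baseSet hc)
    obtain ⟨d, ⟨hdab, ead, had⟩, hd⟩ : ∃ d ∈ s, d ∈ Ioc c' c := hsc.exists_between hc'.2
    refine ⟨ead.piecewiseLe ec d (had ⟨hdab.1, le_rfl⟩) (hc'e hd), subset_ite.2 ?_⟩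
    exact ⟨fun x hx => had ⟨hx.1.1, hx.2⟩, fun x hx => hc'e ⟨hd.1.trans (not_le.1 hx.2), hx.1.2⟩⟩
  rcases hc.2.eq_or_lt with heq | hlt
  · exact ⟨ec, heq ▸ hec⟩
  obtain ⟨d, hdcb, hd⟩ : ∃ d ∈ Ioc c b, Ico c d ⊆ ec.baseSet :=
    (mem_nhdsGE_iff_exists_mem_Ioc_Ico_subset hlt).1
      (mem_nhdsWithin_of_mem_nhds <| IsOpen.mem_nhds ec.open_baseSet (hec ⟨hc.1, le_rfl⟩))
  obtain ⟨d', hcd', hd'd⟩ := exists_between hdcb.1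
  have : d' ∈ s := ⟨⟨hc.1.trans hcd'.le, hd'd.le.trans hdcb.2⟩, ec, fun x hx =>
    (le_or_gt x c).elim (fun h => hec ⟨hx.1, h⟩) fun h => hd ⟨h.le, hx.2.trans_lt hd'd⟩⟩
  exact absurd (hsc.1 this) (not_le.2 hcd')

theorem piecewiseLeOfEq_apply_of_le (e e' : Bundle.Trivialization ℝ π) (a : ℝ) (He : a ∈ e.baseSet)
    (He' : a ∈ e'.baseSet) (Heq : ∀ p, π p = a → e p = e' p) {p : P} (hp : π p ≤ a) :
    e.piecewiseLeOfEq e' a He He' Heq p = e p := by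
  classical
  exact Set.piecewise_eq_of_mem (π ⁻¹' Iic a) e e' hp

theorem piecewiseLeOfEq_apply_of_gt (e e' : Bundle.Trivialization ℝ π) (a : ℝ) (He : a ∈ e.baseSet)
    (He' : a ∈ e'.baseSet) (Heq : ∀ p, π p = a → e p = e' p) {p : P} (hp : a < π p) :
    e.piecewiseLeOfEq e' a He He' Heq p = e' p := by
  classical
  exact Set.piecewise_eq_of_notMem (π ⁻¹' Iic a) e e' (not_le.2 hp)

/-- Keeping the values over `[-n, n]` is what lets the successive extensions converge to a
trivialization over the whole line. At the right end `piecewiseLe` keeps the first trivialization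
and corrects `g`. At the left end `g` comes first, so it is corrected explicitly by the change of
fibre coordinate over `-n`. -/
theorem exists_trivialization_extension (h : ∀ t : ℝ, ∃ e : Bundle.Trivialization ℝ π, t ∈ e.baseSet)
    (e : Bundle.Trivialization ℝ π) (n : ℕ) (he : Icc (-(n : ℝ)) n ⊆ e.baseSet) :
    ∃ e' : Bundle.Trivialization ℝ π, Icc (-((n + 1 : ℕ) : ℝ)) (n + 1 : ℕ) ⊆ e'.baseSet ∧
      ∀ p, π p ∈ Icc (-(n : ℝ)) n → e' p = e p := by
  have hn : (0 : ℝ) ≤ n := n.cast_nonneg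
  obtain ⟨g, hg⟩ := exists_trivialization_Icc h (a := -((n + 1 : ℕ) : ℝ)) (b := (n + 1 : ℕ))
    (by push_cast; linarith)
  push_cast at hg
  have h1 : (n : ℝ) ∈ e.baseSet := he ⟨by linarith, le_rfl⟩
  have h2 : (n : ℝ) ∈ g.baseSet := hg ⟨by linarith, by linarith⟩
  obtain ⟨f, hf⟩ : ∃ f, f = e.piecewiseLe g n h1 h2 := ⟨_, rfl⟩
  have hfb : Icc (-(n : ℝ)) (n + 1) ⊆ f.baseSet := by
    rw [hf]
    exact subset_ite.2
      ⟨fun x hx => he ⟨hx.1.1, hx.2⟩, fun x hx => hg ⟨by linarith [hx.1.1], hx.1.2⟩⟩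
  have hfe : ∀ p, π p ≤ n → f p = e p := by
    rw [hf]
    exact fun p hp => piecewiseLeOfEq_apply_of_le _ _ _ _ _ _ hp
  have h3 : -(n : ℝ) ∈ f.baseSet := hfb ⟨le_rfl, by linarith⟩
  have h4 : -(n : ℝ) ∈ g.baseSet := hg ⟨by linarith, by linarith⟩
  have heq : ∀ p, π p = -(n : ℝ) →
      (g.transFiberHomeomorph (g.coordChangeHomeomorph f h4 h3)) p = f p := by
    clear * -
    generalize -(n : ℝ) = a at *
    rintro p rfl
    ext1
    · simp [*]
    · simp [*]
  refine ⟨(g.transFiberHomeomorph (g.coordChangeHomeomorph f h4 h3)).piecewiseLeOfEq f (-(n : ℝ))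
    h4 h3 heq, ?_, fun p hp => ?_⟩
  · push_cast
    exact subset_ite.2 ⟨fun x hx => hg hx.1,
      fun x hx => hfb ⟨(not_le.1 hx.2).le, hx.1.2⟩⟩
  · rw [← hfe p hp.2]
    rcases hp.1.eq_or_lt with h | h
    · rw [← heq p h.symm]
      exact piecewiseLeOfEq_apply_of_le _ _ _ _ _ _ h.ge
    · exact piecewiseLeOfEq_apply_of_gt _ _ _ _ _ _ h

/-- A locally trivial fibration over `ℝ` with fibre `ℝ` is globally trivial. -/
theorem exists_homeomorph_of_trivializations
    (h : ∀ t : ℝ, ∃ e : Bundle.Trivialization ℝ π, t ∈ e.baseSet) :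
    ∃ Φ : P ≃ₜ ℝ × ℝ, ∀ p, (Φ p).1 = π p := by
  classical
  obtain ⟨e0, he0⟩ := h 0
  let T (n : ℕ) := {e : Bundle.Trivialization ℝ π // Icc (-(n : ℝ)) n ⊆ e.baseSet}
  choose ext hext1 hext2 using fun (n : ℕ) (e : T n) => exists_trivialization_extension h e.1 n e.2
  let E : ∀ n, T n := fun n => Nat.rec (motive := T)
    ⟨e0, by simpa using he0⟩ (fun n e => ⟨ext n e, hext1 n e⟩) n
  have hE : ∀ (n : ℕ) p, π p ∈ Icc (-(n : ℝ)) n → (E (n + 1)).1 p = (E n).1 p :=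
    fun n p hp => hext2 n (E n) p hp
  have hEm : ∀ (n m : ℕ) p, n ≤ m → |π p| ≤ n → (E m).1 p = (E n).1 p := by
    intro n m p hnm hp
    induction m, hnm using Nat.le_induction with
    | base => rfl
    | succ m hm ih =>
      rw [hE m p, ih]
      exact abs_le.1 (hp.trans (by exact_mod_cast hm))
  let N : ℝ → ℕ := fun t => ⌈|t|⌉₊
  have hN : ∀ t, |t| ≤ N t := fun t => Nat.le_ceil _
  have hbase : ∀ (n : ℕ) t, |t| ≤ (n : ℝ) → t ∈ (E n).1.baseSet := fun n t ht => (E n).2 (abs_le.1 ht)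
  have hsymm : ∀ (n m : ℕ) t y, n ≤ m → |t| ≤ (n : ℝ) →
      (E m).1.toOpenPartialHomeomorph.symm (t, y) = (E n).1.toOpenPartialHomeomorph.symm (t, y) := by
    intro n m t y hnm ht
    have htm : |t| ≤ (m : ℝ) := ht.trans (by exact_mod_cast hnm)
    set p := (E n).1.toOpenPartialHomeomorph.symm (t, y)
    have hp : π p = t := (E n).1.proj_symm_apply' (hbase n t ht)
    have h1 : (E n).1 p = (t, y) := (E n).1.apply_symm_apply' (hbase n t ht)
    rw [← hEm n m p hnm (by rwa [hp])] at h1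
    rw [← h1]
    exact (E m).1.toOpenPartialHomeomorph.left_inv ((E m).1.mem_source.2 (by rw [hp]; exact hbase m t htm))
  -- Over `t` the sequence is constant from stage `⌈|t|⌉₊` on, so this stage gives the limit. Near
  -- each point a single later stage represents it, whence continuity.
  let Φ : P → ℝ × ℝ := fun p => (E (N (π p))).1 p
  let Ψ : ℝ × ℝ → P := fun q => (E (N q.1)).1.toOpenPartialHomeomorph.symm q
  have hsrc : ∀ (n : ℕ) p, |π p| ≤ (n : ℝ) → p ∈ (E n).1.source :=
    fun n p hp => (E n).1.mem_source.2 (hbase n _ hp)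
  have hΦ1 : ∀ p, (Φ p).1 = π p := fun p => (E _).1.coe_fst (hsrc _ p (hN _))
  have hle : ∀ t (n : ℕ), |t| ≤ (n : ℝ) → N t ≤ n := fun t n ht => Nat.ceil_le.2 ht
  have hπ : Continuous π := by
    refine continuous_iff_continuousAt.2 fun p => ?_
    exact (E _).1.continuousAt_proj (hsrc (N (π p)) p (hN _))
  refine ⟨⟨⟨Φ, Ψ, fun p => ?_, fun q => ?_⟩, ?_, ?_⟩, hΦ1⟩
  · change (E (N (Φ p).1)).1.toOpenPartialHomeomorph.symm (Φ p) = p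
    rw [hΦ1]
    exact (E _).1.toOpenPartialHomeomorph.left_inv (hsrc _ p (hN _))
  · obtain ⟨t, y⟩ := q
    have hp : π (Ψ (t, y)) = t := (E _).1.proj_symm_apply' (hbase _ t (hN t))
    change (E (N (π (Ψ (t, y))))).1 (Ψ (t, y)) = _
    rw [hp]
    exact (E _).1.apply_symm_apply' (hbase _ t (hN t))
  · refine continuous_iff_continuousAt.2 fun p => ?_
    obtain ⟨n, hn⟩ := exists_nat_gt |π p|
    have : ∀ᶠ q in 𝓝 p, (E n).1 q = Φ q := by
      filter_upwards [(hπ.abs.continuousAt (x := p)).eventually (gt_mem_nhds hn)] with q hq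
      exact hEm _ n q (hle _ _ (le_of_lt hq)) (hN _)
    exact ((E n).1.continuousAt (hsrc n p hn.le)).congr this
  · refine continuous_iff_continuousAt.2 fun q => ?_
    obtain ⟨n, hn⟩ := exists_nat_gt |q.1|
    have : ∀ᶠ r in 𝓝 q, (E n).1.toOpenPartialHomeomorph.symm r = Ψ r := by
      filter_upwards [(continuous_fst.abs.continuousAt (x := q)).eventually (gt_mem_nhds hn)]
        with r hr
      exact hsymm _ n r.1 r.2 (hle _ _ (le_of_lt hr)) (hN _)
    refine ((E n).1.toOpenPartialHomeomorph.continuousAt_symm ?_).congr this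
    exact (E n).1.mem_target.2 (hbase n _ hn.le)

end GlobalTrivialization

end PoincareReeb

namespace PoincareReeb

open Set Topology

/-! ### Logarithms of circle maps and invariance of domain in the plane. -/

section CircleLogarithms

/-- The map `f` from the circle to `ℂ` has a continuous logarithm. -/
def HasLog (f : Circle → ℂ) : Prop := ∃ g : Circle → ℂ, Continuous g ∧ ∀ u, Complex.exp (g u) = f u

theorem hasLog_const {c : ℂ} (hc : c ≠ 0) : HasLog fun _ => c :=
  ⟨fun _ => Complex.log c, continuous_const, fun _ => Complex.exp_log hc⟩

/-- Having a continuous logarithm is invariant under homotopies in `ℂ \ {0}`. -/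
theorem HasLog.of_homotopy (H : unitInterval → Circle → ℂ)
    (hH : Continuous fun q : unitInterval × Circle => H q.1 q.2) (h0 : ∀ t u, H t u ≠ 0)
    (h : HasLog (H 0)) : HasLog (H 1) := by
  obtain ⟨g, hg, hgH⟩ := h
  let H' : C(unitInterval × Circle, {z : ℂ // z ≠ 0}) :=
    ⟨fun q => ⟨H q.1 q.2, h0 _ _⟩, hH.subtype_mk _⟩
  have h00 : ∀ a, H' (0, a) = ⟨_, (g a).exp_ne_zero⟩ := fun a => Subtype.ext (hgH a).symm
  let L := Complex.isCoveringMap_exp.liftHomotopy H' ⟨g, hg⟩ h00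
  refine ⟨fun u => L (1, u), by fun_prop, fun u => ?_⟩
  have := congrFun (Complex.isCoveringMap_exp.liftHomotopy_lifts H' ⟨g, hg⟩ h00) (1, u)
  exact congrArg Subtype.val this

/-- The difference `g (-u) - g u` is an odd multiple of `π I`, constant because the circle is
connected. Exchanging `u` and `-u` reverses its sign, and no odd integer is its own opposite. -/
theorem not_hasLog_of_odd {f : Circle → ℂ} (hodd : ∀ u, f (-u) = -f u) : ¬ HasLog f := by
  rintro ⟨g, hg, hgf⟩
  have hneg : Continuous fun u : Circle => -u := continuous_neg
  have key : ∀ u, ∃ n : ℤ, g (-u) - g u = Real.pi * Complex.I + n * (2 * Real.pi * Complex.I) := by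
    intro u
    have : Complex.exp (g (-u)) = Complex.exp (g u + Real.pi * Complex.I) := by
      rw [hgf, hodd, Complex.exp_add, hgf, Complex.exp_pi_mul_I]; ring
    obtain ⟨n, hn⟩ := Complex.exp_eq_exp_iff_exists_int.1 this
    exact ⟨n, by rw [hn]; ring⟩
  choose n hn using key
  let d : Circle → ℝ := fun u => (g (-u) - g u).im / (2 * Real.pi) - 1 / 2
  have hd : ∀ u, d u = n u := by
    intro u
    have hpi := Real.pi_ne_zero
    simp only [d, hn]
    simp
    field_simp
    ring
  have hdc : Continuous d := by
    have : Continuous fun u => g (-u) := hg.comp hneg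
    fun_prop
  have hnc : Continuous n := by
    refine (Int.isClosedEmbedding_coe_real.isEmbedding.continuous_iff).2 ?_
    convert hdc using 1
    exact (funext hd).symm
  have hconst : n (-1) = n 1 := PreconnectedSpace.constant inferInstance hnc
  have e1 := hd 1
  have e2 := hd (-1)
  rw [hconst, ← e1] at e2
  simp only [d, neg_neg] at e2
  have e3 : (g (-1) - g 1).im = 0 := by
    have hpi := Real.pi_pos
    field_simp at e2
    simp at e2 ⊢
    linarith
  simp only [d, e3] at e1
  have : (2 * n 1 : ℝ) = -1 := by rw [← e1]; ring
  have h' : (2 * n 1 : ℤ) = -1 := by exact_mod_cast this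
  omega

/-- Brouwer's invariance of domain in dimension two. -/
theorem mem_interior_image_closedBall {h : ℂ → ℂ} (hc : ContinuousOn h (Metric.closedBall 0 1))
    (hi : InjOn h (Metric.closedBall 0 1)) : h 0 ∈ interior (h '' Metric.closedBall 0 1) := by
  by_contra hcon
  have hball : ∀ (r : ℝ) (u : Circle), |r| ≤ 1 → (r : ℂ) * u ∈ Metric.closedBall (0 : ℂ) 1 := by
    intro r u hr
    simpa [Complex.norm_real, Circle.norm_coe] using hr
  have hu : ∀ u : Circle, (u : ℂ) ∈ Metric.closedBall (0 : ℂ) 1 := fun u => by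
    simp [Circle.norm_coe]
  have hcoe : Continuous fun u : Circle => (u : ℂ) := continuous_subtype_val
  have hcirc : Continuous fun u : Circle => h u := hc.comp_continuous hcoe hu
  have hu0 : ∀ u : Circle, h u ≠ h 0 := fun u e => u.coe_ne_zero (hi (hu u) (by simp) e)
  obtain ⟨u0, -, hmin⟩ := isCompact_univ.exists_isMinOn (univ_nonempty (α := Circle))
    ((hcirc.sub (continuous_const (y := h 0))).norm.continuousOn)
  set d := ‖h u0 - h 0‖
  have hd : 0 < d := norm_pos_iff.2 (sub_ne_zero.2 (hu0 u0))
  have hdmin : ∀ u : Circle, d ≤ ‖h u - h 0‖ := fun u => hmin (mem_univ u)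
  -- As `h 0` is not interior to the image, some omitted value `w` is nearer to `h 0` than the image
  -- of the unit circle.
  obtain ⟨w, hwd, hwh⟩ : ∃ w, dist w (h 0) < d ∧ w ∉ h '' Metric.closedBall 0 1 := by
    by_contra! hcon'
    exact hcon (mem_interior_iff_mem_nhds.2 (Filter.mem_of_superset (Metric.ball_mem_nhds _ hd)
      fun w hw => hcon' w hw))
  -- The disc itself contracts this loop, since `w` is omitted on all of it.
  have s1 : HasLog fun u => h u - w := by
    have := HasLog.of_homotopy (fun t u => h ((t : ℝ) * u) - w) ?_ ?_ ?_
    · simpa using this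
    · refine Continuous.sub ?_ continuous_const
      refine hc.comp_continuous (by fun_prop) fun q => hball _ _ ?_
      rw [abs_of_nonneg q.1.2.1]; exact q.1.2.2
    · intro t u e
      refine hwh ⟨_, hball t u ?_, sub_eq_zero.1 e⟩
      rw [abs_of_nonneg t.2.1]; exact t.2.2
    · simpa using hasLog_const (sub_ne_zero.2 fun e => hwh ⟨0, by simp, e⟩)
  -- The base point moves from `w` to `h 0` along a segment that stays away from the image of the
  -- circle.
  have s2 : HasLog fun u => h u - h 0 := by
    have := HasLog.of_homotopy (fun t u => h u - (w + (t : ℝ) * (h 0 - w))) ?_ ?_ ?_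
    · simpa using this
    · exact (hcirc.comp continuous_snd).sub (by fun_prop)
    · intro t u e
      have e1 : h u - h 0 = (1 - (t : ℝ)) * (w - h 0) := by linear_combination e
      have := hdmin u
      rw [e1, norm_mul] at this
      have h2 : ‖(1 - (t : ℝ) : ℂ)‖ ≤ 1 := by
        rw [← Complex.ofReal_one, ← Complex.ofReal_sub, Complex.norm_real, Real.norm_eq_abs, abs_le]
        constructor <;> linarith [t.2.1, t.2.2]
      rw [dist_eq_norm] at hwd
      nlinarith [norm_nonneg (w - h 0)]
    · simpa using s1
  have ht : ∀ t : unitInterval, |(1 + (t : ℝ))⁻¹| ≤ 1 ∧ |-(t : ℝ) * (1 + (t : ℝ))⁻¹| ≤ 1 := by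
    intro t
    have h1 : (0 : ℝ) < 1 + t := by linarith [t.2.1]
    rw [abs_mul, abs_neg, abs_of_nonneg t.2.1, abs_of_pos (inv_pos.2 h1)]
    refine ⟨inv_le_one_of_one_le₀ (by linarith [t.2.1]), ?_⟩
    rw [← div_eq_mul_inv, div_le_one h1]
    linarith
  have hinv : Continuous fun t : unitInterval => (1 + (t : ℝ))⁻¹ :=
    (continuous_const.add continuous_subtype_val).inv₀ fun t => by
      have := t.2.1
      exact (by linarith : (0 : ℝ) < 1 + t).ne'
  have hA : Continuous fun q : unitInterval × Circle =>
      h (((1 + (q.1 : ℝ))⁻¹ : ℝ) * q.2) :=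
    hc.comp_continuous ((Complex.continuous_ofReal.comp (hinv.comp continuous_fst)).mul
      (hcoe.comp continuous_snd)) fun q => hball _ _ (ht q.1).1
  have hB : Continuous fun q : unitInterval × Circle =>
      h ((-(q.1 : ℝ) * (1 + (q.1 : ℝ))⁻¹ : ℝ) * q.2) :=
    hc.comp_continuous ((Complex.continuous_ofReal.comp
      ((continuous_subtype_val.comp continuous_fst).neg.mul (hinv.comp continuous_fst))).mul
      (hcoe.comp continuous_snd)) fun q => hball _ _ (ht q.1).2
  -- This homotopy ends at the odd map `h (u / 2) - h (-u / 2)`. The two arguments are distinct for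
  -- every `t`, so injectivity keeps it off zero.
  have s3 := HasLog.of_homotopy (fun t u => h (((1 + (t : ℝ))⁻¹ : ℝ) * u) -
    h ((-(t : ℝ) * (1 + (t : ℝ))⁻¹ : ℝ) * u)) (hA.sub hB) ?_ (by simpa using s2)
  · refine not_hasLog_of_odd (fun u => ?_) s3
    simp
  · intro t u e
    have := hi (hball _ _ (ht t).1) (hball _ _ (ht t).2) (sub_eq_zero.1 e)
    have := mul_right_cancel₀ u.coe_ne_zero this
    rw [Complex.ofReal_inj] at this
    have h1 : (0 : ℝ) < 1 + t := by linarith [t.2.1]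
    field_simp at this
    linarith [t.2.1]

end CircleLogarithms

end PoincareReeb

namespace PoincareReeb

open Set Topology

/-! ### Classification of connected one-manifolds with a finite atlas. -/

section OneManifolds

/-- Invariance of domain in dimension one. -/
theorem image_mem_nhds_of_injOn {k : ℝ → ℝ} {s : Set ℝ} {r : ℝ} (hs : s ∈ 𝓝 r)
    (hc : ContinuousOn k s) (hi : InjOn k s) : k '' s ∈ 𝓝 (k r) := by
  obtain ⟨ε, hε, hεs⟩ := Metric.nhds_basis_closedBall.mem_iff.1 hs
  rw [Real.closedBall_eq_Icc] at hεs
  refine Filter.mem_of_superset ?_ (image_mono hεs)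
  have hr : r ∈ Icc (r - ε) (r + ε) := ⟨by linarith, by linarith⟩
  have hl : r - ε ∈ Icc (r - ε) (r + ε) := ⟨by linarith, by linarith⟩
  have hu : r + ε ∈ Icc (r - ε) (r + ε) := ⟨by linarith, by linarith⟩
  have hle : r - ε ≤ r + ε := by linarith
  rcases (hc.mono hεs).strictMonoOn_of_injOn_Icc' hle (hi.mono hεs) with hm | hm
  · rw [(hc.mono hεs).image_Icc_of_monotoneOn hle hm.monotoneOn]
    exact Icc_mem_nhds (hm hl hr (by linarith)) (hm hr hu (by linarith))
  · have := (hc.mono hεs).neg.image_Icc_of_monotoneOn hle hm.neg.monotoneOn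
    have h2 : k '' Icc (r - ε) (r + ε) = Icc (k (r + ε)) (k (r - ε)) := by
      have h3 := congrArg (fun S => Neg.neg '' S) this
      simp only [image_image] at h3
      simpa using h3
    rw [h2]
    exact Icc_mem_nhds (hm hr hu (by linarith)) (hm hl hr (by linarith))

variable {X : Type*} [TopologicalSpace X]

/-- A continuous injection of the line into a one-manifold is an open embedding. -/
theorem isOpenEmbedding_of_injective (hX : ∀ x : X, ∃ e : ℝ → X, IsOpenEmbedding e ∧ x ∈ range e)
    {h : ℝ → X} (hc : Continuous h) (hi : Function.Injective h) : IsOpenEmbedding h := by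
  refine .of_continuous_injective_isOpenMap hc hi (isOpenMap_iff_nhds_le.2 fun r s hs => ?_)
  obtain ⟨e, he, x, hx⟩ := hX (h r)
  let E := he.toOpenPartialHomeomorph e
  have hE : ∀ y ∈ range e, e (E.symm y) = y := fun y hy => E.right_inv (by simpa [E] using hy)
  set s' := h ⁻¹' s ∩ h ⁻¹' range e
  have hs' : s' ∈ 𝓝 r := Filter.inter_mem hs
    ((he.isOpen_range.preimage hc).mem_nhds (show h r ∈ range e from ⟨x, hx⟩))
  have hcont : ContinuousOn (E.symm ∘ h) s' :=
    E.continuousOn_symm.comp hc.continuousOn fun t ht => by simpa [E] using ht.2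
  have hinj : InjOn (E.symm ∘ h) s' := fun t ht t' ht' heq => hi (by
    rw [← hE _ ht.2, ← hE _ ht'.2]; exact congrArg e heq)
  have h1 := he.isOpenMap.image_mem_nhds (image_mem_nhds_of_injOn hs' hcont hinj)
  rw [Function.comp_apply, hE (h r) ⟨x, hx⟩] at h1
  refine Filter.mem_of_superset h1 ?_
  rintro _ ⟨_, ⟨t, ht, rfl⟩, rfl⟩
  rw [Function.comp_apply, hE _ ht.2]
  exact ht.1

theorem isOpenEmbedding_comp_neg {e : ℝ → X} (he : IsOpenEmbedding e) :
    IsOpenEmbedding fun t => e (-t) :=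
  he.comp (Homeomorph.neg ℝ).isOpenEmbedding

theorem range_comp_neg {X : Type*} (e : ℝ → X) : (range fun t => e (-t)) = range e :=
  (neg_surjective (G := ℝ)).range_comp e

variable [T2Space X]

/-- Where an arc `f` leaves an arc `e`, it follows an end of `e`. -/
theorem exists_end_right {e f : ℝ → X} (he : IsOpenEmbedding e) (hf : IsOpenEmbedding f) {a b : ℝ}
    (hab : a < b) (hO : ∀ s ∈ Ioo a b, f s ∈ range e) (hb : f b ∉ range e) :
    ∃ e' : ℝ → X, (e' = e ∨ e' = fun t => e (-t)) ∧
      ∀ s ∈ Ioo a b, ∃ T, e' T = f s ∧ e' '' Ici T = f '' Ico s b := by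
  have main : ∀ e' : ℝ → X, IsOpenEmbedding e' → range e' = range e → ∀ τ : ℝ → ℝ,
      (∀ s ∈ Ioo a b, e' (τ s) = f s) → ContinuousOn τ (Ioo a b) → StrictMonoOn τ (Ioo a b) →
      ∀ s ∈ Ioo a b, ∃ T, e' T = f s ∧ e' '' Ici T = f '' Ico s b := by
    intro e' he' hr τ hτ hc hm s hs
    refine ⟨τ s, hτ s hs, Subset.antisymm ?_ ?_⟩
    · rintro _ ⟨t, ht, rfl⟩
      -- If `τ` stayed bounded, `e' (τ s)` would converge within the range of `e` as `s` tends to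
      -- `b`, and its limit is `f b`.
      have hunb : ∃ s' ∈ Ioo a b, t < τ s' := by
        by_contra! hcon
        have hne : (τ '' Ioo a b).Nonempty := ⟨_, mem_image_of_mem τ hs⟩
        have hlim := hm.monotoneOn.tendsto_nhdsWithin_Ioo_left (nonempty_Ioo.2 hab)
          ⟨t, by rintro _ ⟨s', hs', rfl⟩; exact hcon s' hs'⟩
        set L := sSup (τ '' Ioo a b)
        have h1 : Filter.Tendsto (fun s => e' (τ s)) (𝓝[<] b) (𝓝 (e' L)) :=
          (he'.continuous.tendsto L).comp hlim
        have h2 : Filter.Tendsto f (𝓝[<] b) (𝓝 (f b)) :=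
          (hf.continuous.tendsto b).mono_left inf_le_left
        have h3 : (fun s => e' (τ s)) =ᶠ[𝓝[<] b] f := by
          filter_upwards [Ioo_mem_nhdsLT hab] with s hs using hτ s hs
        have h4 := tendsto_nhds_unique (h1.congr' h3) h2
        exact hb (by rw [← hr, ← h4]; exact mem_range_self _)
      obtain ⟨s', hs', hts'⟩ := hunb
      have hss' : s ≤ s' := by
        by_contra! hlt
        exact absurd (hm hs' hs hlt) (not_lt.2 (ht.trans hts'.le))
      have hsub : Icc s s' ⊆ Ioo a b := fun x hx => ⟨hs.1.trans_le hx.1, hx.2.trans_lt hs'.2⟩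
      obtain ⟨x, hx, rfl⟩ := intermediate_value_Icc hss' (hc.mono hsub) ⟨ht, hts'.le⟩
      exact ⟨x, ⟨hx.1, (hsub hx).2⟩, (hτ x (hsub hx)).symm⟩
    · rintro _ ⟨x, hx, rfl⟩
      have hx' : x ∈ Ioo a b := ⟨hs.1.trans_le hx.1, hx.2⟩
      exact ⟨τ x, hm.monotoneOn hs hx' hx.1, hτ x hx'⟩
  let E := he.toOpenPartialHomeomorph e
  have hE : ∀ y ∈ range e, e (E.symm y) = y := fun y hy => E.right_inv (by simpa [E] using hy)
  have hcont : ContinuousOn (E.symm ∘ f) (Ioo a b) :=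
    E.continuousOn_symm.comp hf.continuous.continuousOn fun t ht => by simpa [E] using hO t ht
  have hinj : InjOn (E.symm ∘ f) (Ioo a b) := fun t ht t' ht' heq => hf.injective (by
    rw [← hE _ (hO t ht), ← hE _ (hO t' ht')]; exact congrArg e heq)
  rcases hcont.strictMonoOn_of_injOn_Ioo hab hinj with hm | hm
  · exact ⟨e, Or.inl rfl, main e he rfl _ (fun s hs => hE _ (hO s hs)) hcont hm⟩
  · refine ⟨_, Or.inr rfl, main _ (isOpenEmbedding_comp_neg he) (range_comp_neg e)
      (fun s => -(E.symm (f s))) (fun s hs => ?_) hcont.neg hm.neg⟩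
    rw [neg_neg]
    exact hE _ (hO s hs)

theorem exists_end_left {e f : ℝ → X} (he : IsOpenEmbedding e) (hf : IsOpenEmbedding f) {a b : ℝ}
    (hab : a < b) (hO : ∀ s ∈ Ioo a b, f s ∈ range e) (ha : f a ∉ range e) :
    ∃ e' : ℝ → X, (e' = e ∨ e' = fun t => e (-t)) ∧
      ∀ s ∈ Ioo a b, ∃ T, e' T = f s ∧ e' '' Ici T = f '' Ioc a s := by
  obtain ⟨e', he', h⟩ := exists_end_right he (isOpenEmbedding_comp_neg hf) (neg_lt_neg hab)
    (fun s hs => hO (-s) ⟨by linarith [hs.2], by linarith [hs.1]⟩) (by simpa using ha)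
  refine ⟨e', he', fun s hs => ?_⟩
  obtain ⟨T, h1, h2⟩ := h (-s) ⟨by linarith [hs.2], by linarith [hs.1]⟩
  refine ⟨T, by simpa using h1, h2.trans ?_⟩
  rw [show (fun t => f (-t)) = f ∘ Neg.neg from rfl, image_comp]
  simp

theorem exists_first_exit {O : Set ℝ} (hO : IsOpen O) {s t : ℝ} (hs : s ∈ O) (ht : t ∉ O)
    (hst : s < t) : ∃ b, s < b ∧ b ≤ t ∧ b ∉ O ∧ Ico s b ⊆ O := by
  have hne : (Oᶜ ∩ Ici s).Nonempty := ⟨t, ht, hst.le⟩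
  have hbd : BddBelow (Oᶜ ∩ Ici s) := ⟨s, fun x hx => hx.2⟩
  have hmem := (hO.isClosed_compl.inter isClosed_Ici).csInf_mem hne hbd
  refine ⟨sInf (Oᶜ ∩ Ici s), lt_of_le_of_ne hmem.2 fun h => ?_, csInf_le hbd ⟨ht, hst.le⟩, hmem.1,
    fun x hx => ?_⟩
  · rw [← h] at hmem
    exact hmem.1 hs
  · by_contra hxO
    exact absurd (csInf_le hbd ⟨hxO, hx.1⟩) (not_le.2 hx.2)

theorem exists_last_exit {O : Set ℝ} (hO : IsOpen O) {s t : ℝ} (hs : s ∉ O) (ht : t ∈ O)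
    (hst : s < t) : ∃ a, a < t ∧ s ≤ a ∧ a ∉ O ∧ Ioc a t ⊆ O := by
  obtain ⟨b, h1, h2, h3, h4⟩ := exists_first_exit (hO.preimage continuous_neg)
    (s := -t) (t := -s) (by simpa using ht) (by simpa using hs) (by linarith)
  refine ⟨-b, by linarith, by linarith, h3, fun x hx => ?_⟩
  simpa using h4 (⟨by linarith [hx.2], by linarith [hx.1]⟩ : -x ∈ Ico (-t) b)

/-- If the arc `e` is not contained in the arc `f`, then `f` meets `e` along rays. -/
theorem Iio_subset_preimage_range {e f : ℝ → X} (he : IsOpenEmbedding e) (hf : IsOpenEmbedding f)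
    (hnot : ¬ range e ⊆ range f) {s b : ℝ} (hs : s < b) (hsO : Ico s b ⊆ f ⁻¹' range e)
    (hb : f b ∉ range e) : Iio b ⊆ f ⁻¹' range e := by
  intro x hx
  by_contra hxO
  have hopen : IsOpen (f ⁻¹' range e) := he.isOpen_range.preimage hf.continuous
  have hxs : x < s := by
    by_contra! h
    exact hxO (hsO ⟨h, hx⟩)
  obtain ⟨a, has, -, haO, haI⟩ := exists_last_exit hopen hxO (hsO ⟨le_rfl, hs⟩) hxs
  have hI : ∀ y ∈ Ioo a b, f y ∈ range e := fun y hy =>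
    (le_total y s).elim (fun h => haI ⟨hy.1, h⟩) fun h => hsO ⟨h, hy.2⟩
  obtain ⟨e₁, h₁, H₁⟩ := exists_end_right he hf (has.trans hs) hI hb
  obtain ⟨e₂, h₂, H₂⟩ := exists_end_left he hf (has.trans hs) hI haO
  obtain ⟨T₁, hT₁, hI₁⟩ := H₁ s ⟨has, hs⟩
  obtain ⟨T₂, hT₂, hI₂⟩ := H₂ s ⟨has, hs⟩
  have hinj₁ : Function.Injective e₁ := by
    rcases h₁ with rfl | rfl
    exacts [he.injective, (isOpenEmbedding_comp_neg he).injective]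
  -- In both directions from `f s` the arc `f` runs to an end of `e`. The same end twice would make
  -- the two halves of `f` overlap; opposite ends would put all of `e` inside `f`.
  by_cases h12 : e₁ = e₂
  · subst h12
    obtain rfl := hinj₁ (hT₁.trans hT₂.symm)
    obtain ⟨y, hy, hy'⟩ : e₁ (T₁ + 1) ∈ f '' Ioc a s := hI₂ ▸ mem_image_of_mem e₁ (by simp)
    obtain ⟨z, hz, hz'⟩ : e₁ (T₁ + 1) ∈ f '' Ico s b := hI₁ ▸ mem_image_of_mem e₁ (by simp)
    obtain rfl := hf.injective (hy'.trans hz'.symm)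
    obtain rfl : y = s := le_antisymm hy.2 hz.1
    have := hinj₁ (hy'.symm.trans hT₁.symm)
    linarith
  · have h21 : e₂ = fun t => e₁ (-t) := by
      rcases h₁ with rfl | rfl <;> rcases h₂ with rfl | rfl <;> simp_all
    refine hnot ?_
    have hr : range e = range e₁ := by
      rcases h₁ with rfl | rfl
      exacts [rfl, (range_comp_neg e).symm]
    rw [hr]
    rintro _ ⟨t, rfl⟩
    have hTT : -T₂ = T₁ := hinj₁ (by rw [hT₁, ← hT₂, h21])
    rcases le_total T₁ t with h | h
    · obtain ⟨y, -, hy⟩ := hI₁ ▸ mem_image_of_mem e₁ (show t ∈ Ici T₁ from h)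
      exact ⟨y, hy⟩
    · obtain ⟨y, -, hy⟩ := hI₂ ▸ mem_image_of_mem e₂ (show -t ∈ Ici T₂ by simp; linarith)
      refine ⟨y, hy.trans ?_⟩
      simp [h21]

/-- The image of one period is compact and open, hence everything. The induced bijection from the
compact circle to a Hausdorff space is then a homeomorphism. -/
theorem nonempty_homeomorph_circle_of_path [ConnectedSpace X] {h : ℝ → X} {p : ℝ} (hp : 0 < p)
    (hc : Continuous h) (h0 : h 0 = h p) (hi : InjOn h (Ico 0 p)) (ho : IsOpen (h '' Icc 0 p)) :
    Nonempty (X ≃ₜ Circle) := by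
  have : Fact (0 < p) := ⟨hp⟩
  have huniv : h '' Icc 0 p = univ :=
    IsClopen.eq_univ ⟨(isCompact_Icc.image hc).isClosed, ho⟩ ⟨_, 0, ⟨le_rfl, hp.le⟩, rfl⟩
  have hcont : Continuous (AddCircle.liftIco p 0 h) :=
    AddCircle.liftIco_zero_continuous h0 hc.continuousOn
  have hbij : Function.Bijective (AddCircle.liftIco p 0 h) := by
    constructor
    · intro x y hxy
      obtain ⟨x, hx, rfl⟩ := AddCircle.coe_image_Ico_eq p 0 ▸ mem_univ x
      obtain ⟨y, hy, rfl⟩ := AddCircle.coe_image_Ico_eq p 0 ▸ mem_univ y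
      rw [zero_add] at hx hy
      rw [AddCircle.liftIco_zero_coe_apply hx, AddCircle.liftIco_zero_coe_apply hy] at hxy
      rw [hi hx hy hxy]
    · intro x
      obtain ⟨t, ht, rfl⟩ := huniv ▸ mem_univ x
      rcases ht.2.eq_or_lt with rfl | hlt
      · exact ⟨((0 : ℝ) : AddCircle t), by rw [AddCircle.liftIco_zero_coe_apply ⟨le_rfl, hp⟩, h0]⟩
      · exact ⟨(t : AddCircle p), AddCircle.liftIco_zero_coe_apply ⟨ht.1, hlt⟩⟩
  exact ⟨((hcont.homeoOfEquivCompactToT2 (f := Equiv.ofBijective _ hbij)).symm.trans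
    (AddCircle.homeomorphCircle hp.ne'))⟩

/-- Two overlapping arcs, neither of which contains the other, are contained in an arc, unless they
form a circle. -/
theorem exists_arc_or_circle [ConnectedSpace X]
    (hX : ∀ x : X, ∃ e : ℝ → X, IsOpenEmbedding e ∧ x ∈ range e)
    {e f : ℝ → X} (he : IsOpenEmbedding e) (hf : IsOpenEmbedding f)
    (hnot : ¬ range e ⊆ range f) {s₁ s₀ : ℝ} (h10 : s₁ < s₀) (h1 : f s₁ ∈ range e)
    (h0 : f s₀ ∉ range e) :
    (∃ h : ℝ → X, IsOpenEmbedding h ∧ range e ∪ range f ⊆ range h) ∨ Nonempty (X ≃ₜ Circle) := by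
  have hopen : IsOpen (f ⁻¹' range e) := he.isOpen_range.preimage hf.continuous
  obtain ⟨b, hsb, -, hb, hI⟩ := exists_first_exit hopen h1 h0 h10
  have hb' := Iio_subset_preimage_range he hf hnot hsb hI hb
  obtain ⟨e', he'', H⟩ := exists_end_right he hf (sub_one_lt s₁ |>.trans hsb)
    (fun s hs => hb' hs.2) hb
  obtain ⟨T, hT, hIT⟩ := H s₁ ⟨sub_one_lt _, hsb⟩
  have hr : range e' = range e := by
    rcases he'' with rfl | rfl
    exacts [rfl, range_comp_neg e]
  have he' : IsOpenEmbedding e' := by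
    rcases he'' with rfl | rfl
    exacts [he, isOpenEmbedding_comp_neg he]
  have hcase : ∀ r s, r ≤ T → s₁ < s → s < b → e' r ≠ f s := by
    intro r s hr hs1 hsb' heq
    obtain ⟨t, ht, htr⟩ : f s ∈ e' '' Ici T := hIT ▸ mem_image_of_mem f ⟨hs1.le, hsb'⟩
    have h3 := he'.injective (htr.trans heq.symm)
    have h4 : t = T := le_antisymm (h3 ▸ hr) ht
    rw [h4, hT] at htr
    exact hs1.ne (hf.injective htr)
  -- If `f` does not return to `e` after `b`, then `e'` up to `T` followed by `f` from `s₁` is a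
  -- larger arc.
  by_cases hcase1 : ∀ s, b ≤ s → f s ∉ range e
  · left
    let h : ℝ → X := fun r => if r ≤ 0 then e' (T + r) else f (s₁ + r)
    have hc : Continuous h := by
      refine Continuous.if_le (he'.continuous.comp (by fun_prop)) (hf.continuous.comp (by fun_prop))
        continuous_id continuous_const ?_
      rintro x rfl
      simpa using hT
    have hmix : ∀ r r', r ≤ 0 → 0 < r' → e' (T + r) ≠ f (s₁ + r') := by
      intro r r' hr0 hr' heq
      rcases lt_or_ge (s₁ + r') b with hlt | hge
      · exact hcase _ _ (by linarith) (by linarith) hlt heq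
      · exact hcase1 _ hge (hr ▸ ⟨_, heq⟩)
    have hi : Function.Injective h := by
      intro r r' heq
      simp only [h] at heq
      split_ifs at heq with h1 h2 h2
      · simpa using he'.injective heq
      · exact absurd heq (hmix _ _ h1 (not_le.1 h2))
      · exact absurd heq.symm (hmix _ _ h2 (not_le.1 h1))
      · simpa using hf.injective heq
    have hge : ∀ s, s₁ ≤ s → f s ∈ range h := by
      intro s hs
      rcases hs.eq_or_lt with rfl | hlt
      · exact ⟨0, by simp [h, hT]⟩
      · exact ⟨s - s₁, by simp [h, not_le.2 hlt]⟩
    have hre : range e ⊆ range h := by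
      rw [← hr]
      rintro _ ⟨t, rfl⟩
      rcases le_total t T with hle | hle
      · exact ⟨t - T, by simp [h, hle]⟩
      · obtain ⟨s, hs, hst⟩ : e' t ∈ f '' Ico s₁ b := hIT ▸ mem_image_of_mem e' hle
        exact hst ▸ hge s hs.1
    refine ⟨h, isOpenEmbedding_of_injective hX hc hi, union_subset hre ?_⟩
    rintro _ ⟨s, rfl⟩
    rcases le_or_gt s₁ s with hle | hlt
    · exact hge s hle
    · exact hre (hb' (hlt.trans hsb))
  · right
    push Not at hcase1
    -- If `f` does return, it is outside `e` exactly on `[b, a]` and follows `e` before and after.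
    obtain ⟨s₂, hbs, hs₂⟩ := hcase1
    have hbs₂ : b < s₂ := lt_of_le_of_ne hbs fun h => hb (h ▸ hs₂)
    obtain ⟨a, has, hba, ha, hIa⟩ := exists_last_exit hopen hb hs₂ hbs₂
    have hmid : ∀ s, b ≤ s → s ≤ a → f s ∉ range e := by
      intro s hbs' hsa hs
      have hlt : s < a := lt_of_le_of_ne hsa fun h => ha (h ▸ hs)
      obtain ⟨b', h1, h2, h3, h4⟩ := exists_first_exit hopen hs ha hlt
      exact hb (Iio_subset_preimage_range he hf hnot h1 h4 h3 (hbs'.trans_lt h1))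
    have ha' : Ioi a ⊆ f ⁻¹' range e := by
      have := Iio_subset_preimage_range he (isOpenEmbedding_comp_neg hf)
        (by rwa [range_comp_neg]) (neg_lt_neg has)
        (fun x hx => hIa ⟨by linarith [hx.2], by linarith [hx.1]⟩) (by simpa using ha)
      intro x hx
      simpa using this (show -x ∈ Iio (-a) by simpa using hx)
    obtain ⟨e₃, he₃, H₃⟩ := exists_end_left he' hf (has.trans (lt_add_one s₂))
      (fun s hs => hr ▸ ha' hs.1) (hr ▸ ha)
    obtain ⟨T₃, hT₃, hIT₃⟩ := H₃ s₂ ⟨has, lt_add_one _⟩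
    have hdisj : ∀ s s', s < b → a < s' → f s ≠ f s' := fun s s' h1 h2 heq => by
      have := hf.injective heq
      linarith
    -- The pieces of `f` before `b` and after `a` are disjoint, so they follow opposite ends of `e`.
    rcases he₃ with rfl | rfl
    · exfalso
      obtain ⟨s, hs, hs'⟩ : e₃ (max T T₃) ∈ f '' Ico s₁ b :=
        hIT ▸ mem_image_of_mem e₃ (mem_Ici.2 (le_max_left T T₃))
      obtain ⟨s', hs2, hs2'⟩ : e₃ (max T T₃) ∈ f '' Ioc a s₂ :=
        hIT₃ ▸ mem_image_of_mem e₃ (mem_Ici.2 (le_max_right T T₃))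
      exact hdisj s s' hs.2 hs2.1 (hs'.trans hs2'.symm)
    set T' := -T₃
    have hIT' : ∀ t ≤ T', e' t ∈ f '' Ioc a s₂ := fun t ht => by
      have := mem_image_of_mem (fun t => e' (-t)) (show -t ∈ Ici T₃ by simp; linarith)
      rw [hIT₃] at this
      simpa using this
    have hIT'' : ∀ s ∈ Ioc a s₂, ∃ t ≤ T', e' t = f s := fun s hs => by
      obtain ⟨t, ht, hts⟩ := hIT₃ ▸ mem_image_of_mem f hs
      exact ⟨-t, neg_le_neg ht, hts⟩
    have hTT : T' < T := by
      by_contra! hle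
      obtain ⟨s', hs', h2⟩ := hIT' T hle
      exact hdisj s₁ s' hsb hs'.1 (hT.symm.trans h2.symm)
    have hcase' : ∀ r s, T' ≤ r → a < s → s < s₂ → e' r ≠ f s := by
      intro r s hr hs1 hsb' heq
      obtain ⟨t, ht, htr⟩ := hIT'' s ⟨hs1, hsb'.le⟩
      have h3 := he'.injective (htr.trans heq.symm)
      have h4 : t = T' := le_antisymm ht (h3 ▸ hr)
      rw [h4] at htr
      exact hsb'.ne (hf.injective (htr.symm.trans hT₃))
    -- The loop follows `e'` from `T'` to `T` and then `f` from `s₁` to `s₂`; it starts and ends at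
    -- `f s₂`.
    let h : ℝ → X := fun r => if r ≤ T - T' then e' (T' + r) else f (s₁ + (r - (T - T')))
    have hc : Continuous h := by
      refine Continuous.if_le (he'.continuous.comp (by fun_prop)) (hf.continuous.comp (by fun_prop))
        continuous_id continuous_const ?_
      rintro x rfl
      simpa using hT
    have h12 : s₁ < s₂ := hsb.trans hbs₂
    have hmix : ∀ r r', 0 ≤ r → r ≤ T - T' → T - T' < r' → r' < T - T' + (s₂ - s₁) →
        e' (T' + r) ≠ f (s₁ + (r' - (T - T'))) := by
      intro r r' hr0 hr1 hr' hr'' heq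
      rcases lt_or_ge (s₁ + (r' - (T - T'))) b with hlt | hge
      · exact hcase _ _ (by linarith) (by linarith) hlt heq
      rcases lt_or_ge a (s₁ + (r' - (T - T'))) with hlt | hge'
      · exact hcase' _ _ (by linarith) hlt (by linarith) heq
      · exact hmid _ hge hge' (hr ▸ ⟨_, heq⟩)
    have hi : InjOn h (Ico 0 (T - T' + (s₂ - s₁))) := by
      intro r hr r' hr' heq
      simp only [h] at heq
      split_ifs at heq with h1 h2 h2
      · simpa using he'.injective heq
      · exact absurd heq (hmix _ _ hr.1 h1 (not_le.1 h2) hr'.2)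
      · exact absurd heq.symm (hmix _ _ hr'.1 h2 (not_le.1 h1) hr.2)
      · simpa using hf.injective heq
    have hfmem : ∀ s ∈ Icc s₁ s₂, f s ∈ h '' Icc 0 (T - T' + (s₂ - s₁)) := by
      intro s hs
      rcases hs.1.eq_or_lt with rfl | hlt
      · exact ⟨T - T', ⟨by linarith, by linarith⟩, by simp [h, hT]⟩
      · exact ⟨s - s₁ + (T - T'), ⟨by linarith, by linarith [hs.2]⟩, by simp [h, not_le.2 hlt]⟩
    have hre : range e ⊆ h '' Icc 0 (T - T' + (s₂ - s₁)) := by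
      rw [← hr]
      rintro _ ⟨t, rfl⟩
      rcases le_total t T with hle | hle
      · rcases le_total t T' with hle' | hle'
        · obtain ⟨s, hs, hst⟩ := hIT' t hle'
          exact hst ▸ hfmem s ⟨by linarith [hs.1], hs.2⟩
        · exact ⟨t - T', ⟨by linarith, by linarith⟩, by simp [h, hle]⟩
      · obtain ⟨s, hs, hst⟩ : e' t ∈ f '' Ico s₁ b := hIT ▸ mem_image_of_mem e' hle
        exact hst ▸ hfmem s ⟨hs.1, by linarith [hs.2]⟩
    have hrange : h '' Icc 0 (T - T' + (s₂ - s₁)) = range e ∪ range f := by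
      refine Subset.antisymm ?_ (union_subset hre ?_)
      · rintro _ ⟨r, -, rfl⟩
        simp only [h]
        split_ifs
        · exact Or.inl (hr ▸ mem_range_self _)
        · exact Or.inr (mem_range_self _)
      · rintro _ ⟨s, rfl⟩
        rcases lt_or_ge s s₁ with hlt | hge
        · exact hre (hb' (hlt.trans hsb))
        rcases le_or_gt s s₂ with hle | hlt'
        · exact hfmem s ⟨hge, hle⟩
        · exact hre (ha' (has.trans hlt'))
    refine nonempty_homeomorph_circle_of_path (p := T - T' + (s₂ - s₁)) (by linarith) hc ?_ hi
      (hrange ▸ he.isOpen_range.union hf.isOpen_range)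
    have e1 : h 0 = f s₂ := by simpa [h, hTT.le] using hT₃
    rw [e1]
    simp [h, not_le.2 h12]

/-- The classification of connected one-manifolds with a finite atlas. -/
theorem nonempty_homeomorph_real_or_circle [ConnectedSpace X] {ι : Type*} [Finite ι]
    (E : ι → ℝ → X) (hE : ∀ i, IsOpenEmbedding (E i)) (hcov : ∀ x, ∃ i, x ∈ range (E i)) :
    Nonempty (X ≃ₜ ℝ) ∨ Nonempty (X ≃ₜ Circle) := by
  have hX : ∀ x : X, ∃ e : ℝ → X, IsOpenEmbedding e ∧ x ∈ range e := fun x =>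
    (hcov x).elim fun i hi => ⟨E i, hE i, hi⟩
  let 𝒮 : Set (Set ι) := {S | ∃ e : ℝ → X, IsOpenEmbedding e ∧ S = {i | range (E i) ⊆ range e}}
  obtain ⟨x₀⟩ : Nonempty X := inferInstance
  obtain ⟨i₀, -⟩ := hcov x₀
  -- The arc is chosen to contain a maximal set of charts. If it is not everything, a chart around a
  -- limit point outside it either enlarges it, against maximality, or closes it to a circle.
  obtain ⟨S, ⟨e, he, rfl⟩, hmax⟩ := 𝒮.toFinite.exists_maximal ⟨_, E i₀, hE i₀, rfl⟩
  have hmax' : ∀ (h : ℝ → X) (i : ι), IsOpenEmbedding h → range e ⊆ range h →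
      range (E i) ⊆ range h → range (E i) ⊆ range e := fun h i hh hsub hi =>
    hmax ⟨h, hh, rfl⟩ (fun j (hj : range (E j) ⊆ range e) => hj.trans hsub) hi
  by_cases huniv : range e = univ
  · exact Or.inl ⟨(he.isEmbedding.toHomeomorphOfSurjective (range_eq_univ.1 huniv)).symm⟩
  right
  obtain ⟨p, hpc, hp⟩ : ∃ p ∈ closure (range e), p ∉ range e := by
    by_contra! hcon
    exact huniv (IsClopen.eq_univ ⟨isClosed_of_closure_subset hcon, he.isOpen_range⟩ ⟨_, 0, rfl⟩)
  obtain ⟨i, s₀, hs₀⟩ := hcov p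
  have hi : ¬ range (E i) ⊆ range e := fun h => hp (h ⟨s₀, hs₀⟩)
  have hnot : ¬ range e ⊆ range (E i) := fun h => hi (hmax' _ i (hE i) h Subset.rfl)
  obtain ⟨_, ⟨s₁, rfl⟩, hs₁⟩ := mem_closure_iff.1 hpc _ (hE i).isOpen_range ⟨s₀, hs₀⟩
  have hne : s₁ ≠ s₀ := by
    rintro rfl
    exact hp (hs₀ ▸ hs₁)
  have key : ∀ f : ℝ → X, IsOpenEmbedding f → range f = range (E i) → ∀ s₁ s₀, s₁ < s₀ →
      f s₁ ∈ range e → f s₀ ∉ range e → Nonempty (X ≃ₜ Circle) := by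
    intro f hf hfr s₁ s₀ hlt h1 h0
    rcases exists_arc_or_circle hX he hf (hfr ▸ hnot) hlt h1 h0 with ⟨h, hh, hsub⟩ | h
    · rw [hfr] at hsub
      exact absurd (hmax' h i hh (subset_union_left.trans hsub) (subset_union_right.trans hsub)) hi
    · exact h
  rcases lt_or_gt_of_ne hne with hlt | hlt
  · exact key _ (hE i) rfl s₁ s₀ hlt hs₁ (hs₀ ▸ hp)
  · exact key _ (isOpenEmbedding_comp_neg (hE i)) (range_comp_neg _) (-s₁) (-s₀) (neg_lt_neg hlt)
      (by simpa using hs₁) (by simpa [hs₀] using hp)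

end OneManifolds

end PoincareReeb

namespace PoincareReeb

open Set Topology

/-! ### Local homeomorphisms to the line, and open intervals. -/

section LocallyInjective

variable {X : Type*} [TopologicalSpace X]

/-- The inverses of `f` on `U` and on `U'` agree at `f p`. On the common interval of values, the set
where they agree is open because `f` is open, and so is the set where they differ because `X` is
Hausdorff. -/
theorem eq_of_mem_of_injOn [T2Space X] {f : X → ℝ} (hc : Continuous f) (ho : IsOpenMap f)
    {U U' : Set X} (hU : IsOpen U) (hU' : IsOpen U') (hpU : IsPreconnected U)
    (hpU' : IsPreconnected U') (hi : InjOn f U) (hi' : InjOn f U') {p : X} (hp : p ∈ U)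
    (hp' : p ∈ U') {u u' : X} (hu : u ∈ U) (hu' : u' ∈ U') (huu' : f u = f u') : u = u' := by
  have hI : IsPreconnected (f '' U ∩ f '' U') :=
    ((hpU.image f hc.continuousOn).ordConnected.inter
      (hpU'.image f hc.continuousOn).ordConnected).isPreconnected
  let B := ⋃₀ {W : Set ℝ | IsOpen W ∧ Disjoint W (f '' (U ∩ U'))}
  have hB : IsOpen B := isOpen_sUnion fun W hW => hW.1
  have hAB : Disjoint (f '' (U ∩ U')) B := disjoint_sUnion_right.2 fun W hW => hW.2.symm
  have hcov : f '' U ∩ f '' U' ⊆ f '' (U ∩ U') ∪ B := by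
    rintro t ⟨⟨v, hv, rfl⟩, v', hv', hvv'⟩
    by_cases h : v = v'
    · exact Or.inl ⟨v, ⟨hv, h ▸ hv'⟩, rfl⟩
    obtain ⟨V, V', hV, hV', hvV, hvV', hVV'⟩ := t2_separation h
    refine Or.inr ⟨f '' (V ∩ U) ∩ f '' (V' ∩ U'), ⟨(ho _ (hV.inter hU)).inter
      (ho _ (hV'.inter hU')), ?_⟩, ⟨v, ⟨hvV, hv⟩, rfl⟩, v', ⟨hvV', hv'⟩, hvv'⟩
    rw [disjoint_left]
    rintro _ ⟨⟨x, hx, rfl⟩, x', hx', hxx'⟩ ⟨y, hy, hyx⟩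
    have e1 := hi hy.1 hx.2 hyx
    have e2 := hi' hy.2 hx'.2 (hyx.trans hxx'.symm)
    exact disjoint_left.1 hVV' hx.1 (e1 ▸ e2 ▸ hx'.1)
  have hsub := hI.subset_left_of_subset_union (ho _ (hU.inter hU')) hB hAB hcov
    ⟨f p, ⟨⟨p, hp, rfl⟩, p, hp', rfl⟩, p, ⟨hp, hp'⟩, rfl⟩
  obtain ⟨x, hx, hxu⟩ := hsub ⟨⟨u, hu, rfl⟩, u', hu', huu'.symm⟩
  exact (hi hx.1 hu hxu).symm.trans (hi' hx.2 hu' (hxu.trans huu'))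

/-- A local homeomorphism from a connected Hausdorff space to the line is injective. -/
theorem injective_of_locally_injective [T2Space X] [PreconnectedSpace X] {f : X → ℝ}
    (hc : Continuous f) (ho : IsOpenMap f)
    (hloc : ∀ x, ∃ N, IsOpen N ∧ x ∈ N ∧ IsPreconnected N ∧ InjOn f N) : Function.Injective f := by
  let 𝒰 : X → Set (Set X) := fun p => {N | IsOpen N ∧ p ∈ N ∧ IsPreconnected N ∧ InjOn f N}
  -- By `eq_of_mem_of_injOn` the union of all good neighbourhoods of `p` is again good. These
  -- largest neighbourhoods coincide as soon as they meet, hence are closed.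
  let U : X → Set X := fun p => ⋃₀ 𝒰 p
  have hUo : ∀ p, IsOpen (U p) := fun p => isOpen_sUnion fun N hN => hN.1
  have hUp : ∀ p, IsPreconnected (U p) := fun p =>
    isPreconnected_sUnion p _ (fun N hN => hN.2.1) fun N hN => hN.2.2.1
  have hUi : ∀ p, InjOn f (U p) := by
    rintro p x ⟨N, hN, hx⟩ y ⟨N', hN', hy⟩ hxy
    exact eq_of_mem_of_injOn hc ho hN.1 hN'.1 hN.2.2.1 hN'.2.2.1 hN.2.2.2 hN'.2.2.2 hN.2.1 hN'.2.1
      hx hy hxy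
  have hUm : ∀ p, p ∈ U p := fun p => (hloc p).elim fun N hN => ⟨N, hN, hN.2.1⟩
  have hsub : ∀ p q, q ∈ U p → U p ⊆ U q := fun p q hq x hx =>
    ⟨U p, ⟨hUo p, hq, hUp p, hUi p⟩, hx⟩
  have hclosed : ∀ p, IsClosed (U p) := by
    refine fun p => isClosed_of_closure_subset fun q hq => ?_
    obtain ⟨r, hrq, hrp⟩ := mem_closure_iff.1 hq _ (hUo q) (hUm q)
    exact hsub r p (hsub p r hrp (hUm p)) (hsub q r hrq (hUm q))
  intro x y hxy
  have huniv : U x = univ := IsClopen.eq_univ ⟨hclosed x, hUo x⟩ ⟨x, hUm x⟩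
  exact hUi x (hUm x) (huniv ▸ mem_univ y) hxy

/-- Every open interval is the range of an open embedding of the line. -/
theorem exists_isOpenEmbedding_range_eq {S : Set ℝ} (ho : IsOpen S) (hp : IsPreconnected S)
    (hne : S.Nonempty) : ∃ e : ℝ → ℝ, IsOpenEmbedding e ∧ range e = S := by
  have hat : IsOpenEmbedding Real.arctan :=
    isOpenEmbedding_of_injective (fun x => ⟨id, .id, x, rfl⟩) Real.continuous_arctan
      Real.arctan_injective
  -- After applying `arctan` the interval is bounded, so finite and infinite ends need no separate
  -- treatment.
  set S' := Real.arctan '' S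
  have ho' : IsOpen S' := hat.isOpenMap _ ho
  have hp' : IsPreconnected S' := hp.image _ Real.continuous_arctan.continuousOn
  have hbd : BddBelow S' ∧ BddAbove S' := by
    refine ⟨⟨-(Real.pi / 2), ?_⟩, ⟨Real.pi / 2, ?_⟩⟩ <;> rintro _ ⟨x, -, rfl⟩
    exacts [(Real.neg_pi_div_two_lt_arctan x).le, (Real.arctan_lt_pi_div_two x).le]
  have hS' : S' = Ioo (sInf S') (sSup S') := by
    refine Subset.antisymm (fun x hx => ?_) (IsConnected.Ioo_csInf_csSup_subset ⟨hne.image _, hp'⟩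
      hbd.1 hbd.2)
    obtain ⟨ε, hε, hεS⟩ := Metric.isOpen_iff.1 ho' x hx
    rw [Real.ball_eq_Ioo] at hεS
    have h1 := csInf_le hbd.1 (hεS (show x - ε / 2 ∈ _ from ⟨by linarith, by linarith⟩))
    have h2 := le_csSup hbd.2 (hεS (show x + ε / 2 ∈ _ from ⟨by linarith, by linarith⟩))
    constructor <;> linarith
  set a := sInf S'
  set b := sSup S'
  have hab : a < b := by
    obtain ⟨x, hx⟩ : S'.Nonempty := hne.image _
    rw [hS'] at hx
    exact hx.1.trans hx.2
  have hpi := Real.pi_pos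
  let k : ℝ → ℝ := fun t => a + (b - a) * (Real.arctan t / Real.pi + 1 / 2)
  have hk : ∀ t, k t ∈ Ioo a b := by
    intro t
    have h1 := Real.neg_pi_div_two_lt_arctan t
    have h2 := Real.arctan_lt_pi_div_two t
    have h3 : -(1 / 2) < Real.arctan t / Real.pi := by rw [lt_div_iff₀ hpi]; linarith
    have h4 : Real.arctan t / Real.pi < 1 / 2 := by rw [div_lt_iff₀ hpi]; linarith
    constructor <;> simp only [k] <;> nlinarith
  have hkS : ∀ t, ∃ x ∈ S, Real.arctan x = k t := fun t => by
    have := hk t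
    rw [← hS'] at this
    exact this
  have htan : ∀ t, Real.tan (k t) ∈ S ∧ Real.arctan (Real.tan (k t)) = k t := fun t => by
    obtain ⟨x, hx, hxk⟩ := hkS t
    rw [← hxk, Real.tan_arctan]
    exact ⟨hx, rfl⟩
  have hcont : Continuous fun t => Real.tan (k t) := by
    rw [hat.isEmbedding.continuous_iff]
    have : Real.arctan ∘ (fun t => Real.tan (k t)) = k := funext fun t => (htan t).2
    rw [this]
    have := Real.continuous_arctan
    fun_prop
  refine ⟨_, isOpenEmbedding_of_injective (fun x => ⟨id, .id, x, rfl⟩) hcont fun t t' h => ?_, ?_⟩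
  · have h1 : k t = k t' := by rw [← (htan t).2, ← (htan t').2]; exact congrArg _ h
    have h2 : Real.arctan t / Real.pi = Real.arctan t' / Real.pi := by
      have := mul_left_cancel₀ (sub_pos.2 hab).ne' (add_left_cancel h1)
      linarith
    exact Real.arctan_injective (by field_simp at h2; exact h2)
  · refine Subset.antisymm ?_ fun x hx => ?_
    · rintro _ ⟨t, rfl⟩
      exact (htan t).1
    · have hx' : Real.arctan x ∈ Ioo a b := hS' ▸ mem_image_of_mem _ hx
      have hba := sub_pos.2 hab
      set θ := Real.pi * ((Real.arctan x - a) / (b - a) - 1 / 2) with hθ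
      have h1 : 0 < (Real.arctan x - a) / (b - a) := div_pos (by linarith [hx'.1]) hba
      have h2 : (Real.arctan x - a) / (b - a) < 1 := (div_lt_one hba).2 (by linarith [hx'.2])
      refine ⟨Real.tan θ, ?_⟩
      have h3 : Real.arctan (Real.tan θ) = θ :=
        Real.arctan_tan (by rw [hθ]; nlinarith) (by rw [hθ]; nlinarith)
      have h4 : k (Real.tan θ) = Real.arctan x := by
        change a + (b - a) * (Real.arctan (Real.tan θ) / Real.pi + 1 / 2) = _
        rw [h3, hθ]
        field_simp
        ring
      change Real.tan (k (Real.tan θ)) = x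
      rw [h4, Real.tan_arctan]

end LocallyInjective

end PoincareReeb

namespace PoincareReeb

open Set Topology

/-! ### Half-plane charts: the boundary of a plane surface is `D \ interior D`, and it is a curve.
-/

section HalfPlane

/-- The retraction of the plane onto the closed right half-plane. -/
noncomputable def toHalfPlane (z : ℂ) : EuclideanHalfSpace 2 := ⟨!₂[max z.re 0, z.im], by simp⟩

/-- The inclusion of the closed half-plane in the plane. -/
noncomputable def ofHalfPlane (v : EuclideanHalfSpace 2) : ℂ := ⟨v.1 0, v.1 1⟩

theorem continuous_toHalfPlane : Continuous toHalfPlane := by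
  refine Continuous.subtype_mk ?_ _
  refine (PiLp.continuous_toLp 2 _).comp (continuous_pi fun i => ?_)
  fin_cases i
  · exact Complex.continuous_re.max continuous_const
  · exact Complex.continuous_im

theorem continuous_ofHalfPlane : Continuous ofHalfPlane := by
  have h : ∀ i : Fin 2, Continuous fun v : EuclideanHalfSpace 2 => v.1 i := fun i =>
    (EuclideanSpace.proj i : EuclideanSpace ℝ (Fin 2) →L[ℝ] ℝ).continuous.comp
      continuous_subtype_val
  exact Complex.equivRealProdCLM.symm.continuous.comp ((h 0).prodMk (h 1))

theorem toHalfPlane_ofHalfPlane (v : EuclideanHalfSpace 2) : toHalfPlane (ofHalfPlane v) = v := by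
  refine Subtype.ext ?_
  ext i
  fin_cases i
  · exact max_eq_left v.2
  · rfl

theorem ofHalfPlane_toHalfPlane {z : ℂ} (hz : 0 ≤ z.re) : ofHalfPlane (toHalfPlane z) = z :=
  Complex.ext (max_eq_left hz) rfl

variable {P : Type*} [TopologicalSpace P] {D : Set P}

theorem exists_closedBall_subset_target (φ : OpenPartialHomeomorph D (EuclideanHalfSpace 2)) {p : D}
    (hp : p ∈ φ.source) {W : Set ℂ} (hW : W ∈ 𝓝 (ofHalfPlane (φ p))) :
    ∃ r > 0, Metric.closedBall (ofHalfPlane (φ p)) r ⊆ toHalfPlane ⁻¹' φ.target ∩ W :=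
  Metric.nhds_basis_closedBall.mem_iff.1 (Filter.inter_mem
    ((φ.open_target.preimage continuous_toHalfPlane).mem_nhds
      (by simpa [toHalfPlane_ofHalfPlane] using φ.map_source hp)) hW)

/-- Invariance of domain, for a disc in the chart that avoids the boundary line: its image lies in
`D` and is a neighbourhood of the point in the plane. -/
theorem mem_interior_of_chart (Ψ : P ≃ₜ ℂ) (φ : OpenPartialHomeomorph D (EuclideanHalfSpace 2))
    {p : D} (hp : p ∈ φ.source) (h0 : 0 < (φ p).1 0) : (p : P) ∈ interior D := by
  set c := ofHalfPlane (φ p) with hc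
  obtain ⟨r, hr, hsub⟩ := exists_closedBall_subset_target φ hp
    ((isOpen_lt continuous_const Complex.continuous_re).mem_nhds (show 0 < c.re from h0))
  have hmem : ∀ z ∈ Metric.closedBall (0 : ℂ) 1, c + r * z ∈ Metric.closedBall c r := by
    intro z hz
    rw [mem_closedBall_iff_norm] at hz ⊢
    rw [add_sub_cancel_left, norm_mul, Complex.norm_real, Real.norm_eq_abs, abs_of_pos hr]
    rw [sub_zero] at hz
    nlinarith
  let h : ℂ → ℂ := fun z => Ψ (φ.symm (toHalfPlane (c + r * z)))
  have hcont : ContinuousOn h (Metric.closedBall 0 1) := by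
    refine (Ψ.continuous.comp continuous_subtype_val).comp_continuousOn
      (φ.continuousOn_symm.comp (continuous_toHalfPlane.comp (by fun_prop)).continuousOn ?_)
    exact fun z hz => (hsub (hmem z hz)).1
  have hinj : InjOn h (Metric.closedBall 0 1) := by
    intro z hz z' hz' heq
    have h1 := φ.symm.injOn (hsub (hmem z hz)).1 (hsub (hmem z' hz')).1
      (Subtype.ext (Ψ.injective heq))
    have h2 := congrArg ofHalfPlane h1
    rw [ofHalfPlane_toHalfPlane (le_of_lt (hsub (hmem z hz)).2),
      ofHalfPlane_toHalfPlane (le_of_lt (hsub (hmem z' hz')).2)] at h2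
    exact mul_left_cancel₀ (Complex.ofReal_ne_zero.2 hr.ne') (add_left_cancel h2)
  have h00 : h 0 = Ψ p := by
    simp only [h, mul_zero, add_zero, hc, toHalfPlane_ofHalfPlane]
    rw [φ.left_inv hp]
  have hint := mem_interior_image_closedBall hcont hinj
  have hsub' : h '' Metric.closedBall 0 1 ⊆ Ψ '' D := by
    rintro _ ⟨z, -, rfl⟩
    exact mem_image_of_mem _ (Subtype.coe_prop _)
  have := interior_mono hsub' hint
  rw [h00, ← Ψ.image_interior] at this
  exact (Ψ.injective.mem_set_image).1 this

/-- A small circle around an interior point lies in `D`. If the chart put its centre on the boundary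
line, the circle could be contracted in a half-disc without passing through the centre. Yet a circle
minus its centre is the odd map `ρ * u`, which has no logarithm. -/
theorem notMem_interior_of_chart (Ψ : P ≃ₜ ℂ) (φ : OpenPartialHomeomorph D (EuclideanHalfSpace 2))
    {p : D} (hp : p ∈ φ.source) (h0 : (φ p).1 0 = 0) : (p : P) ∉ interior D := by
  intro hint
  set c := ofHalfPlane (φ p) with hc
  have hc0 : c.re = 0 := h0
  obtain ⟨r, hr, hsub⟩ := exists_closedBall_subset_target φ hp Filter.univ_mem
  have hO : IsOpen (φ.source ∩ φ ⁻¹' (ofHalfPlane ⁻¹' Metric.ball c r)) :=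
    φ.isOpen_inter_preimage (Metric.isOpen_ball.preimage continuous_ofHalfPlane)
  obtain ⟨O, hO', hOeq⟩ := isOpen_induced_iff.1 hO
  have hpO : (p : P) ∈ O := by
    have : p ∈ Subtype.val ⁻¹' O := by
      rw [hOeq]
      exact ⟨hp, Metric.mem_ball_self hr⟩
    exact this
  have hN : Ψ.symm ⁻¹' (O ∩ interior D) ∈ 𝓝 (Ψ p) :=
    ((hO'.inter isOpen_interior).preimage Ψ.symm.continuous).mem_nhds
      (by simpa using ⟨hpO, hint⟩)
  obtain ⟨ρ, hρ, hρsub⟩ := Metric.nhds_basis_closedBall.mem_iff.1 hN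
  have hw : ∀ u : Circle, Ψ p + ρ * u ∈ Metric.closedBall (Ψ p) ρ := fun u => by
    simp [Circle.norm_coe, abs_of_pos hρ]
  let q : Circle → D := fun u => ⟨Ψ.symm (Ψ p + ρ * u), interior_subset (hρsub (hw u)).2⟩
  have hcoe : Continuous fun u : Circle => (u : ℂ) := continuous_subtype_val
  have hq : Continuous q := (Ψ.symm.continuous.comp (by fun_prop)).subtype_mk _
  have hqs : ∀ u, q u ∈ φ.source ∧ ofHalfPlane (φ (q u)) ∈ Metric.ball c r := fun u => by
    have : q u ∈ Subtype.val ⁻¹' O := (hρsub (hw u)).1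
    rw [hOeq] at this
    exact this
  have hqp : ∀ u, q u ≠ p := fun u h => by
    have h1 := congrArg (fun x : D => Ψ x) h
    simp only [q, Homeomorph.apply_symm_apply, add_eq_left, mul_eq_zero, Complex.ofReal_eq_zero,
      Circle.coe_ne_zero, or_false] at h1
    exact hρ.ne' h1
  let ζ : Circle → ℂ := fun u => ofHalfPlane (φ (q u))
  have hζ : Continuous ζ := continuous_ofHalfPlane.comp
    (φ.continuousOn.comp_continuous hq fun u => (hqs u).1)
  have hζ0 : ∀ u, 0 ≤ (ζ u).re := fun u => (φ (q u)).2
  -- The centre of the contraction has positive real part. A segment from it to `ζ u` can meet the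
  -- boundary line only at its end `ζ u`, and that end is not `c`.
  set s₀ : ℂ := c + (r / 2 : ℝ) with hs₀
  have hs₀b : s₀ ∈ Metric.closedBall c r := by
    rw [mem_closedBall_iff_norm, hs₀, add_sub_cancel_left, Complex.norm_real, Real.norm_eq_abs,
      abs_of_pos (by linarith)]
    linarith
  let z : unitInterval → Circle → ℂ := fun t u => s₀ + (t : ℝ) * (ζ u - s₀)
  have hz : ∀ t u, z t u ∈ Metric.closedBall c r := by
    intro t u
    refine (convex_closedBall c r).segment_subset hs₀b (Metric.ball_subset_closedBall (hqs u).2) ?_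
    rw [segment_eq_image']
    exact ⟨t, t.2, by simp [z, ζ]⟩
  have hzre : ∀ t u, (z t u).re = (1 - t) * (r / 2) + t * (ζ u).re := by
    intro t u
    simp [z, hs₀, hc0]
    ring
  let H : unitInterval → Circle → ℂ := fun t u => Ψ (φ.symm (toHalfPlane (z t u))) - Ψ p
  have hzc : Continuous fun x : unitInterval × Circle => z x.1 x.2 :=
    continuous_const.add ((Complex.continuous_ofReal.comp
      (continuous_subtype_val.comp continuous_fst)).mul
      ((hζ.comp continuous_snd).sub continuous_const))
  have hHc : Continuous fun x : unitInterval × Circle => H x.1 x.2 := by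
    refine Continuous.sub ?_ continuous_const
    exact (Ψ.continuous.comp continuous_subtype_val).comp
      (φ.continuousOn_symm.comp_continuous (continuous_toHalfPlane.comp hzc)
        fun x => (hsub (hz x.1 x.2)).1)
  have hH0 : ∀ t u, H t u ≠ 0 := by
    intro t u h
    have h1 : φ.symm (toHalfPlane (z t u)) = p :=
      Subtype.ext (Ψ.injective (sub_eq_zero.1 h))
    have h2 : toHalfPlane (z t u) = φ p := by
      rw [← h1, φ.right_inv (hsub (hz t u)).1]
    have hre : 0 ≤ (z t u).re := by
      rw [hzre]
      have := hζ0 u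
      have := t.2.1
      have := t.2.2
      have : 0 ≤ 1 - (t : ℝ) := by linarith
      positivity
    have h3 : z t u = c := by
      rw [hc, ← h2, ofHalfPlane_toHalfPlane hre]
    have h4 := hzre t u
    rw [h3, hc0] at h4
    have ht : (t : ℝ) = 1 := by
      have h5 := hζ0 u
      have h6 := t.2.1
      have h7 := t.2.2
      nlinarith [mul_nonneg h6 h5]
    have h5 : ζ u = c := by
      rw [← h3]
      simp [z, ht]
    refine hqp u (φ.injOn (hqs u).1 hp ?_)
    rw [← toHalfPlane_ofHalfPlane (φ (q u)), ← toHalfPlane_ofHalfPlane (φ p)]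
    exact congrArg _ h5
  have hlog : HasLog (H 1) := by
    refine HasLog.of_homotopy H hHc hH0 ?_
    have : H 0 = fun _ => H 0 1 := by
      funext u
      simp [H, z]
    rw [this]
    exact hasLog_const (hH0 0 1)
  refine not_hasLog_of_odd (fun u => ?_) hlog
  have h1 : ∀ u, H 1 u = ρ * u := by
    intro u
    have : z 1 u = ζ u := by simp [z]
    simp only [H, this, ζ, toHalfPlane_ofHalfPlane]
    rw [φ.left_inv (hqs u).1]
    simp [q]
  rw [h1, h1]
  simp

/-- By the two preceding lemmas, the position of a point relative to the boundary line in any chart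
tells whether it is interior to `D` in the plane. -/
theorem boundary_eq_diff_interior (Ψ : P ≃ₜ ℂ) (hD : IsSurface D) :
    boundary D = D \ interior D := by
  ext p
  constructor
  · rintro ⟨hp, φ, hφ, h0⟩
    exact ⟨hp, notMem_interior_of_chart Ψ φ hφ h0⟩
  · rintro ⟨hp, hint⟩
    obtain ⟨φ, hφ⟩ := hD ⟨p, hp⟩
    refine ⟨hp, φ, hφ, ?_⟩
    by_contra h0
    exact hint (mem_interior_of_chart Ψ φ hφ (lt_of_le_of_ne (φ _).2 (Ne.symm h0)))

/-- In a chart, any point is the limit of points pushed into the open half-plane. This excludes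
curve points near which `D` is reduced to the curve. -/
theorem subset_closure_interior (Ψ : P ≃ₜ ℂ) (hD : IsSurface D) : D ⊆ closure (interior D) := by
  intro p hp
  obtain ⟨φ, hφ⟩ := hD ⟨p, hp⟩
  set c := ofHalfPlane (φ ⟨p, hp⟩) with hc
  let γ : ℝ → P := fun s => φ.symm (toHalfPlane (c + s))
  have hγ0 : γ 0 = p := by
    simp only [γ, Complex.ofReal_zero, add_zero, hc, toHalfPlane_ofHalfPlane]
    rw [φ.left_inv hφ]
  have hmem : toHalfPlane (c + (0 : ℝ)) ∈ φ.target := by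
    simpa [hc, toHalfPlane_ofHalfPlane] using φ.map_source hφ
  have hcont : ContinuousAt γ 0 := by
    refine continuous_subtype_val.continuousAt.comp ?_
    refine (φ.continuousAt_symm hmem).comp (f := fun s : ℝ => toHalfPlane (c + s)) ?_
    exact (continuous_toHalfPlane.comp (by fun_prop)).continuousAt
  have hlim : Filter.Tendsto γ (𝓝[>] 0) (𝓝 p) := by
    have := hcont.tendsto
    rw [hγ0] at this
    exact this.mono_left inf_le_left
  refine mem_closure_of_tendsto hlim ?_
  have h1 : ∀ᶠ s : ℝ in 𝓝 0, toHalfPlane (c + s) ∈ φ.target :=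
    (continuous_toHalfPlane.comp (by fun_prop : Continuous fun s : ℝ => c + (s : ℂ))).continuousAt
      (φ.open_target.mem_nhds hmem)
  filter_upwards [h1.filter_mono inf_le_left, self_mem_nhdsWithin] with s hs hs0
  refine mem_interior_of_chart Ψ φ (φ.map_target hs) ?_
  rw [φ.right_inv hs]
  have : 0 ≤ c.re := (φ ⟨p, hp⟩).2
  change 0 < max (c + s).re 0
  refine lt_max_of_lt_left ?_
  simp only [Complex.add_re, Complex.ofReal_re]
  exact add_pos_of_nonneg_of_pos this hs0

/-- The boundary of a surface in the plane is a topological curve. -/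
theorem exists_isOpenEmbedding_boundary (Ψ : P ≃ₜ ℂ) (p : boundary D) :
    ∃ e : ℝ → boundary D, IsOpenEmbedding e ∧ p ∈ range e := by
  obtain ⟨p, hp, φ, hφ, h0⟩ := p
  set c := ofHalfPlane (φ ⟨p, hp⟩) with hc
  have hc0 : c.re = 0 := h0
  obtain ⟨r, hr, hsub⟩ := exists_closedBall_subset_target φ hφ Filter.univ_mem
  obtain ⟨k, hk, hkr⟩ := exists_isOpenEmbedding_range_eq (isOpen_Ioo (a := -r) (b := r))
    isPreconnected_Ioo ⟨0, by simpa using hr⟩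
  have hkm : ∀ t, k t ∈ Ioo (-r) r := fun t => hkr ▸ mem_range_self t
  have hball : ∀ s ∈ Ioo (-r) r, c + s * Complex.I ∈ Metric.ball c r := fun s hs => by
    simpa [abs_lt] using hs
  have htar : ∀ t, toHalfPlane (c + k t * Complex.I) ∈ φ.target := fun t =>
    (hsub (Metric.ball_subset_closedBall (hball _ (hkm t)))).1
  have hre : ∀ s : ℝ, (c + s * Complex.I).re = 0 := fun s => by simp [hc0]
  let γ : ℝ → D := fun t => φ.symm (toHalfPlane (c + k t * Complex.I))
  have hγs : ∀ t, γ t ∈ φ.source := fun t => φ.map_target (htar t)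
  have hγφ : ∀ t, ofHalfPlane (φ (γ t)) = c + k t * Complex.I := fun t => by
    simp only [γ]
    rw [φ.right_inv (htar t), ofHalfPlane_toHalfPlane (hre _).ge]
  have hγc : Continuous γ := by
    refine φ.continuousOn_symm.comp_continuous (continuous_toHalfPlane.comp ?_) htar
    have := hk.continuous
    fun_prop
  have hγb : ∀ t, (γ t : P) ∈ boundary D := fun t => ⟨(γ t).2, φ, hγs t, by
    change (ofHalfPlane (φ (γ t))).re = 0
    rw [hγφ, hre]⟩
  have hinj : Function.Injective fun t => (⟨γ t, hγb t⟩ : boundary D) := by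
    intro t t' h
    have h1 : γ t = γ t' := Subtype.ext (Subtype.mk.inj h)
    have h2 := hγφ t
    rw [h1, hγφ] at h2
    have := mul_right_cancel₀ Complex.I_ne_zero (add_left_cancel h2)
    exact (hk.injective (Complex.ofReal_injective this)).symm
  refine ⟨fun t => ⟨γ t, hγb t⟩, .of_continuous_injective_isOpenMap
    ((continuous_subtype_val.comp hγc).subtype_mk _) hinj fun O hO => ?_, ?_⟩
  · let ι : boundary D → D := fun q => ⟨q, q.2.1⟩
    have hι : Continuous ι := continuous_subtype_val.subtype_mk _
    -- A boundary point lies on the boundary line in every chart, so its imaginary part determines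
    -- it and the image of `O` is cut out by open conditions.
    have hset : (fun t => (⟨γ t, hγb t⟩ : boundary D)) '' O =
        ι ⁻¹' (φ.source ∩ φ ⁻¹' (ofHalfPlane ⁻¹' (Metric.ball c r ∩
          (fun z : ℂ => z.im - c.im) ⁻¹' (k '' O)))) := by
      ext q
      constructor
      · rintro ⟨t, ht, rfl⟩
        refine ⟨hγs t, ?_, t, ht, ?_⟩
        · change ofHalfPlane (φ (γ t)) ∈ _
          rw [hγφ]
          exact hball _ (hkm t)
        · change k t = (ofHalfPlane (φ (γ t))).im - c.im
          simp [hγφ]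
      · rintro ⟨hq, -, t, ht, htq⟩
        refine ⟨t, ht, Subtype.ext ?_⟩
        obtain ⟨hqD, ψ, hψ, hψ0⟩ := q.2
        have hq0 : (φ (ι q)).1 0 = 0 := by
          by_contra hne
          exact notMem_interior_of_chart Ψ ψ hψ hψ0
            (mem_interior_of_chart Ψ φ hq (lt_of_le_of_ne (φ (ι q)).2 (Ne.symm hne)))
        have h1 : ofHalfPlane (φ (ι q)) = c + k t * Complex.I := by
          refine Complex.ext ?_ ?_
          · rw [hre, ← hq0]; rfl
          · change k t = (ofHalfPlane (φ (ι q))).im - c.im at htq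
            simp [htq]
        rw [← hγφ] at h1
        have h2 := congrArg toHalfPlane h1
        rw [toHalfPlane_ofHalfPlane, toHalfPlane_ofHalfPlane] at h2
        exact (congrArg Subtype.val (φ.injOn hq (hγs t) h2)).symm
    rw [hset]
    refine (φ.isOpen_inter_preimage (IsOpen.preimage continuous_ofHalfPlane
      (Metric.isOpen_ball.inter ((hk.isOpenMap O hO).preimage ?_)))).preimage hι
    exact Complex.continuous_im.sub continuous_const
  · obtain ⟨t, ht⟩ : (0 : ℝ) ∈ range k := hkr ▸ ⟨by linarith, hr⟩
    refine ⟨t, Subtype.ext ?_⟩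
    change ((φ.symm (toHalfPlane (c + k t * Complex.I)) : D) : P) = p
    rw [ht, Complex.ofReal_zero, zero_mul, add_zero, hc, toHalfPlane_ofHalfPlane, φ.left_inv hφ]

end HalfPlane

end PoincareReeb

namespace PoincareReeb

open Set Topology

/-! ### Coordinates on the vertical plane. -/

section Coordinates

variable {P : Type*} [TopologicalSpace P] (Φ : P ≃ₜ ℝ × ℝ)

/-- The horizontal coordinate. -/
def xc (p : P) : ℝ := (Φ p).1

/-- The vertical coordinate. -/
def yc (p : P) : ℝ := (Φ p).2

/-- The point with given coordinates. -/
def pt (t y : ℝ) : P := Φ.symm (t, y)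

@[simp] theorem xc_pt (t y : ℝ) : xc Φ (pt Φ t y) = t := by simp [xc, pt]

@[simp] theorem yc_pt (t y : ℝ) : yc Φ (pt Φ t y) = y := by simp [yc, pt]

@[simp] theorem pt_xc_yc (p : P) : pt Φ (xc Φ p) (yc Φ p) = p := by simp [xc, yc, pt]

@[fun_prop] theorem continuous_xc : Continuous (xc Φ) := continuous_fst.comp Φ.continuous

@[fun_prop] theorem continuous_yc : Continuous (yc Φ) := continuous_snd.comp Φ.continuous

@[fun_prop] theorem Continuous.pt {Z : Type*} [TopologicalSpace Z] {f g : Z → ℝ}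
    (hf : Continuous f) (hg : Continuous g) : Continuous fun z => pt Φ (f z) (g z) :=
  Φ.symm.continuous.comp (hf.prodMk hg)

variable {Φ}

theorem ext_coords {p q : P} (h1 : xc Φ p = xc Φ q) (h2 : yc Φ p = yc Φ q) : p = q :=
  Φ.injective (Prod.ext h1 h2)

/-- Neighbourhoods contain boxes. -/
theorem exists_box {p : P} {Q : P → Prop} (h : ∀ᶠ q in 𝓝 p, Q q) :
    ∃ ε > 0, ∀ t y, |t - xc Φ p| < ε → |y - yc Φ p| < ε → Q (pt Φ t y) := by
  have h' : ∀ᶠ z in 𝓝 (Φ p), Q (Φ.symm z) := by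
    have := Φ.symm.continuous.tendsto (Φ p)
    rw [Φ.symm_apply_apply] at this
    exact this.eventually h
  obtain ⟨ε, hε, hb⟩ := Metric.eventually_nhds_iff.1 h'
  refine ⟨ε, hε, fun t y ht hy => @hb (t, y) ?_⟩
  rw [Prod.dist_eq]
  exact max_lt ht hy

theorem eventually_box (p : P) {ε : ℝ} (hε : 0 < ε) :
    ∀ᶠ q in 𝓝 p, |xc Φ q - xc Φ p| < ε ∧ |yc Φ q - yc Φ p| < ε := by
  have h1 : Continuous fun q => |xc Φ q - xc Φ p| := by fun_prop
  have h2 : Continuous fun q => |yc Φ q - yc Φ p| := by fun_prop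
  exact ((h1.tendsto p).eventually (gt_mem_nhds (by simpa))).and
    ((h2.tendsto p).eventually (gt_mem_nhds (by simpa)))

theorem eventually_pt {p : P} {Q : P → Prop} (h : ∀ᶠ q in 𝓝 p, Q q) {f : ℝ → ℝ}
    (hf : ContinuousAt f (xc Φ p)) (hf0 : f (xc Φ p) = yc Φ p) :
    ∀ᶠ t in 𝓝 (xc Φ p), Q (pt Φ t (f t)) := by
  have : ContinuousAt (fun t => pt Φ t (f t)) (xc Φ p) :=
    Φ.symm.continuous.continuousAt.comp (continuousAt_id.prodMk hf)
  refine this.eventually ?_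
  change ∀ᶠ y in 𝓝 (pt Φ (xc Φ p) (f (xc Φ p))), Q y
  rwa [hf0, pt_xc_yc]

/-- The region is the image of a rectangle under vertical interpolation between the two graphs. -/
theorem isPreconnected_region {a b : ℝ} {f g : ℝ → ℝ} (hf : Continuous f) (hg : Continuous g)
    (hfg : ∀ t ∈ Ioo a b, f t < g t) :
    IsPreconnected {p : P | xc Φ p ∈ Ioo a b ∧ f (xc Φ p) < yc Φ p ∧ yc Φ p < g (xc Φ p)} := by
  have h : IsPreconnected ((fun z : ℝ × ℝ => pt Φ z.1 (f z.1 + z.2 * (g z.1 - f z.1))) ''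
      (Ioo a b ×ˢ Ioo 0 1)) :=
    (isPreconnected_Ioo.prod isPreconnected_Ioo).image _ (by fun_prop)
  convert h using 1
  ext p
  constructor
  · rintro ⟨hx, h1, h2⟩
    have h3 := sub_pos.2 (hfg _ hx)
    refine ⟨(xc Φ p, (yc Φ p - f (xc Φ p)) / (g (xc Φ p) - f (xc Φ p))), ⟨hx, ?_, ?_⟩, ?_⟩
    · exact div_pos (by linarith) h3
    · exact (div_lt_one h3).2 (by linarith)
    · refine ext_coords (Φ := Φ) (by simp) ?_
      simp [div_mul_cancel₀ _ h3.ne']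
  · rintro ⟨⟨t, l⟩, ⟨ht, hl⟩, rfl⟩
    have h3 := sub_pos.2 (hfg _ ht)
    refine ⟨by simpa using ht, ?_, ?_⟩
    · simpa using mul_pos hl.1 h3
    · simp only [xc_pt, yc_pt]
      nlinarith [hl.2]

/-- A strictly increasing continuous function on an interval extends to a homeomorphism of the
line. -/
theorem exists_homeomorph_extension {k : ℝ → ℝ} {a b : ℝ} (hab : a ≤ b)
    (hc : ContinuousOn k (Icc a b)) (hm : StrictMonoOn k (Icc a b)) :
    ∃ K : ℝ ≃ₜ ℝ, StrictMono K ∧ ∀ r ∈ Icc a b, K r = k r := by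
  -- Outside `[a, b]` the function is continued with slope one.
  let K : ℝ → ℝ := fun r => k (projIcc a b hab r) + (r - projIcc a b hab r)
  have hKc : Continuous K := by
    have h1 : Continuous fun r => (projIcc a b hab r : ℝ) :=
      continuous_subtype_val.comp continuous_projIcc
    have h2 : Continuous fun r => k (projIcc a b hab r : ℝ) :=
      hc.comp_continuous h1 fun r => (projIcc a b hab r).2
    exact h2.add (continuous_id.sub h1)
  have hKm : StrictMono K := by
    intro r s hrs
    have h1 : (projIcc a b hab r : ℝ) ≤ projIcc a b hab s := monotone_projIcc hab hrs.le
    have h2 : r - projIcc a b hab r ≤ s - projIcc a b hab s := by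
      simp only [coe_projIcc]
      rcases le_total b r with h | h <;> rcases le_total b s with h' | h' <;>
      rcases le_total a r with h'' | h'' <;> rcases le_total a s with h''' | h''' <;>
      simp [*] <;> linarith
    rcases h1.eq_or_lt with h | h
    · simp only [K]
      rw [h]
      linarith
    · have := hm (projIcc a b hab r).2 (projIcc a b hab s).2 h
      simp only [K]
      linarith
  have hKs : Function.Surjective K := by
    have hbound : ∀ r, k a + (r - b) ≤ K r ∧ K r ≤ k b + (r - a) := by
      intro r
      have h1 := hm.monotoneOn (left_mem_Icc.2 hab) (projIcc a b hab r).2 (projIcc a b hab r).2.1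
      have h2 := hm.monotoneOn (projIcc a b hab r).2 (right_mem_Icc.2 hab) (projIcc a b hab r).2.2
      have h3 := (projIcc a b hab r).2
      simp only [K]
      constructor <;> linarith [h3.1, h3.2]
    refine hKc.surjective ?_ ?_
    · refine Filter.tendsto_atTop_mono (fun r => (hbound r).1) ?_
      exact Filter.tendsto_atTop_add_const_left _ _ (Filter.tendsto_atTop_add_const_right _ _
        Filter.tendsto_id)
    · refine Filter.tendsto_atBot_mono (fun r => (hbound r).2) ?_
      exact Filter.tendsto_atBot_add_const_left _ _ (Filter.tendsto_atBot_add_const_right _ _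
        Filter.tendsto_id)
  refine ⟨(hKm.orderIsoOfSurjective K hKs).toHomeomorph, hKm, fun r hr => ?_⟩
  change k (projIcc a b hab r) + (r - projIcc a b hab r) = k r
  rw [projIcc_of_mem hab hr]
  simp

end Coordinates

/-! ### Ordinary points of the curve. -/

section LocalStructure

variable {P : Type*} [TopologicalSpace P] (Φ : P ≃ₜ ℝ × ℝ) (D C S : Set P)

/-- The point `q` of the curve `C` is an ordinary point: `C` is a graph near `q`, and `D` lies below
it if `s = 1`, above it if `s = -1`. -/
def IsGraphPoint (q : P) (s : ℝ) (f : ℝ → ℝ) : Prop :=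
  Continuous f ∧ f (xc Φ q) = yc Φ q ∧ ∀ᶠ r in 𝓝 q,
    (r ∈ C ↔ yc Φ r = f (xc Φ r)) ∧ (r ∈ D ↔ s * yc Φ r ≤ s * f (xc Φ r))

/-- The point `p` of the curve `C` is a fold: near `p`, the curve is the union of the graphs of `f`
and `g` over one side of the line through `p`. -/
def IsFold (p : P) (σ : ℝ) (f g : ℝ → ℝ) : Prop :=
  (σ = 1 ∨ σ = -1) ∧ Continuous f ∧ Continuous g ∧ f (xc Φ p) = yc Φ p ∧ g (xc Φ p) = yc Φ p ∧
  (∀ᶠ t in 𝓝 (xc Φ p), 0 < σ * (t - xc Φ p) → f t < g t) ∧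
  ∀ᶠ r in 𝓝 p, r ∈ C ↔ 0 ≤ σ * (xc Φ r - xc Φ p) ∧ (yc Φ r = f (xc Φ r) ∨ yc Φ r = g (xc Φ r))

/-- A fold with `D` lying between the two branches. -/
def IsLeaf (p : P) (σ : ℝ) (f g : ℝ → ℝ) : Prop :=
  IsFold Φ C p σ f g ∧ ∀ᶠ r in 𝓝 p,
    r ∈ D ↔ 0 ≤ σ * (xc Φ r - xc Φ p) ∧ f (xc Φ r) ≤ yc Φ r ∧ yc Φ r ≤ g (xc Φ r)

/-- A fold with the complement of `D` lying between the two branches. -/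
def IsSplit (p : P) (σ : ℝ) (f g : ℝ → ℝ) : Prop :=
  IsFold Φ C p σ f g ∧ ∀ᶠ r in 𝓝 p,
    r ∈ D ↔ ¬ (0 < σ * (xc Φ r - xc Φ p) ∧ f (xc Φ r) < yc Φ r ∧ yc Φ r < g (xc Φ r))

/-- The geometry of a generic domain of weakly finite type, in coordinates. -/
structure Geometry : Prop where
  isClosed : IsClosed D
  curve_eq : C = D \ interior D
  critical_subset : S ⊆ C
  finite_critical : S.Finite
  injOn_critical : InjOn (xc Φ) S
  bounded : ∀ a b, ∃ B, ∀ t ∈ Icc a b, ∀ y, pt Φ t y ∈ C → |y| < B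
  graph : ∀ q ∈ C, q ∉ S → ∃ s f, (s = 1 ∨ s = -1) ∧ IsGraphPoint Φ D C q s f
  fold : ∀ p ∈ S, ∃ σ f g, IsLeaf Φ D C p σ f g ∨ IsSplit Φ D C p σ f g

variable {Φ D C S}

/-- The open sets `interior D` and `Dᶜ` are disjoint and cover everything off `C`, so connectedness
forces a choice. This is how the side on which `D` lies is decided throughout. -/
theorem subset_interior_or_subset_compl (hcl : IsClosed D) (hC : C = D \ interior D) {R : Set P}
    (hR : IsPreconnected R) (hRC : Disjoint R C) : R ⊆ interior D ∨ R ⊆ Dᶜ := by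
  refine hR.subset_or_subset isOpen_interior hcl.isOpen_compl
    (disjoint_compl_right.mono_left interior_subset) fun r hr => ?_
  by_cases hrD : r ∈ D
  · refine Or.inl ?_
    by_contra hint
    exact disjoint_left.1 hRC hr (hC ▸ ⟨hrD, hint⟩)
  · exact Or.inr hrD

/-- Along a short piece of the arc the abscissa is injective, hence strictly monotone, and
increasing after reversing the arc if necessary. The graph is the ordinate as a function of the
abscissa; the inverse of the abscissa is extended to the whole line to keep `f` globally continuous.
-/
theorem exists_graph_of_injOn {e : ℝ → C} (he : IsOpenEmbedding e) {U : Set P} (hU : U ∈ 𝓝 (e 0 : P))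
    (hi : InjOn (xc Φ) (C ∩ U)) : ∃ f : ℝ → ℝ, Continuous f ∧ f (xc Φ (e 0)) = yc Φ (e 0) ∧
      ∀ᶠ r in 𝓝 (e 0 : P), r ∈ C ↔ yc Φ r = f (xc Φ r) := by
  have main : ∀ e : ℝ → C, IsOpenEmbedding e → U ∈ 𝓝 (e 0 : P) → ∀ η > 0,
      (∀ r ∈ Icc (-η) η, (e r : P) ∈ U) → StrictMonoOn (fun r => xc Φ (e r)) (Icc (-η) η) →
      ∃ f : ℝ → ℝ, Continuous f ∧ f (xc Φ (e 0)) = yc Φ (e 0) ∧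
      ∀ᶠ r in 𝓝 (e 0 : P), r ∈ C ↔ yc Φ r = f (xc Φ r) := by
    intro e he hU η hη hηU hm
    have hec : Continuous fun r => (e r : P) := continuous_subtype_val.comp he.continuous
    obtain ⟨K, hK, hKk⟩ := exists_homeomorph_extension (k := fun r => xc Φ (e r)) (by linarith)
      ((continuous_xc Φ).comp hec).continuousOn hm
    have h0 : (0 : ℝ) ∈ Icc (-η) η := ⟨by linarith, by linarith⟩
    have hK0 : K.symm (xc Φ (e 0)) = 0 := by rw [← hKk 0 h0, K.symm_apply_apply]
    refine ⟨fun t => yc Φ (e (K.symm t)),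
      (continuous_yc Φ).comp (hec.comp K.symm.continuous), congrArg (fun r => yc Φ (e r)) hK0, ?_⟩
    have hev : ∀ᶠ r in 𝓝 (e 0 : P), K.symm (xc Φ r) ∈ Ioo (-η) η := by
      have : Continuous fun r => K.symm (xc Φ r) := by fun_prop
      refine (this.tendsto _).eventually (Ioo_mem_nhds ?_ ?_) <;> rw [hK0] <;> linarith
    filter_upwards [hev, hU] with r hr hrU
    have hr' := Ioo_subset_Icc_self hr
    have hx : xc Φ (e (K.symm (xc Φ r))) = xc Φ r := by
      rw [← hKk _ hr', K.apply_symm_apply]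
    constructor
    · intro hrC
      rw [← hi ⟨(e _).2, hηU _ hr'⟩ ⟨hrC, hrU⟩ hx]
      simp only [hx]
    · intro hy
      rw [ext_coords hx.symm hy]
      exact (e _).2
  have hec : Continuous fun r => (e r : P) := continuous_subtype_val.comp he.continuous
  obtain ⟨η, hη, hηU⟩ := Metric.nhds_basis_closedBall.mem_iff.1 (hec.continuousAt.preimage_mem_nhds hU)
  rw [Real.closedBall_eq_Icc, zero_sub, zero_add] at hηU
  have hinj : InjOn (fun r => xc Φ (e r)) (Icc (-η) η) := fun r hr r' hr' h =>
    he.injective (Subtype.ext (hi ⟨(e r).2, hηU hr⟩ ⟨(e r').2, hηU hr'⟩ h))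
  have hcont : ContinuousOn (fun r => xc Φ (e r)) (Icc (-η) η) :=
    ((continuous_xc Φ).comp hec).continuousOn
  rcases hcont.strictMonoOn_of_injOn_Icc' (by linarith) hinj with hm | hm
  · exact main e he hU η hη hηU hm
  · have := main (fun r => e (-r)) (isOpenEmbedding_comp_neg he) (by simpa using hU) η hη
      (fun r hr => hηU ⟨by linarith [hr.2], by linarith [hr.1]⟩) fun r hr r' hr' h =>
        hm ⟨by linarith [hr'.2], by linarith [hr'.1]⟩ ⟨by linarith [hr.2], by linarith [hr.1]⟩
          (by linarith)
    simpa using this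

/-- At an ordinary point of the curve, `D` lies on one side. -/
theorem exists_side (hcl : IsClosed D) (hC : C = D \ interior D) (hcl' : D ⊆ closure (interior D))
    {q : P} (hq : q ∈ C) {f : ℝ → ℝ} (hf : Continuous f) (hf0 : f (xc Φ q) = yc Φ q)
    (hfC : ∀ᶠ r in 𝓝 q, r ∈ C ↔ yc Φ r = f (xc Φ r)) :
    ∃ s, (s = 1 ∨ s = -1) ∧ IsGraphPoint Φ D C q s f := by
  obtain ⟨ε, hε, hbox⟩ := exists_box (Φ := Φ) hfC
  have hbox' : ∀ r, |xc Φ r - xc Φ q| < ε → |yc Φ r - yc Φ q| < ε →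
      (r ∈ C ↔ yc Φ r = f (xc Φ r)) := fun r h1 h2 => by simpa using hbox _ _ h1 h2
  obtain ⟨δ, hδ, hδf⟩ := Metric.continuousAt_iff.1 (hf.continuousAt (x := xc Φ q)) ε hε
  rw [hf0] at hδf
  set δ' := min δ ε
  have hδ' : 0 < δ' := lt_min hδ hε
  have hfε : ∀ t ∈ Ioo (xc Φ q - δ') (xc Φ q + δ'), |f t - yc Φ q| < ε := fun t ht =>
    @hδf t (by
      rw [Real.dist_eq, abs_lt]
      have := min_le_left δ ε
      constructor <;> linarith [ht.1, ht.2])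
  have htε : ∀ t ∈ Ioo (xc Φ q - δ') (xc Φ q + δ'), |t - xc Φ q| < ε := fun t ht => by
    rw [abs_lt]
    have := min_le_right δ ε
    constructor <;> linarith [ht.1, ht.2]
  have hup := subset_interior_or_subset_compl hcl hC
    (isPreconnected_region (Φ := Φ) (a := xc Φ q - δ') (b := xc Φ q + δ') hf
      (continuous_const (y := yc Φ q + ε)) fun t ht => by linarith [(abs_lt.1 (hfε t ht)).2])
    (disjoint_left.2 fun r ⟨h1, h2, h3⟩ hrC => by
      have h4 := abs_lt.1 (hfε _ h1)
      exact h2.ne' ((hbox' r (htε _ h1) (abs_lt.2 ⟨by linarith, by linarith⟩)).1 hrC))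
  have hdown := subset_interior_or_subset_compl hcl hC
    (isPreconnected_region (Φ := Φ) (a := xc Φ q - δ') (b := xc Φ q + δ')
      (continuous_const (y := yc Φ q - ε)) hf fun t ht => by linarith [(abs_lt.1 (hfε t ht)).1])
    (disjoint_left.2 fun r ⟨h1, h2, h3⟩ hrC => by
      have h4 := abs_lt.1 (hfε _ h1)
      exact h3.ne ((hbox' r (htε _ h1) (abs_lt.2 ⟨by linarith, by linarith⟩)).1 hrC))
  have hnear := eventually_box (Φ := Φ) q hδ'
  have hIoo : ∀ r, |xc Φ r - xc Φ q| < δ' → xc Φ r ∈ Ioo (xc Φ q - δ') (xc Φ q + δ') :=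
    fun r h => ⟨by linarith [(abs_lt.1 h).1], by linarith [(abs_lt.1 h).2]⟩
  have hδε : δ' ≤ ε := min_le_right _ _
  have hup' : ∀ r, |xc Φ r - xc Φ q| < δ' → |yc Φ r - yc Φ q| < δ' → f (xc Φ r) < yc Φ r →
      r ∈ {p : P | xc Φ p ∈ Ioo (xc Φ q - δ') (xc Φ q + δ') ∧ f (xc Φ p) < yc Φ p ∧
        yc Φ p < yc Φ q + ε} :=
    fun r h1 h2 h3 => ⟨hIoo r h1, h3, by linarith [(abs_lt.1 h2).2]⟩
  have hdown' : ∀ r, |xc Φ r - xc Φ q| < δ' → |yc Φ r - yc Φ q| < δ' → yc Φ r < f (xc Φ r) →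
      r ∈ {p : P | xc Φ p ∈ Ioo (xc Φ q - δ') (xc Φ q + δ') ∧ yc Φ q - ε < yc Φ p ∧
        yc Φ p < f (xc Φ p)} :=
    fun r h1 h2 h3 => ⟨hIoo r h1, by linarith [(abs_lt.1 h2).1], h3⟩
  have hCD : C ⊆ D := hC ▸ sdiff_subset
  -- With `D` on both sides `q` would be an interior point; with `D` on neither side it would not be
  -- in the closure of the interior.
  rcases hup with hup | hup <;> rcases hdown with hdown | hdown
  · exfalso
    rw [hC] at hq
    refine hq.2 (mem_interior_iff_mem_nhds.2 ?_)
    filter_upwards [hnear, hfC] with r hr hrC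
    rcases lt_trichotomy (yc Φ r) (f (xc Φ r)) with h | h | h
    · exact interior_subset (hdown (hdown' r hr.1 hr.2 h))
    · exact hCD (hrC.2 h)
    · exact interior_subset (hup (hup' r hr.1 hr.2 h))
  · refine ⟨-1, Or.inr rfl, hf, hf0, ?_⟩
    filter_upwards [hnear, hfC] with r hr hrC
    refine ⟨hrC, ?_⟩
    rcases lt_trichotomy (yc Φ r) (f (xc Φ r)) with h | h | h
    · exact iff_of_false (hdown (hdown' r hr.1 hr.2 h)) (by linarith)
    · exact iff_of_true (hCD (hrC.2 h)) (by linarith)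
    · exact iff_of_true (interior_subset (hup (hup' r hr.1 hr.2 h))) (by linarith)
  · refine ⟨1, Or.inl rfl, hf, hf0, ?_⟩
    filter_upwards [hnear, hfC] with r hr hrC
    refine ⟨hrC, ?_⟩
    rcases lt_trichotomy (yc Φ r) (f (xc Φ r)) with h | h | h
    · exact iff_of_true (interior_subset (hdown (hdown' r hr.1 hr.2 h))) (by linarith)
    · exact iff_of_true (hCD (hrC.2 h)) (by linarith)
    · exact iff_of_false (hup (hup' r hr.1 hr.2 h)) (by linarith)
  · exfalso
    obtain ⟨r, ⟨hr, hrC⟩, hrD⟩ :=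
      ((mem_closure_iff_frequently.1 (hcl' (hCD hq))).and_eventually (hnear.and hfC)).exists
        |>.imp fun r h => And.intro h.2 h.1
    have hrC' : r ∉ C := fun h => (hC ▸ h).2 hrD
    rcases lt_trichotomy (yc Φ r) (f (xc Φ r)) with h | h | h
    · exact hdown (hdown' r hr.1 hr.2 h) (interior_subset hrD)
    · exact hrC' (hrC.2 h)
    · exact hup (hup' r hr.1 hr.2 h) (interior_subset hrD)

end LocalStructure

end PoincareReeb

namespace PoincareReeb

open Set Topology

/-! ### Critical points of the curve are folds. -/

section Folds

theorem injOn_Ioo_of_locally_injOn {k : ℝ → ℝ} (hk : Continuous k) {a b : ℝ}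
    (hloc : ∀ r ∈ Ioo a b, ∃ V ∈ 𝓝 r, InjOn k V) : InjOn k (Ioo a b) := by
  have hemb : IsOpenEmbedding (Subtype.val : Ioo a b → ℝ) := isOpen_Ioo.isOpenEmbedding_subtypeVal
  have : PreconnectedSpace (Ioo a b) := Subtype.preconnectedSpace isPreconnected_Ioo
  have hinj : Function.Injective fun x : Ioo a b => k x := by
    refine injective_of_locally_injective (by fun_prop) (isOpenMap_iff_nhds_le.2 fun x s hs => ?_)
      fun x => ?_
    · obtain ⟨V, hV, hVi⟩ := hloc x x.2
      have h1 := Filter.inter_mem (hemb.image_mem_nhds.2 hs) hV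
      refine Filter.mem_of_superset (image_mem_nhds_of_injOn h1 hk.continuousOn
        (hVi.mono inter_subset_right)) ?_
      rintro _ ⟨_, ⟨⟨y, hy, rfl⟩, -⟩, rfl⟩
      exact hy
    · obtain ⟨V, hV, hVi⟩ := hloc x x.2
      obtain ⟨ε, hε, hεV⟩ := Metric.mem_nhds_iff.1 (Filter.inter_mem hV (isOpen_Ioo.mem_nhds x.2))
      refine ⟨Subtype.val ⁻¹' Metric.ball (x : ℝ) ε, Metric.isOpen_ball.preimage
        continuous_subtype_val, Metric.mem_ball_self hε, ?_, fun y hy z hz h =>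
          Subtype.ext (hVi (hεV hy).1 (hεV hz).1 h)⟩
      rw [← hemb.isInducing.isPreconnected_image, Subtype.image_preimage_coe,
        inter_eq_right.2 fun y hy => (hεV hy).2, Real.ball_eq_Ioo]
      exact isPreconnected_Ioo
  intro x hx y hy h
  exact congrArg Subtype.val (@hinj ⟨x, hx⟩ ⟨y, hy⟩ h)

/-- Monotonicity on the open interval passes to the end point `0` by continuity; it stays strict
because an intermediate point can be inserted. -/
theorem exists_strictMonoOn_of_injOn {k : ℝ → ℝ} (hk : Continuous k) {η : ℝ} (hη : 0 < η)
    (hi : InjOn k (Ioo 0 η)) : ∃ σ : ℝ, (σ = 1 ∨ σ = -1) ∧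
      StrictMonoOn (fun u => σ * (k u - k 0)) (Icc 0 (η / 2)) := by
  have main : ∀ h : ℝ → ℝ, Continuous h → StrictMonoOn h (Ioo 0 η) →
      StrictMonoOn h (Icc 0 (η / 2)) := by
    intro h hh hm u hu v hv huv
    rcases hu.1.eq_or_lt with rfl | hu0
    · have h1 : h 0 ≤ h (v / 2) := by
        have hlim : Filter.Tendsto h (𝓝[>] 0) (𝓝 (h 0)) := (hh.tendsto 0).mono_left inf_le_left
        refine le_of_tendsto hlim ?_
        filter_upwards [Ioo_mem_nhdsGT (show (0 : ℝ) < v / 2 by linarith)] with w hw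
        exact (hm ⟨hw.1, by linarith [hw.2, hv.2]⟩ ⟨by linarith, by linarith [hv.2]⟩ hw.2).le
      have h2 := hm (a := v / 2) (b := v) ⟨by linarith, by linarith [hv.2]⟩ ⟨huv, by linarith [hv.2]⟩
        (by linarith)
      linarith
    · exact hm ⟨hu0, by linarith [hu.2]⟩ ⟨hu0.trans huv, by linarith [hv.2]⟩ huv
  rcases hk.continuousOn.strictMonoOn_of_injOn_Ioo hη hi with hm | hm
  · refine ⟨1, Or.inl rfl, ?_⟩
    have := main k hk hm
    exact fun u hu v hv huv => by simpa using this hu hv huv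
  · refine ⟨-1, Or.inr rfl, ?_⟩
    have := main (fun u => -k u) hk.neg hm.neg
    exact fun u hu v hv huv => by simpa using this hu hv huv

variable {P : Type*} [TopologicalSpace P] {Φ : P ≃ₜ ℝ × ℝ} {D C S : Set P}

/-- On each of the two half-arcs at the point, the abscissa is locally injective and hence strictly
monotone. If it passed through `t₀`, the projection would be an embedding near the point. So it
turns back, and both half-arcs are graphs over the same side. -/
theorem exists_isFold {e : ℝ → C} (he : IsOpenEmbedding e)
    (hcrit : ¬ ∃ U ∈ 𝓝 (e 0 : P), IsEmbedding ((C ∩ U).domRestrict (xc Φ)))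
    (hreg : ∀ᶠ q in 𝓝 (e 0 : P), q ∈ C → q ≠ e 0 → ∃ U ∈ 𝓝 q, InjOn (xc Φ) (C ∩ U)) :
    ∃ σ f g, IsFold Φ C (e 0 : P) σ f g := by
  have hec : Continuous fun r => (e r : P) := continuous_subtype_val.comp he.continuous
  have hkc : Continuous fun r => xc Φ (e r) := (continuous_xc Φ).comp hec
  set t₀ := xc Φ (e 0) with ht₀
  obtain ⟨η, hη, hηr⟩ := Metric.eventually_nhds_iff_ball.1 (hec.continuousAt.eventually hreg)
  rw [Real.ball_eq_Ioo, zero_sub, zero_add] at hηr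
  have hloc : ∀ r ∈ Ioo (-η) η, r ≠ 0 → ∃ V ∈ 𝓝 r, InjOn (fun r => xc Φ (e r)) V := by
    intro r hr hr0
    obtain ⟨U, hU, hUi⟩ := hηr r hr (e r).2 fun h => hr0 (he.injective (Subtype.ext h))
    exact ⟨_, hec.continuousAt.preimage_mem_nhds hU, fun x hx y hy h =>
      he.injective (Subtype.ext (hUi ⟨(e x).2, hx⟩ ⟨(e y).2, hy⟩ h))⟩
  have hi₁ : InjOn (fun r => xc Φ (e r)) (Ioo 0 η) := injOn_Ioo_of_locally_injOn hkc
    fun r hr => hloc r ⟨by linarith [hr.1], hr.2⟩ hr.1.ne'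
  have hi₂ : InjOn (fun r => xc Φ (e (-r))) (Ioo 0 η) := by
    have : InjOn (fun r => xc Φ (e r)) (Ioo (-η) 0) := injOn_Ioo_of_locally_injOn hkc
      fun r hr => hloc r ⟨hr.1, by linarith [hr.2]⟩ hr.2.ne
    intro x hx y hy h
    exact neg_injective (this ⟨by linarith [hx.2], by linarith [hx.1]⟩
      ⟨by linarith [hy.2], by linarith [hy.1]⟩ h)
  obtain ⟨σ, hσ, hm₁⟩ := exists_strictMonoOn_of_injOn hkc hη hi₁
  obtain ⟨σ', hσ', hm₂⟩ := exists_strictMonoOn_of_injOn (hkc.comp continuous_neg) hη hi₂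
  simp only [Function.comp_def, neg_zero] at hm₂
  rw [← ht₀] at hm₁ hm₂
  have hη2 : 0 < η / 2 := by linarith
  obtain ⟨U, hUo, hU⟩ := isOpen_induced_iff.1 (he.isOpenMap _ (isOpen_Ioo (a := -(η / 2)) (b := η / 2)))
  have hUm : ∀ q : P, q ∈ C → q ∈ U → ∃ r ∈ Ioo (-(η / 2)) (η / 2), (e r : P) = q := by
    intro q hq hqU
    have : (⟨q, hq⟩ : C) ∈ e '' Ioo (-(η / 2)) (η / 2) := hU ▸ hqU
    obtain ⟨r, hr, hrq⟩ := this
    exact ⟨r, hr, congrArg Subtype.val hrq⟩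
  have hU0 : U ∈ 𝓝 (e 0 : P) := hUo.mem_nhds (by
    have : e 0 ∈ Subtype.val ⁻¹' U := by
      rw [hU]
      exact ⟨0, ⟨by linarith, by linarith⟩, rfl⟩
    exact this)
  -- The signs give the directions in which the abscissa leaves `t₀` along the two half-arcs. Were
  -- they opposite, it would be strictly monotone through `0`, with a continuous inverse.
  have hσσ : σ = σ' := by
    by_contra hne
    have hσ'' : σ' = -σ := by rcases hσ with rfl | rfl <;> rcases hσ' with rfl | rfl <;> simp_all
    subst hσ''
    refine hcrit ⟨U, hU0, ?_⟩
    have hm₃ : StrictMonoOn (fun r => σ * (xc Φ (e r) - t₀)) (Icc (-(η / 2)) 0) := by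
      intro u hu v hv huv
      have := hm₂ (a := -v) (b := -u) ⟨by linarith [hv.2], by linarith [hv.1]⟩
        ⟨by linarith [hu.2], by linarith [hu.1]⟩ (by linarith)
      simp only [neg_neg] at this
      linarith
    have hm := hm₃.union hm₁ (isGreatest_Icc (by linarith)) (isLeast_Icc (by linarith))
    rw [Icc_union_Icc_eq_Icc (by linarith) (by linarith)] at hm
    obtain ⟨K, -, hKk⟩ := exists_homeomorph_extension (k := fun u => σ * (xc Φ (e u) - t₀))
      (by linarith)
      ((continuous_const.mul (hkc.sub continuous_const)).continuousOn) hm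
    have hg : Continuous fun t => (e (K.symm (σ * (t - t₀))) : P) :=
      hec.comp (K.symm.continuous.comp (by fun_prop))
    refine IsEmbedding.of_comp ((continuous_xc Φ).comp continuous_subtype_val) hg ?_
    convert (IsEmbedding.subtypeVal : IsEmbedding (Subtype.val : ↥(C ∩ U) → P)) using 1
    funext q
    obtain ⟨r, hr, hrq⟩ := hUm q q.2.1 q.2.2
    change (e (K.symm (σ * (xc Φ q - t₀))) : P) = q
    rw [← hrq, ← hKk r (Ioo_subset_Icc_self hr), K.symm_apply_apply]
  subst hσσ
  have hσ2 : σ * σ = 1 := by rcases hσ with rfl | rfl <;> norm_num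
  -- the two branches
  have branch : ∀ d : ℝ → C, (Continuous fun r => (d r : P)) → d 0 = e 0 →
      StrictMonoOn (fun u => σ * (xc Φ (d u) - t₀)) (Icc 0 (η / 2)) →
      ∃ K : ℝ ≃ₜ ℝ, (∀ u ∈ Icc 0 (η / 2), K.symm (σ * (xc Φ (d u) - t₀)) = u) ∧
        (∀ u ∈ Icc 0 (η / 2), 0 ≤ σ * (xc Φ (d u) - t₀)) ∧
        (∀ᶠ t in 𝓝 t₀, 0 ≤ σ * (t - t₀) → K.symm (σ * (t - t₀)) ∈ Icc 0 (η / 2) ∧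
          xc Φ (d (K.symm (σ * (t - t₀)))) = t ∧
          (0 < σ * (t - t₀) → 0 < K.symm (σ * (t - t₀)))) := by
    intro d hd hd0 hm
    have h0 : (0 : ℝ) ∈ Icc 0 (η / 2) := ⟨le_rfl, by linarith⟩
    obtain ⟨K, hK, hKk⟩ := exists_homeomorph_extension (k := fun u => σ * (xc Φ (d u) - t₀))
      (by linarith)
      ((continuous_const.mul (((continuous_xc Φ).comp hd).sub continuous_const)).continuousOn) hm
    have hK0 : K 0 = 0 := by
      rw [hKk 0 h0]
      simp [hd0, t₀]
    have hKs0 : K.symm 0 = 0 := by rw [← hK0, K.symm_apply_apply, hK0]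
    refine ⟨K, fun u hu => by rw [← hKk u hu]; exact K.symm_apply_apply u, fun u hu => ?_, ?_⟩
    · have := hm.monotoneOn h0 hu hu.1
      simpa [hd0, ht₀] using this
    · have hcont : Continuous fun t => K.symm (σ * (t - t₀)) := by fun_prop
      have hlt : ∀ᶠ t in 𝓝 t₀, K.symm (σ * (t - t₀)) < η / 2 :=
        (hcont.tendsto t₀).eventually (gt_mem_nhds (by simpa [hKs0] using hη2))
      filter_upwards [hlt] with t ht ht0
      have hge : 0 ≤ K.symm (σ * (t - t₀)) := by
        rw [← hK.le_iff_le, hK0, K.apply_symm_apply]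
        exact ht0
      refine ⟨⟨hge, ht.le⟩, ?_, fun h => ?_⟩
      · have h1 := hKk _ ⟨hge, ht.le⟩
        rw [K.apply_symm_apply] at h1
        have h2 : σ * σ * (t - t₀) = σ * σ * (xc Φ (d (K.symm (σ * (t - t₀)))) - t₀) := by
          rw [mul_assoc, mul_assoc, ← h1]
        rw [hσ2] at h2
        linarith
      · rw [← hK.lt_iff_lt, hK0, K.apply_symm_apply]
        exact h
  obtain ⟨K₁, hK₁, hp₁, hr₁⟩ := branch e hec rfl hm₁
  obtain ⟨K₂, hK₂, hp₂, hr₂⟩ := branch (fun u => e (-u)) (hec.comp continuous_neg) (by simp) hm₂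
  let F₁ : ℝ → ℝ := fun t => yc Φ (e (K₁.symm (σ * (t - t₀))))
  let F₂ : ℝ → ℝ := fun t => yc Φ (e (-K₂.symm (σ * (t - t₀))))
  have hF₁ : Continuous F₁ := (continuous_yc Φ).comp (hec.comp (by fun_prop))
  have hF₂ : Continuous F₂ := (continuous_yc Φ).comp (hec.comp (by fun_prop))
  have h0m : (0 : ℝ) ∈ Icc 0 (η / 2) := ⟨le_rfl, by linarith⟩
  have hK₁0 : K₁.symm 0 = 0 := by simpa [ht₀] using hK₁ 0 h0m
  have hK₂0 : K₂.symm 0 = 0 := by simpa [ht₀] using hK₂ 0 h0m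
  have hF₁0 : F₁ t₀ = yc Φ (e 0) := by simp [F₁, hK₁0]
  have hF₂0 : F₂ t₀ = yc Φ (e 0) := by simp [F₂, hK₂0]
  have hcurve : ∀ᶠ r in 𝓝 (e 0 : P), r ∈ C ↔ 0 ≤ σ * (xc Φ r - t₀) ∧
      (yc Φ r = F₁ (xc Φ r) ∨ yc Φ r = F₂ (xc Φ r)) := by
    filter_upwards [hU0, (continuous_xc Φ).continuousAt.eventually hr₁,
      (continuous_xc Φ).continuousAt.eventually hr₂] with r hrU h1 h2
    constructor
    · intro hrC
      obtain ⟨u, hu, rfl⟩ := hUm r hrC hrU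
      rcases le_total 0 u with hu0 | hu0
      · exact ⟨hp₁ u ⟨hu0, hu.2.le⟩, Or.inl (by simp only [F₁]; rw [hK₁ u ⟨hu0, hu.2.le⟩])⟩
      · have hmem : -u ∈ Icc 0 (η / 2) := ⟨by linarith, by linarith [hu.1]⟩
        have h3 := hp₂ _ hmem
        have h4 := hK₂ _ hmem
        simp only [neg_neg] at h3 h4
        exact ⟨h3, Or.inr (by simp only [F₂]; rw [h4, neg_neg])⟩
    · rintro ⟨h0, h | h⟩
      · rw [ext_coords (h1 h0).2.1.symm h]
        exact (e _).2
      · rw [ext_coords (h2 h0).2.1.symm h]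
        exact (e _).2
  have hne : ∀ᶠ t in 𝓝 t₀, 0 < σ * (t - t₀) → F₁ t ≠ F₂ t := by
    filter_upwards [hr₁, hr₂] with t h1 h2 ht heq
    obtain ⟨-, h3, h4⟩ := h1 ht.le
    obtain ⟨-, h5, h6⟩ := h2 ht.le
    have h7 := he.injective (Subtype.ext (ext_coords (h3.trans h5.symm) heq))
    linarith [h4 ht, h6 ht]
  obtain ⟨δ, hδ, hδne⟩ := Metric.eventually_nhds_iff.1 hne
  have hG : ∀ τ ∈ Ioo 0 δ, F₁ (t₀ + σ * τ) - F₂ (t₀ + σ * τ) ≠ 0 := by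
    intro τ hτ
    refine sub_ne_zero.2 (hδne ?_ ?_)
    · rw [Real.dist_eq, add_sub_cancel_left, abs_mul, abs_of_pos hτ.1]
      rcases hσ with rfl | rfl <;> simpa using hτ.2
    · rw [add_sub_cancel_left, ← mul_assoc, hσ2, one_mul]
      exact hτ.1
  have hGc : Continuous fun τ => F₁ (t₀ + σ * τ) - F₂ (t₀ + σ * τ) := by fun_prop
  -- The branches meet only at the fold, so their difference keeps its sign; the sign tells which
  -- branch is the lower one.
  have hsub := (isPreconnected_Ioo.image _ hGc.continuousOn).subset_or_subset
    (isOpen_Iio (a := (0 : ℝ))) isOpen_Ioi (by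
      rw [disjoint_left]; intro x h1 h2; exact lt_asymm (mem_Iio.1 h1) (mem_Ioi.1 h2)) (by
      rintro _ ⟨τ, hτ, rfl⟩
      exact lt_or_gt_of_ne (hG τ hτ))
  have hconv : ∀ Q : ℝ → Prop, (∀ τ ∈ Ioo 0 δ, Q (t₀ + σ * τ)) →
      ∀ᶠ t in 𝓝 t₀, 0 < σ * (t - t₀) → Q t := by
    intro Q hQ
    filter_upwards [Metric.ball_mem_nhds t₀ hδ] with t ht h0
    have h1 := hQ (σ * (t - t₀)) ⟨h0, by
      rw [Metric.mem_ball, Real.dist_eq, abs_lt] at ht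
      rcases hσ with rfl | rfl <;> linarith [ht.1, ht.2]⟩
    rwa [← mul_assoc, hσ2, one_mul, add_sub_cancel] at h1
  rcases hsub with hsub | hsub
  · refine ⟨σ, F₁, F₂, hσ, hF₁, hF₂, hF₁0, hF₂0, hconv _ fun τ hτ => ?_, hcurve⟩
    exact sub_neg.1 (hsub (mem_image_of_mem _ hτ))
  · refine ⟨σ, F₂, F₁, hσ, hF₂, hF₁, hF₂0, hF₁0, hconv _ fun τ hτ => ?_, ?_⟩
    · exact sub_pos.1 (hsub (mem_image_of_mem _ hτ))
    · filter_upwards [hcurve] with r hr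
      rw [hr, or_comm]

/-- At a fold, `D` lies between the branches or on the other side of them. -/
theorem IsFold.isLeaf_or_isSplit (hcl : IsClosed D) (hC : C = D \ interior D)
    (hcl' : D ⊆ closure (interior D)) {p : P} (hp : p ∈ C) {σ : ℝ} {f g : ℝ → ℝ}
    (h : IsFold Φ C p σ f g) : IsLeaf Φ D C p σ f g ∨ IsSplit Φ D C p σ f g := by
  have hfold := h
  obtain ⟨hσ, hf, hg, hf0, hg0, hlt, hcurve⟩ := h
  have hCD : C ⊆ D := hC ▸ sdiff_subset
  set t₀ := xc Φ p with ht₀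
  set y₀ := yc Φ p with hy₀
  -- Clamping the abscissa continues both branches past the fold by the constant `y₀`. The regions
  -- above the upper branch and below the lower one then both reach the side without curve.
  let cl : ℝ → ℝ := fun t => t₀ + σ * max 0 (σ * (t - t₀))
  have hσ2 : σ * σ = 1 := by rcases hσ with rfl | rfl <;> norm_num
  have hcl1 : ∀ t, 0 ≤ σ * (t - t₀) → cl t = t := fun t ht => by
    simp only [cl]
    rw [max_eq_right ht, ← mul_assoc, hσ2]
    ring
  have hcl2 : ∀ t, σ * (t - t₀) ≤ 0 → cl t = t₀ := fun t ht => by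
    simp only [cl]
    rw [max_eq_left ht]
    ring
  have hclc : Continuous cl := by fun_prop
  have hcl0 : cl t₀ = t₀ := hcl2 t₀ (by simp)
  obtain ⟨ε, hε, hbox⟩ := exists_box (Φ := Φ) hcurve
  have hbox' : ∀ r, |xc Φ r - t₀| < ε → |yc Φ r - y₀| < ε → (r ∈ C ↔
      0 ≤ σ * (xc Φ r - t₀) ∧ (yc Φ r = f (xc Φ r) ∨ yc Φ r = g (xc Φ r))) := fun r h1 h2 => by
    simpa using hbox _ _ h1 h2
  have hfc : ∀ᶠ t in 𝓝 t₀, |f (cl t) - y₀| < ε := by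
    have : Continuous fun t => |f (cl t) - y₀| := by fun_prop
    exact (this.tendsto t₀).eventually (gt_mem_nhds (by simpa [hcl0, hf0]))
  have hgc : ∀ᶠ t in 𝓝 t₀, |g (cl t) - y₀| < ε := by
    have : Continuous fun t => |g (cl t) - y₀| := by fun_prop
    exact (this.tendsto t₀).eventually (gt_mem_nhds (by simpa [hcl0, hg0]))
  obtain ⟨δ₀, hδ₀, hev⟩ := Metric.eventually_nhds_iff.1 (hfc.and (hgc.and hlt))
  set δ := min δ₀ ε
  have hδ : 0 < δ := lt_min hδ₀ hε
  have hδε : δ ≤ ε := min_le_right _ _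
  have hev' : ∀ t ∈ Ioo (t₀ - δ) (t₀ + δ), |t - t₀| < ε ∧ |f (cl t) - y₀| < ε ∧
      |g (cl t) - y₀| < ε ∧ (0 < σ * (t - t₀) → f t < g t) := fun t ht => by
    have h1 : |t - t₀| < δ := abs_lt.2 ⟨by linarith [ht.1], by linarith [ht.2]⟩
    exact ⟨h1.trans_le hδε, @hev t (h1.trans_le (min_le_left _ _))⟩
  -- the four regions
  have hA := subset_interior_or_subset_compl hcl hC
    (isPreconnected_region (Φ := Φ) (a := t₀ - δ) (b := t₀ + δ) (hg.comp hclc)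
      (continuous_const (y := y₀ + ε)) fun t ht => by
        have := (abs_lt.1 (hev' t ht).2.2.1).2
        simp only [Function.comp]
        linarith)
    (disjoint_left.2 fun r ⟨h1, h2, h3⟩ hrC => by
      obtain ⟨h4, h5, h6, h7⟩ := hev' _ h1
      simp only [Function.comp] at h2
      obtain ⟨h8, h9⟩ := (hbox' r h4 (abs_lt.2 ⟨by linarith [(abs_lt.1 h6).1], by linarith⟩)).1 hrC
      rw [hcl1 _ h8] at h2
      rcases h9 with h9 | h9
      · rcases h8.eq_or_lt with h10 | h10
        · have h11 : xc Φ r = t₀ := by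
            rcases hσ with rfl | rfl <;> linarith
          rw [h11, hf0] at h9
          rw [h11, hg0] at h2
          linarith
        · linarith [h7 h10]
      · linarith)
  have hB := subset_interior_or_subset_compl hcl hC
    (isPreconnected_region (Φ := Φ) (a := t₀ - δ) (b := t₀ + δ)
      (continuous_const (y := y₀ - ε)) (hf.comp hclc) fun t ht => by
        have := (abs_lt.1 (hev' t ht).2.1).1
        simp only [Function.comp]
        linarith)
    (disjoint_left.2 fun r ⟨h1, h2, h3⟩ hrC => by
      obtain ⟨h4, h5, h6, h7⟩ := hev' _ h1
      simp only [Function.comp] at h3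
      obtain ⟨h8, h9⟩ := (hbox' r h4 (abs_lt.2 ⟨by linarith, by linarith [(abs_lt.1 h5).2]⟩)).1 hrC
      rw [hcl1 _ h8] at h3
      rcases h9 with h9 | h9
      · linarith
      · rcases h8.eq_or_lt with h10 | h10
        · have h11 : xc Φ r = t₀ := by
            rcases hσ with rfl | rfl <;> linarith
          rw [h11, hg0] at h9
          rw [h11, hf0] at h3
          linarith
        · linarith [h7 h10])
  obtain ⟨a, b, hab⟩ : ∃ a b, ∀ t, t ∈ Ioo a b ↔ σ * (t - t₀) < 0 ∧ t ∈ Ioo (t₀ - δ) (t₀ + δ) := by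
    rcases hσ with rfl | rfl
    · exact ⟨t₀ - δ, t₀, fun t => ⟨fun h => ⟨by linarith [h.2], h.1, by linarith [h.2]⟩,
        fun h => ⟨h.2.1, by linarith [h.1]⟩⟩⟩
    · exact ⟨t₀, t₀ + δ, fun t => ⟨fun h => ⟨by linarith [h.1], by linarith [h.1], h.2⟩,
        fun h => ⟨by linarith [h.1], h.2.2⟩⟩⟩
  obtain ⟨a', b', hab'⟩ : ∃ a b, ∀ t, t ∈ Ioo a b ↔
      0 < σ * (t - t₀) ∧ t ∈ Ioo (t₀ - δ) (t₀ + δ) := by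
    rcases hσ with rfl | rfl
    · exact ⟨t₀, t₀ + δ, fun t => ⟨fun h => ⟨by linarith [h.1], by linarith [h.1], h.2⟩,
        fun h => ⟨by linarith [h.1], h.2.2⟩⟩⟩
    · exact ⟨t₀ - δ, t₀, fun t => ⟨fun h => ⟨by linarith [h.2], h.1, by linarith [h.2]⟩,
        fun h => ⟨h.2.1, by linarith [h.1]⟩⟩⟩
  have hL := subset_interior_or_subset_compl hcl hC
    (isPreconnected_region (Φ := Φ) (a := a) (b := b)
      (continuous_const (y := y₀ - ε)) (continuous_const (y := y₀ + ε)) fun t ht => by linarith)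
    (disjoint_left.2 fun r ⟨h1, h2, h3⟩ hrC => by
      obtain ⟨h4, h5⟩ := (hab _).1 h1
      obtain ⟨h8, -⟩ := (hbox' r (hev' _ h5).1 (abs_lt.2 ⟨by linarith, by linarith⟩)).1 hrC
      linarith)
  have hI := subset_interior_or_subset_compl hcl hC
    (isPreconnected_region (Φ := Φ) (a := a') (b := b') hf hg
      fun t ht => (hev' t ((hab' t).1 ht).2).2.2.2 ((hab' t).1 ht).1)
    (disjoint_left.2 fun r ⟨h1, h2, h3⟩ hrC => by
      obtain ⟨h4, h5⟩ := (hab' _).1 h1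
      obtain ⟨h6, h7, h8, -⟩ := hev' _ h5
      rw [hcl1 _ h4.le] at h7 h8
      obtain ⟨-, h9⟩ := (hbox' r h6 (abs_lt.2
        ⟨by linarith [(abs_lt.1 h7).1], by linarith [(abs_lt.1 h8).2]⟩)).1 hrC
      rcases h9 with h9 | h9 <;> linarith)
  have hnear := eventually_box (Φ := Φ) p hδ
  have hIoo : ∀ r, |xc Φ r - t₀| < δ → xc Φ r ∈ Ioo (t₀ - δ) (t₀ + δ) :=
    fun r h => ⟨by linarith [(abs_lt.1 h).1], by linarith [(abs_lt.1 h).2]⟩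
  have hzero : ∀ r, σ * (xc Φ r - t₀) = 0 → f (xc Φ r) = y₀ ∧ g (xc Φ r) = y₀ := fun r h => by
    have : xc Φ r = t₀ := by rcases hσ with rfl | rfl <;> linarith
    rw [this]
    exact ⟨hf0, hg0⟩
  have hcases : ∀ r, |xc Φ r - t₀| < δ → |yc Φ r - y₀| < δ → r ∈ C ∨
      (0 < σ * (xc Φ r - t₀) ∧ f (xc Φ r) < yc Φ r ∧ yc Φ r < g (xc Φ r)) ∨
      (¬ (0 ≤ σ * (xc Φ r - t₀) ∧ f (xc Φ r) ≤ yc Φ r ∧ yc Φ r ≤ g (xc Φ r)) ∧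
        (σ * (xc Φ r - t₀) < 0 ∨ g (cl (xc Φ r)) < yc Φ r ∨ yc Φ r < f (cl (xc Φ r)))) := by
    intro r h1 h2
    by_cases hrC : r ∈ C
    · exact Or.inl hrC
    right
    rw [hbox' r (h1.trans_le hδε) (h2.trans_le hδε)] at hrC
    rcases lt_trichotomy (σ * (xc Φ r - t₀)) 0 with h3 | h3 | h3
    · exact Or.inr ⟨fun h => by linarith [h.1], Or.inl h3⟩
    · obtain ⟨h4, h5⟩ := hzero r h3
      right
      rw [hcl1 _ h3.ge]
      have h6 : yc Φ r ≠ y₀ := fun h => hrC ⟨h3.ge, Or.inl (h.trans h4.symm)⟩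
      rw [h4, h5]
      exact ⟨fun h => h6 (le_antisymm h.2.2 h.2.1), Or.inr ((lt_or_gt_of_ne h6).symm)⟩
    · rw [hcl1 _ h3.le]
      rcases lt_trichotomy (yc Φ r) (f (xc Φ r)) with h4 | h4 | h4
      · exact Or.inr ⟨fun h => by linarith [h.2.1], Or.inr (Or.inr h4)⟩
      · exact absurd ⟨h3.le, Or.inl h4⟩ hrC
      rcases lt_trichotomy (yc Φ r) (g (xc Φ r)) with h5 | h5 | h5
      · exact Or.inl ⟨h3, h4, h5⟩
      · exact absurd ⟨h3.le, Or.inr h5⟩ hrC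
      · exact Or.inr ⟨fun h => by linarith [h.2.2], Or.inr (Or.inl h5)⟩
  have hσ0 : σ * (t₀ - σ * (δ / 2) - t₀) < 0 := by
    have : σ * (t₀ - σ * (δ / 2) - t₀) = -(σ * σ * (δ / 2)) := by ring
    rw [this, hσ2]
    linarith
  have hu : t₀ - σ * (δ / 2) ∈ Ioo (t₀ - δ) (t₀ + δ) := by
    rcases hσ with rfl | rfl <;> constructor <;> linarith
  have hclu := hcl2 _ hσ0.le
  have huA : pt Φ (t₀ - σ * (δ / 2)) (y₀ + ε / 2) ∈ {q : P | xc Φ q ∈ Ioo (t₀ - δ) (t₀ + δ) ∧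
      (g ∘ cl) (xc Φ q) < yc Φ q ∧ yc Φ q < y₀ + ε} := by
    refine ⟨by simpa using hu, ?_, ?_⟩ <;> simp only [Function.comp, xc_pt, yc_pt]
    · rw [hclu, hg0]
      linarith
    · linarith
  have huL : pt Φ (t₀ - σ * (δ / 2)) (y₀ + ε / 2) ∈ {q : P | xc Φ q ∈ Ioo a b ∧
      y₀ - ε < yc Φ q ∧ yc Φ q < y₀ + ε} := by
    refine ⟨?_, ?_, ?_⟩ <;> simp only [xc_pt, yc_pt]
    · exact (hab _).2 ⟨hσ0, hu⟩
    · linarith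
    · linarith
  have hvB : pt Φ (t₀ - σ * (δ / 2)) (y₀ - ε / 2) ∈ {q : P | xc Φ q ∈ Ioo (t₀ - δ) (t₀ + δ) ∧
      y₀ - ε < yc Φ q ∧ yc Φ q < (f ∘ cl) (xc Φ q)} := by
    refine ⟨by simpa using hu, ?_, ?_⟩ <;> simp only [Function.comp, xc_pt, yc_pt]
    · linarith
    · rw [hclu, hf0]
      linarith
  have hvL : pt Φ (t₀ - σ * (δ / 2)) (y₀ - ε / 2) ∈ {q : P | xc Φ q ∈ Ioo a b ∧
      y₀ - ε < yc Φ q ∧ yc Φ q < y₀ + ε} := by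
    refine ⟨?_, ?_, ?_⟩ <;> simp only [xc_pt, yc_pt]
    · exact (hab _).2 ⟨hσ0, hu⟩
    · linarith
    · linarith
  have hout : ∀ T : Set P, (∀ r, xc Φ r ∈ Ioo (t₀ - δ) (t₀ + δ) → g (cl (xc Φ r)) < yc Φ r →
      yc Φ r < y₀ + ε → r ∈ T) → (∀ r, xc Φ r ∈ Ioo (t₀ - δ) (t₀ + δ) → y₀ - ε < yc Φ r →
      yc Φ r < f (cl (xc Φ r)) → r ∈ T) → (∀ r, xc Φ r ∈ Ioo a b → y₀ - ε < yc Φ r →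
      yc Φ r < y₀ + ε → r ∈ T) → ∀ r, |xc Φ r - t₀| < δ → |yc Φ r - y₀| < δ →
      (σ * (xc Φ r - t₀) < 0 ∨ g (cl (xc Φ r)) < yc Φ r ∨ yc Φ r < f (cl (xc Φ r))) → r ∈ T := by
    intro T hTA hTB hTL r h1 h2 h
    have h3 := abs_lt.1 (h2.trans_le hδε)
    rcases h with h | h | h
    · exact hTL r ((hab _).2 ⟨h, hIoo r h1⟩) (by linarith) (by linarith)
    · exact hTA r (hIoo r h1) h (by linarith)
    · exact hTB r (hIoo r h1) (by linarith) h
  have hcontr : ∀ {r : P}, r ∈ interior D → r ∈ Dᶜ → False := fun h1 h2 => h2 (interior_subset h1)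
  have hinM : ∀ r, |xc Φ r - t₀| < δ → 0 < σ * (xc Φ r - t₀) → xc Φ r ∈ Ioo a' b' :=
    fun r h1 h2 => (hab' _).2 ⟨h2, hIoo r h1⟩
  have hout' : (∀ r, |xc Φ r - t₀| < δ → |yc Φ r - y₀| < δ → (σ * (xc Φ r - t₀) < 0 ∨
      g (cl (xc Φ r)) < yc Φ r ∨ yc Φ r < f (cl (xc Φ r))) → r ∈ interior D) ∨
      (∀ r, |xc Φ r - t₀| < δ → |yc Φ r - y₀| < δ → (σ * (xc Φ r - t₀) < 0 ∨
      g (cl (xc Φ r)) < yc Φ r ∨ yc Φ r < f (cl (xc Φ r))) → r ∈ Dᶜ) := by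
    -- The regions `A` (above) and `B` (below) both meet `L`, so the whole outside of the fold is of
    -- one kind.
    rcases hL with hL | hL <;> rcases hA with hA | hA
    · rcases hB with hB | hB
      · exact Or.inl (hout _ (fun r h1 h2 h3 => hA ⟨h1, h2, h3⟩) (fun r h1 h2 h3 => hB ⟨h1, h2, h3⟩)
          fun r h1 h2 h3 => hL ⟨h1, h2, h3⟩)
      · exact (hcontr (hL hvL) (hB hvB)).elim
    · exact (hcontr (hL huL) (hA huA)).elim
    · exact (hcontr (hA huA) (hL huL)).elim
    · rcases hB with hB | hB
      · exact (hcontr (hB hvB) (hL hvL)).elim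
      · exact Or.inr (hout _ (fun r h1 h2 h3 => hA ⟨h1, h2, h3⟩) (fun r h1 h2 h3 => hB ⟨h1, h2, h3⟩)
          fun r h1 h2 h3 => hL ⟨h1, h2, h3⟩)
  have hcurve' : ∀ r, |xc Φ r - t₀| < δ → |yc Φ r - y₀| < δ → r ∈ C →
      0 ≤ σ * (xc Φ r - t₀) ∧ (yc Φ r = f (xc Φ r) ∨ yc Φ r = g (xc Φ r)) ∧
      f (xc Φ r) ≤ g (xc Φ r) := fun r h1 h2 hrC => by
    obtain ⟨h3, h4⟩ := (hbox' r (h1.trans_le hδε) (h2.trans_le hδε)).1 hrC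
    refine ⟨h3, h4, ?_⟩
    rcases h3.eq_or_lt with h5 | h5
    · rw [(hzero r h5.symm).1, (hzero r h5.symm).2]
    · exact ((hev' _ (hIoo r h1)).2.2.2 h5).le
  -- Inside and outside of the fold must differ: otherwise `p` would be interior to `D`, or not in
  -- the closure of the interior.
  rcases hout' with ho | ho <;> rcases hI with hI | hI
  · exfalso
    refine (hC ▸ hp : p ∈ D \ interior D).2 (mem_interior_iff_mem_nhds.2 ?_)
    filter_upwards [hnear] with r hr
    rcases hcases r hr.1 hr.2 with h | h | h
    · exact hCD h
    · exact interior_subset (hI ⟨hinM r hr.1 h.1, h.2⟩)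
    · exact interior_subset (ho r hr.1 hr.2 h.2)
  · refine Or.inr ⟨hfold, ?_⟩
    filter_upwards [hnear] with r hr
    rcases hcases r hr.1 hr.2 with h | h | h
    · obtain ⟨-, h2, -⟩ := hcurve' r hr.1 hr.2 h
      exact iff_of_true (hCD h) fun h3 => by rcases h2 with h2 | h2 <;> linarith [h3.2.1, h3.2.2]
    · exact iff_of_false (hI ⟨hinM r hr.1 h.1, h.2⟩) (not_not.2 h)
    · exact iff_of_true (interior_subset (ho r hr.1 hr.2 h.2)) fun h3 =>
        h.1 ⟨h3.1.le, h3.2.1.le, h3.2.2.le⟩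
  · refine Or.inl ⟨hfold, ?_⟩
    filter_upwards [hnear] with r hr
    rcases hcases r hr.1 hr.2 with h | h | h
    · obtain ⟨h1, h2, h3⟩ := hcurve' r hr.1 hr.2 h
      refine iff_of_true (hCD h) ⟨h1, ?_, ?_⟩ <;> rcases h2 with h2 | h2 <;> linarith
    · exact iff_of_true (interior_subset (hI ⟨hinM r hr.1 h.1, h.2⟩)) ⟨h.1.le, h.2.1.le, h.2.2.le⟩
    · exact iff_of_false (ho r hr.1 hr.2 h.2) h.1
  · exfalso
    obtain ⟨r, hrD, hr⟩ :=
      ((mem_closure_iff_frequently.1 (hcl' (hCD hp))).and_eventually hnear).exists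
    rcases hcases r hr.1 hr.2 with h | h | h
    · exact (hC ▸ h : r ∈ D \ interior D).2 hrD
    · exact hcontr hrD (hI ⟨hinM r hr.1 h.1, h.2⟩)
    · exact hcontr hrD (ho r hr.1 hr.2 h.2)

/-- The domain of the theorem has the expected local geometry. -/
theorem geometry_of_isWeaklyFiniteType (hD : IsWeaklyFiniteType (xc Φ) D)
    (hgen : IsGenericDomain (xc Φ) D) :
    Geometry Φ D (boundary D) (topCriticalSet (xc Φ) (boundary D)) := by
  let Ψ : P ≃ₜ ℂ := Φ.trans Complex.equivRealProdCLM.symm.toHomeomorph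
  have hC := boundary_eq_diff_interior Ψ hD.isSurface
  have hcl' := subset_closure_interior Ψ hD.isSurface
  have harc : ∀ p ∈ boundary D, ∃ e : ℝ → boundary D, IsOpenEmbedding e ∧ (e 0 : P) = p := by
    intro p hp
    obtain ⟨e, he, r, hr⟩ := exists_isOpenEmbedding_boundary Ψ ⟨p, hp⟩
    refine ⟨_, he.comp (Homeomorph.addRight r).isOpenEmbedding, ?_⟩
    simp [hr]
  have hreg : ∀ q ∈ boundary D, q ∉ topCriticalSet (xc Φ) (boundary D) →
      ∃ U ∈ 𝓝 q, InjOn (xc Φ) (boundary D ∩ U) := by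
    intro q hq hqS
    obtain ⟨U, hU, hUe⟩ := not_not.1 fun h => hqS ⟨hq, h⟩
    exact ⟨U, hU, injOn_iff_injective.2 hUe.injective⟩
  refine ⟨hD.isClosed, hC, sep_subset _ _, hD.finite_critical, hgen, fun a b => ?_,
    fun q hq hqS => ?_, fun p hp => ?_⟩
  · have hcomp := hD.isProperMap.isCompact_preimage (isCompact_Icc (a := a) (b := b))
    have hyc : Continuous fun q : boundary D => |yc Φ q| :=
      ((continuous_yc Φ).comp continuous_subtype_val).abs
    obtain ⟨B, hB⟩ := (hcomp.image hyc).bddAbove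
    refine ⟨B + 1, fun t ht y hy => ?_⟩
    have : |y| ≤ B := hB ⟨⟨pt Φ t y, hy⟩, by simpa using ht, by simp⟩
    linarith
  · obtain ⟨e, he, rfl⟩ := harc q hq
    obtain ⟨U, hU, hUi⟩ := hreg _ hq hqS
    obtain ⟨f, hf, hf0, hfC⟩ := exists_graph_of_injOn he hU hUi
    obtain ⟨s, hs, h⟩ := exists_side hD.isClosed hC hcl' hq hf hf0 hfC
    exact ⟨s, f, hs, h⟩
  · obtain ⟨e, he, rfl⟩ := harc p hp.1
    have : ∀ᶠ q in 𝓝 (e 0 : P), q ∉ topCriticalSet (xc Φ) (boundary D) \ {(e 0 : P)} := by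
      have : T1Space P := Φ.isEmbedding.t1Space
      exact (hD.finite_critical.sdiff.isClosed.isOpen_compl).mem_nhds (by simp)
    obtain ⟨σ, f, g, h⟩ := exists_isFold he hp.2 (this.mono fun q hq hqC hne =>
      hreg q hqC fun hqS => hq ⟨hqS, hne⟩)
    exact ⟨σ, f, g, h.isLeaf_or_isSplit hD.isClosed hC hcl' hp.1⟩

end Folds

end PoincareReeb

/-! ### Curves fibred over the line, a common framework for the boundary curve and the graph. -/

namespace PoincareReeb

open Set Topology

/-- `T` samples every gap of `A`. Inserting a new point `a` cuts one gap in two, and `a ± δ / 2`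
sample the two parts. -/
theorem exists_finite_gap_sample {A : Set ℝ} (hA : A.Finite) : ∃ T : Set ℝ, T.Finite ∧
    (∀ t ∈ T, t ∉ A) ∧ ∀ t ∉ A, ∃ t' ∈ T, Disjoint (uIcc t t') A := by
  induction A, hA using Set.Finite.induction_on with
  | empty => exact ⟨{0}, by simp, by simp, fun t _ => ⟨0, rfl, by simp⟩⟩
  | @insert a A ha hA ih =>
    obtain ⟨T, hT, hTA, hTg⟩ := ih
    obtain ⟨δ, hδ, hball⟩ := Metric.isOpen_iff.1 hA.isClosed.isOpen_compl a ha
    rw [Real.ball_eq_Ioo] at hball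
    refine ⟨(T \ {a}) ∪ {a - δ / 2, a + δ / 2},
      (hT.subset sdiff_subset).union (by simp), ?_, ?_⟩
    · rintro t (⟨ht, hta⟩ | rfl | rfl)
      · simp only [mem_insert_iff, not_or]
        exact ⟨hta, hTA t ht⟩
      · simp only [mem_insert_iff, not_or]
        exact ⟨by linarith, hball ⟨by linarith, by linarith⟩⟩
      · simp only [mem_insert_iff, not_or]
        exact ⟨by linarith, hball ⟨by linarith, by linarith⟩⟩
    · intro t ht
      simp only [mem_insert_iff, not_or] at ht
      obtain ⟨t', ht', hd⟩ := hTg t ht.2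
      have hd' : ∀ r, r ∈ uIcc t t' → r ∉ A := fun r hr => disjoint_left.1 hd hr
      by_cases hat : a ∈ uIcc t t'
      · rcases lt_or_gt_of_ne ht.1 with hta | hta
        · refine ⟨a - δ / 2, by simp, disjoint_left.2 fun r hr => ?_⟩
          have hra : r < a := by
            rcases mem_uIcc.1 hr with h | h <;> linarith [h.1, h.2]
          simp only [mem_insert_iff, not_or]
          refine ⟨hra.ne, ?_⟩
          by_cases hrδ : a - δ < r
          · exact hball ⟨hrδ, by linarith⟩
          · refine hd' r ?_
            rw [mem_uIcc] at hat hr ⊢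
            grind
        · refine ⟨a + δ / 2, by simp, disjoint_left.2 fun r hr => ?_⟩
          have hra : a < r := by
            rcases mem_uIcc.1 hr with h | h <;> linarith [h.1, h.2]
          simp only [mem_insert_iff, not_or]
          refine ⟨hra.ne', ?_⟩
          by_cases hrδ : r < a + δ
          · exact hball ⟨by linarith, hrδ⟩
          · refine hd' r ?_
            rw [mem_uIcc] at hat hr ⊢
            grind
      · refine ⟨t', Or.inl ⟨ht', fun h => hat (h ▸ right_mem_uIcc)⟩, ?_⟩
        rw [disjoint_insert_right]
        exact ⟨hat, hd⟩

section FibredCurve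

variable {P : Type*} [TopologicalSpace P] (Φ : P ≃ₜ ℝ × ℝ) (X X₀ : Set P)

/-- A curve `X` with finitely many singular points `X₀`, away from which it is locally the image of
a section of the projection, and which is compact over compact intervals. -/
structure FibredCurve : Prop where
  subset : X₀ ⊆ X
  finite : X₀.Finite
  compact : ∀ a b, IsCompact (X ∩ xc Φ ⁻¹' Icc a b)
  graph : ∀ p ∈ X, p ∉ X₀ → ∃ c : ℝ → P, (∀ᶠ t in 𝓝 (xc Φ p), ContinuousAt c t) ∧
    (∀ᶠ t in 𝓝 (xc Φ p), c t ∈ X ∧ xc Φ (c t) = t) ∧ ∀ᶠ q in 𝓝[X] p, q = c (xc Φ q)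

variable {Φ X X₀}

theorem t2Space_of_chart (Φ : P ≃ₜ ℝ × ℝ) : T2Space P := Φ.symm.t2Space

namespace FibredCurve

variable (h : FibredCurve Φ X X₀)
include h

theorem isClosed : IsClosed X := by
  have := t2Space_of_chart Φ
  refine isClosed_of_closure_subset fun p hp => ?_
  have h1 : p ∈ closure (X ∩ xc Φ ⁻¹' Icc (xc Φ p - 1) (xc Φ p + 1)) := by
    rw [mem_closure_iff_frequently] at hp ⊢
    exact hp.and_eventually ((continuous_xc Φ).continuousAt.eventually
      (Icc_mem_nhds (by linarith) (by linarith)))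
  exact ((h.compact _ _).isClosed.closure_eq ▸ h1).1

theorem exists_arc {p : P} (hp : p ∈ X) (hp' : p ∉ X₀) : ∃ ε > 0, ∃ c : ℝ → P, ∃ U : Set P,
    ContinuousOn c (Ioo (xc Φ p - ε) (xc Φ p + ε)) ∧ c (xc Φ p) = p ∧ IsOpen U ∧ p ∈ U ∧
    (∀ t ∈ Ioo (xc Φ p - ε) (xc Φ p + ε), c t ∈ X \ X₀ ∧ xc Φ (c t) = t) ∧
    X ∩ U = c '' Ioo (xc Φ p - ε) (xc Φ p + ε) := by
  have := t2Space_of_chart Φ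
  obtain ⟨c, hc, hcX, hXc⟩ := h.graph p hp hp'
  have hcp : c (xc Φ p) = p := (hXc.self_of_nhdsWithin hp).symm
  obtain ⟨U, hU, hpU, hUc⟩ := mem_nhdsWithin.1 hXc
  have h1 : ∀ᶠ t in 𝓝 (xc Φ p), c t ∈ U ∩ X₀ᶜ := hc.self_of_nhds.eventually
    ((hU.inter h.finite.isClosed.isOpen_compl).mem_nhds (by rw [hcp]; exact ⟨hpU, hp'⟩))
  obtain ⟨ε, hε, hball⟩ := Metric.eventually_nhds_iff_ball.1 ((hc.and hcX).and h1)
  rw [Real.ball_eq_Ioo] at hball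
  refine ⟨ε, hε, c, U ∩ xc Φ ⁻¹' Ioo (xc Φ p - ε) (xc Φ p + ε),
    fun t ht => (hball t ht).1.1.continuousWithinAt, hcp,
    hU.inter (isOpen_Ioo.preimage (continuous_xc Φ)), ⟨hpU, by constructor <;> linarith⟩,
    fun t ht => ⟨⟨(hball t ht).1.2.1, (hball t ht).2.2⟩, (hball t ht).1.2.2⟩, ?_⟩
  ext q
  constructor
  · rintro ⟨hqX, hqU, hq⟩
    exact ⟨_, hq, (hUc ⟨hqU, hqX⟩).symm⟩
  · rintro ⟨t, ht, rfl⟩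
    have := hball t ht
    exact ⟨this.1.2.1, this.2.1, by rwa [mem_preimage, this.1.2.2]⟩

omit h in
theorem arc_subset {p : P} {ε : ℝ} {c : ℝ → P}
    (hc : ContinuousOn c (Ioo (xc Φ p - ε) (xc Φ p + ε)))
    (hcX : ∀ t ∈ Ioo (xc Φ p - ε) (xc Φ p + ε), c t ∈ X \ X₀ ∧ xc Φ (c t) = t) {q : P}
    (hq : q ∈ c '' Ioo (xc Φ p - ε) (xc Φ p + ε)) :
    c '' Ioo (xc Φ p - ε) (xc Φ p + ε) ⊆ connectedComponentIn (X \ X₀) q := by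
  refine (isPreconnected_Ioo.image c hc).subset_connectedComponentIn hq ?_
  rintro _ ⟨t, ht, rfl⟩
  exact (hcX t ht).1

/-- The smooth components: local structure. -/
theorem exists_arc_component {q p : P} (hp : p ∈ connectedComponentIn (X \ X₀) q) :
    ∃ ε > 0, ∃ c : ℝ → P, ∃ U : Set P,
    ContinuousOn c (Ioo (xc Φ p - ε) (xc Φ p + ε)) ∧ c (xc Φ p) = p ∧ IsOpen U ∧ p ∈ U ∧
    (∀ t ∈ Ioo (xc Φ p - ε) (xc Φ p + ε), c t ∈ connectedComponentIn (X \ X₀) q ∧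
      xc Φ (c t) = t) ∧
    X ∩ U = c '' Ioo (xc Φ p - ε) (xc Φ p + ε) := by
  have hpX := connectedComponentIn_subset _ _ hp
  obtain ⟨ε, hε, c, U, hc, hcp, hU, hpU, hcX, hXU⟩ := h.exists_arc hpX.1 hpX.2
  have hsub := arc_subset hc hcX
    (hXU ▸ ⟨hpX.1, hpU⟩ : p ∈ c '' Ioo (xc Φ p - ε) (xc Φ p + ε))
  rw [← connectedComponentIn_eq hp] at hsub
  exact ⟨ε, hε, c, U, hc, hcp, hU, hpU, fun t ht => ⟨hsub ⟨t, ht, rfl⟩, (hcX t ht).2⟩, hXU⟩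

theorem exists_isOpen_component (q : P) : ∃ U, IsOpen U ∧ X ∩ U = connectedComponentIn (X \ X₀) q := by
  choose! ε hε c U hc hcp hU hpU hcX hXU using
    fun p (hp : p ∈ connectedComponentIn (X \ X₀) q) => h.exists_arc_component hp
  refine ⟨⋃ p ∈ connectedComponentIn (X \ X₀) q, U p, isOpen_biUnion hU, ?_⟩
  ext r
  simp only [mem_inter_iff, mem_iUnion, exists_prop]
  constructor
  · rintro ⟨hr, p, hp, hrU⟩
    obtain ⟨t, ht, rfl⟩ := (hXU p hp).subset ⟨hr, hrU⟩
    exact (hcX p hp t ht).1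
  · intro hr
    exact ⟨(connectedComponentIn_subset _ _ hr).1, r, hr, hpU r hr⟩

theorem isOpen_image_component {q : P} {W : Set P} (hW : IsOpen W) :
    IsOpen (xc Φ '' (connectedComponentIn (X \ X₀) q ∩ W)) := by
  rw [isOpen_iff_mem_nhds]
  rintro _ ⟨p, ⟨hp, hpW⟩, rfl⟩
  obtain ⟨ε, hε, c, U, hc, hcp, hU, hpU, hcX, hXU⟩ := h.exists_arc_component hp
  have hI : Ioo (xc Φ p - ε) (xc Φ p + ε) ∈ 𝓝 (xc Φ p) :=
    Ioo_mem_nhds (by linarith) (by linarith)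
  filter_upwards [hI, (hc.continuousAt hI).eventually (hW.mem_nhds (by rwa [hcp]))] with t ht htW
  exact ⟨c t, ⟨(hcX t ht).1, htW⟩, (hcX t ht).2⟩

theorem isOpen_image (q : P) : IsOpen (xc Φ '' connectedComponentIn (X \ X₀) q) := by
  simpa using h.isOpen_image_component (q := q) isOpen_univ

/-- On a smooth component the projection is a local homeomorphism from a connected Hausdorff space,
so `injective_of_locally_injective` applies. -/
theorem injOn_component (q : P) : InjOn (xc Φ) (connectedComponentIn (X \ X₀) q) := by
  have := t2Space_of_chart Φ
  set E := connectedComponentIn (X \ X₀) q with hE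
  have : PreconnectedSpace E := Subtype.preconnectedSpace isPreconnected_connectedComponentIn
  rw [injOn_iff_injective]
  refine injective_of_locally_injective (f := E.domRestrict (xc Φ))
    ((continuous_xc Φ).comp continuous_subtype_val) ?_ ?_
  · intro W hW
    obtain ⟨W', hW', rfl⟩ := isOpen_induced_iff.1 hW
    convert h.isOpen_image_component (q := q) hW' using 1
    ext t
    constructor
    · rintro ⟨x, hx, rfl⟩
      exact ⟨x, ⟨x.2, hx⟩, rfl⟩
    · rintro ⟨x, ⟨hx, hxW⟩, rfl⟩
      exact ⟨⟨x, hx⟩, hxW, rfl⟩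
  · intro p
    obtain ⟨ε, hε, c, U, hc, hcp, hU, hpU, hcX, hXU⟩ := h.exists_arc_component p.2
    have himg : (Subtype.val '' (Subtype.val ⁻¹' U : Set E)) = c '' Ioo (xc Φ p - ε) (xc Φ p + ε) := by
      rw [Subtype.image_preimage_coe, ← hXU]
      ext r
      constructor
      · rintro ⟨h1, h2⟩
        exact ⟨(connectedComponentIn_subset _ _ h1).1, h2⟩
      · intro hr
        obtain ⟨t, ht, rfl⟩ := hXU.subset hr
        exact ⟨(hcX t ht).1, hr.2⟩
    refine ⟨Subtype.val ⁻¹' U, hU.preimage continuous_subtype_val, hpU, ?_, ?_⟩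
    · rw [← IsInducing.subtypeVal.isPreconnected_image, himg]
      exact isPreconnected_Ioo.image c hc
    · intro r hr r' hr' hrr'
      obtain ⟨t, ht, htr⟩ := himg.subset ⟨r, hr, rfl⟩
      obtain ⟨t', ht', htr'⟩ := himg.subset ⟨r', hr', rfl⟩
      simp only [domRestrict_apply, ← htr, ← htr', (hcX t ht).2, (hcX t' ht').2] at hrr'
      exact Subtype.ext (by rw [← htr, ← htr', hrr'])

/-- Over an interval without critical values, the smooth components are unbroken. -/
theorem subset_image {I : Set ℝ} (hI : IsPreconnected I) (hI₀ : ∀ p ∈ X₀, xc Φ p ∉ I) {p : P}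
    (hp : p ∈ X) (hpI : xc Φ p ∈ I) : I ⊆ xc Φ '' connectedComponentIn (X \ X₀) p := by
  have := t2Space_of_chart Φ
  refine hI.subset_of_closure_inter_subset (h.isOpen_image p)
    ⟨_, hpI, p, mem_connectedComponentIn ⟨hp, fun h0 => hI₀ p h0 hpI⟩, rfl⟩ ?_
  rintro b ⟨hb, hbI⟩
  -- Compactness over `[b - 1, b + 1]` produces a point `e` of `X` over the limit abscissa in the
  -- closure of the component. The arc through `e` meets the component and so belongs to it.
  have hK : IsCompact (closure (connectedComponentIn (X \ X₀) p) ∩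
      (X ∩ xc Φ ⁻¹' Icc (b - 1) (b + 1))) := (h.compact _ _).inter_left isClosed_closure
  have hb' : b ∈ closure (xc Φ '' (closure (connectedComponentIn (X \ X₀) p) ∩
      (X ∩ xc Φ ⁻¹' Icc (b - 1) (b + 1)))) := by
    rw [mem_closure_iff_frequently] at hb ⊢
    refine (hb.and_eventually (Icc_mem_nhds (a := b - 1) (b := b + 1) (by linarith)
      (by linarith))).mono ?_
    rintro _ ⟨⟨e, he, rfl⟩, ht⟩
    exact ⟨e, ⟨subset_closure he, (connectedComponentIn_subset _ _ he).1, ht⟩, rfl⟩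
  rw [(hK.image (continuous_xc Φ)).isClosed.closure_eq] at hb'
  obtain ⟨e, ⟨he, heX, -⟩, rfl⟩ := hb'
  obtain ⟨ε, hε, c, U, hc, hcp, hU, hpU, hcX, hXU⟩ :=
    h.exists_arc heX fun h0 => hI₀ e h0 hbI
  obtain ⟨r, hrU, hr⟩ := mem_closure_iff.1 he U hU hpU
  have hr' := hXU.subset ⟨(connectedComponentIn_subset _ _ hr).1, hrU⟩
  have := arc_subset hc hcX hr' (hXU.subset ⟨heX, hpU⟩)
  rw [← connectedComponentIn_eq hr] at this
  exact ⟨e, this, rfl⟩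

/-- The inverse of the projection on a smooth component. -/
theorem exists_section (q : P) : ∃ c : ℝ → P,
    ContinuousOn c (xc Φ '' connectedComponentIn (X \ X₀) q) ∧
    (∀ t ∈ xc Φ '' connectedComponentIn (X \ X₀) q,
      c t ∈ connectedComponentIn (X \ X₀) q ∧ xc Φ (c t) = t) ∧
    ∀ p ∈ connectedComponentIn (X \ X₀) q, c (xc Φ p) = p := by
  have : Nonempty P := ⟨q⟩
  choose! c hc using fun t (ht : t ∈ xc Φ '' connectedComponentIn (X \ X₀) q) => ht
  have hcp : ∀ p ∈ connectedComponentIn (X \ X₀) q, c (xc Φ p) = p := fun p hp =>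
    h.injOn_component q (hc _ ⟨p, hp, rfl⟩).1 hp (hc _ ⟨p, hp, rfl⟩).2
  refine ⟨c, ?_, hc, hcp⟩
  rintro _ ⟨p, hp, rfl⟩
  obtain ⟨ε, hε, c', U, hc', hcp', hU, hpU, hcX, hXU⟩ := h.exists_arc_component hp
  have hI : Ioo (xc Φ p - ε) (xc Φ p + ε) ∈ 𝓝 (xc Φ p) :=
    Ioo_mem_nhds (by linarith) (by linarith)
  refine ((hc'.continuousAt hI).congr ?_).continuousWithinAt
  filter_upwards [hI] with t ht
  have := hcp _ (hcX t ht).1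
  rw [(hcX t ht).2] at this
  exact this.symm

/-- The fibre is compact and, by the local sections, discrete. -/
theorem finite_fibre {t : ℝ} (ht : ∀ p ∈ X₀, xc Φ p ≠ t) : (X ∩ xc Φ ⁻¹' {t}).Finite := by
  have := t2Space_of_chart Φ
  have hK := h.compact t t
  rw [Icc_self] at hK
  refine hK.finite ?_
  rw [isDiscrete_iff_forall_mem_exists_isOpen]
  rintro p ⟨hp, rfl⟩
  obtain ⟨ε, hε, c, U, hc, hcp, hU, hpU, hcX, hXU⟩ := h.exists_arc hp fun h0 => ht p h0 rfl
  refine ⟨U, hU, ?_⟩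
  ext r
  constructor
  · rintro ⟨hrU, hr, hrt⟩
    obtain ⟨t', ht', rfl⟩ := hXU.subset ⟨hr, hrU⟩
    rw [mem_preimage, (hcX t' ht').2, mem_singleton_iff] at hrt
    rw [hrt, hcp]
    rfl
  · rintro rfl
    exact ⟨hpU, hp, rfl⟩

/-- A smooth component projects to an open set, so it has a point over some gap of the critical
values. It then covers the whole gap and meets the finite fibre over the sample value of that gap.
All finiteness statements come from here. -/
theorem exists_finite_sample : ∃ F : Set P, F.Finite ∧ F ⊆ X ∧
    ∀ p ∈ X, p ∉ X₀ → ∃ q ∈ F, q ∉ X₀ ∧ q ∈ connectedComponentIn (X \ X₀) p := by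
  obtain ⟨T, hT, hT₀, hTg⟩ := exists_finite_gap_sample (h.finite.image (xc Φ))
  refine ⟨⋃ t ∈ T, X ∩ xc Φ ⁻¹' {t}, hT.biUnion fun t ht => h.finite_fibre ?_, ?_, ?_⟩
  · rintro p hp rfl
    exact hT₀ _ ht ⟨p, hp, rfl⟩
  · simp
  · intro p hp hp'
    have h1 := h.isOpen_image p
    have h2 : xc Φ p ∈ xc Φ '' connectedComponentIn (X \ X₀) p :=
      ⟨p, mem_connectedComponentIn ⟨hp, hp'⟩, rfl⟩
    obtain ⟨t, ⟨r, hr, hrt⟩, ht⟩ : (xc Φ '' connectedComponentIn (X \ X₀) p ∩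
        (xc Φ '' X₀)ᶜ).Nonempty :=
      (h.finite.image (xc Φ)).countable.dense_compl ℝ |>.inter_open_nonempty _ h1 ⟨_, h2⟩
    obtain ⟨t', ht', hd⟩ := hTg t ht
    obtain ⟨q, hq, hqt⟩ := h.subset_image (I := uIcc t t') isPreconnected_uIcc
      (fun s hs hst => disjoint_left.1 hd hst ⟨s, hs, rfl⟩) (connectedComponentIn_subset _ _ hr).1
      (hrt ▸ left_mem_uIcc) right_mem_uIcc
    rw [← connectedComponentIn_eq hr] at hq
    have hqX := connectedComponentIn_subset _ _ hq
    exact ⟨q, mem_biUnion ht' ⟨hqX.1, hqt⟩, hqX.2, hq⟩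

theorem finite_components_diff : (components (X \ X₀)).Finite := by
  obtain ⟨F, hF, hFX, hF'⟩ := h.exists_finite_sample
  refine (hF.image (connectedComponentIn (X \ X₀))).subset ?_
  rintro _ ⟨p, hp, rfl⟩
  obtain ⟨q, hq, -, hqp⟩ := hF' p hp.1 hp.2
  exact ⟨q, hq, (connectedComponentIn_eq hqp).symm⟩

theorem finite_components : (components X).Finite := by
  obtain ⟨F, hF, hFX, hF'⟩ := h.exists_finite_sample
  refine ((hF.union h.finite).image (connectedComponentIn X)).subset ?_
  rintro _ ⟨p, hp, rfl⟩
  by_cases hp' : p ∈ X₀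
  · exact ⟨p, Or.inr hp', rfl⟩
  · obtain ⟨q, hq, -, hqp⟩ := hF' p hp hp'
    exact ⟨q, Or.inl hq, (connectedComponentIn_eq
      (connectedComponentIn_mono p sdiff_subset hqp)).symm⟩

theorem isClosed_component (p : P) : IsClosed (connectedComponentIn X p) := by
  by_cases hp : p ∈ X
  · refine isClosed_of_closure_subset ?_
    exact isPreconnected_connectedComponentIn.closure.subset_connectedComponentIn
      (subset_closure (mem_connectedComponentIn hp))
      (closure_minimal (connectedComponentIn_subset _ _) h.isClosed)
  · rw [connectedComponentIn_eq_empty hp]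
    exact isClosed_empty

/-- The other components are closed and finite in number, so their union is closed. -/
theorem component_mem_nhdsWithin {p : P} : connectedComponentIn X p ∈ 𝓝[X] p := by
  have h1 : IsClosed (⋃₀ (components X \ {connectedComponentIn X p})) := by
    rw [sUnion_eq_biUnion]
    refine (h.finite_components.subset sdiff_subset).isClosed_biUnion ?_
    rintro _ ⟨⟨q, hq, rfl⟩, -⟩
    exact h.isClosed_component q
  refine mem_nhdsWithin.2 ⟨_, h1.isOpen_compl, ?_, ?_⟩
  · rintro ⟨_, ⟨⟨q, hq, rfl⟩, hne⟩, hpq⟩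
    exact hne (connectedComponentIn_eq hpq)
  · rintro q ⟨hq, hqX⟩
    by_contra hqp
    refine hq ⟨connectedComponentIn X q, ⟨⟨q, hqX, rfl⟩, fun heq => hqp ?_⟩,
      mem_connectedComponentIn hqX⟩
    rw [← mem_singleton_iff.1 heq]
    exact mem_connectedComponentIn hqX

/-- No critical value lies in `[M, ∞)`, so a component with one point there covers all of it.
Unboundedness is thus detected at the single abscissa `M`, where the arrows are counted. -/
theorem escapes_right_iff {M : ℝ} (hM : ∀ p ∈ X₀, xc Φ p < M) {E : Set P}
    (hE : E ∈ components (X \ X₀)) : ¬ BddAbove (xc Φ '' E) ↔ M ∈ xc Φ '' E := by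
  obtain ⟨p, hp, rfl⟩ := hE
  have key : ∀ q ∈ connectedComponentIn (X \ X₀) p, M ≤ xc Φ q →
      Ici M ⊆ xc Φ '' connectedComponentIn (X \ X₀) p := by
    intro q hq hMq
    rw [connectedComponentIn_eq hq]
    exact h.subset_image isPreconnected_Ici (fun s hs => not_le.2 (hM s hs))
      (connectedComponentIn_subset _ _ hq).1 hMq
  constructor
  · intro hb
    obtain ⟨_, ⟨q, hq, rfl⟩, hMq⟩ := not_bddAbove_iff.1 hb M
    exact key q hq hMq.le self_mem_Ici
  · rintro ⟨q, hq, hqM⟩ hb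
    exact not_bddAbove_Ici M (hb.mono (key q hq hqM.ge))

theorem escapes_left_iff {M : ℝ} (hM : ∀ p ∈ X₀, M < xc Φ p) {E : Set P}
    (hE : E ∈ components (X \ X₀)) : ¬ BddBelow (xc Φ '' E) ↔ M ∈ xc Φ '' E := by
  obtain ⟨p, hp, rfl⟩ := hE
  have key : ∀ q ∈ connectedComponentIn (X \ X₀) p, xc Φ q ≤ M →
      Iic M ⊆ xc Φ '' connectedComponentIn (X \ X₀) p := by
    intro q hq hMq
    rw [connectedComponentIn_eq hq]
    exact h.subset_image isPreconnected_Iic (fun s hs => not_le.2 (hM s hs))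
      (connectedComponentIn_subset _ _ hq).1 hMq
  constructor
  · intro hb
    obtain ⟨_, ⟨q, hq, rfl⟩, hMq⟩ := not_bddBelow_iff.1 hb M
    exact key q hq hMq.le self_mem_Iic
  · rintro ⟨q, hq, hqM⟩ hb
    exact not_bddBelow_Iic M (hb.mono (key q hq hqM.le))

end FibredCurve

end FibredCurve

end PoincareReeb

namespace PoincareReeb

open Set Topology

/-! ### Vertical equivalence in coordinates. -/

section Rel

variable {P : Type*} [TopologicalSpace P] (Φ : P ≃ₜ ℝ × ℝ) (D : Set P)

/-- Vertical equivalence in coordinates: the vertical segment between the points lies in `D`. -/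
def Rel (p q : P) : Prop :=
  xc Φ p = xc Φ q ∧ ∀ y ∈ uIcc (yc Φ p) (yc Φ q), pt Φ (xc Φ p) y ∈ D

/-- The upside-down coordinates. -/
def flip : P ≃ₜ ℝ × ℝ := Φ.trans ((Homeomorph.refl ℝ).prodCongr (Homeomorph.neg ℝ))

@[simp] theorem xc_flip (p : P) : xc (flip Φ) p = xc Φ p := rfl

@[simp] theorem yc_flip (p : P) : yc (flip Φ) p = -yc Φ p := rfl

@[simp] theorem pt_flip (t y : ℝ) : pt (flip Φ) t y = pt Φ t (-y) := rfl

variable {Φ D}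

namespace Rel

theorem refl {p : P} (hp : p ∈ D) : Rel Φ D p p := by
  refine ⟨rfl, fun y hy => ?_⟩
  rw [uIcc_self, mem_singleton_iff] at hy
  rwa [hy, pt_xc_yc]

theorem symm {p q : P} (h : Rel Φ D p q) : Rel Φ D q p :=
  ⟨h.1.symm, fun y hy => h.1 ▸ h.2 y (uIcc_comm (yc Φ q) _ ▸ hy)⟩

theorem trans {p q r : P} (h : Rel Φ D p q) (h' : Rel Φ D q r) : Rel Φ D p r := by
  refine ⟨h.1.trans h'.1, fun y hy => ?_⟩
  rcases uIcc_subset_uIcc_union_uIcc (b := yc Φ q) hy with hy | hy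
  · exact h.2 y hy
  · exact h.1 ▸ h'.2 y hy

theorem left_mem {p q : P} (h : Rel Φ D p q) : p ∈ D := by
  simpa using h.2 (yc Φ p) left_mem_uIcc

theorem right_mem {p q : P} (h : Rel Φ D p q) : q ∈ D := h.symm.left_mem

end Rel

theorem rel_pt_right {p : P} {t y : ℝ} :
    Rel Φ D p (pt Φ t y) ↔ xc Φ p = t ∧ ∀ z ∈ uIcc (yc Φ p) y, pt Φ t z ∈ D := by
  simp only [Rel, xc_pt, yc_pt]
  constructor <;> rintro ⟨rfl, h⟩ <;> exact ⟨rfl, h⟩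

theorem rel_pt {t y y' : ℝ} :
    Rel Φ D (pt Φ t y) (pt Φ t y') ↔ ∀ z ∈ uIcc y y', pt Φ t z ∈ D := by
  simp [Rel]

theorem Rel.of_mem {p q : P} (h : Rel Φ D p q) {y : ℝ} (hy : y ∈ uIcc (yc Φ p) (yc Φ q)) :
    Rel Φ D p (pt Φ (xc Φ p) y) :=
  rel_pt_right.2 ⟨rfl, fun z hz => h.2 z (uIcc_subset_uIcc left_mem_uIcc hy hz)⟩

@[simp] theorem rel_flip {p q : P} : Rel (flip Φ) D p q ↔ Rel Φ D p q := by
  simp only [Rel, xc_flip, yc_flip, pt_flip]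
  refine and_congr_right fun h => ⟨fun h y hy => ?_, fun h y hy => ?_⟩
  · have := h (-y) (by rw [mem_uIcc] at hy ⊢; grind)
    rwa [neg_neg] at this
  · exact h _ (by rw [mem_uIcc] at hy ⊢; grind)

theorem mem_verticalInterval_iff {p q : P} (hp : p ∈ D) :
    q ∈ verticalInterval (xc Φ) D p ↔ Rel Φ D p q := by
  have hp' : p ∈ D ∩ xc Φ ⁻¹' {xc Φ p} := ⟨hp, rfl⟩
  constructor
  · intro hq
    have hx : xc Φ q = xc Φ p := (connectedComponentIn_subset _ _ hq).2
    have himg : (yc Φ '' verticalInterval (xc Φ) D p).OrdConnected :=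
      (isPreconnected_connectedComponentIn.image _ (continuous_yc Φ).continuousOn).ordConnected
    refine ⟨hx.symm, fun y hy => ?_⟩
    obtain ⟨r, hr, rfl⟩ := himg.uIcc_subset ⟨p, mem_connectedComponentIn hp', rfl⟩ ⟨q, hq, rfl⟩ hy
    have hr' := connectedComponentIn_subset _ _ hr
    rw [← (hr'.2 : xc Φ r = xc Φ p), pt_xc_yc]
    exact hr'.1
  · intro h
    have hc : IsPreconnected (pt Φ (xc Φ p) '' uIcc (yc Φ p) (yc Φ q)) :=
      isPreconnected_uIcc.image _ (by fun_prop)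
    refine hc.subset_connectedComponentIn (F := D ∩ xc Φ ⁻¹' {xc Φ p})
      ⟨_, left_mem_uIcc, pt_xc_yc Φ p⟩ ?_ ⟨_, right_mem_uIcc, ?_⟩
    · rintro _ ⟨y, hy, rfl⟩
      exact ⟨h.2 y hy, xc_pt Φ _ _⟩
    · rw [h.1, pt_xc_yc]

end Rel

/-! ### Tops of vertical intervals, and turning the plane upside down. -/

section Tops

variable {P : Type*} [TopologicalSpace P] (Φ : P ≃ₜ ℝ × ℝ) (D : Set P)

/-- `q` is the highest point of the vertical interval through `p`. -/
def IsTop (p q : P) : Prop := Rel Φ D p q ∧ ∀ r, Rel Φ D p r → yc Φ r ≤ yc Φ q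

open Classical in
/-- The value of `w` at the top of the vertical interval through `p` (zero if there is none). -/
noncomputable def topVal (w : P → ZMod 2) (p : P) : ZMod 2 :=
  if h : ∃ q, IsTop Φ D p q then w h.choose else 0

variable {Φ D}

theorem IsTop.eq {p q q' : P} (h : IsTop Φ D p q) (h' : IsTop Φ D p q') : q = q' :=
  ext_coords (Φ := Φ) (h.1.1.symm.trans h'.1.1) (le_antisymm (h'.2 _ h.1) (h.2 _ h'.1))

theorem IsTop.congr {p p' q : P} (h : IsTop Φ D p q) (hp : Rel Φ D p' p) : IsTop Φ D p' q :=
  ⟨hp.trans h.1, fun r hr => h.2 r (hp.symm.trans hr)⟩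

theorem IsTop.self {p q : P} (h : IsTop Φ D p q) : IsTop Φ D q q := h.congr h.1.symm

theorem topVal_of_isTop (w : P → ZMod 2) {p q : P} (h : IsTop Φ D p q) : topVal Φ D w p = w q := by
  have hex : ∃ q, IsTop Φ D p q := ⟨q, h⟩
  rw [topVal, dif_pos hex, hex.choose_spec.eq h]

theorem topVal_of_not_exists (w : P → ZMod 2) {p : P} (h : ¬ ∃ q, IsTop Φ D p q) :
    topVal Φ D w p = 0 := dif_neg h

theorem topVal_congr (w : P → ZMod 2) {p p' : P} (h : Rel Φ D p p') :
    topVal Φ D w p = topVal Φ D w p' := by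
  by_cases hex : ∃ q, IsTop Φ D p q
  · obtain ⟨q, hq⟩ := hex
    rw [topVal_of_isTop w hq, topVal_of_isTop w (hq.congr h.symm)]
  · rw [topVal_of_not_exists w hex, topVal_of_not_exists w]
    rintro ⟨q, hq⟩
    exact hex ⟨q, hq.congr h⟩

/-- If the upward ray leaves `D`, the heights reachable from `p` are bounded, and their supremum is
reached because `D` is closed. -/
theorem exists_isTop_or (hD : IsClosed D) {p : P} (hp : p ∈ D) :
    (∃ q, IsTop Φ D p q) ∨ ∀ y, yc Φ p ≤ y → pt Φ (xc Φ p) y ∈ D := by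
  by_cases hall : ∀ y, yc Φ p ≤ y → pt Φ (xc Φ p) y ∈ D
  · exact Or.inr hall
  · left
    push Not at hall
    obtain ⟨b, hb, hbD⟩ := hall
    set A := {y | Rel Φ D p (pt Φ (xc Φ p) y)} with hA
    have hAb : ∀ y ∈ A, y ≤ b := by
      intro y hy
      by_contra! hby
      exact hbD ((rel_pt_right.1 hy).2 b (mem_uIcc.2 (Or.inl ⟨hb, hby.le⟩)))
    have hpA : yc Φ p ∈ A := by
      simpa [hA] using Rel.refl (Φ := Φ) hp
    have hbdd : BddAbove A := ⟨b, hAb⟩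
    have hsup : sSup A ∈ A := by
      refine rel_pt_right.2 ⟨rfl, fun z hz => ?_⟩
      rw [uIcc_of_le (le_csSup hbdd hpA)] at hz
      rcases hz.2.eq_or_lt with rfl | hlt
      · have hcl : IsClosed (pt Φ (xc Φ p) ⁻¹' D) := hD.preimage (by fun_prop)
        refine hcl.closure_subset_iff.2 ?_ (csSup_mem_closure ⟨_, hpA⟩ hbdd)
        exact fun y hy => (rel_pt_right.1 hy).2 y right_mem_uIcc
      · obtain ⟨y, hy, hzy⟩ := exists_lt_of_lt_csSup ⟨_, hpA⟩ hlt
        exact (rel_pt_right.1 hy).2 z (mem_uIcc.2 (Or.inl ⟨hz.1, hzy.le⟩))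
    refine ⟨pt Φ (xc Φ p) (sSup A), hsup, fun r hr => ?_⟩
    rw [yc_pt]
    refine le_csSup hbdd ?_
    change Rel Φ D p _
    rwa [hr.1, pt_xc_yc]

theorem not_exists_isTop {p : P} (h : ∀ y, yc Φ p ≤ y → pt Φ (xc Φ p) y ∈ D) :
    ¬ ∃ q, IsTop Φ D p q := by
  rintro ⟨q, hq⟩
  have h1 := hq.2 p (Rel.refl (by simpa using h _ le_rfl))
  have := hq.2 (pt Φ (xc Φ p) (yc Φ q + 1)) (rel_pt_right.2 ⟨rfl, fun z hz => h z ?_⟩)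
  · simp at this
    linarith
  · rw [uIcc_of_le (by linarith)] at hz
    exact hz.1

theorem isTop_of_frequently {p q : P} (h : Rel Φ D p q)
    (hq : ∀ y, yc Φ q < y → ∃ z, yc Φ q < z ∧ z < y ∧ pt Φ (xc Φ q) z ∉ D) : IsTop Φ D p q := by
  refine ⟨h, fun r hr => ?_⟩
  by_contra! hlt
  obtain ⟨z, hz, hzr, hzD⟩ := hq _ hlt
  exact hzD ((h.symm.trans hr).2 z (mem_uIcc.2 (Or.inl ⟨hz.le, hzr.le⟩)))

end Tops

namespace Geometry

variable {P : Type*} [TopologicalSpace P] {Φ : P ≃ₜ ℝ × ℝ} {D C S : Set P}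
variable (h : Geometry Φ D C S)
include h

theorem curve_subset : C ⊆ D := h.curve_eq ▸ sdiff_subset

theorem isClosed_curve : IsClosed C := by
  rw [h.curve_eq]
  exact h.isClosed.sdiff isOpen_interior

theorem mem_nhds {p : P} (hp : p ∈ D) (hp' : p ∉ C) : D ∈ 𝓝 p := by
  rw [← mem_interior_iff_mem_nhds]
  by_contra hint
  exact hp' (h.curve_eq ▸ ⟨hp, hint⟩)

omit h in
theorem _root_.PoincareReeb.IsGraphPoint.flip {q : P} {s : ℝ} {f : ℝ → ℝ}
    (h : IsGraphPoint Φ D C q s f) :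
    IsGraphPoint (PoincareReeb.flip Φ) D C q (-s) fun t => -f t := by
  refine ⟨h.1.neg, by simp [h.2.1], ?_⟩
  filter_upwards [h.2.2] with r hr
  simpa using hr

omit h in
theorem _root_.PoincareReeb.IsFold.flip {q : P} {σ : ℝ} {f g : ℝ → ℝ} (h : IsFold Φ C q σ f g) :
    IsFold (PoincareReeb.flip Φ) C q σ (fun t => -g t) fun t => -f t := by
  obtain ⟨h1, h2, h3, h4, h5, h6, h7⟩ := h
  refine ⟨h1, h3.neg, h2.neg, by simp [h5], by simp [h4], ?_, ?_⟩
  · filter_upwards [h6] with t ht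
    simpa using ht
  · filter_upwards [h7] with r hr
    simp only [xc_flip, yc_flip, neg_inj, hr]
    tauto

/-- A bottom is a top for the flipped coordinates. Through this symmetry every result about tops
also serves for bottoms. -/
theorem flip : Geometry (PoincareReeb.flip Φ) D C S where
  isClosed := h.isClosed
  curve_eq := h.curve_eq
  critical_subset := h.critical_subset
  finite_critical := h.finite_critical
  injOn_critical := h.injOn_critical
  bounded a b := by
    obtain ⟨B, hB⟩ := h.bounded a b
    exact ⟨B, fun t ht y hy => by simpa using hB t ht _ hy⟩
  graph q hq hq' := by
    obtain ⟨s, f, hs, hf⟩ := h.graph q hq hq'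
    refine ⟨-s, fun t => -f t, ?_, hf.flip⟩
    rcases hs with rfl | rfl <;> simp
  fold p hp := by
    obtain ⟨σ, f, g, hl | hs⟩ := h.fold p hp
    · refine ⟨σ, fun t => -g t, fun t => -f t, Or.inl ⟨hl.1.flip, ?_⟩⟩
      filter_upwards [hl.2] with r hr
      simp only [xc_flip, yc_flip, neg_le_neg_iff, hr]
      tauto
    · refine ⟨σ, fun t => -g t, fun t => -f t, Or.inr ⟨hs.1.flip, ?_⟩⟩
      filter_upwards [hs.2] with r hr
      simp only [xc_flip, yc_flip, neg_lt_neg_iff, hr]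
      tauto

end Geometry

end PoincareReeb

namespace PoincareReeb

open Set Topology

/-! ### Variation of the vertical intervals away from critical points. -/

section

variable {P : Type*} [TopologicalSpace P] {Φ : P ≃ₜ ℝ × ℝ} {D C S : Set P}

/-- The tube lemma for vertical segments. -/
theorem eventually_forall_pt_mem {K : Set ℝ} (hK : IsCompact K) {U : Set P} (hU : IsOpen U)
    {t₀ : ℝ} (h : ∀ y ∈ K, pt Φ t₀ y ∈ U) : ∀ᶠ t in 𝓝 t₀, ∀ y ∈ K, pt Φ t y ∈ U := by
  refine hK.eventually_forall_of_forall_eventually fun y hy => ?_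
  have hc : Continuous fun z : ℝ × ℝ => pt Φ z.1 z.2 := by fun_prop
  exact hc.continuousAt.eventually (hU.mem_nhds (h y hy))

/-- Rectangular form of the local description of the curve at an ordinary point. -/
theorem IsGraphPoint.exists_box {q : P} {s : ℝ} {f : ℝ → ℝ} (h : IsGraphPoint Φ D C q s f) {ε₀ : ℝ}
    (hε₀ : 0 < ε₀) : ∃ ε > 0, ε ≤ ε₀ ∧ ∃ δ > 0, ∀ t, |t - xc Φ q| < δ →
      |f t - yc Φ q| < ε / 2 ∧ ∀ y, |y - yc Φ q| < ε →
        (pt Φ t y ∈ C ↔ y = f t) ∧ (pt Φ t y ∈ D ↔ s * y ≤ s * f t) := by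
  obtain ⟨ε, hε, hbox⟩ := PoincareReeb.exists_box (Φ := Φ) h.2.2
  obtain ⟨δ, hδ, hf⟩ := Metric.continuousAt_iff.1 (h.1.continuousAt (x := xc Φ q))
    (min ε ε₀ / 2) (by positivity)
  refine ⟨min ε ε₀, by positivity, min_le_right _ _, min δ ε, by positivity, fun t ht => ⟨?_, ?_⟩⟩
  · have := hf (lt_of_lt_of_le ht (min_le_left _ _))
    rwa [h.2.1] at this
  · intro y hy
    have := hbox t y (lt_of_lt_of_le ht (min_le_right _ _)) (lt_of_lt_of_le hy (min_le_left _ _))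
    simpa using this

end

namespace Geometry

variable {P : Type*} [TopologicalSpace P] {Φ : P ≃ₜ ℝ × ℝ} {D C S : Set P}
variable (h : Geometry Φ D C S)
include h

theorem mem_interior {p : P} (hp : p ∈ D) (hp' : p ∉ C) : p ∈ interior D :=
  mem_interior_iff_mem_nhds.2 (h.mem_nhds hp hp')

theorem exists_notMem_near {q : P} (hq : q ∈ C) (hq' : q ∉ S) {ε₀ : ℝ} (hε₀ : 0 < ε₀) :
    ∃ y, |y - yc Φ q| < ε₀ ∧ pt Φ (xc Φ q) y ∉ D := by
  obtain ⟨s, f, hs, hf⟩ := h.graph q hq hq'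
  obtain ⟨ε, hε, hεε, δ, hδ, hbox⟩ := hf.exists_box hε₀
  obtain ⟨-, hb⟩ := hbox (xc Φ q) (by simpa)
  refine ⟨yc Φ q + s * (ε / 2), ?_, ?_⟩
  · rcases hs with rfl | rfl <;> simp only [add_sub_cancel_left, abs_lt] <;>
      constructor <;> linarith
  · rw [(hb _ _).2, hf.2.1]
    · rcases hs with rfl | rfl <;> simp <;> linarith
    · rcases hs with rfl | rfl <;> simp only [add_sub_cancel_left, abs_lt] <;>
        constructor <;> linarith

/-- A point of the curve inside a vertical segment of `D` is critical. -/
theorem mem_critical_of_segment {t y y₁ y₂ : ℝ} (hy : pt Φ t y ∈ C) (h₁ : y₁ < y) (h₂ : y < y₂)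
    (hD : ∀ z ∈ Icc y₁ y₂, pt Φ t z ∈ D) : pt Φ t y ∈ S := by
  by_contra hS
  obtain ⟨z, hz, hzD⟩ := h.exists_notMem_near hy hS (ε₀ := min (y - y₁) (y₂ - y))
    (lt_min (by linarith) (by linarith))
  rw [xc_pt] at hzD
  rw [yc_pt] at hz
  have := abs_lt.1 hz
  have h3 := min_le_left (y - y₁) (y₂ - y)
  have h4 := min_le_right (y - y₁) (y₂ - y)
  exact hzD (hD z ⟨by linarith, by linarith⟩)

/-- A curve point strictly inside a segment of `D` is critical, so here the curve is avoided
altogether. The segment is thereby made ready for the tube lemma. -/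
theorem isOpen_interior_segment {t a b : ℝ} (hD : ∀ z ∈ Icc a b, pt Φ t z ∈ D)
    (ha : pt Φ t a ∉ C) (hb : pt Φ t b ∉ C) (hS : ∀ z ∈ Icc a b, pt Φ t z ∉ S) :
    ∀ z ∈ Icc a b, pt Φ t z ∈ interior D := by
  intro z hz
  refine h.mem_interior (hD z hz) fun hzC => ?_
  rcases hz.1.eq_or_lt with rfl | h1
  · exact ha hzC
  rcases hz.2.eq_or_lt with rfl | h2
  · exact hb hzC
  exact hS z hz (h.mem_critical_of_segment hzC h1 h2 hD)

/-- The tube lemma controls the segment up to height `m`, except near `p` when `p` lies on the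
curve. There `D` lies above a graph, since the segment goes up from `p`, and the missing short
segment stays above that graph. -/
theorem eventually_rel_of_le {p : P} (hp : p ∈ D) (hpS : p ∉ S) {m : ℝ} (hpm : yc Φ p ≤ m)
    (hr : Rel Φ D p (pt Φ (xc Φ p) m)) (hm : pt Φ (xc Φ p) m ∉ C)
    (hS : ∀ y ∈ Icc (yc Φ p) m, pt Φ (xc Φ p) y ∉ S) :
    ∀ᶠ q in 𝓝[D] p, Rel Φ D q (pt Φ (xc Φ q) m) := by
  have hr' := (rel_pt_right.1 hr).2
  rw [uIcc_of_le hpm] at hr'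
  by_cases hpC : p ∈ C
  · have hpm' : yc Φ p < m := lt_of_le_of_ne hpm (by rintro rfl; simp [hpC] at hm)
    obtain ⟨s, f, hs, hf⟩ := h.graph p hpC hpS
    obtain ⟨ε, hε, hεm, δ, hδ, hbox⟩ := hf.exists_box (sub_pos.2 hpm')
    have hb0 := (hbox (xc Φ p) (by simpa)).2 (yc Φ p + ε / 2)
      (by rw [add_sub_cancel_left, abs_lt]; constructor <;> linarith)
    obtain rfl : s = -1 := by
      rcases hs with rfl | rfl
      · have := hb0.2.1 (hr' _ ⟨by linarith, by linarith⟩)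
        rw [hf.2.1] at this
        linarith
      · rfl
    have hbC : pt Φ (xc Φ p) (yc Φ p + ε / 2) ∉ C := fun hC => by
      have := hb0.1.1 hC
      rw [hf.2.1] at this
      linarith
    have htube := eventually_forall_pt_mem (Φ := Φ) isCompact_Icc isOpen_interior
      (h.isOpen_interior_segment (a := yc Φ p + ε / 2) (b := m)
        (fun z hz => hr' z ⟨by linarith [hz.1], hz.2⟩) hbC hm
        fun z hz => hS z ⟨by linarith [hz.1], hz.2⟩)
    refine Filter.Eventually.filter_mono nhdsWithin_le_nhds
      (((continuous_xc Φ).continuousAt.eventually htube).and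
      (eventually_box (Φ := Φ) p (ε := min δ (ε / 2)) (by positivity))) |>.and self_mem_nhdsWithin
      |>.mono ?_
    rintro q ⟨⟨hq, hqx, hqy⟩, hqD⟩
    have hb := hbox (xc Φ q) (lt_of_lt_of_le hqx (min_le_left _ _))
    have hqy' := abs_lt.1 (lt_of_lt_of_le hqy (min_le_right δ (ε / 2)))
    have hqf := (hb.2 (yc Φ q) (abs_lt.2 ⟨by linarith, by linarith⟩)).2
    rw [pt_xc_yc] at hqf
    have hqf' := hqf.1 hqD
    refine rel_pt_right.2 ⟨rfl, fun z hz => ?_⟩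
    rw [uIcc_of_le (by linarith)] at hz
    rcases le_total z (yc Φ p + ε / 2) with hzz | hzz
    · refine (hb.2 z (abs_lt.2 ⟨by linarith [hz.1], by linarith⟩)).2.2 ?_
      linarith [hz.1]
    · exact interior_subset (hq z ⟨hzz, hz.2⟩)
  · have htube := eventually_forall_pt_mem (Φ := Φ) isCompact_Icc isOpen_interior
      (h.isOpen_interior_segment hr' (by simpa using hpC) hm hS)
    obtain ⟨ε, hε, hbox⟩ := PoincareReeb.exists_box (Φ := Φ) (h.mem_nhds hp hpC)
    refine Filter.Eventually.filter_mono nhdsWithin_le_nhds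
      (((continuous_xc Φ).continuousAt.eventually htube).and (eventually_box (Φ := Φ) p hε)) |>.mono ?_
    rintro q ⟨hq, hqx, hqy⟩
    have hqy' := abs_lt.1 hqy
    refine rel_pt_right.2 ⟨rfl, fun z hz => ?_⟩
    by_cases hzz : |z - yc Φ p| < ε
    · exact hbox _ _ hqx hzz
    · refine interior_subset (hq z ?_)
      rw [abs_lt, not_and_or] at hzz
      rw [mem_uIcc] at hz
      rw [mem_Icc]
      grind

/-- The vertical intervals near a non-critical part of a vertical interval. -/
theorem eventually_rel {p : P} (hp : p ∈ D) (hpS : p ∉ S) {m : ℝ}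
    (hr : Rel Φ D p (pt Φ (xc Φ p) m)) (hm : pt Φ (xc Φ p) m ∉ C)
    (hS : ∀ y ∈ uIcc (yc Φ p) m, pt Φ (xc Φ p) y ∉ S) :
    ∀ᶠ q in 𝓝[D] p, Rel Φ D q (pt Φ (xc Φ q) m) := by
  rcases le_total (yc Φ p) m with hpm | hpm
  · rw [uIcc_of_le hpm] at hS
    exact h.eventually_rel_of_le hp hpS hpm hr hm hS
  · rw [uIcc_of_ge hpm] at hS
    have := h.flip.eventually_rel_of_le hp hpS (m := -m) (by simpa) (by simpa) (by simpa)
      fun y hy => by simpa using hS (-y) ⟨by linarith [hy.2], by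
        have := hy.1
        simp only [yc_flip] at this
        linarith⟩
    simpa using this

/-- When `p` lies on the curve, `m` is taken slightly inside `D`. The horizontal path at height `m`
then represents all vertical intervals near `p`, and serves as a local parameter for the graph. -/
theorem exists_regular_height {p : P} (hp : p ∈ D) (hpS : p ∉ S) : ∃ m,
    pt Φ (xc Φ p) m ∉ C ∧ Rel Φ D p (pt Φ (xc Φ p) m) ∧
    ∀ᶠ q in 𝓝[D] p, Rel Φ D q (pt Φ (xc Φ q) m) := by
  suffices hm : ∃ m, pt Φ (xc Φ p) m ∉ C ∧ Rel Φ D p (pt Φ (xc Φ p) m) ∧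
      ∀ y ∈ uIcc (yc Φ p) m, pt Φ (xc Φ p) y ∉ S by
    obtain ⟨m, hm, hr, hS⟩ := hm
    exact ⟨m, hm, hr, h.eventually_rel hp hpS hr hm hS⟩
  by_cases hpC : p ∈ C
  · obtain ⟨s, f, hs, hf⟩ := h.graph p hpC hpS
    obtain ⟨ε, hε, -, δ, hδ, hbox⟩ := hf.exists_box one_pos
    have hb := (hbox (xc Φ p) (by simpa)).2
    rw [hf.2.1] at hb
    have hlt : ∀ z ∈ uIcc (yc Φ p) (yc Φ p - s * (ε / 2)), |z - yc Φ p| < ε ∧ s * z ≤ s * yc Φ p := by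
      intro z hz
      rw [mem_uIcc] at hz
      rw [abs_lt]
      rcases hs with rfl | rfl <;> refine ⟨⟨?_, ?_⟩, ?_⟩ <;> grind
    refine ⟨yc Φ p - s * (ε / 2), ?_, rel_pt_right.2 ⟨rfl, fun z hz => ?_⟩, fun z hz hzS => ?_⟩
    · rw [(hb _ (hlt _ right_mem_uIcc).1).1]
      rcases hs with rfl | rfl <;> intro <;> linarith
    · exact (hb _ (hlt _ hz).1).2.2 (hlt _ hz).2
    · obtain rfl := (hb _ (hlt _ hz).1).1.1 (h.critical_subset hzS)
      rw [pt_xc_yc] at hzS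
      exact hpS hzS
  · refine ⟨yc Φ p, by simpa using hpC, by simpa using Rel.refl hp, fun y hy => ?_⟩
    rw [uIcc_self, mem_singleton_iff] at hy
    rwa [hy, pt_xc_yc]

/-- Vertical rays stay in `D` when the line moves. -/
theorem eventually_ray {t₀ m : ℝ} (hray : ∀ y, m ≤ y → pt Φ t₀ y ∈ D) (hm : pt Φ t₀ m ∉ C)
    (hS : ∀ y, m ≤ y → pt Φ t₀ y ∉ S) : ∀ᶠ t in 𝓝 t₀, ∀ y, m ≤ y → pt Φ t y ∈ D := by
  -- The tube lemma handles the heights up to `B`; above `B` there is no curve to leave `D` through.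
  obtain ⟨B, hB⟩ := h.bounded (t₀ - 1) (t₀ + 1)
  have hC : ∀ y, m ≤ y → pt Φ t₀ y ∈ interior D := fun y hy => by
    refine h.mem_interior (hray y hy) fun hyC => ?_
    rcases hy.eq_or_lt with rfl | hlt
    · exact hm hyC
    · exact hS y hy (h.mem_critical_of_segment hyC hlt (lt_add_one y) fun z hz => hray z hz.1)
  filter_upwards [eventually_forall_pt_mem (Φ := Φ) isCompact_Icc isOpen_interior
    (K := Icc m (max m B)) fun y hy => hC y hy.1, Icc_mem_nhds (a := t₀ - 1) (b := t₀ + 1)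
      (by linarith) (by linarith)] with t ht htI y hy
  rcases le_total y (max m B) with hyB | hyB
  · exact interior_subset (ht y ⟨hy, hyB⟩)
  · have hpre : IsPreconnected (pt Φ t '' Icc (max m B) y) :=
      isPreconnected_Icc.image _ (by fun_prop)
    have hmem := ht (max m B) ⟨le_max_left _ _, le_rfl⟩
    have hdis : Disjoint (pt Φ t '' Icc (max m B) y) C := by
      rw [disjoint_left]
      rintro _ ⟨z, hz, rfl⟩ hzC
      have := (abs_lt.1 (hB t htI z hzC)).2
      linarith [hz.1, le_max_right m B]
    rcases subset_interior_or_subset_compl h.isClosed h.curve_eq hpre hdis with h1 | h1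
    · exact interior_subset (h1 ⟨y, ⟨hyB, le_rfl⟩, rfl⟩)
    · exact absurd (interior_subset hmem) (h1 ⟨_, ⟨le_rfl, hyB⟩, rfl⟩)

/-- The top of a vertical interval, without critical point in its upper part, moves along the
curve. -/
theorem eventually_topVal {w : P → ZMod 2} (hw : ∀ q ∈ C, ∀ᶠ r in 𝓝[C] q, w r = w q) {t₀ m : ℝ}
    (hD : pt Φ t₀ m ∈ D) (hm : pt Φ t₀ m ∉ C)
    (hS : ∀ y, m ≤ y → Rel Φ D (pt Φ t₀ m) (pt Φ t₀ y) → pt Φ t₀ y ∉ S) :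
    ∀ᶠ t in 𝓝 t₀, topVal Φ D w (pt Φ t m) = topVal Φ D w (pt Φ t₀ m) := by
  rcases exists_isTop_or (Φ := Φ) h.isClosed hD with ⟨q, hq⟩ | hray
  · have hqx : xc Φ q = t₀ := by simpa using hq.1.1.symm
    have hseg := hq.1
    rw [← pt_xc_yc Φ q, hqx, rel_pt] at hseg
    have hmq : m ≤ yc Φ q := by simpa using hq.2 _ (Rel.refl hD)
    rw [uIcc_of_le hmq] at hseg
    have hqC : q ∈ C := by
      by_contra hqC
      obtain ⟨ε, hε, hbox⟩ := PoincareReeb.exists_box (Φ := Φ) (h.mem_nhds hq.1.right_mem hqC)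
      have := hq.2 (pt Φ (xc Φ q) (yc Φ q + ε / 2)) (hq.1.trans (rel_pt_right.2 ⟨rfl, fun z hz => ?_⟩))
      · rw [yc_pt] at this
        linarith
      · rw [uIcc_of_le (by linarith)] at hz
        exact hbox _ _ (by simpa) (abs_lt.2 ⟨by linarith [hz.1], by linarith [hz.2]⟩)
    have hmq' : m < yc Φ q := lt_of_le_of_ne hmq fun heq => hm (by
      rw [heq, ← hqx, pt_xc_yc]; exact hqC)
    have hqS : q ∉ S := by
      have := hS (yc Φ q) hmq
      rw [← hqx, pt_xc_yc] at this
      exact this (hqx ▸ hq.1)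
    obtain ⟨s, f, hs, hf⟩ := h.graph q hqC hqS
    obtain ⟨ε, hε, hεm, δ, hδ, hbox⟩ := hf.exists_box (sub_pos.2 hmq')
    have hb0 := (hbox (xc Φ q) (by simpa)).2
    rw [hf.2.1] at hb0
    obtain rfl : s = 1 := by
      rcases hs with rfl | rfl
      · rfl
      · have := (hb0 (yc Φ q - ε / 2) (by rw [abs_lt]; constructor <;> linarith)).2.1
          (hqx ▸ hseg _ ⟨by linarith, by linarith⟩)
        linarith
    have hbC : pt Φ t₀ (yc Φ q - ε / 2) ∉ C := fun hC => by
      have := (hb0 (yc Φ q - ε / 2) (by rw [abs_lt]; constructor <;> linarith)).1.1 (hqx ▸ hC)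
      linarith
    have htube := eventually_forall_pt_mem (Φ := Φ) isCompact_Icc isOpen_interior
      (h.isOpen_interior_segment (a := m) (b := yc Φ q - ε / 2)
        (fun z hz => hseg z ⟨hz.1, by linarith [hz.2]⟩) hm hbC fun z hz =>
          hS z hz.1 (rel_pt.2 fun z' hz' => hseg z' (by
            rw [uIcc_of_le hz.1] at hz'
            exact ⟨hz'.1, by linarith [hz'.2, hz.2]⟩)))
    have hwq : ∀ᶠ t in 𝓝 t₀, pt Φ t (f t) ∈ C → w (pt Φ t (f t)) = w q := by
      have := eventually_pt (Φ := Φ) (eventually_nhdsWithin_iff.1 (hw q hqC)) hf.1.continuousAt hf.2.1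
      rwa [hqx] at this
    rw [topVal_of_isTop w hq]
    filter_upwards [htube, hwq, Metric.ball_mem_nhds t₀ hδ] with t ht htw htδ
    rw [Metric.mem_ball, Real.dist_eq, ← hqx] at htδ
    obtain ⟨hfε, hb⟩ := hbox t htδ
    have hfε' := abs_lt.1 hfε
    rw [← htw ((hb (f t) (by linarith)).1.2 rfl)]
    refine topVal_of_isTop w (isTop_of_frequently (rel_pt.2 fun z hz => ?_) fun y hy => ?_)
    · rw [uIcc_of_le (by linarith)] at hz
      rcases le_total z (yc Φ q - ε / 2) with hzz | hzz
      · exact interior_subset (ht z ⟨hz.1, hzz⟩)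
      · exact (hb z (abs_lt.2 ⟨by linarith, by linarith [hz.2]⟩)).2.2 (by linarith [hz.2])
    · rw [yc_pt] at hy ⊢
      rw [xc_pt]
      have hmin : f t < min y (f t + ε / 4) := lt_min hy (by linarith)
      refine ⟨(f t + min y (f t + ε / 4)) / 2, by linarith, ?_, fun hzD => ?_⟩
      · linarith [min_le_left y (f t + ε / 4)]
      · have h4 := min_le_right y (f t + ε / 4)
        have := (hb _ (abs_lt.2 ⟨by linarith, by linarith⟩)).2.1 hzD
        linarith
  · simp only [xc_pt, yc_pt] at hray
    rw [topVal_of_not_exists w (not_exists_isTop (by simpa using hray))]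
    refine (h.eventually_ray hray hm fun y hy => hS y hy (rel_pt.2 fun z hz => hray z ?_)).mono
      fun t ht => topVal_of_not_exists w (not_exists_isTop (by simpa using ht))
    rw [uIcc_of_le hy] at hz
    exact hz.1

end Geometry

end PoincareReeb

namespace PoincareReeb

open Set Topology

/-! ### The collapsing map, and the graph as a fibred curve. -/

section

variable {P : Type*} [TopologicalSpace P] (Φ : P ≃ₜ ℝ × ℝ) (D G S : Set P) (κ : P → P)

/-- `κ` collapses the vertical intervals of `D` to points of themselves, with image `G`. -/
structure Collapse : Prop where
  continuousOn : ContinuousOn κ D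
  rel : ∀ p ∈ D, Rel Φ D p (κ p)
  eq_of_rel : ∀ p q, Rel Φ D p q → κ p = κ q
  image_eq : G = κ '' D

/-- The points of `G` on critical segments, in coordinates. -/
def crit : Set P := {g ∈ G | ∃ s ∈ S, Rel Φ D g s}

variable {Φ D G S κ}

/-- `κ` is the section after the quotient map, and the identity off `D`, where its value is
irrelevant. Its continuity on `D` is all that is kept of the quotient topology. -/
theorem exists_collapse [Nonempty P] (hG : IsReebGraph (xc Φ) D G) : ∃ κ : P → P, Collapse Φ D G κ := by
  classical
  obtain ⟨s, hs, hmk, rfl⟩ := hG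
  let κ : P → P := fun p => if hp : p ∈ D then s (Quotient.mk _ ⟨p, hp⟩) else p
  have hκ : ∀ p : D, κ p = s (Quotient.mk _ p) := fun p => dif_pos p.2
  have hrel : ∀ p q : D, Quotient.mk (verticalSetoid (xc Φ) D) p = Quotient.mk _ q ↔
      Rel Φ D p q := by
    intro p q
    rw [Quotient.eq]
    constructor
    · rintro ⟨h1, h2⟩
      rw [← mem_verticalInterval_iff p.2, h2, mem_verticalInterval_iff q.2]
      exact Rel.refl q.2
    · intro h
      refine ⟨h.1, ?_⟩
      ext r
      rw [mem_verticalInterval_iff p.2, mem_verticalInterval_iff q.2]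
      exact ⟨h.symm.trans, h.trans⟩
  refine ⟨κ, ?_, ?_, ?_, ?_⟩
  · rw [continuousOn_iff_continuous_domRestrict]
    have : D.domRestrict κ = fun p => (s (Quotient.mk _ p) : P) := funext hκ
    rw [this]
    exact continuous_subtype_val.comp (hs.comp continuous_quotient_mk')
  · intro p hp
    rw [hκ ⟨p, hp⟩]
    exact ((hrel ⟨p, hp⟩ _).1 (hmk _).symm)
  · intro p q h
    rw [hκ ⟨p, h.left_mem⟩, hκ ⟨q, h.right_mem⟩, (hrel ⟨p, h.left_mem⟩ ⟨q, h.right_mem⟩).2 h]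
  · ext g
    constructor
    · rintro ⟨x, rfl⟩
      obtain ⟨p, rfl⟩ := Quotient.exists_rep x
      exact ⟨p, p.2, hκ p⟩
    · rintro ⟨p, hp, rfl⟩
      exact ⟨_, (hκ ⟨p, hp⟩).symm⟩

theorem vertices_eq_crit (hGD : G ⊆ D) :
    vertices (xc Φ) D G = crit Φ D G (topCriticalSet (xc Φ) (boundary D)) := by
  ext g
  refine and_congr_right fun hg => exists_congr fun s => and_congr_right fun _ => ?_
  exact mem_verticalInterval_iff (hGD hg)

namespace Collapse

variable (hκ : Collapse Φ D G κ)
include hκ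

theorem subset : G ⊆ D := by
  rw [hκ.image_eq]
  rintro _ ⟨p, hp, rfl⟩
  exact (hκ.rel p hp).right_mem

theorem mem {p : P} (hp : p ∈ D) : κ p ∈ G := hκ.image_eq ▸ ⟨p, hp, rfl⟩

theorem eq_self {g : P} (hg : g ∈ G) : κ g = g := by
  obtain ⟨p, hp, rfl⟩ := hκ.image_eq ▸ hg
  exact (hκ.eq_of_rel _ _ (hκ.rel p hp)).symm

theorem xc_eq {p : P} (hp : p ∈ D) : xc Φ (κ p) = xc Φ p := (hκ.rel p hp).1.symm

theorem flip : Collapse (PoincareReeb.flip Φ) D G κ where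
  continuousOn := hκ.continuousOn
  rel p hp := rel_flip.2 (hκ.rel p hp)
  eq_of_rel p q hpq := hκ.eq_of_rel p q (rel_flip.1 hpq)
  image_eq := hκ.image_eq

theorem rel_of_eq {p q : P} (hp : p ∈ D) (hq : q ∈ D) (h : κ p = κ q) : Rel Φ D p q :=
  (hκ.rel p hp).trans (h ▸ (hκ.rel q hq).symm)

theorem crit_eq (hS : S ⊆ D) : crit Φ D G S = κ '' S := by
  ext g
  constructor
  · rintro ⟨hg, s, hs, h⟩
    exact ⟨s, hs, by rw [← hκ.eq_of_rel _ _ h, hκ.eq_self hg]⟩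
  · rintro ⟨s, hs, rfl⟩
    exact ⟨hκ.mem (hS hs), s, hs, (hκ.rel s (hS hs)).symm⟩

theorem mem_diff_crit {p : P} (hp : p ∈ D) (hpS : ∀ s ∈ S, ¬ Rel Φ D p s) : κ p ∈ G \ crit Φ D G S :=
  ⟨hκ.mem hp, fun ⟨_, s, hs, h⟩ => hpS s hs ((hκ.rel p hp).trans h)⟩

end Collapse

theorem rel_crit_of_notMem {g : P} (hg : g ∈ G \ crit Φ D G S) : ∀ s ∈ S, ¬ Rel Φ D g s :=
  fun s hs h => hg.2 ⟨hg.1, s, hs, h⟩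

end

namespace Geometry

variable {P : Type*} [TopologicalSpace P] {Φ : P ≃ₜ ℝ × ℝ} {D C S G : Set P} {κ : P → P}
variable (h : Geometry Φ D C S)
include h

theorem critical_subset_domain : S ⊆ D := h.critical_subset.trans h.curve_subset

omit h in
theorem isCompact_box (a b B : ℝ) : IsCompact {p : P | xc Φ p ∈ Icc a b ∧ yc Φ p ∈ Icc (-B) B} := by
  have : IsCompact ((fun z : ℝ × ℝ => pt Φ z.1 z.2) '' (Icc a b ×ˢ Icc (-B) B)) :=
    (isCompact_Icc.prod isCompact_Icc).image (by fun_prop)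
  convert this using 1
  ext p
  constructor
  · rintro ⟨h1, h2⟩
    exact ⟨(xc Φ p, yc Φ p), ⟨h1, h2⟩, pt_xc_yc Φ p⟩
  · rintro ⟨⟨t, y⟩, ⟨ht, hy⟩, rfl⟩
    simpa using And.intro ht hy

theorem fibredCurve : FibredCurve Φ C S where
  subset := h.critical_subset
  finite := h.finite_critical
  compact a b := by
    obtain ⟨B, hB⟩ := h.bounded a b
    refine (isCompact_box (Φ := Φ) a b B).of_isClosed_subset
      (h.isClosed_curve.inter (isClosed_Icc.preimage (continuous_xc Φ))) ?_
    rintro p ⟨hp, hpx⟩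
    have := abs_lt.1 (hB _ hpx (yc Φ p) (by simpa))
    exact ⟨hpx, this.1.le, this.2.le⟩
  graph p hp hpS := by
    obtain ⟨s, f, -, hf⟩ := h.graph p hp hpS
    have hc : Continuous fun t => pt Φ t (f t) := Continuous.pt Φ continuous_id hf.1
    refine ⟨fun t => pt Φ t (f t), Filter.Eventually.of_forall fun t => hc.continuousAt, ?_, ?_⟩
    · filter_upwards [eventually_pt (Φ := Φ) hf.2.2 hf.1.continuousAt hf.2.1] with t ht
      exact ⟨ht.1.2 (by simp), by simp⟩
    · filter_upwards [nhdsWithin_le_nhds hf.2.2, self_mem_nhdsWithin] with q hq hqC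
      rw [← hq.1.1 hqC, pt_xc_yc]

/-- A vertical interval meets every horizontal strip containing the curve. -/
theorem exists_rel_abs_le {t B : ℝ} (hB : ∀ y, pt Φ t y ∈ C → |y| < B) (hB0 : 0 ≤ B) {p : P}
    (hp : p ∈ D) (hpt : xc Φ p = t) : ∃ q, Rel Φ D p q ∧ yc Φ q ∈ Icc (-B) B := by
  have hup : ∀ (Φ : P ≃ₜ ℝ × ℝ), Geometry Φ D C S → xc Φ p = t →
      (∀ y, pt Φ t y ∈ C → |y| < B) → B < yc Φ p → Rel Φ D p (pt Φ t B) := by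
    intro Φ h hpt hB hlt
    have hpre : IsPreconnected (pt Φ t '' Icc B (yc Φ p)) :=
      isPreconnected_Icc.image _ (by fun_prop)
    have hdis : Disjoint (pt Φ t '' Icc B (yc Φ p)) C := by
      rw [disjoint_left]
      rintro _ ⟨z, hz, rfl⟩ hzC
      have := (abs_lt.1 (hB z hzC)).2
      linarith [hz.1]
    have hpmem : p ∈ pt Φ t '' Icc B (yc Φ p) := ⟨_, ⟨hlt.le, le_rfl⟩, by rw [← hpt, pt_xc_yc]⟩
    rcases subset_interior_or_subset_compl h.isClosed h.curve_eq hpre hdis with h1 | h1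
    · refine rel_pt_right.2 ⟨hpt, fun z hz => interior_subset (h1 ⟨z, ?_, rfl⟩)⟩
      rwa [uIcc_of_ge hlt.le] at hz
    · exact absurd hp (h1 hpmem)
  rcases lt_or_ge B (yc Φ p) with h1 | h1
  · exact ⟨_, hup Φ h hpt hB h1, by rw [yc_pt]; exact ⟨by linarith, le_rfl⟩⟩
  rcases lt_or_ge (yc Φ p) (-B) with h2 | h2
  · have := hup (PoincareReeb.flip Φ) h.flip hpt (fun y hy => by simpa using hB _ hy)
      (by simp only [yc_flip]; linarith)
    rw [rel_flip, pt_flip] at this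
    exact ⟨_, this, by rw [yc_pt]; exact ⟨le_rfl, by linarith⟩⟩
  · exact ⟨p, Rel.refl hp, h2, h1⟩

/-- Near a point off the vertices, `G` is the image under `κ` of a horizontal segment at a regular
height, and this image is a section of the projection. Over `[a, b]` every vertical interval meets
one fixed box, so `G` is there the image of a compact set. -/
theorem graph_fibredCurve (hκ : Collapse Φ D G κ) : FibredCurve Φ G (crit Φ D G S) where
  subset := fun _ hp => hp.1
  finite := by
    rw [hκ.crit_eq h.critical_subset_domain]
    exact h.finite_critical.image κ
  compact a b := by
    obtain ⟨B, hB⟩ := h.bounded a b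
    have hK : IsCompact (D ∩ {p : P | xc Φ p ∈ Icc a b ∧ yc Φ p ∈ Icc (-max B 0) (max B 0)}) :=
      (isCompact_box (Φ := Φ) a b _).inter_left h.isClosed
    convert hK.image_of_continuousOn (hκ.continuousOn.mono inter_subset_left) using 1
    ext g
    constructor
    · rintro ⟨hg, hgx⟩
      obtain ⟨q, hq, hqy⟩ := h.exists_rel_abs_le (B := max B 0) (t := xc Φ g)
        (fun y hy => (hB _ hgx y hy).trans_le (le_max_left _ _)) (le_max_right _ _)
        (hκ.subset hg) rfl
      refine ⟨q, ⟨hq.right_mem, ?_, hqy⟩, ?_⟩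
      · rw [← hq.1]
        exact hgx
      · rw [← hκ.eq_of_rel _ _ hq, hκ.eq_self hg]
    · rintro ⟨p, ⟨hp, hpx, -⟩, rfl⟩
      exact ⟨hκ.mem hp, by rwa [mem_preimage, hκ.xc_eq hp]⟩
  graph g hg hg' := by
    have hgS : g ∉ S := fun hS => hg' ⟨hg, g, hS, Rel.refl (hκ.subset hg)⟩
    obtain ⟨m, hm, hgm, hev⟩ := h.exists_regular_height (hκ.subset hg) hgS
    have hint : ∀ᶠ t in 𝓝 (xc Φ g), pt Φ t m ∈ interior D := by
      have hc : Continuous fun t => pt Φ t m := by fun_prop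
      exact hc.continuousAt.eventually
        (isOpen_interior.mem_nhds (h.mem_interior hgm.right_mem hm))
    refine ⟨fun t => κ (pt Φ t m), ?_, ?_, ?_⟩
    · filter_upwards [hint] with t ht
      have hc : Continuous fun t => pt Φ t m := by fun_prop
      exact (hκ.continuousOn.continuousAt (mem_interior_iff_mem_nhds.1 ht)).comp
        (f := fun t => pt Φ t m) hc.continuousAt
    · filter_upwards [hint] with t ht
      have := interior_subset ht
      exact ⟨hκ.mem this, by rw [hκ.xc_eq this, xc_pt]⟩
    · filter_upwards [nhdsWithin_mono _ hκ.subset hev, self_mem_nhdsWithin] with q hq hqG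
      rw [← hκ.eq_of_rel _ _ hq, hκ.eq_self hqG]

/-- Nearby vertical intervals are collapsed to the same open edge. -/
theorem eventually_mem_edge (hκ : Collapse Φ D G κ) {p : P} (hp : p ∈ D)
    (hpS : ∀ s ∈ S, ¬ Rel Φ D p s) :
    ∀ᶠ q in 𝓝[D] p, κ q ∈ connectedComponentIn (G \ crit Φ D G S) (κ p) := by
  obtain ⟨U, hU, hGU⟩ := (h.graph_fibredCurve hκ).exists_isOpen_component (κ p)
  have hpU : κ p ∈ U := (hGU.symm.subset (mem_connectedComponentIn (hκ.mem_diff_crit hp hpS))).2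
  filter_upwards [(hκ.continuousOn p hp).eventually (hU.mem_nhds hpU), self_mem_nhdsWithin]
    with q hq hqD
  exact hGU.subset ⟨hκ.mem hqD, hq⟩

theorem eventually_topVal_of_regular {w : P → ZMod 2} (hw : ∀ q ∈ C, ∀ᶠ r in 𝓝[C] q, w r = w q)
    {p : P} (hp : p ∈ D) (hpS : ∀ s ∈ S, ¬ Rel Φ D p s) :
    ∀ᶠ q in 𝓝[D] p, topVal Φ D w q = topVal Φ D w p := by
  obtain ⟨m, hm, hpm, hev⟩ := h.exists_regular_height hp fun hS => hpS p hS (Rel.refl hp)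
  have := h.eventually_topVal hw hpm.right_mem hm fun y _ hr hS => hpS _ hS (hpm.trans hr)
  filter_upwards [hev, nhdsWithin_le_nhds ((continuous_xc Φ).continuousAt.eventually this)]
    with q hq hqt
  rw [topVal_congr w hq, hqt, topVal_congr w hpm]

end Geometry

end PoincareReeb

namespace PoincareReeb

open Set Topology

/-! ### Lines and ovals of a fibred curve. -/

section

variable {P : Type*} [TopologicalSpace P] {Φ : P ≃ₜ ℝ × ℝ} {X X₀ : Set P}

theorem component_eq {K : Set P} (hK : K ∈ components X) {p : P} (hp : p ∈ K) :
    connectedComponentIn X p = K := by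
  obtain ⟨q, hq, rfl⟩ := hK
  exact (connectedComponentIn_eq hp).symm

theorem component_subset {K : Set P} (hK : K ∈ components X) : K ⊆ X := by
  obtain ⟨q, hq, rfl⟩ := hK
  exact connectedComponentIn_subset _ _

theorem smooth_component_subset {K : Set P} (hK : K ∈ components X) {p : P} (hp : p ∈ K) :
    connectedComponentIn (X \ X₀) p ⊆ K := by
  rw [← component_eq hK hp]
  exact connectedComponentIn_mono _ sdiff_subset

theorem component_mem_components {p : P} (hp : p ∈ X) : connectedComponentIn X p ∈ components X :=
  ⟨p, hp, rfl⟩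

namespace FibredCurve

variable (h : FibredCurve Φ X X₀)
include h

omit h in
theorem exists_isOpenEmbedding_component
    (hloc : ∀ p : X, ∃ e : ℝ → X, IsOpenEmbedding e ∧ p ∈ range e) {K : Set P}
    (hK : K ∈ components X) (p : K) : ∃ e : ℝ → K, IsOpenEmbedding e ∧ p ∈ range e := by
  have hKX := component_subset hK
  obtain ⟨e, he, r, hr⟩ := hloc ⟨p, hKX p.2⟩
  have hr' : (e r : P) = p := congrArg Subtype.val hr
  have hec : Continuous fun r => (e r : P) := continuous_subtype_val.comp he.continuous
  have heK : ∀ r, (e r : P) ∈ K := by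
    have hsub := (isPreconnected_range hec).subset_connectedComponentIn (F := X) (x := (p : P))
      ⟨r, hr'⟩ (by rintro _ ⟨r, rfl⟩; exact (e r).2)
    rw [component_eq hK p.2] at hsub
    exact fun r => hsub ⟨r, rfl⟩
  let i : K → X := inclusion hKX
  have hi : IsEmbedding i := IsEmbedding.inclusion hKX
  let e' : ℝ → K := fun r => ⟨e r, heK r⟩
  have hie : i ∘ e' = e := rfl
  refine ⟨e', ⟨⟨?_, ?_⟩, ?_⟩, r, Subtype.ext hr'⟩
  · exact IsInducing.of_comp (hec.subtype_mk _) hi.continuous (hie ▸ he.isInducing)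
  · exact Function.Injective.of_comp (hie ▸ he.injective)
  · have : range e' = i ⁻¹' range e := by
      rw [← hie, range_comp, hi.injective.preimage_image]
    rw [this]
    exact he.isOpen_range.preimage hi.continuous

/-- A finite atlas of `K` consists of the smooth components inside `K`, parametrized by their
sections, together with one chart around each singular point of `K`. -/
theorem nonempty_homeomorph_component
    (hloc : ∀ p : X, ∃ e : ℝ → X, IsOpenEmbedding e ∧ p ∈ range e) {K : Set P}
    (hK : K ∈ components X) : Nonempty (K ≃ₜ ℝ) ∨ Nonempty (K ≃ₜ Circle) := by
  have := t2Space_of_chart Φ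
  have hKc : IsConnected K := by
    obtain ⟨q, hq, rfl⟩ := hK
    exact isConnected_connectedComponentIn_iff.2 hq
  have : ConnectedSpace K := isConnected_iff_connectedSpace.1 hKc
  have hlocK := exists_isOpenEmbedding_component hloc hK
  let ι := {E : Set P // E ∈ components (X \ X₀) ∧ E ⊆ K} ⊕ {p : K // (p : P) ∈ X₀}
  have : Finite {E : Set P // E ∈ components (X \ X₀) ∧ E ⊆ K} :=
    (h.finite_components_diff.subset fun E hE => hE.1).to_subtype
  have : Finite {p : K // (p : P) ∈ X₀} :=
    (h.finite.preimage Subtype.val_injective.injOn).to_subtype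
  have harc : ∀ E : {E : Set P // E ∈ components (X \ X₀) ∧ E ⊆ K},
      ∃ e : ℝ → K, IsOpenEmbedding e ∧ ∀ p : K, (p : P) ∈ E.1 → p ∈ range e := by
    rintro ⟨_, ⟨q, hq, rfl⟩, hEK⟩
    obtain ⟨c, hc, hcE, hcp⟩ := h.exists_section q
    obtain ⟨e, he, her⟩ := exists_isOpenEmbedding_range_eq (h.isOpen_image q)
      (isPreconnected_connectedComponentIn.image _ (continuous_xc Φ).continuousOn)
      ⟨_, q, mem_connectedComponentIn hq, rfl⟩
    have heI : ∀ r, e r ∈ xc Φ '' connectedComponentIn (X \ X₀) q := fun r => her ▸ ⟨r, rfl⟩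
    refine ⟨fun r => ⟨c (e r), hEK (hcE _ (heI r)).1⟩, isOpenEmbedding_of_injective hlocK ?_ ?_, ?_⟩
    · exact (hc.comp_continuous he.continuous heI).subtype_mk _
    · intro r r' hrr'
      have h1 : c (e r) = c (e r') := congrArg Subtype.val hrr'
      apply he.injective
      rw [← (hcE _ (heI r)).2, h1, (hcE _ (heI r')).2]
    · intro p hp
      obtain ⟨r, hr⟩ := her.symm.subset ⟨p, hp, rfl⟩
      exact ⟨r, Subtype.ext (by simp only [hr, hcp _ hp])⟩
  choose e he hep using harc
  choose e' he' hep' using fun p : {p : K // (p : P) ∈ X₀} => hlocK p.1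
  refine nonempty_homeomorph_real_or_circle (ι := ι) (Sum.elim e e') ?_ ?_
  · rintro (i | i)
    · exact he i
    · exact he' i
  · intro p
    by_cases hp : (p : P) ∈ X₀
    · exact ⟨Sum.inr ⟨p, hp⟩, hep' ⟨p, hp⟩⟩
    · have hpX : (p : P) ∈ X \ X₀ := ⟨component_subset hK p.2, hp⟩
      refine ⟨Sum.inl ⟨connectedComponentIn (X \ X₀) p, ⟨p, hpX, rfl⟩, ?_⟩,
        hep _ p (mem_connectedComponentIn hpX)⟩
      exact smooth_component_subset hK p.2

theorem isClosed_of_mem_components {K : Set P} (hK : K ∈ components X) : IsClosed K := by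
  obtain ⟨q, hq, rfl⟩ := hK
  exact h.isClosed_component q

theorem isCompact_component {M : ℝ} {K : Set P} (hK : K ∈ components X)
    (hKM : ∀ p ∈ K, |xc Φ p| < M) : IsCompact K :=
  (h.compact (-M) M).of_isClosed_subset (h.isClosed_of_mem_components hK) fun p hp =>
    ⟨component_subset hK hp, abs_le.1 (hKM p hp).le⟩

/-- A component that leaves the strip containing the critical values is unbounded. -/
theorem not_isCompact_component {M : ℝ} (hM : ∀ p ∈ X₀, |xc Φ p| < M) {K : Set P}
    (hK : K ∈ components X) {p : P} (hp : p ∈ K) (hpM : M ≤ |xc Φ p|) : ¬ IsCompact K := by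
  intro hKc
  have hb := (hKc.image (continuous_xc Φ)).isBounded
  have hsub := smooth_component_subset (X₀ := X₀) hK hp
  rcases le_abs'.1 hpM with h1 | h1
  · have := h.subset_image (isPreconnected_Iic (a := -M))
      (fun s hs hs' => absurd (abs_lt.1 (hM s hs)).1 (not_lt.2 hs')) (component_subset hK hp) h1
    exact not_bddBelow_Iic (-M) (hb.bddBelow.mono (this.trans (image_mono hsub)))
  · have := h.subset_image (isPreconnected_Ici (a := M))
      (fun s hs hs' => absurd (abs_lt.1 (hM s hs)).2 (not_lt.2 hs')) (component_subset hK hp) h1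
    exact not_bddAbove_Ici M (hb.bddAbove.mono (this.trans (image_mono hsub)))

/-- A component that leaves the strip meets its boundary. -/
theorem exists_abs_eq {M : ℝ} (hM0 : 0 < M) (hM : ∀ p ∈ X₀, |xc Φ p| < M) {p : P} (hp : p ∈ X)
    (hpM : M ≤ |xc Φ p|) : ∃ q ∈ connectedComponentIn (X \ X₀) p, |xc Φ q| = M := by
  rcases le_abs'.1 hpM with h1 | h1
  · obtain ⟨q, hq, hqM⟩ := h.subset_image (isPreconnected_Iic (a := -M))
      (fun s hs hs' => absurd (abs_lt.1 (hM s hs)).1 (not_lt.2 hs')) hp h1 self_mem_Iic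
    exact ⟨q, hq, by rw [hqM, abs_neg, abs_of_pos hM0]⟩
  · obtain ⟨q, hq, hqM⟩ := h.subset_image (isPreconnected_Ici (a := M))
      (fun s hs hs' => absurd (abs_lt.1 (hM s hs)).2 (not_lt.2 hs')) hp h1 self_mem_Ici
    exact ⟨q, hq, by rw [hqM, abs_of_pos hM0]⟩

theorem finite_abs_eq {M : ℝ} (hM : ∀ p ∈ X₀, |xc Φ p| < M) :
    (X ∩ {p | |xc Φ p| = M}).Finite := by
  refine ((h.finite_fibre (t := M) ?_).union (h.finite_fibre (t := -M) ?_)).subset ?_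
  · rintro p hp rfl
    exact absurd (hM p hp) (not_lt.2 (le_abs_self _))
  · rintro p hp hpM
    have := hM p hp
    rw [hpM, abs_neg] at this
    exact absurd this (not_lt.2 (le_abs_self _))
  · rintro p ⟨hp, hpM⟩
    rcases eq_or_eq_neg_of_abs_eq hpM with h1 | h1
    · exact Or.inl ⟨hp, h1⟩
    · exact Or.inr ⟨hp, h1⟩

/-- By the classification only compactness has to be decided. A component inside the strip is
compact by properness, and one that leaves the strip covers a half-line of abscissas. -/
theorem line_iff (hloc : ∀ p : X, ∃ e : ℝ → X, IsOpenEmbedding e ∧ p ∈ range e)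
    {M : ℝ} (hM : ∀ p ∈ X₀, |xc Φ p| < M) {K : Set P} (hK : K ∈ components X) :
    K ∈ lines X ↔ ∃ p ∈ K, M ≤ |xc Φ p| := by
  constructor
  · rintro ⟨-, ⟨e⟩⟩
    by_contra! hcon
    have : CompactSpace K := isCompact_iff_compactSpace.1 (h.isCompact_component hK hcon)
    have := e.compactSpace
    exact not_compactSpace_iff.2 (inferInstance : NoncompactSpace ℝ) this
  · rintro ⟨p, hp, hpM⟩
    refine ⟨hK, (h.nonempty_homeomorph_component hloc hK).resolve_right ?_⟩
    rintro ⟨e⟩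
    refine h.not_isCompact_component hM hK hp hpM (isCompact_iff_compactSpace.2 ?_)
    exact e.symm.compactSpace

theorem oval_iff (hloc : ∀ p : X, ∃ e : ℝ → X, IsOpenEmbedding e ∧ p ∈ range e)
    {M : ℝ} (hM : ∀ p ∈ X₀, |xc Φ p| < M) {K : Set P} (hK : K ∈ components X) :
    K ∈ ovals X ↔ ∀ p ∈ K, |xc Φ p| < M := by
  constructor
  · rintro ⟨-, ⟨e⟩⟩
    by_contra! hcon
    obtain ⟨p, hp, hpM⟩ := hcon
    refine h.not_isCompact_component hM hK hp hpM (isCompact_iff_compactSpace.2 ?_)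
    exact e.symm.compactSpace
  · intro hb
    refine ⟨hK, (h.nonempty_homeomorph_component hloc hK).resolve_left ?_⟩
    rintro ⟨e⟩
    have : CompactSpace K := isCompact_iff_compactSpace.1 (h.isCompact_component hK hb)
    have := e.compactSpace
    exact not_compactSpace_iff.2 (inferInstance : NoncompactSpace ℝ) this

end FibredCurve

end

/-- A proper function without local extrema of value at least `M` takes the value `M` exactly
twice. -/
theorem ncard_eq_two_of_no_extr {v : ℝ → ℝ} (hv : Continuous v)
    (htop : Filter.Tendsto v Filter.atTop Filter.atTop)
    (hbot : Filter.Tendsto v Filter.atBot Filter.atTop) {M : ℝ}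
    (hext : ∀ r, M ≤ v r → ¬ IsLocalExtr v r) : {r | v r = M}.ncard = 2 := by
  have hmid : ∀ a b r, a < r → r < b → v a = M → v b = M → v r < M := by
    intro a b r har hrb ha hb
    by_contra! hr
    obtain ⟨x, hx, hmax⟩ := isCompact_Icc.exists_isMaxOn ⟨a, left_mem_Icc.2 (har.trans hrb).le⟩
      hv.continuousOn (s := Icc a b)
    by_cases hx' : x ∈ Ioo a b
    · exact hext x (hr.trans (hmax ⟨har.le, hrb.le⟩))
        (Or.inr (hmax.isLocalMax (Icc_mem_nhds hx'.1 hx'.2)))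
    · have hxM : v x = M := by
        rcases hx.1.eq_or_lt with rfl | h1
        · exact ha
        · rcases hx.2.eq_or_lt with rfl | h2
          · exact hb
          · exact absurd ⟨h1, h2⟩ hx'
      refine hext r hr (Or.inr ?_)
      have : IsMaxOn v (Icc a b) r := fun y hy => by
        have h1 : v y ≤ v x := hmax hy
        change v y ≤ v r
        linarith
      exact this.isLocalMax (Icc_mem_nhds har hrb)
  -- The global minimum lies below `M`. The value `M` is taken on each side of it, and `hmid`
  -- excludes a third time.
  obtain ⟨r₀, hr₀⟩ := hv.exists_forall_le (by
    rw [cocompact_eq_atBot_atTop]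
    exact hbot.sup htop)
  have hr₀M : v r₀ < M := by
    by_contra! hcon
    exact hext r₀ hcon (Or.inl (Filter.Eventually.of_forall hr₀))
  obtain ⟨b, hb, hbM⟩ : ∃ b, r₀ < b ∧ v b = M := by
    obtain ⟨x, hx, hxr⟩ := ((htop.eventually (Filter.eventually_ge_atTop M)).and
      (Filter.eventually_ge_atTop r₀)).exists
    obtain ⟨b, hb, hbM⟩ := intermediate_value_Icc hxr hv.continuousOn ⟨hr₀M.le, hx⟩
    exact ⟨b, lt_of_le_of_ne hb.1 (by rintro rfl; exact hr₀M.ne hbM), hbM⟩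
  obtain ⟨a, ha, haM⟩ : ∃ a, a < r₀ ∧ v a = M := by
    obtain ⟨x, hx, hxr⟩ := ((hbot.eventually (Filter.eventually_ge_atTop M)).and
      (Filter.eventually_le_atBot r₀)).exists
    obtain ⟨b, hb, hbM⟩ := intermediate_value_Icc' hxr hv.continuousOn ⟨hr₀M.le, hx⟩
    exact ⟨b, lt_of_le_of_ne hb.2 (by rintro rfl; exact hr₀M.ne hbM), hbM⟩
  have : {r | v r = M} = {a, b} := by
    ext r
    simp only [mem_ofPred_eq, mem_insert_iff, mem_singleton_iff]
    constructor
    · intro hr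
      by_contra! hne
      rcases lt_or_gt_of_ne hne.1 with h1 | h1
      · exact (hmid r b a h1 (ha.trans hb) hr hbM).ne haM
      · rcases lt_or_gt_of_ne hne.2 with h2 | h2
        · exact (hmid a b r h1 h2 haM hbM).ne hr
        · exact (hmid a r b (ha.trans hb) h2 haM hr).ne hbM
    · rintro (rfl | rfl) <;> assumption
  rw [this, ncard_pair (ha.trans hb).ne]

namespace FibredCurve

variable {P : Type*} [TopologicalSpace P] {Φ : P ≃ₜ ℝ × ℝ} {X X₀ : Set P}
variable (h : FibredCurve Φ X X₀)
include h

/-- A line crosses the boundary of the strip containing the critical values exactly twice. -/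
theorem ncard_line {M : ℝ} (hM0 : 0 < M) (hM : ∀ p ∈ X₀, |xc Φ p| < M) {K : Set P}
    (hK : K ∈ lines X) : (K ∩ {p | |xc Φ p| = M}).ncard = 2 := by
  obtain ⟨hK, ⟨e⟩⟩ := hK
  set u : ℝ → ℝ := fun r => xc Φ (e.symm r) with hu
  have huc : Continuous u := (continuous_xc Φ).comp (continuous_subtype_val.comp e.symm.continuous)
  have hcoc : Filter.Tendsto (fun r => |u r|) (Filter.cocompact ℝ) Filter.atTop := by
    rw [Filter.tendsto_atTop]
    intro N
    have hKN : IsCompact (K ∩ (X ∩ xc Φ ⁻¹' Icc (-N) N)) :=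
      (h.compact _ _).inter_left (h.isClosed_of_mem_components hK)
    have hpre : IsCompact ((Subtype.val : ↥K → P) ⁻¹' (K ∩ (X ∩ xc Φ ⁻¹' Icc (-N) N))) :=
      (h.isClosed_of_mem_components hK).isClosedEmbedding_subtypeVal.isCompact_preimage hKN
    filter_upwards [(hpre.image e.continuous).compl_mem_cocompact] with r hr
    by_contra! hcon
    refine hr ⟨e.symm r, ⟨(e.symm r).2, component_subset hK (e.symm r).2, ?_⟩, e.apply_symm_apply r⟩
    exact abs_le.1 hcon.le
  have hcoc' := hcoc
  rw [cocompact_eq_atBot_atTop, Filter.tendsto_sup] at hcoc'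
  have hopen : ∀ r, M ≤ |u r| → ∀ N ∈ 𝓝 r, u '' N ∈ 𝓝 (u r) := by
    intro r hr N hN
    obtain ⟨p, hp⟩ : ∃ p, p = e.symm r := ⟨_, rfl⟩
    have hpX : (p : P) ∈ X \ X₀ := ⟨component_subset hK p.2, fun h0 => by
      have := hM _ h0
      rw [hp] at this
      exact not_lt.2 hr this⟩
    have hN' : e ⁻¹' N ∈ 𝓝 p := e.continuous.continuousAt.preimage_mem_nhds (by
      rw [hp, e.apply_symm_apply]
      exact hN)
    obtain ⟨W, hW, hWN⟩ := mem_nhds_induced Subtype.val p _ |>.1 hN'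
    obtain ⟨W', hW'W, hW', hpW'⟩ := mem_nhds_iff.1 hW
    have hmem : u r ∈ xc Φ '' (connectedComponentIn (X \ X₀) p ∩ W') :=
      ⟨p, ⟨mem_connectedComponentIn hpX, hpW'⟩, by rw [hp]⟩
    refine Filter.mem_of_superset ((h.isOpen_image_component (q := p) hW').mem_nhds hmem) ?_
    rintro _ ⟨q, ⟨hq, hqW⟩, rfl⟩
    have hqK : q ∈ K := smooth_component_subset hK p.2 hq
    exact ⟨e ⟨q, hqK⟩, hWN (hW'W hqW), by simp [hu]⟩
  have hext : ∀ r, M ≤ |u r| → ¬ IsLocalExtr (fun r => |u r|) r := by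
    rintro r hr hext
    have hu0 : u r ≠ 0 := fun h0 => by
      rw [h0, abs_zero] at hr
      linarith
    -- Since `u` is open at `r`, it takes the values `k * u r` near `r` for `k` slightly below and
    -- slightly above `1`. So `|u|` has neither a minimum nor a maximum there.
    have hscale : Filter.Tendsto (fun k : ℝ => k * u r) (𝓝 1) (𝓝 (u r)) := by
      have : Continuous fun k : ℝ => k * u r := by fun_prop
      simpa using this.tendsto 1
    rcases hext with hmin | hmax
    · have h1 := hscale.eventually (hopen r hr _ hmin)
      obtain ⟨k, ⟨s, hs, hsk⟩, hk0, hk⟩ := ((h1.filter_mono nhdsWithin_le_nhds).and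
        (Ioo_mem_nhdsLT (zero_lt_one' ℝ))).exists
      change |u r| ≤ |u s| at hs
      rw [hsk, abs_mul, abs_of_pos hk0] at hs
      nlinarith [abs_pos.2 hu0]
    · have h1 := hscale.eventually (hopen r hr _ hmax)
      obtain ⟨k, ⟨s, hs, hsk⟩, hk⟩ := ((h1.filter_mono nhdsWithin_le_nhds).and
        (self_mem_nhdsWithin (s := Ioi (1 : ℝ)))).exists
      change |u s| ≤ |u r| at hs
      change 1 < k at hk
      rw [hsk, abs_mul, abs_of_pos (by linarith)] at hs
      nlinarith [abs_pos.2 hu0]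
  have h2 := ncard_eq_two_of_no_extr huc.abs hcoc'.2 hcoc'.1 hext
  rw [← h2]
  refine (ncard_congr (fun r _ => (e.symm r : P)) ?_ ?_ ?_).symm
  · intro r hr
    exact ⟨(e.symm r).2, hr⟩
  · intro r r' _ _ hrr'
    exact e.symm.injective (Subtype.ext hrr')
  · rintro p ⟨hp, hpM⟩
    exact ⟨e ⟨p, hp⟩, by simpa [hu] using hpM, by simp⟩

/-- Double counting: the points at `|x| = M` are sorted by their components, which are all lines,
and each line receives two of them. -/
theorem two_mul_ncard_lines (hloc : ∀ p : X, ∃ e : ℝ → X, IsOpenEmbedding e ∧ p ∈ range e)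
    {M : ℝ} (hM0 : 0 < M) (hM : ∀ p ∈ X₀, |xc Φ p| < M) :
    2 * (lines X).ncard = (X ∩ {p | |xc Φ p| = M}).ncard := by
  classical
  have hfin := h.finite_abs_eq hM
  have hlfin : (lines X).Finite := h.finite_components.subset fun K hK => hK.1
  rw [ncard_eq_toFinset_card _ hfin, ncard_eq_toFinset_card _ hlfin,
    Finset.card_eq_sum_card_fiberwise (f := connectedComponentIn X) (t := hlfin.toFinset),
    Finset.sum_const_nat (m := 2), mul_comm]
  · intro K hK
    rw [Finite.mem_toFinset] at hK
    rw [← h.ncard_line hM0 hM hK, ← ncard_coe_finset]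
    congr 1
    ext p
    simp only [Finset.coe_filter, Finite.mem_toFinset, mem_inter_iff, mem_ofPred_eq]
    constructor
    · rintro ⟨⟨hp, hpM⟩, rfl⟩
      exact ⟨mem_connectedComponentIn hp, hpM⟩
    · rintro ⟨hp, hpM⟩
      exact ⟨⟨component_subset hK.1 hp, hpM⟩, component_eq hK.1 hp⟩
  · intro p hp
    simp only [Finite.coe_toFinset, mem_inter_iff, mem_ofPred_eq] at hp ⊢
    exact (h.line_iff hloc hM (component_mem_components hp.1)).2
      ⟨p, mem_connectedComponentIn hp.1, hp.2.ge⟩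

end FibredCurve

end PoincareReeb

namespace PoincareReeb

open Set Topology

/-! ### Types of vertical intervals, arrows, and the number of lines. -/

section

variable {P : Type*} [TopologicalSpace P] {Φ : P ≃ₜ ℝ × ℝ} {D C S G : Set P} {κ : P → P}

theorem eq_of_isPreconnected {α : Type*} {A : Set P} (hA : IsPreconnected A) {f : P → α}
    (hf : ∀ p ∈ A, ∀ᶠ q in 𝓝[A] p, f q = f p) {p q : P} (hp : p ∈ A) (hq : q ∈ A) : f p = f q := by
  let _ : TopologicalSpace α := ⊥
  have : DiscreteTopology α := ⟨rfl⟩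
  have hc : ContinuousOn f A := fun p hp => by
    rw [ContinuousWithinAt, nhds_discrete, Filter.tendsto_pure]
    exact hf p hp
  exact (hA.image f hc).subsingleton ⟨p, hp, rfl⟩ ⟨q, hq, rfl⟩

/-- Without its end point the half-line is still connected, while the line is disconnected by the
removal of any point. -/
theorem not_nonempty_homeomorph_real_Ici : ¬ Nonempty (ℝ ≃ₜ Ici (0 : ℝ)) := by
  rintro ⟨φ⟩
  have hpre : IsPreconnected {x : Ici (0 : ℝ) | 0 < (x : ℝ)} := by
    rw [← IsInducing.subtypeVal.isPreconnected_image]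
    convert isPreconnected_Ioi (a := (0 : ℝ)) using 1
    ext x
    constructor
    · rintro ⟨y, hy, rfl⟩
      exact hy
    · intro hx
      exact ⟨⟨x, mem_Ici.2 (mem_Ioi.1 hx).le⟩, hx, rfl⟩
  have hord := (hpre.image φ.symm φ.symm.continuous.continuousOn).ordConnected
  set r := φ.symm ⟨0, self_mem_Ici⟩ with hr
  have hmem : ∀ x, x ≠ r → x ∈ φ.symm '' {x : Ici (0 : ℝ) | 0 < (x : ℝ)} := by
    intro x hx
    refine ⟨φ x, show (0 : ℝ) < φ x from lt_of_le_of_ne (φ x).2 fun h0 => hx ?_,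
      φ.symm_apply_apply x⟩
    rw [hr, ← φ.symm_apply_apply x]
    congr 1
    exact Subtype.ext h0.symm
  obtain ⟨y, hy, hyr⟩ := hord.out (hmem (r - 1) (by linarith)) (hmem (r + 1) (by linarith))
    (⟨by linarith, by linarith⟩ : r ∈ Icc (r - 1) (r + 1))
  have := φ.symm.injective (hyr.trans hr)
  rw [this] at hy
  exact lt_irrefl (0 : ℝ) hy

theorem nonempty_homeomorph_Iic_Ici (a : ℝ) : Nonempty (Iic a ≃ₜ Ici (0 : ℝ)) :=
  ⟨{ toFun := fun x => ⟨a - x, mem_Ici.2 (sub_nonneg.2 (mem_Iic.1 x.2))⟩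
     invFun := fun x => ⟨a - x, mem_Iic.2 (sub_le_self _ (mem_Ici.1 x.2))⟩
     left_inv := fun x => Subtype.ext (by simp)
     right_inv := fun x => Subtype.ext (by simp)
     continuous_toFun := (continuous_const.sub continuous_subtype_val).subtype_mk _
     continuous_invFun := (continuous_const.sub continuous_subtype_val).subtype_mk _ }⟩

theorem isEmbedding_pt (t : ℝ) : IsEmbedding (pt Φ t) := by
  refine Φ.symm.isEmbedding.comp (g := Φ.symm) (f := fun y : ℝ => (t, y)) ?_
  exact IsEmbedding.of_leftInverse (f := Prod.snd) (fun y => rfl) (by fun_prop) (by fun_prop)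

theorem verticalInterval_eq {p : P} (hp : p ∈ D) :
    verticalInterval (xc Φ) D p = pt Φ (xc Φ p) '' {y | Rel Φ D p (pt Φ (xc Φ p) y)} := by
  ext q
  rw [mem_verticalInterval_iff hp]
  constructor
  · intro h
    have hq : pt Φ (xc Φ p) (yc Φ q) = q := by rw [h.1, pt_xc_yc]
    exact ⟨yc Φ q, by rwa [mem_ofPred_eq, hq], hq⟩
  · rintro ⟨y, hy, rfl⟩
    exact hy

theorem heights_subset_of_isTop {p q : P} (hq : IsTop Φ D p q) :
    {y | Rel Φ D p (pt Φ (xc Φ p) y)} ⊆ Iic (yc Φ q) := fun y hy => by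
  simpa using hq.2 _ hy

theorem Rel.of_between {p : P} {y₁ y₂ y : ℝ} (h₁ : Rel Φ D p (pt Φ (xc Φ p) y₁))
    (h₂ : Rel Φ D p (pt Φ (xc Φ p) y₂)) (hy : y ∈ Icc y₁ y₂) : Rel Φ D p (pt Φ (xc Φ p) y) :=
  h₁.trans (rel_pt.2 fun z hz => rel_pt.1 (h₁.symm.trans h₂) z (by
    rw [uIcc_of_le hy.1] at hz
    exact mem_uIcc.2 (Or.inl ⟨hz.1, hz.2.trans hy.2⟩)))

theorem heights_of_isTop_of_isTop {p q r : P} (hq : IsTop Φ D p q) (hr : IsTop (flip Φ) D p r) :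
    {y | Rel Φ D p (pt Φ (xc Φ p) y)} = Icc (yc Φ r) (yc Φ q) := by
  have hr' : Rel Φ D p r := rel_flip.1 hr.1
  refine Subset.antisymm (fun y hy => ⟨?_, heights_subset_of_isTop hq hy⟩) fun y hy => ?_
  · simpa using hr.2 _ (rel_flip.2 hy)
  · refine Rel.of_between (y₁ := yc Φ r) (y₂ := yc Φ q) ?_ ?_ hy
    · rw [hr'.1, pt_xc_yc]
      exact hr'
    · rw [hq.1.1, pt_xc_yc]
      exact hq.1

theorem heights_of_isTop_of_ray {p q : P} (hq : IsTop Φ D p q)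
    (hray : ∀ y ≤ yc Φ p, pt Φ (xc Φ p) y ∈ D) :
    {y | Rel Φ D p (pt Φ (xc Φ p) y)} = Iic (yc Φ q) := by
  refine Subset.antisymm (heights_subset_of_isTop hq) fun y hy => ?_
  have hq' : Rel Φ D p (pt Φ (xc Φ p) (yc Φ q)) := by
    rw [hq.1.1, pt_xc_yc]
    exact hq.1
  refine Rel.of_between (y₁ := min y (yc Φ p)) ?_ hq' ⟨min_le_left _ _, hy⟩
  refine rel_pt_right.2 ⟨rfl, fun z hz => hray z ?_⟩
  rw [uIcc_of_ge (min_le_right _ _)] at hz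
  exact hz.2

theorem exists_isTop_flip_or (hD : IsClosed D) {p : P} (hp : p ∈ D) :
    (∃ q, IsTop (flip Φ) D p q) ∨ ∀ y ≤ yc Φ p, pt Φ (xc Φ p) y ∈ D := by
  refine (exists_isTop_or (Φ := flip Φ) hD hp).imp_right fun h y hy => ?_
  simpa using h (-y) (by simpa using hy)

/-- The homeomorphism types of the vertical intervals. -/
theorem verticalInterval_type (hD : IsClosed D) {p : P} (hp : p ∈ D) :
    (IsCompact (verticalInterval (xc Φ) D p) ↔
      (∃ q, IsTop Φ D p q) ∧ ∃ q, IsTop (flip Φ) D p q) ∧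
    (Nonempty (verticalInterval (xc Φ) D p ≃ₜ Ici (0 : ℝ)) ↔
      ¬ ((∃ q, IsTop Φ D p q) ↔ ∃ q, IsTop (flip Φ) D p q)) := by
  have hnc : ¬ CompactSpace (Ici (0 : ℝ)) := fun hc =>
    not_bddAbove_Ici (0 : ℝ) (isCompact_iff_compactSpace.2 hc).bddAbove
  have hhalf : ∀ (Φ : P ≃ₜ ℝ × ℝ), (∃ q, IsTop Φ D p q) → (∀ y ≤ yc Φ p, pt Φ (xc Φ p) y ∈ D) →
      Nonempty (verticalInterval (xc Φ) D p ≃ₜ Ici (0 : ℝ)) := by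
    rintro Φ ⟨q, hq⟩ hray
    rw [verticalInterval_eq hp, heights_of_isTop_of_ray hq hray]
    obtain ⟨φ⟩ := nonempty_homeomorph_Iic_Ici (yc Φ q)
    exact ⟨((isEmbedding_pt _).homeomorphImage _).symm.trans φ⟩
  have hray_top : (∀ y ≤ yc Φ p, pt Φ (xc Φ p) y ∈ D) → ¬ ∃ q, IsTop (flip Φ) D p q := fun hray =>
    not_exists_isTop fun y hy => by
      rw [yc_flip] at hy
      simpa using hray (-y) (by linarith)
  have key : ∀ {A : Prop}, (Nonempty (verticalInterval (xc Φ) D p ≃ₜ Ici (0 : ℝ))) → ¬ A →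
      (IsCompact (verticalInterval (xc Φ) D p) ↔ A) := by
    rintro A ⟨φ⟩ hA
    refine iff_of_false (fun hc => hnc ?_) hA
    have := isCompact_iff_compactSpace.1 hc
    exact φ.compactSpace
  rcases exists_isTop_or (Φ := Φ) hD hp with h1 | h1 <;>
    rcases exists_isTop_flip_or (Φ := Φ) hD hp with h2 | h2
  · have hc : IsCompact (verticalInterval (xc Φ) D p) := by
      obtain ⟨q, hq⟩ := h1
      obtain ⟨r, hr⟩ := h2
      rw [verticalInterval_eq hp, heights_of_isTop_of_isTop hq hr]
      exact isCompact_Icc.image (by fun_prop)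
    refine ⟨iff_of_true hc ⟨h1, h2⟩, iff_of_false ?_ (by tauto)⟩
    rintro ⟨φ⟩
    have := isCompact_iff_compactSpace.1 hc
    exact hnc φ.compactSpace
  · have h3 := hray_top h2
    have h4 := hhalf Φ h1 h2
    exact ⟨key h4 (by tauto), iff_of_true h4 (by tauto)⟩
  · have h3 := not_exists_isTop h1
    have h4 := hhalf (flip Φ) h2 fun y hy => h1 (-y) (by rw [yc_flip] at hy; linarith)
    exact ⟨key h4 (by tauto), iff_of_true h4 (by tauto)⟩
  · have h3 := not_exists_isTop h1
    have h4 := hray_top h2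
    have huniv : {y | Rel Φ D p (pt Φ (xc Φ p) y)} = univ := eq_univ_of_forall fun y =>
      rel_pt_right.2 ⟨rfl, fun z hz => (le_total z (yc Φ p)).elim (h2 z) (h1 z)⟩
    have φ : verticalInterval (xc Φ) D p ≃ₜ ℝ := by
      rw [verticalInterval_eq hp, huniv]
      exact ((isEmbedding_pt _).homeomorphImage _).symm.trans (Homeomorph.Set.univ ℝ)
    refine ⟨iff_of_false (fun hc => ?_) (by tauto), iff_of_false (fun ⟨ψ⟩ => ?_) (by tauto)⟩
    · have := isCompact_iff_compactSpace.1 hc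
      exact not_compactSpace_iff.2 (inferInstance : NoncompactSpace ℝ) φ.compactSpace
    · exact not_nonempty_homeomorph_real_Ici ⟨φ.symm.trans ψ⟩

end

namespace Geometry

variable {P : Type*} [TopologicalSpace P] {Φ : P ≃ₜ ℝ × ℝ} {D C S G : Set P} {κ : P → P}
variable (h : Geometry Φ D C S)
include h

/-- At a point of `D` off the curve, `D` is a neighbourhood and the interval continues upwards. -/
theorem mem_curve_of_isTop {p q : P} (hq : IsTop Φ D p q) : q ∈ C := by
  by_contra hqC
  obtain ⟨ε, hε, hbox⟩ := PoincareReeb.exists_box (Φ := Φ) (h.mem_nhds hq.1.right_mem hqC)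
  have := hq.2 (pt Φ (xc Φ q) (yc Φ q + ε / 2)) (hq.1.trans (rel_pt_right.2 ⟨rfl, fun z hz => ?_⟩))
  · rw [yc_pt] at this
    linarith
  · rw [uIcc_of_le (by linarith)] at hz
    exact hbox _ _ (by simpa) (abs_lt.2 ⟨by linarith [hz.1], by linarith [hz.2]⟩)

omit h in
theorem _root_.PoincareReeb.IsGraphPoint.isTop {q : P} {f : ℝ → ℝ}
    (hf : IsGraphPoint Φ D C q 1 f) (hq : q ∈ D) : IsTop Φ D q q := by
  refine isTop_of_frequently (Rel.refl hq) fun y hy => ?_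
  obtain ⟨ε, hε, hεy, δ, hδ, hbox⟩ := hf.exists_box (sub_pos.2 hy)
  refine ⟨yc Φ q + ε / 2, by linarith, by linarith, fun hD => ?_⟩
  have := ((hbox (xc Φ q) (by simpa)).2 (yc Φ q + ε / 2)
    (by rw [add_sub_cancel_left, abs_lt]; constructor <;> linarith)).2.1 hD
  rw [hf.2.1] at this
  linarith

theorem isTop_or {q : P} (hq : q ∈ C) (hqS : q ∉ S) : IsTop Φ D q q ∨ IsTop (PoincareReeb.flip Φ) D q q := by
  obtain ⟨s, f, rfl | rfl, hf⟩ := h.graph q hq hqS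
  · exact Or.inl (hf.isTop (h.curve_subset hq))
  · have := hf.flip
    rw [neg_neg] at this
    exact Or.inr (this.isTop (h.curve_subset hq))

/-- The interval would be the single point `q` of the curve, whereas `exists_regular_height`
provides a point of it off the curve. -/
theorem not_isTop_flip {q : P} (hqS : q ∉ S) (hq : IsTop Φ D q q) :
    ¬ IsTop (PoincareReeb.flip Φ) D q q := by
  intro hq'
  obtain ⟨m, hm, hr, -⟩ := h.exists_regular_height hq.1.left_mem hqS
  have h1 := hq.2 _ hr
  have h2 := hq'.2 _ (rel_flip.2 hr)
  simp only [yc_flip, yc_pt] at h1 h2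
  obtain rfl : m = yc Φ q := by linarith
  rw [pt_xc_yc] at hm
  exact hm (h.mem_curve_of_isTop hq)

/-- Along an open edge, the value at the top of the vertical intervals is constant. -/
theorem topVal_eq_of_mem_edge (hκ : Collapse Φ D G κ) {w : P → ZMod 2}
    (hw : ∀ q ∈ C, ∀ᶠ r in 𝓝[C] q, w r = w q) {g g' : P}
    (hg : g' ∈ connectedComponentIn (G \ crit Φ D G S) g) :
    topVal Φ D w g = topVal Φ D w g' := by
  have hsub := connectedComponentIn_subset (G \ crit Φ D G S) g
  refine eq_of_isPreconnected (A := connectedComponentIn (G \ crit Φ D G S) g)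
    isPreconnected_connectedComponentIn (fun p hp => ?_)
    (mem_connectedComponentIn (connectedComponentIn_nonempty_iff.1 ⟨g', hg⟩)) hg
  exact nhdsWithin_mono _ ((hsub.trans sdiff_subset).trans hκ.subset)
    (h.eventually_topVal_of_regular hw (hκ.subset (hsub hp).1) (rel_crit_of_notMem (hsub hp)))

/-- For `w = 1` the value `topVal` is `1` or the default `0` according to whether a top exists, and
it is constant along an edge. -/
theorem exists_isTop_iff_of_mem_edge (hκ : Collapse Φ D G κ) {g g' : P}
    (hg : g' ∈ connectedComponentIn (G \ crit Φ D G S) g) :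
    (∃ q, IsTop Φ D g q) ↔ ∃ q, IsTop Φ D g' q := by
  have key : ∀ g, (∃ q, IsTop Φ D g q) ↔ topVal Φ D (fun _ => 1) g = 1 := by
    intro g
    constructor
    · rintro ⟨q, hq⟩
      rw [topVal_of_isTop _ hq]
    · intro h1
      by_contra hcon
      rw [topVal_of_not_exists _ hcon] at h1
      exact absurd h1 (by decide)
  rw [key, key, h.topVal_eq_of_mem_edge hκ (w := fun _ => 1) (fun q _ => Filter.Eventually.of_forall
    fun _ => rfl) hg]

omit h in
theorem _root_.PoincareReeb.crit_flip :
    crit (PoincareReeb.flip Φ) D G S = crit Φ D G S := by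
  simp [crit]

theorem verticalInterval_type_of_mem_edge (hκ : Collapse Φ D G κ) {g g' : P}
    (hg : g' ∈ connectedComponentIn (G \ crit Φ D G S) g) :
    (IsCompact (verticalInterval (xc Φ) D g) ↔ IsCompact (verticalInterval (xc Φ) D g')) ∧
    (Nonempty (verticalInterval (xc Φ) D g ≃ₜ Ici (0 : ℝ)) ↔
      Nonempty (verticalInterval (xc Φ) D g' ≃ₜ Ici (0 : ℝ))) := by
  have hg' := connectedComponentIn_nonempty_iff.1 ⟨g', hg⟩
  have h1 := verticalInterval_type (Φ := Φ) h.isClosed (hκ.subset hg'.1)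
  have h2 := verticalInterval_type (Φ := Φ) h.isClosed
    (hκ.subset (connectedComponentIn_subset _ _ hg).1)
  have h3 := h.exists_isTop_iff_of_mem_edge hκ hg
  have h4 := h.flip.exists_isTop_iff_of_mem_edge hκ.flip (S := S) (by rwa [crit_flip])
  rw [h1.1, h1.2, h2.1, h2.2, h3, h4]
  exact ⟨Iff.rfl, Iff.rfl⟩

omit h in
/-- The points of the curve that are tops correspond to the vertical intervals
that are bounded above. -/
theorem _root_.PoincareReeb.Collapse.bijOn_tops (hκ : Collapse Φ D G κ) (T : Set ℝ) :
    BijOn κ {q | xc Φ q ∈ T ∧ IsTop Φ D q q} {g | g ∈ G ∧ xc Φ g ∈ T ∧ ∃ q, IsTop Φ D g q} := by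
  refine ⟨?_, ?_, ?_⟩
  · rintro q ⟨hqT, hq⟩
    have hqD := hq.1.left_mem
    exact ⟨hκ.mem hqD, by rwa [hκ.xc_eq hqD], q, hq.congr (hκ.rel q hqD).symm⟩
  · rintro q ⟨-, hq⟩ q' ⟨-, hq'⟩ hqq
    exact hq.eq (hq'.congr (hκ.rel_of_eq hq.1.left_mem hq'.1.left_mem hqq))
  · rintro g ⟨hg, hgT, q, hq⟩
    refine ⟨q, ⟨by rwa [← hq.1.1], hq.self⟩, ?_⟩
    rw [← hκ.eq_of_rel _ _ hq.1, hκ.eq_self hg]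

/-- An edge unbounded in one direction passes over `M`, respectively `-M`, and does so only once
because the projection is injective on edges. An edge unbounded in both directions meets both
abscissas and carries two arrows. -/
theorem bijOn_arrows (hκ : Collapse Φ D G κ) (hV : vertices (xc Φ) D G = crit Φ D G S) {M : ℝ}
    (hM0 : 0 < M) (hM : ∀ p ∈ S, |xc Φ p| < M) :
    BijOn (fun g => (connectedComponentIn (G \ crit Φ D G S) g,
      if 0 < xc Φ g then Side.right else Side.left)) (G ∩ {p | |xc Φ p| = M})
      (arrows (xc Φ) D G) := by
  have hG := h.graph_fibredCurve hκ
  have hMV : ∀ p ∈ crit Φ D G S, |xc Φ p| < M := by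
    rintro p ⟨-, s, hs, hps⟩
    rw [hps.1]
    exact hM s hs
  have hr : ∀ p ∈ crit Φ D G S, xc Φ p < M := fun p hp => (abs_lt.1 (hMV p hp)).2
  have hl : ∀ p ∈ crit Φ D G S, -M < xc Φ p := fun p hp => (abs_lt.1 (hMV p hp)).1
  have hmem : ∀ g ∈ G ∩ {p | |xc Φ p| = M}, g ∈ G \ crit Φ D G S := fun g hg =>
    ⟨hg.1, fun hc => (hMV g hc).ne hg.2⟩
  have hsign : ∀ g : P, |xc Φ g| = M → (0 < xc Φ g ∧ xc Φ g = M) ∨ (¬ 0 < xc Φ g ∧ xc Φ g = -M) := by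
    intro g hg
    rcases eq_or_eq_neg_of_abs_eq hg with h1 | h1
    · exact Or.inl ⟨h1 ▸ hM0, h1⟩
    · exact Or.inr ⟨by linarith, h1⟩
  refine ⟨?_, ?_, ?_⟩
  · intro g hg
    have hE : connectedComponentIn (G \ crit Φ D G S) g ∈ components (G \ crit Φ D G S) :=
      component_mem_components (hmem g hg)
    have hgE := mem_connectedComponentIn (hmem g hg)
    refine ⟨by rwa [openEdges, hV], ?_⟩
    dsimp only
    rcases hsign g hg.2 with ⟨h1, h2⟩ | ⟨h1, h2⟩
    · rw [if_pos h1]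
      exact (hG.escapes_right_iff hr hE).2 ⟨g, hgE, h2⟩
    · rw [if_neg h1]
      exact (hG.escapes_left_iff hl hE).2 ⟨g, hgE, h2⟩
  · intro g hg g' hg' hgg
    rw [Prod.mk.injEq] at hgg
    have hmem' := mem_connectedComponentIn (hmem g' hg')
    rw [← hgg.1] at hmem'
    refine hG.injOn_component g (mem_connectedComponentIn (hmem g hg)) hmem' ?_
    rcases hsign g hg.2 with ⟨h1, h2⟩ | ⟨h1, h2⟩ <;>
      rcases hsign g' hg'.2 with ⟨h3, h4⟩ | ⟨h3, h4⟩ <;> simp_all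
  · rintro ⟨E, s⟩ ⟨hE, hs⟩
    rw [openEdges, hV] at hE
    have hEs := component_subset hE
    cases s with
    | right =>
      obtain ⟨g, hg, hgM⟩ := (hG.escapes_right_iff hr hE).1 hs
      refine ⟨g, ⟨(hEs hg).1, by rw [mem_ofPred_eq, hgM, abs_of_pos hM0]⟩, ?_⟩
      simp only [component_eq hE hg, hgM, if_pos hM0]
    | left =>
      obtain ⟨g, hg, hgM⟩ := (hG.escapes_left_iff hl hE).1 hs
      refine ⟨g, ⟨(hEs hg).1, by rw [mem_ofPred_eq, hgM, abs_neg, abs_of_pos hM0]⟩, ?_⟩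
      simp only [component_eq hE hg, hgM]
      rw [if_neg (by linarith)]

/-- The number of lines in terms of arrows. -/
theorem two_mul_ncard_lines (hκ : Collapse Φ D G κ) (hV : vertices (xc Φ) D G = crit Φ D G S)
    (hloc : ∀ p : C, ∃ e : ℝ → C, IsOpenEmbedding e ∧ p ∈ range e) :
    2 * (lines C).ncard = 2 * (arrowsWithoutFeathers (xc Φ) D G).ncard +
      (arrowsWithSimpleFeathers (xc Φ) D G).ncard := by
  obtain ⟨M, hM0, hM⟩ : ∃ M : ℝ, 0 < M ∧ ∀ p ∈ S, |xc Φ p| < M := by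
    obtain ⟨M, hM⟩ := (h.finite_critical.image fun p => |xc Φ p|).bddAbove
    refine ⟨max M 0 + 1, by positivity, fun p hp => ?_⟩
    have := hM ⟨p, hp, rfl⟩
    change |xc Φ p| ≤ M at this
    linarith [le_max_left M 0]
  set T : Set ℝ := {t | |t| = M} with hT
  set F := G ∩ {p | |xc Φ p| = M} with hF
  set A := {g | g ∈ G ∧ xc Φ g ∈ T ∧ ∃ q, IsTop Φ D g q} with hA
  set B := {g | g ∈ G ∧ xc Φ g ∈ T ∧ ∃ q, IsTop (PoincareReeb.flip Φ) D g q} with hB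
  have hfin : F.Finite := (h.graph_fibredCurve hκ).finite_abs_eq (by
    rintro p ⟨-, s, hs, hps⟩
    rw [hps.1]
    exact hM s hs)
  have hAF : A ⊆ F := fun g hg => ⟨hg.1, hg.2.1⟩
  have hBF : B ⊆ F := fun g hg => ⟨hg.1, hg.2.1⟩
  have hFD : ∀ g ∈ F, g ∈ D := fun g hg => hκ.subset hg.1
  have hbij := h.bijOn_arrows hκ hV hM0 hM
  have hFE : ∀ g ∈ F, g ∈ connectedComponentIn (G \ crit Φ D G S) g := fun g hg =>
    mem_connectedComponentIn ⟨hg.1, fun ⟨_, s, hs, hps⟩ => by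
      have h1 := hM s hs
      rw [← hps.1] at h1
      exact h1.ne hg.2⟩
  have hcompact : (arrowsWithoutFeathers (xc Φ) D G).ncard = (A ∩ B).ncard := by
    rw [← (hbij.injOn.mono (inter_subset_left.trans hAF)).ncard_image]
    congr 1
    ext a
    constructor
    · rintro ⟨ha, hac⟩
      obtain ⟨g, hg, rfl⟩ := hbij.surjOn ha
      have := (verticalInterval_type (Φ := Φ) h.isClosed (hFD g hg)).1.1 (hac g (hFE g hg))
      exact ⟨g, ⟨⟨hg.1, hg.2, this.1⟩, hg.1, hg.2, this.2⟩, rfl⟩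
    · rintro ⟨g, ⟨hgA, hgB⟩, rfl⟩
      refine ⟨hbij.mapsTo (hAF hgA), fun p hp => ?_⟩
      rw [← (h.verticalInterval_type_of_mem_edge hκ hp).1]
      exact (verticalInterval_type (Φ := Φ) h.isClosed (hFD g (hAF hgA))).1.2 ⟨hgA.2.2, hgB.2.2⟩
  have hhalf : (arrowsWithSimpleFeathers (xc Φ) D G).ncard = ((A \ B) ∪ (B \ A)).ncard := by
    rw [← (hbij.injOn.mono (union_subset (sdiff_subset.trans hAF)
      (sdiff_subset.trans hBF))).ncard_image]
    congr 1
    ext a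
    constructor
    · rintro ⟨ha, hac⟩
      obtain ⟨g, hg, rfl⟩ := hbij.surjOn ha
      have := (verticalInterval_type (Φ := Φ) h.isClosed (hFD g hg)).2.1 (hac g (hFE g hg))
      refine ⟨g, ?_, rfl⟩
      by_cases h1 : ∃ q, IsTop Φ D g q
      · exact Or.inl ⟨⟨hg.1, hg.2, h1⟩, fun h2 => this (iff_of_true h1 h2.2.2)⟩
      · refine Or.inr ⟨⟨hg.1, hg.2, ?_⟩, fun h2 => h1 h2.2.2⟩
        by_contra h2
        exact this (iff_of_false h1 h2)
    · rintro ⟨g, hg, rfl⟩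
      have hgF : g ∈ F := hg.elim (fun h1 => hAF h1.1) fun h1 => hBF h1.1
      refine ⟨hbij.mapsTo hgF, fun p hp => ?_⟩
      rw [← (h.verticalInterval_type_of_mem_edge hκ hp).2]
      refine (verticalInterval_type (Φ := Φ) h.isClosed (hFD g hgF)).2.2 ?_
      rcases hg with ⟨h1, h2⟩ | ⟨h1, h2⟩
      · exact fun h3 => h2 ⟨h1.1, h1.2.1, h3.1 h1.2.2⟩
      · exact fun h3 => h2 ⟨h1.1, h1.2.1, h3.2 h1.2.2⟩
  have htop := (hκ.bijOn_tops T).ncard_eq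
  have hbot := (hκ.flip.bijOn_tops T).ncard_eq
  have hCF := h.fibredCurve.finite_abs_eq hM
  have hsplit : C ∩ {p | |xc Φ p| = M} = {q | xc Φ q ∈ T ∧ IsTop Φ D q q} ∪
      {q | xc Φ q ∈ T ∧ IsTop (PoincareReeb.flip Φ) D q q} := by
    ext q
    constructor
    · rintro ⟨hq, hqM⟩
      have hqS : q ∉ S := fun hS => (hM q hS).ne hqM
      exact (h.isTop_or hq hqS).imp (fun h1 => ⟨hqM, h1⟩) fun h1 => ⟨hqM, h1⟩
    · rintro (⟨h1, h2⟩ | ⟨h1, h2⟩)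
      · exact ⟨h.mem_curve_of_isTop h2, h1⟩
      · exact ⟨h.flip.mem_curve_of_isTop h2, h1⟩
  have hdisj : Disjoint {q | xc Φ q ∈ T ∧ IsTop Φ D q q}
      {q | xc Φ q ∈ T ∧ IsTop (PoincareReeb.flip Φ) D q q} := by
    rw [disjoint_left]
    rintro q ⟨hqM, h1⟩ ⟨-, h2⟩
    exact h.not_isTop_flip (fun hS => (hM q hS).ne hqM) h1 h2
  rw [h.fibredCurve.two_mul_ncard_lines hloc hM0 hM, hcompact, hhalf]
  rw [hsplit] at hCF ⊢
  rw [ncard_union_eq hdisj (hCF.subset subset_union_left) (hCF.subset subset_union_right), htop]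
  have hbot' : {q | xc Φ q ∈ T ∧ IsTop (PoincareReeb.flip Φ) D q q}.ncard = B.ncard := hbot
  have hAfin := hfin.subset hAF
  have hBfin := hfin.subset hBF
  rw [hbot', ncard_union_eq (disjoint_left.2 fun x h1 h2 => h1.2 h2.1) hAfin.sdiff hBfin.sdiff]
  -- `A` and `B` are the points of `G` over `±M` whose interval has a top, respectively a bottom.
  -- The count is `|A| + |B| = 2 |A ∩ B| + |A \ B| + |B \ A|`.
  have e1 := ncard_inter_add_ncard_sdiff_eq_ncard A B hAfin
  have e2 := ncard_inter_add_ncard_sdiff_eq_ncard B A hBfin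
  rw [inter_comm] at e2
  change A.ncard + B.ncard = _
  omega

end Geometry

end PoincareReeb

namespace PoincareReeb

open Set Topology

/-! ### Spaces of locally constant mod 2 functions. -/

section

variable {P : Type*} [TopologicalSpace P] (Φ : P ≃ₜ ℝ × ℝ) (X : Set P) (M : ℝ)

/-- The locally constant mod 2 functions on `X` that vanish far to the left and to the right. -/
def locConst : Submodule (ZMod 2) (P → ZMod 2) where
  carrier := {f | (∀ p ∉ X, f p = 0) ∧ (∀ p ∈ X, ∀ᶠ q in 𝓝[X] p, f q = f p) ∧
    ∀ p ∈ X, M ≤ |xc Φ p| → f p = 0}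
  add_mem' := by
    rintro f g ⟨h1, h2, h3⟩ ⟨h1', h2', h3'⟩
    refine ⟨fun p hp => by simp [h1 p hp, h1' p hp], fun p hp => ?_,
      fun p hp hpM => by simp [h3 p hp hpM, h3' p hp hpM]⟩
    filter_upwards [h2 p hp, h2' p hp] with q hq hq'
    simp [hq, hq']
  zero_mem' := ⟨fun _ _ => rfl, fun _ _ => Filter.Eventually.of_forall fun _ => rfl,
    fun _ _ _ => rfl⟩
  smul_mem' := by
    rintro c f ⟨h1, h2, h3⟩
    refine ⟨fun p hp => by simp [h1 p hp], fun p hp => ?_, fun p hp hpM => by simp [h3 p hp hpM]⟩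
    filter_upwards [h2 p hp] with q hq
    simp [hq]

variable {Φ X M}

theorem locConst_eq {f : P → ZMod 2} (hf : f ∈ locConst Φ X M) {A : Set P} (hA : IsPreconnected A)
    (hAX : A ⊆ X) {p q : P} (hp : p ∈ A) (hq : q ∈ A) : f p = f q :=
  eq_of_isPreconnected hA (fun r hr => nhdsWithin_mono _ hAX (hf.2.1 r (hAX hr))) hp hq

/-- The components of `X` inside the strip. -/
def nearComponents (Φ : P ≃ₜ ℝ × ℝ) (X : Set P) (M : ℝ) : Set (Set P) :=
  {K ∈ components X | ∀ p ∈ K, |xc Φ p| < M}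

open Classical in
/-- Locally constant functions are functions on the set of components. -/
noncomputable def locConstEquiv {X₀ : Set P} (h : FibredCurve Φ X X₀) :
    locConst Φ X M ≃ₗ[ZMod 2] (nearComponents Φ X M → ZMod 2) where
  toFun f K := f.1 K.2.1.choose
  map_add' f g := rfl
  map_smul' c f := rfl
  invFun g := ⟨fun p => if hp : p ∈ X ∧ connectedComponentIn X p ∈ nearComponents Φ X M then
      g ⟨connectedComponentIn X p, hp.2⟩ else 0, by
    refine ⟨fun p hp => dif_neg fun h => hp h.1, fun p hp => ?_, fun p hp hpM => dif_neg fun h =>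
      (h.2.2 p (mem_connectedComponentIn hp)).not_ge hpM⟩
    filter_upwards [h.component_mem_nhdsWithin (p := p), self_mem_nhdsWithin] with q hq hqX
    have heq := connectedComponentIn_eq hq
    simp only [hp, hqX, true_and, heq]⟩
  left_inv f := by
    ext p
    by_cases hp : p ∈ X ∧ connectedComponentIn X p ∈ nearComponents Φ X M
    · simp only [dif_pos hp]
      have hK := hp.2.1
      refine locConst_eq f.2 isPreconnected_connectedComponentIn (connectedComponentIn_subset X p)
        ?_ (mem_connectedComponentIn hp.1)
      have h1 := mem_connectedComponentIn hK.choose_spec.1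
      rwa [hK.choose_spec.2] at h1
    · simp only [dif_neg hp]
      by_cases hpX : p ∈ X
      -- A component not contained in the strip reaches a point where the function vanishes, so the
      -- function vanishes on all of it.
      · have : ∃ q ∈ connectedComponentIn X p, M ≤ |xc Φ q| := by
          by_contra! hcon
          exact hp ⟨hpX, component_mem_components hpX, hcon⟩
        obtain ⟨q, hq, hqM⟩ := this
        rw [locConst_eq f.2 isPreconnected_connectedComponentIn (connectedComponentIn_subset X p)
          (mem_connectedComponentIn hpX) hq]
        exact (f.2.2.2 q (connectedComponentIn_subset _ _ hq) hqM).symm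
      · exact (f.2.1 p hpX).symm
  right_inv g := by
    ext K
    have h1 := K.2.1.choose_spec
    have h2 : K.2.1.choose ∈ X ∧ connectedComponentIn X K.2.1.choose ∈ nearComponents Φ X M :=
      ⟨h1.1, by rw [h1.2]; exact K.2⟩
    simp only [dif_pos h2]
    congr 1
    exact Subtype.ext h1.2

theorem finite_locConst {X₀ : Set P} (h : FibredCurve Φ X X₀) :
    Module.Finite (ZMod 2) (locConst Φ X M) := by
  have : Finite (nearComponents Φ X M) := (h.finite_components.subset fun K hK => hK.1).to_subtype
  exact Module.Finite.equiv (locConstEquiv (M := M) h).symm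

theorem finrank_locConst {X₀ : Set P} (h : FibredCurve Φ X X₀) :
    Module.finrank (ZMod 2) (locConst Φ X M) = (nearComponents Φ X M).ncard := by
  have : Finite (nearComponents Φ X M) := (h.finite_components.subset fun K hK => hK.1).to_subtype
  have := Fintype.ofFinite (nearComponents Φ X M)
  rw [(locConstEquiv (M := M) h).finrank_eq, Module.finrank_fintype_fun_eq_card,
    ← Nat.card_eq_fintype_card, Nat.card_coe_set_eq]

end

/-! ### Adapted rectangles at folds. -/

section

variable {P : Type*} [TopologicalSpace P] (Φ : P ≃ₜ ℝ × ℝ) (D C : Set P)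

/-- Adapted rectangles at a fold: the curve in the rectangle consists of two graphs over one
side. -/
structure FoldBox (s : P) (σ : ℝ) (f g : ℝ → ℝ) (m n δ : ℝ) : Prop where
  sign : σ = 1 ∨ σ = -1
  pos : 0 < δ
  lower : m < yc Φ s
  upper : yc Φ s < n
  continuous_left : Continuous f
  continuous_right : Continuous g
  left_eq : f (xc Φ s) = yc Φ s
  right_eq : g (xc Φ s) = yc Φ s
  left_mem : ∀ t, |t - xc Φ s| < δ → f t ∈ Ioo m n
  right_mem : ∀ t, |t - xc Φ s| < δ → g t ∈ Ioo m n
  lt : ∀ t, |t - xc Φ s| < δ → 0 < σ * (t - xc Φ s) → f t < g t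
  curve : ∀ t, |t - xc Φ s| < δ → ∀ y ∈ Icc m n,
    (pt Φ t y ∈ C ↔ 0 ≤ σ * (t - xc Φ s) ∧ (y = f t ∨ y = g t))

/-- Adapted rectangles at a leaf. -/
structure LeafBox (s : P) (σ : ℝ) (f g : ℝ → ℝ) (m n δ : ℝ) : Prop
    extends FoldBox Φ C s σ f g m n δ where
  domain : ∀ t, |t - xc Φ s| < δ → ∀ y ∈ Icc m n,
    (pt Φ t y ∈ D ↔ 0 ≤ σ * (t - xc Φ s) ∧ f t ≤ y ∧ y ≤ g t)

/-- Adapted rectangles at a split. -/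
structure SplitBox (s : P) (σ : ℝ) (f g : ℝ → ℝ) (m n δ : ℝ) : Prop
    extends FoldBox Φ C s σ f g m n δ where
  domain : ∀ t, |t - xc Φ s| < δ → ∀ y ∈ Icc m n,
    (pt Φ t y ∈ D ↔ ¬ (0 < σ * (t - xc Φ s) ∧ f t < y ∧ y < g t))

variable {Φ D C} {s : P} {σ : ℝ} {f g : ℝ → ℝ} {m n δ : ℝ}

/-- The height of the rectangle is fixed first. The width is then taken so small that both branches
stay strictly between the horizontal sides, which therefore avoid the curve. -/
theorem IsFold.exists_foldBox (hf : IsFold Φ C s σ f g) {Q : P → Prop} (hQ : ∀ᶠ r in 𝓝 s, Q r) :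
    ∃ m n δ, FoldBox Φ C s σ f g m n δ ∧
      ∀ t, |t - xc Φ s| < δ → ∀ y ∈ Icc m n, Q (pt Φ t y) := by
  obtain ⟨h1, h2, h3, h4, h5, h6, h7⟩ := hf
  obtain ⟨ε, hε, hbox⟩ := exists_box (Φ := Φ) (h7.and hQ)
  have hIoo : ∀ k : ℝ → ℝ, Continuous k → k (xc Φ s) = yc Φ s →
      ∀ᶠ t in 𝓝 (xc Φ s), k t ∈ Ioo (yc Φ s - ε / 2) (yc Φ s + ε / 2) := fun k hk hk0 =>
    hk.continuousAt.eventually (Ioo_mem_nhds (by linarith) (by linarith))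
  obtain ⟨δ, hδ, hball⟩ := Metric.eventually_nhds_iff.1 (h6.and ((hIoo f h2 h4).and (hIoo g h3 h5)))
  have hb : ∀ t, |t - xc Φ s| < min δ ε → ∀ y ∈ Icc (yc Φ s - ε / 2) (yc Φ s + ε / 2),
      ((pt Φ t y ∈ C ↔ 0 ≤ σ * (t - xc Φ s) ∧ (y = f t ∨ y = g t)) ∧ Q (pt Φ t y)) := by
    intro t ht y hy
    have := hbox t y (ht.trans_le (min_le_right _ _))
      (abs_lt.2 ⟨by linarith [hy.1], by linarith [hy.2]⟩)
    simpa using this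
  have hd : ∀ t, |t - xc Φ s| < min δ ε → dist t (xc Φ s) < δ := fun t ht =>
    ht.trans_le (min_le_left _ _)
  exact ⟨yc Φ s - ε / 2, yc Φ s + ε / 2, min δ ε,
    { sign := h1, pos := lt_min hδ hε, lower := by linarith, upper := by linarith
      continuous_left := h2, continuous_right := h3, left_eq := h4, right_eq := h5
      left_mem := fun t ht => (hball (hd t ht)).2.1
      right_mem := fun t ht => (hball (hd t ht)).2.2
      lt := fun t ht => (hball (hd t ht)).1
      curve := fun t ht y hy => (hb t ht y hy).1 }, fun t ht y hy => (hb t ht y hy).2⟩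

theorem IsLeaf.exists_leafBox (h : IsLeaf Φ D C s σ f g) : ∃ m n δ, LeafBox Φ D C s σ f g m n δ := by
  obtain ⟨m, n, δ, hb, hQ⟩ := h.1.exists_foldBox h.2
  exact ⟨m, n, δ, { hb with domain := fun t ht y hy => by simpa using hQ t ht y hy }⟩

theorem IsSplit.exists_splitBox (h : IsSplit Φ D C s σ f g) :
    ∃ m n δ, SplitBox Φ D C s σ f g m n δ := by
  obtain ⟨m, n, δ, hb, hQ⟩ := h.1.exists_foldBox h.2
  exact ⟨m, n, δ, { hb with domain := fun t ht y hy => by simpa using hQ t ht y hy }⟩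

theorem FoldBox.flip (h : FoldBox Φ C s σ f g m n δ) :
    FoldBox (flip Φ) C s σ (fun t => -g t) (fun t => -f t) (-n) (-m) δ where
  sign := h.sign
  pos := h.pos
  lower := neg_lt_neg h.upper
  upper := neg_lt_neg h.lower
  continuous_left := h.continuous_right.neg
  continuous_right := h.continuous_left.neg
  left_eq := by simp [h.right_eq]
  right_eq := by simp [h.left_eq]
  left_mem t ht := ⟨neg_lt_neg (h.right_mem t ht).2, neg_lt_neg (h.right_mem t ht).1⟩
  right_mem t ht := ⟨neg_lt_neg (h.left_mem t ht).2, neg_lt_neg (h.left_mem t ht).1⟩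
  lt t ht hσ := neg_lt_neg (h.lt t ht hσ)
  curve t ht y hy := by
    rw [pt_flip, h.curve t ht (-y) ⟨by linarith [hy.2], by linarith [hy.1]⟩, neg_eq_iff_eq_neg,
      neg_eq_iff_eq_neg, or_comm]
    rfl

theorem LeafBox.flip (h : LeafBox Φ D C s σ f g m n δ) :
    LeafBox (flip Φ) D C s σ (fun t => -g t) (fun t => -f t) (-n) (-m) δ :=
  { h.toFoldBox.flip with
    domain := fun t ht y hy => by
      rw [pt_flip, h.domain t ht (-y) ⟨by linarith [hy.2], by linarith [hy.1]⟩, xc_flip]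
      constructor <;> rintro ⟨h1, h2, h3⟩ <;> exact ⟨h1, by linarith, by linarith⟩ }

theorem SplitBox.flip (h : SplitBox Φ D C s σ f g m n δ) :
    SplitBox (flip Φ) D C s σ (fun t => -g t) (fun t => -f t) (-n) (-m) δ :=
  { h.toFoldBox.flip with
    domain := fun t ht y hy => by
      rw [pt_flip, h.domain t ht (-y) ⟨by linarith [hy.2], by linarith [hy.1]⟩, xc_flip, not_iff_not]
      constructor <;> rintro ⟨h1, h2, h3⟩ <;> exact ⟨h1, by linarith, by linarith⟩ }

end

end PoincareReeb

namespace PoincareReeb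

open Set Topology

/-! ### One-sided limits and vertical intervals near a critical one. -/

section

/-- One side of a real number. -/
def side (τ t₀ : ℝ) : Set ℝ := {t | 0 < τ * (t - t₀)}

theorem side_one (t₀ : ℝ) : side 1 t₀ = Ioi t₀ := by
  ext t
  simp [side]

theorem side_neg_one (t₀ : ℝ) : side (-1) t₀ = Iio t₀ := by
  ext t
  simp [side]

theorem neBot_side {τ : ℝ} (hτ : τ = 1 ∨ τ = -1) (t₀ : ℝ) : (𝓝[side τ t₀] t₀).NeBot := by
  rcases hτ with rfl | rfl
  · rw [side_one]
    infer_instance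
  · rw [side_neg_one]
    infer_instance

theorem ne_of_mem_side {τ t₀ t : ℝ} (ht : t ∈ side τ t₀) : t ≠ t₀ := by
  rintro rfl
  simp [side] at ht

theorem mem_side_or {τ t₀ t : ℝ} (hτ : τ = 1 ∨ τ = -1) (ht : t ≠ t₀) :
    t ∈ side τ t₀ ∨ t ∈ side (-τ) t₀ := by
  rcases hτ with rfl | rfl
  · rw [side_one, side_neg_one]
    exact (lt_or_gt_of_ne ht).symm
  · rw [neg_neg, side_one, side_neg_one]
    exact lt_or_gt_of_ne ht

theorem isPreconnected_side_inter_ball {τ : ℝ} (hτ : τ = 1 ∨ τ = -1) (t₀ δ : ℝ) :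
    IsPreconnected (side τ t₀ ∩ {t | |t - t₀| < δ}) := by
  have hball : {t | |t - t₀| < δ} = Ioo (t₀ - δ) (t₀ + δ) := by
    ext t
    rw [mem_ofPred_eq, abs_lt, mem_Ioo]
    constructor <;> rintro ⟨h1, h2⟩ <;> constructor <;> linarith
  rw [hball]
  rcases hτ with rfl | rfl
  · rw [side_one]
    exact (ordConnected_Ioi.inter ordConnected_Ioo).isPreconnected
  · rw [side_neg_one]
    exact (ordConnected_Iio.inter ordConnected_Ioo).isPreconnected

end

section

variable {P : Type*} [TopologicalSpace P] {Φ : P ≃ₜ ℝ × ℝ} {D C S : Set P}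
variable {s : P} {σ : ℝ} {f g : ℝ → ℝ} {m n δ t : ℝ}

theorem rel_pt_of_Icc {y y' a b : ℝ} (hD : ∀ z ∈ Icc a b, pt Φ t z ∈ D) (hy : y ∈ Icc a b)
    (hy' : y' ∈ Icc a b) : Rel Φ D (pt Φ t y) (pt Φ t y') :=
  rel_pt.2 fun z hz => hD z (ordConnected_Icc.uIcc_subset hy hy' hz)

namespace FoldBox

variable (h : FoldBox Φ C s σ f g m n δ)
include h

theorem eventually_abs : ∀ᶠ t in 𝓝 (xc Φ s), |t - xc Φ s| < δ := Metric.ball_mem_nhds _ h.pos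

theorem lower_notMem (ht : |t - xc Φ s| < δ) : pt Φ t m ∉ C := by
  rw [h.curve t ht m ⟨le_rfl, (h.lower.trans h.upper).le⟩]
  rintro ⟨-, h1 | h1⟩
  · exact (h.left_mem t ht).1.ne h1
  · exact (h.right_mem t ht).1.ne h1

theorem upper_notMem (ht : |t - xc Φ s| < δ) : pt Φ t n ∉ C := by
  rw [h.curve t ht n ⟨(h.lower.trans h.upper).le, le_rfl⟩]
  rintro ⟨-, h1 | h1⟩
  · exact (h.left_mem t ht).2.ne' h1
  · exact (h.right_mem t ht).2.ne' h1

theorem eventually_near : ∀ᶠ q in 𝓝 s, |xc Φ q - xc Φ s| < δ ∧ yc Φ q ∈ Icc m n := by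
  filter_upwards [(continuous_xc Φ).continuousAt.eventually h.eventually_abs,
    (continuous_yc Φ).continuousAt.eventually (Icc_mem_nhds h.lower h.upper)] with q h1 h2
  exact ⟨h1, h2⟩

theorem left_mem_curve (ht : |t - xc Φ s| < δ) (hσ : t ∈ side σ (xc Φ s)) : pt Φ t (f t) ∈ C :=
  (h.curve t ht _ (Ioo_subset_Icc_self (h.left_mem t ht))).2 ⟨le_of_lt hσ, Or.inl rfl⟩

theorem right_mem_curve (ht : |t - xc Φ s| < δ) (hσ : t ∈ side σ (xc Φ s)) : pt Φ t (g t) ∈ C :=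
  (h.curve t ht _ (Ioo_subset_Icc_self (h.right_mem t ht))).2 ⟨le_of_lt hσ, Or.inr rfl⟩

/-- A function which is locally constant on the curve has the same value on both branches. -/
theorem eventually_branches {w : P → ZMod 2} (hw : ∀ q ∈ C, ∀ᶠ r in 𝓝[C] q, w r = w q)
    (hs : s ∈ C) : ∀ᶠ t in 𝓝 (xc Φ s), t ∈ side σ (xc Φ s) →
      w (pt Φ t (f t)) = w s ∧ w (pt Φ t (g t)) = w s := by
  have hev := eventually_nhdsWithin_iff.1 (hw s hs)
  filter_upwards [eventually_pt (Φ := Φ) hev h.continuous_left.continuousAt h.left_eq,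
    eventually_pt (Φ := Φ) hev h.continuous_right.continuousAt h.right_eq, h.eventually_abs]
    with t h1 h2 ht hσ
  exact ⟨h1 (h.left_mem_curve ht hσ), h2 (h.right_mem_curve ht hσ)⟩

end FoldBox

namespace SplitBox

variable (h : SplitBox Φ D C s σ f g m n δ)
include h

theorem rel_across (ht : |t - xc Φ s| < δ) (hσ : t ∉ side σ (xc Φ s)) {y y' : ℝ}
    (hy : y ∈ Icc m n) (hy' : y' ∈ Icc m n) : Rel Φ D (pt Φ t y) (pt Φ t y') :=
  rel_pt_of_Icc (fun z hz => (h.domain t ht z hz).2 fun hz' => hσ hz'.1) hy hy'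

theorem rel_lower (ht : |t - xc Φ s| < δ) {y y' : ℝ} (hy : y ∈ Icc m (f t))
    (hy' : y' ∈ Icc m (f t)) : Rel Φ D (pt Φ t y) (pt Φ t y') :=
  rel_pt_of_Icc (fun z hz => (h.domain t ht z ⟨hz.1, hz.2.trans (h.left_mem t ht).2.le⟩).2
    fun hz' => (hz'.2.1.trans_le hz.2).false) hy hy'

theorem rel_upper (ht : |t - xc Φ s| < δ) {y y' : ℝ} (hy : y ∈ Icc (g t) n)
    (hy' : y' ∈ Icc (g t) n) : Rel Φ D (pt Φ t y) (pt Φ t y') :=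
  rel_pt_of_Icc (fun z hz => (h.domain t ht z ⟨(h.right_mem t ht).1.le.trans hz.1, hz.2⟩).2
    fun hz' => (hz.1.trans_lt hz'.2.2).false) hy hy'

theorem lower_mem (ht : |t - xc Φ s| < δ) : pt Φ t m ∈ D :=
  (h.rel_lower ht (left_mem_Icc.2 (h.left_mem t ht).1.le)
    (left_mem_Icc.2 (h.left_mem t ht).1.le)).left_mem

theorem upper_mem (ht : |t - xc Φ s| < δ) : pt Φ t n ∈ D :=
  (h.rel_upper ht (right_mem_Icc.2 (h.right_mem t ht).2.le)
    (right_mem_Icc.2 (h.right_mem t ht).2.le)).left_mem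

theorem isTop_left (ht : |t - xc Φ s| < δ) (hσ : t ∈ side σ (xc Φ s)) :
    IsTop Φ D (pt Φ t m) (pt Φ t (f t)) := by
  have hf := h.left_mem t ht
  have hg := h.right_mem t ht
  have hlt := h.lt t ht hσ
  refine isTop_of_frequently (h.rel_lower ht ⟨le_rfl, hf.1.le⟩ ⟨hf.1.le, le_rfl⟩) fun y hy => ?_
  rw [yc_pt] at hy ⊢
  rw [xc_pt]
  have h1 := lt_min hy hlt
  have h2 := min_le_left y (g t)
  have h3 := min_le_right y (g t)
  refine ⟨(f t + min y (g t)) / 2, by linarith, by linarith, ?_⟩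
  rw [h.domain t ht _ ⟨by linarith [hf.1], by linarith [hg.2]⟩, not_not]
  exact ⟨hσ, by linarith, by linarith⟩

theorem not_rel (ht : |t - xc Φ s| < δ) (hσ : t ∈ side σ (xc Φ s)) :
    ¬ Rel Φ D (pt Φ t m) (pt Φ t n) := fun hr => by
  have := (h.isTop_left ht hσ).2 _ hr
  rw [yc_pt, yc_pt] at this
  exact this.not_gt (h.left_mem t ht).2

theorem rel_center {y : ℝ} (hy : y ∈ Icc m n) : Rel Φ D s (pt Φ (xc Φ s) y) := by
  have := h.rel_across (t := xc Φ s) (by simpa using h.pos) (fun hs => ne_of_mem_side hs rfl)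
    ⟨h.lower.le, h.upper.le⟩ hy
  rwa [pt_xc_yc] at this

end SplitBox

namespace LeafBox

variable (h : LeafBox Φ D C s σ f g m n δ)
include h

theorem rel (ht : |t - xc Φ s| < δ) (hσ : 0 ≤ σ * (t - xc Φ s)) {y y' : ℝ} (hy : y ∈ Icc (f t) (g t))
    (hy' : y' ∈ Icc (f t) (g t)) : Rel Φ D (pt Φ t y) (pt Φ t y') :=
  rel_pt_of_Icc (fun z hz => (h.domain t ht z ⟨(h.left_mem t ht).1.le.trans hz.1,
    hz.2.trans (h.right_mem t ht).2.le⟩).2 ⟨hσ, hz⟩) hy hy'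

theorem isTop (ht : |t - xc Φ s| < δ) (hσ : 0 ≤ σ * (t - xc Φ s)) {y : ℝ}
    (hy : y ∈ Icc (f t) (g t)) : IsTop Φ D (pt Φ t y) (pt Φ t (g t)) := by
  have hg := h.right_mem t ht
  refine isTop_of_frequently (h.rel ht hσ hy ⟨hy.1.trans hy.2, le_rfl⟩) fun z hz => ?_
  rw [yc_pt] at hz ⊢
  rw [xc_pt]
  have h1 := lt_min hz hg.2
  have h2 := min_le_left z n
  have h3 := min_le_right z n
  refine ⟨(g t + min z n) / 2, by linarith, by linarith, fun hD => ?_⟩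
  have := ((h.domain t ht _ ⟨by linarith [hg.1], by linarith⟩).1 hD).2.2
  linarith

theorem isTop_flip (ht : |t - xc Φ s| < δ) (hσ : 0 ≤ σ * (t - xc Φ s)) {y : ℝ}
    (hy : y ∈ Icc (f t) (g t)) : IsTop (PoincareReeb.flip Φ) D (pt Φ t y) (pt Φ t (f t)) := by
  simpa using h.flip.isTop (t := t) (y := -y) ht hσ ⟨neg_le_neg hy.2, neg_le_neg hy.1⟩

/-- Both branches pass through `s`, which is thus the top and the bottom of its own vertical
interval. -/
theorem eq_of_rel {p : P} (hp : Rel Φ D s p) : p = s := by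
  have h0 : |xc Φ s - xc Φ s| < δ := by simpa using h.pos
  have hy : yc Φ s ∈ Icc (f (xc Φ s)) (g (xc Φ s)) := by rw [h.left_eq, h.right_eq]; simp
  have h1 := h.isTop h0 (by simp) hy
  have h2 := h.isTop_flip h0 (by simp) hy
  rw [pt_xc_yc, h.right_eq, pt_xc_yc] at h1
  rw [pt_xc_yc, h.left_eq, pt_xc_yc] at h2
  have h3 := h1.2 p hp
  have h4 := h2.2 p (rel_flip.2 hp)
  simp only [yc_flip] at h4
  exact ext_coords (Φ := Φ) hp.1.symm (by linarith)

theorem eventually_mem : ∀ᶠ q in 𝓝[D] s, |xc Φ q - xc Φ s| < δ ∧ 0 ≤ σ * (xc Φ q - xc Φ s) ∧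
    yc Φ q ∈ Icc (f (xc Φ q)) (g (xc Φ q)) := by
  filter_upwards [nhdsWithin_le_nhds h.eventually_near, self_mem_nhdsWithin] with q hq hqD
  have := (h.domain _ hq.1 _ hq.2).1 (by rwa [pt_xc_yc])
  exact ⟨hq.1, this⟩

end LeafBox

/-- The regular values. -/
def regVals (Φ : P ≃ₜ ℝ × ℝ) (S : Set P) : Set ℝ := {t | ∀ s ∈ S, xc Φ s ≠ t}

namespace Geometry

variable (h : Geometry Φ D C S)
include h

theorem eventually_regVals (t₀ : ℝ) : ∀ᶠ t in 𝓝 t₀, t ≠ t₀ → t ∈ regVals Φ S := by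
  have hfin : (xc Φ '' S \ {t₀}).Finite := (h.finite_critical.image _).sdiff
  filter_upwards [hfin.isClosed.isOpen_compl.mem_nhds (x := t₀) fun ht => ht.2 rfl] with t ht hne s hs hst
  exact ht ⟨⟨s, hs, hst⟩, hne⟩

omit h in
theorem _root_.PoincareReeb.not_rel_of_regVals {p : P} (hp : xc Φ p ∈ regVals Φ S) : ∀ s ∈ S, ¬ Rel Φ D p s :=
  fun s hs hr => hp s hs hr.1.symm

omit h in
theorem _root_.PoincareReeb.notMem_of_regVals {p : P} (hp : xc Φ p ∈ regVals Φ S) : p ∉ S := fun hs => hp p hs rfl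

theorem neBot_regVals (t₀ : ℝ) : (𝓝[regVals Φ S] t₀).NeBot := by
  have : 𝓝[side 1 t₀] t₀ ≤ 𝓝[regVals Φ S] t₀ := by
    refine le_inf nhdsWithin_le_nhds ?_
    rw [Filter.le_principal_iff]
    filter_upwards [nhdsWithin_le_nhds (h.eventually_regVals t₀), self_mem_nhdsWithin] with t ht hts
    exact ht (ne_of_mem_side hts)
  exact (neBot_side (Or.inl rfl) t₀).mono this

theorem exists_fold_box (hs : s ∈ S) : ∃ σ f g m n δ,
    LeafBox Φ D C s σ f g m n δ ∨ SplitBox Φ D C s σ f g m n δ := by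
  obtain ⟨σ, f, g, hl | hl⟩ := h.fold s hs
  · obtain ⟨m, n, δ, hb⟩ := hl.exists_leafBox
    exact ⟨σ, f, g, m, n, δ, Or.inl hb⟩
  · obtain ⟨m, n, δ, hb⟩ := hl.exists_splitBox
    exact ⟨σ, f, g, m, n, δ, Or.inr hb⟩

/-- The points of the curve over regular values are dense in the curve. -/
theorem neBot_regular_curve {q : P} (hq : q ∈ C) : (𝓝[C ∩ xc Φ ⁻¹' regVals Φ S] q).NeBot := by
  obtain ⟨k, τ, hk, hkq, hτ, hkC⟩ : ∃ (k : ℝ → ℝ) (τ : ℝ), Continuous k ∧ k (xc Φ q) = yc Φ q ∧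
      (τ = 1 ∨ τ = -1) ∧ ∀ᶠ t in 𝓝 (xc Φ q), t ∈ side τ (xc Φ q) → pt Φ t (k t) ∈ C := by
    by_cases hqS : q ∈ S
    · obtain ⟨σ, f, g, m, n, δ, hb⟩ := h.exists_fold_box hqS
      have hb : FoldBox Φ C q σ f g m n δ := hb.elim LeafBox.toFoldBox SplitBox.toFoldBox
      refine ⟨f, σ, hb.continuous_left, hb.left_eq, hb.sign, ?_⟩
      filter_upwards [hb.eventually_abs] with t ht hσ
      exact hb.left_mem_curve ht hσ
    · obtain ⟨s, f, hs, hf⟩ := h.graph q hq hqS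
      refine ⟨f, 1, hf.1, hf.2.1, Or.inl rfl, ?_⟩
      filter_upwards [eventually_pt (Φ := Φ) hf.2.2 hf.1.continuousAt hf.2.1] with t ht _
      exact ht.1.2 (by simp)
  have := neBot_side hτ (xc Φ q)
  have hlim : Filter.Tendsto (fun t => pt Φ t (k t)) (𝓝[side τ (xc Φ q)] (xc Φ q))
      (𝓝[C ∩ xc Φ ⁻¹' regVals Φ S] q) := by
    refine tendsto_nhdsWithin_iff.2 ⟨?_, ?_⟩
    · have hc : Continuous fun t => pt Φ t (k t) := Continuous.pt Φ continuous_id hk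
      have := hc.tendsto (xc Φ q)
      rw [hkq, pt_xc_yc] at this
      exact this.mono_left nhdsWithin_le_nhds
    · filter_upwards [nhdsWithin_le_nhds hkC, nhdsWithin_le_nhds (h.eventually_regVals _),
        self_mem_nhdsWithin] with t h1 h2 h3
      exact ⟨h1 h3, by rw [mem_preimage, xc_pt]; exact h2 (ne_of_mem_side h3)⟩
  exact hlim.neBot

/-- Near a vertical interval with a split, the vertical intervals pass through the upper or the
lower side of the adapted rectangle. -/
theorem eventually_rel_or (hs : s ∈ S) (hb : SplitBox Φ D C s σ f g m n δ) {p : P}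
    (hp : Rel Φ D p s) : ∀ᶠ q in 𝓝[D] p, |xc Φ q - xc Φ s| < δ ∧
      (Rel Φ D q (pt Φ (xc Φ q) n) ∨ Rel Φ D q (pt Φ (xc Φ q) m)) := by
  have habs : ∀ᶠ q in 𝓝[D] p, |xc Φ q - xc Φ s| < δ := by
    have h1 : ∀ᶠ t in 𝓝 (xc Φ p), |t - xc Φ s| < δ := by
      rw [hp.1]
      exact hb.eventually_abs
    exact nhdsWithin_le_nhds ((continuous_xc Φ).continuousAt.eventually h1)
  refine habs.and ?_
  have h0 : |xc Φ s - xc Φ s| < δ := by simpa using hb.pos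
  have hmn := hb.lower.trans hb.upper
  -- Genericity is used here: `s` is the only critical point on its line. From a point below `s` the
  -- way to the lower side of the rectangle is free of critical points, and likewise above.
  have hunique : ∀ y, pt Φ (xc Φ s) y ∈ S → y = yc Φ s := fun y hy => by
    have := h.injOn_critical hy hs (by simp)
    rw [← this, yc_pt]
  have hpS : p ≠ s → p ∉ S := fun hne hpS => hne (h.injOn_critical hpS hs hp.1)
  rcases lt_trichotomy (yc Φ p) (yc Φ s) with hlt | heq | hlt
  · refine (h.eventually_rel hp.left_mem (hpS fun he => hlt.ne (he ▸ rfl)) (m := m) ?_ ?_ ?_).mono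
      fun q hq => Or.inr hq
    · rw [hp.1]
      exact hp.trans (hb.rel_center ⟨le_rfl, hmn.le⟩)
    · rw [hp.1]
      exact hb.lower_notMem h0
    · intro y hy hyS
      rw [hp.1] at hyS
      rw [hunique y hyS, mem_uIcc] at hy
      have := hb.lower
      rcases hy with hy | hy <;> linarith [hy.1, hy.2]
  · obtain rfl : p = s := ext_coords (Φ := Φ) hp.1 heq
    filter_upwards [nhdsWithin_le_nhds hb.eventually_near, self_mem_nhdsWithin] with q hq hqD
    have hf := hb.left_mem _ hq.1
    have hg := hb.right_mem _ hq.1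
    by_cases hσ : xc Φ q ∈ side σ (xc Φ p)
    · rcases le_or_gt (yc Φ q) (f (xc Φ q)) with h1 | h1
      · have := hb.rel_lower hq.1 ⟨hq.2.1, h1⟩ (left_mem_Icc.2 hf.1.le)
        rw [pt_xc_yc] at this
        exact Or.inr this
      · have h2 : g (xc Φ q) ≤ yc Φ q := by
          by_contra! hcon
          exact (hb.domain _ hq.1 _ hq.2).1 (by rwa [pt_xc_yc]) ⟨hσ, h1, hcon⟩
        have := hb.rel_upper hq.1 ⟨h2, hq.2.2⟩ (right_mem_Icc.2 hg.2.le)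
        rw [pt_xc_yc] at this
        exact Or.inl this
    · have := hb.rel_across hq.1 hσ hq.2 (right_mem_Icc.2 hmn.le)
      rw [pt_xc_yc] at this
      exact Or.inl this
  · refine (h.eventually_rel hp.left_mem (hpS fun he => hlt.ne' (he ▸ rfl)) (m := n) ?_ ?_ ?_).mono
      fun q hq => Or.inl hq
    · rw [hp.1]
      exact hp.trans (hb.rel_center ⟨hmn.le, le_rfl⟩)
    · rw [hp.1]
      exact hb.upper_notMem h0
    · intro y hy hyS
      rw [hp.1] at hyS
      rw [hunique y hyS, mem_uIcc] at hy
      have := hb.upper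
      rcases hy with hy | hy <;> linarith [hy.1, hy.2]

/-- The top values in a split rectangle. -/
theorem eventually_topVal_upper (hs : s ∈ S) (hb : SplitBox Φ D C s σ f g m n δ) {w : P → ZMod 2}
    (hw : ∀ q ∈ C, ∀ᶠ r in 𝓝[C] q, w r = w q) :
    ∀ᶠ t in 𝓝 (xc Φ s), topVal Φ D w (pt Φ t n) = topVal Φ D w s := by
  have h0 : |xc Φ s - xc Φ s| < δ := by simpa using hb.pos
  rw [topVal_congr w (hb.rel_center (right_mem_Icc.2 (hb.lower.trans hb.upper).le))]
  refine h.eventually_topVal hw (hb.upper_mem h0) (hb.upper_notMem h0) fun y hy _ hyS => ?_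
  have hup := hb.upper
  rw [← h.injOn_critical hyS hs (by simp), yc_pt] at hup
  exact (hup.trans_le hy).false

/-- On the forked side the lower interval ends on the lower branch, where `w` still has its value at
the fold. -/
theorem eventually_topVal_lower (hs : s ∈ S) (hb : SplitBox Φ D C s σ f g m n δ) {w : P → ZMod 2}
    (hw : ∀ q ∈ C, ∀ᶠ r in 𝓝[C] q, w r = w q) :
    ∀ᶠ t in 𝓝 (xc Φ s), t ∈ side σ (xc Φ s) → topVal Φ D w (pt Φ t m) = w s := by
  filter_upwards [hb.eventually_branches hw (h.critical_subset hs), hb.eventually_abs] with t h1 h2 hσ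
  rw [topVal_of_isTop w (hb.isTop_left h2 hσ), (h1 hσ).1]

end Geometry

end

end PoincareReeb

namespace PoincareReeb

open Set Topology

/-! ### The kernel of the end sum: functions that come from the graph. -/

section

variable {P : Type*} [TopologicalSpace P] {Φ : P ≃ₜ ℝ × ℝ} {D C S G : Set P} {κ : P → P} {M : ℝ}

theorem topVal_add (w w' : P → ZMod 2) (p : P) :
    topVal Φ D (w + w') p = topVal Φ D w p + topVal Φ D w' p := by
  by_cases hex : ∃ q, IsTop Φ D p q
  · obtain ⟨q, hq⟩ := hex
    simp [topVal_of_isTop _ hq]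
  · simp [topVal_of_not_exists _ hex]

theorem topVal_smul (c : ZMod 2) (w : P → ZMod 2) (p : P) :
    topVal Φ D (c • w) p = c * topVal Φ D w p := by
  by_cases hex : ∃ q, IsTop Φ D p q
  · obtain ⟨q, hq⟩ := hex
    simp [topVal_of_isTop _ hq]
  · simp [topVal_of_not_exists _ hex]

/-- The sum of the values at both ends of the vertical interval through `p`. -/
noncomputable def endSum (Φ : P ≃ₜ ℝ × ℝ) (D : Set P) (w : P → ZMod 2) (p : P) : ZMod 2 :=
  topVal Φ D w p + topVal (flip Φ) D w p

theorem endSum_congr (w : P → ZMod 2) {p p' : P} (h : Rel Φ D p p') :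
    endSum Φ D w p = endSum Φ D w p' := by
  rw [endSum, endSum, topVal_congr w h, topVal_congr w (rel_flip.2 h)]

theorem Collapse.exists_edge (hκ : Collapse Φ D G κ) {p : P} (hp : p ∈ D)
    (hpR : xc Φ p ∈ regVals Φ S) : κ p ∈ G \ crit Φ D G S :=
  hκ.mem_diff_crit hp (not_rel_of_regVals hpR)

namespace Geometry

variable (h : Geometry Φ D C S)
include h

/-- A vertical interval which is unbounded above can be pushed to infinity. -/
theorem eq_zero_of_ray (hκ : Collapse Φ D G κ) {y : P → ZMod 2} (hy : y ∈ locConst Φ G M) {p : P}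
    (hray : ∀ z, yc Φ p ≤ z → pt Φ (xc Φ p) z ∈ D) : y (κ p) = 0 := by
  -- Above `B` there is no curve over this interval. A horizontal path at that height stays in `D`
  -- and joins the vertical interval to abscissas at least `M`, where `y` vanishes.
  obtain ⟨B, hB⟩ := h.bounded (xc Φ p) (max (xc Φ p) M)
  set b := max (yc Φ p) B with hb
  have hpre : IsPreconnected ((fun t => pt Φ t b) '' Icc (xc Φ p) (max (xc Φ p) M)) :=
    isPreconnected_Icc.image _ (by fun_prop)
  have hpb := hray b (le_max_left _ _)
  have hmem : ∀ t ∈ Icc (xc Φ p) (max (xc Φ p) M), pt Φ t b ∈ D := by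
    have hdis : Disjoint ((fun t => pt Φ t b) '' Icc (xc Φ p) (max (xc Φ p) M)) C := by
      rw [disjoint_left]
      rintro _ ⟨t, ht, rfl⟩ htC
      have := (abs_lt.1 (hB t ht b htC)).2
      exact (this.trans_le (le_max_right _ _)).false
    rcases subset_interior_or_subset_compl h.isClosed h.curve_eq hpre hdis with h1 | h1
    · exact fun t ht => interior_subset (h1 ⟨t, ht, rfl⟩)
    · exact absurd hpb (h1 ⟨_, left_mem_Icc.2 (le_max_left _ _), rfl⟩)
  have hmaps : (fun t => pt Φ t b) '' Icc (xc Φ p) (max (xc Φ p) M) ⊆ D := by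
    rintro _ ⟨t, ht, rfl⟩
    exact hmem t ht
  have hr : Rel Φ D p (pt Φ (xc Φ p) b) := rel_pt_right.2 ⟨rfl, fun z hz => hray z (by
    rw [uIcc_of_le (le_max_left _ _)] at hz
    exact hz.1)⟩
  have hend := right_mem_Icc.2 (le_max_left (xc Φ p) M)
  rw [hκ.eq_of_rel _ _ hr, locConst_eq hy (hpre.image κ (hκ.continuousOn.mono hmaps))
    (by rintro _ ⟨q, hq, rfl⟩; exact hκ.mem (hmaps hq))
    ⟨_, ⟨_, left_mem_Icc.2 (le_max_left _ _), rfl⟩, rfl⟩ ⟨_, ⟨_, hend, rfl⟩, rfl⟩]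
  refine hy.2.2 _ (hκ.mem (hmem _ hend)) ?_
  rw [hκ.xc_eq (hmem _ hend), xc_pt]
  exact (le_max_right _ _).trans (le_abs_self _)

open Classical in
/-- A locally constant function on the graph, carried over to the curve. -/
noncomputable def lift (hκ : Collapse Φ D G κ) : locConst Φ G M →ₗ[ZMod 2] locConst Φ C M where
  toFun y := ⟨fun q => if q ∈ C then y.1 (κ q) else 0, by
    refine ⟨fun p hp => if_neg hp, fun p hp => ?_, fun p hp hpM => ?_⟩
    · have hpD := h.curve_subset hp
      have hlim : Filter.Tendsto κ (𝓝[C] p) (𝓝[G] (κ p)) :=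
        tendsto_nhdsWithin_iff.2 ⟨(hκ.continuousOn p hpD).mono h.curve_subset,
          eventually_nhdsWithin_of_forall fun q hq => hκ.mem (h.curve_subset hq)⟩
      filter_upwards [hlim.eventually (y.2.2.1 _ (hκ.mem hpD)), self_mem_nhdsWithin] with q hq hqC
      rw [if_pos hp, if_pos hqC, hq]
    · have hpD := h.curve_subset hp
      refine (if_pos hp).trans ?_
      exact y.2.2.2 _ (hκ.mem hpD) (by rwa [hκ.xc_eq hpD])⟩
  map_add' y y' := by
    ext q
    by_cases hq : q ∈ C <;> simp [hq]
  map_smul' c y := by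
    ext q
    by_cases hq : q ∈ C <;> simp [hq]

/-- If there is a top, the lift takes there the value of `y` on the whole interval. Without a top
the default value `0` is the right one, by `eq_zero_of_ray`. -/
theorem topVal_lift (hκ : Collapse Φ D G κ) (y : locConst Φ G M) {p : P} (hp : p ∈ D) :
    topVal Φ D (h.lift hκ y).1 p = y.1 (κ p) := by
  rcases exists_isTop_or (Φ := Φ) h.isClosed hp with ⟨q, hq⟩ | hray
  · rw [topVal_of_isTop _ hq]
    exact (if_pos (h.mem_curve_of_isTop hq)).trans (by rw [hκ.eq_of_rel _ _ hq.1])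
  · rw [topVal_of_not_exists _ (not_exists_isTop hray), h.eq_zero_of_ray hκ y.2 hray]

theorem topVal_flip_lift (hκ : Collapse Φ D G κ) (y : locConst Φ G M) {p : P} (hp : p ∈ D) :
    topVal (PoincareReeb.flip Φ) D (h.lift hκ y).1 p = y.1 (κ p) :=
  h.flip.topVal_lift (M := M) hκ.flip ⟨y.1, y.2⟩ hp

theorem injective_lift (hκ : Collapse Φ D G κ) : Function.Injective (h.lift (M := M) hκ) := by
  intro y y' hyy
  ext g
  by_cases hg : g ∈ G
  · have h1 := h.topVal_lift hκ y (hκ.subset hg)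
    rw [hyy, h.topVal_lift hκ y' (hκ.subset hg), hκ.eq_self hg] at h1
    exact h1.symm
  · rw [y.2.1 g hg, y'.2.1 g hg]

/-- If the values at both ends agree for all regular vertical intervals, the value at the top is
locally constant. -/
theorem eventually_topVal_eq {w : P → ZMod 2} (hw : ∀ q ∈ C, ∀ᶠ r in 𝓝[C] q, w r = w q)
    (heq : ∀ p ∈ D, xc Φ p ∈ regVals Φ S → topVal Φ D w p = topVal (PoincareReeb.flip Φ) D w p)
    {p : P} (hp : p ∈ D) : ∀ᶠ q in 𝓝[D] p, topVal Φ D w q = topVal Φ D w p := by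
  by_cases hreg : ∀ s ∈ S, ¬ Rel Φ D p s
  · exact h.eventually_topVal_of_regular hw hp hreg
  push Not at hreg
  obtain ⟨s, hs, hps⟩ := hreg
  have hxc : ∀ {Q : ℝ → Prop}, (∀ᶠ t in 𝓝 (xc Φ s), Q t) → ∀ᶠ q in 𝓝[D] p, Q (xc Φ q) := by
    intro Q hQ
    rw [← hps.1] at hQ
    exact nhdsWithin_le_nhds ((continuous_xc Φ).continuousAt.eventually hQ)
  obtain ⟨σ, f, g, m, n, δ, hb | hb⟩ := h.exists_fold_box hs
  · obtain rfl := hb.eq_of_rel hps.symm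
    have htop : topVal Φ D w p = w p := by
      have := hb.isTop (t := xc Φ p) (y := yc Φ p) (by simpa using hb.pos) (by simp)
        (by rw [hb.left_eq, hb.right_eq]; simp)
      rw [hb.right_eq, pt_xc_yc] at this
      exact topVal_of_isTop w this
    filter_upwards [hb.eventually_mem, hxc (hb.eventually_branches hw (h.critical_subset hs)),
      hxc (h.eventually_regVals _), self_mem_nhdsWithin] with q hq hqb hqR hqD
    have h1 := hb.isTop hq.1 hq.2.1 hq.2.2
    rw [pt_xc_yc] at h1
    rw [htop, topVal_of_isTop w h1]
    by_cases hqx : xc Φ q = xc Φ p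
    · rw [hqx, hb.right_eq, pt_xc_yc]
    · refine (hqb ?_).2
      refine (mem_side_or hb.sign hqx).resolve_right fun hσ => ?_
      have h2 : 0 < -σ * (xc Φ q - xc Φ p) := hσ
      linarith [hq.2.1]
  · filter_upwards [h.eventually_rel_or hs hb hps, hxc (h.eventually_topVal_upper hs hb hw),
      hxc (h.eventually_topVal_lower hs hb hw), hxc (h.flip.eventually_topVal_lower hs hb.flip hw),
      hxc (h.eventually_regVals _)] with q ⟨hq, hqr⟩ hup hlow hlow' hR
    rw [topVal_congr w hps, ← hup]
    rcases hqr with hqr | hqr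
    · exact topVal_congr w hqr
    -- On the forked side, the top of the lower interval and the bottom of the upper one are on the
    -- two branches, where `w` equals `w s`. The hypothesis on the upper interval turns its bottom
    -- value into its top value.
    · by_cases hσ : xc Φ q ∈ side σ (xc Φ s)
      · have h1 := hlow' hσ
        rw [pt_flip, neg_neg] at h1
        rw [topVal_congr w hqr, hlow hσ, heq _ (hb.upper_mem hq), h1]
        rw [xc_pt]
        exact hR (ne_of_mem_side hσ)
      · exact topVal_congr w (hqr.trans (hb.rel_across hq hσ
          (left_mem_Icc.2 (hb.lower.trans hb.upper).le)
          (right_mem_Icc.2 (hb.lower.trans hb.upper).le)))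

/-- Over a regular abscissa a curve point is a top or a bottom, and both ends have the same value.
Regular points are dense in the curve and both sides are locally constant there. -/
theorem topVal_eq_self {w : P → ZMod 2} (hw : ∀ q ∈ C, ∀ᶠ r in 𝓝[C] q, w r = w q)
    (heq : ∀ p ∈ D, xc Φ p ∈ regVals Φ S → topVal Φ D w p = topVal (PoincareReeb.flip Φ) D w p)
    {q : P} (hq : q ∈ C) : topVal Φ D w q = w q := by
  have := h.neBot_regular_curve hq
  have h1 : ∀ᶠ r in 𝓝[C] q, topVal Φ D w r = topVal Φ D w q :=
    nhdsWithin_mono q h.curve_subset (h.eventually_topVal_eq hw heq (h.curve_subset hq))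
  have h2 := (h1.and (hw q hq)).filter_mono (nhdsWithin_mono q
    (inter_subset_left (s := C) (t := xc Φ ⁻¹' regVals Φ S)))
  obtain ⟨r, ⟨hr1, hr2⟩, hrC, hrR⟩ := (h2.and self_mem_nhdsWithin).exists
  rw [← hr1, ← hr2]
  rcases h.isTop_or hrC (notMem_of_regVals hrR) with h3 | h3
  · exact topVal_of_isTop w h3
  · rw [heq r (h.curve_subset hrC) hrR]
    exact topVal_of_isTop w h3

/-- The functions on the curve with equal values at both ends come from the graph. -/
theorem exists_lift_eq (hκ : Collapse Φ D G κ) (w : locConst Φ C M)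
    (heq : ∀ p ∈ D, xc Φ p ∈ regVals Φ S →
      topVal Φ D w.1 p = topVal (PoincareReeb.flip Φ) D w.1 p) : ∃ y, h.lift hκ y = w := by
  classical
  have hw := w.2.2.1
  refine ⟨⟨fun g => if g ∈ G then topVal Φ D w.1 g else 0, fun p hp => if_neg hp, ?_, ?_⟩, ?_⟩
  · intro g hg
    filter_upwards [nhdsWithin_mono _ hκ.subset (h.eventually_topVal_eq hw heq (hκ.subset hg)),
      self_mem_nhdsWithin] with q hq hqG
    rw [if_pos hg, if_pos hqG, hq]
  · intro g hg hgM
    refine (if_pos hg).trans ?_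
    by_cases hex : ∃ q, IsTop Φ D g q
    · obtain ⟨q, hq⟩ := hex
      rw [topVal_of_isTop _ hq]
      exact w.2.2.2 q (h.mem_curve_of_isTop hq) (by rwa [← hq.1.1])
    · exact topVal_of_not_exists _ hex
  · ext q
    by_cases hq : q ∈ C
    · have hqD := h.curve_subset hq
      refine (if_pos hq).trans ((if_pos (hκ.mem hqD)).trans ?_)
      rw [← topVal_congr _ (hκ.rel q hqD), h.topVal_eq_self hw heq hq]
    · exact (if_neg hq).trans (w.2.1 q hq).symm

/-- The values on the open edges of the sum of the values at both ends. -/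
noncomputable def edgeSum (_ : Geometry Φ D C S) (G : Set P) (M : ℝ) :
    locConst Φ C M →ₗ[ZMod 2] (openEdges (xc Φ) D G → ZMod 2) where
  toFun w E := endSum Φ D w.1 E.2.choose
  map_add' w w' := by
    ext E
    simp only [endSum, Submodule.coe_add, topVal_add, Pi.add_apply]
    ring
  map_smul' c w := by
    ext E
    simp only [endSum, Submodule.coe_smul, topVal_smul, Pi.smul_apply, RingHom.id_apply, smul_eq_mul]
    ring

theorem endSum_eq_of_mem_edge (hκ : Collapse Φ D G κ) {w : P → ZMod 2}
    (hw : ∀ q ∈ C, ∀ᶠ r in 𝓝[C] q, w r = w q) {g g' : P}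
    (hg : g' ∈ connectedComponentIn (G \ crit Φ D G S) g) : endSum Φ D w g = endSum Φ D w g' := by
  rw [endSum, endSum, h.topVal_eq_of_mem_edge hκ hw hg,
    h.flip.topVal_eq_of_mem_edge hκ.flip hw (by rwa [crit_flip])]

/-- The end sum is constant along an edge, so the point chosen on the edge in the definition can be
replaced by any point of `D` collapsed into it. -/
theorem edgeSum_apply (hκ : Collapse Φ D G κ) (hV : vertices (xc Φ) D G = crit Φ D G S)
    (w : locConst Φ C M) (E : openEdges (xc Φ) D G) {p : P} (hp : p ∈ D) (hpE : κ p ∈ E.1) :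
    h.edgeSum G M w E = endSum Φ D w.1 p := by
  have hE := E.2.choose_spec
  change endSum Φ D w.1 E.2.choose = _
  generalize E.2.choose = g at hE
  rw [hV] at hE
  rw [endSum_congr _ (hκ.rel p hp)]
  refine h.endSum_eq_of_mem_edge hκ w.2.2.1 ?_
  rwa [hE.2]

/-- The end sum of a lift is twice a value, hence zero. Conversely, a vanishing end sum means equal
values at both ends, as required by `exists_lift_eq`. -/
theorem range_lift (hκ : Collapse Φ D G κ) (hV : vertices (xc Φ) D G = crit Φ D G S) :
    LinearMap.range (h.lift (M := M) hκ) = LinearMap.ker (h.edgeSum G M) := by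
  ext w
  rw [LinearMap.mem_range, LinearMap.mem_ker]
  constructor
  · rintro ⟨y, rfl⟩
    ext E
    have hE := E.2.choose_spec.1
    have hD := hκ.subset hE.1
    change endSum Φ D _ E.2.choose = 0
    rw [endSum, h.topVal_lift hκ y hD, h.topVal_flip_lift hκ y hD]
    exact CharTwo.add_self_eq_zero _
  · intro hw
    refine h.exists_lift_eq hκ w fun p hp hpR => ?_
    have hedge := hκ.exists_edge hp hpR
    have hE : connectedComponentIn (G \ crit Φ D G S) (κ p) ∈ openEdges (xc Φ) D G := by
      rw [openEdges, hV]
      exact component_mem_components hedge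
    have := h.edgeSum_apply hκ hV w ⟨_, hE⟩ hp (mem_connectedComponentIn hedge)
    rw [hw] at this
    exact CharTwo.add_eq_zero.1 this.symm

end Geometry

end

end PoincareReeb

namespace PoincareReeb

open Set Topology

/-! ### The edges at a vertex of the graph. -/

section

variable {P : Type*} [TopologicalSpace P] {Φ : P ≃ₜ ℝ × ℝ} {D C S G : Set P} {κ : P → P}
variable {s : P} {σ τ t₀ : ℝ} {f g k : ℝ → ℝ} {m n δ : ℝ}

theorem components_eq_of_mem {X E E' : Set P} (hE : E ∈ components X) (hE' : E' ∈ components X)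
    {p : P} (hp : p ∈ E) (hp' : p ∈ E') : E = E' := by
  rw [← component_eq hE hp, component_eq hE' hp']

namespace Geometry

variable (h : Geometry Φ D C S)
include h

/-- A one-sided path of vertical intervals ending at a critical one lies on one open edge. -/
theorem exists_branch (hκ : Collapse Φ D G κ) (hτ : τ = 1 ∨ τ = -1) (hk : Continuous k)
    (hD : ∀ᶠ t in 𝓝 t₀, t ∈ side τ t₀ → pt Φ t (k t) ∈ D) (hD₀ : pt Φ t₀ (k t₀) ∈ D) :
    ∃ E ∈ components (G \ crit Φ D G S), κ (pt Φ t₀ (k t₀)) ∈ closure E ∧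
      ∀ᶠ t in 𝓝 t₀, t ∈ side τ t₀ → κ (pt Φ t (k t)) ∈ E := by
  obtain ⟨δ, hδ, hball⟩ := Metric.eventually_nhds_iff.1 (hD.and (h.eventually_regVals t₀))
  set J := side τ t₀ ∩ {t | |t - t₀| < δ} with hJ
  have hJD : ∀ t ∈ J, pt Φ t (k t) ∈ D := fun t ht => (hball ht.2).1 ht.1
  have hJR : ∀ t ∈ J, κ (pt Φ t (k t)) ∈ G \ crit Φ D G S := fun t ht =>
    hκ.exists_edge (hJD t ht) (by rw [xc_pt]; exact (hball ht.2).2 (ne_of_mem_side ht.1))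
  have hJn : J ∈ 𝓝[side τ t₀] t₀ :=
    Filter.inter_mem self_mem_nhdsWithin (nhdsWithin_le_nhds (Metric.ball_mem_nhds t₀ hδ))
  have := neBot_side hτ t₀
  have hkc : Continuous fun t => pt Φ t (k t) := Continuous.pt Φ continuous_id hk
  obtain ⟨t₁, ht₁⟩ := Filter.nonempty_of_mem hJn
  have hcomp : ∀ t ∈ J, κ (pt Φ t (k t)) ∈
      connectedComponentIn (G \ crit Φ D G S) (κ (pt Φ t₁ (k t₁))) := by
    have hpre : IsPreconnected ((fun t => κ (pt Φ t (k t))) '' J) :=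
      (isPreconnected_side_inter_ball hτ t₀ δ).image _
        (hκ.continuousOn.comp hkc.continuousOn fun t ht => hJD t ht)
    have hsub := hpre.subset_connectedComponentIn (F := G \ crit Φ D G S)
      (x := κ (pt Φ t₁ (k t₁))) ⟨t₁, ht₁, rfl⟩ (by rintro _ ⟨t, ht, rfl⟩; exact hJR t ht)
    exact fun t ht => hsub ⟨t, ht, rfl⟩
  refine ⟨_, component_mem_components (hJR t₁ ht₁), ?_, ?_⟩
  · have hlim : Filter.Tendsto (fun t => κ (pt Φ t (k t))) (𝓝[side τ t₀] t₀)
        (𝓝 (κ (pt Φ t₀ (k t₀)))) := by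
      refine (hκ.continuousOn _ hD₀).tendsto.comp (tendsto_nhdsWithin_iff.2
        ⟨(hkc.tendsto t₀).mono_left nhdsWithin_le_nhds, ?_⟩)
      filter_upwards [hJn] with t ht using hJD t ht
    refine mem_closure_of_tendsto hlim ?_
    filter_upwards [hJn] with t ht using hcomp t ht
  · filter_upwards [Metric.ball_mem_nhds t₀ hδ] with t ht hts
    exact hcomp t ⟨hts, ht⟩

/-- Paths on both sides of a critical vertical interval lie on different edges. -/
theorem branch_ne (hκ : Collapse Φ D G κ) (hτ : τ = 1 ∨ τ = -1) {k' : ℝ → ℝ} (hk : Continuous k)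
    (hD : ∀ᶠ t in 𝓝 t₀, t ∈ side τ t₀ → pt Φ t (k t) ∈ D) (hD₀ : pt Φ t₀ (k t₀) ∈ D)
    (hcrit : κ (pt Φ t₀ (k t₀)) ∈ crit Φ D G S)
    (hD' : ∀ᶠ t in 𝓝 t₀, t ∈ side (-τ) t₀ → pt Φ t (k' t) ∈ D)
    {E : Set P} (hE : E ∈ components (G \ crit Φ D G S))
    (hE₁ : ∀ᶠ t in 𝓝 t₀, t ∈ side τ t₀ → κ (pt Φ t (k t)) ∈ E)
    (hE₂ : ∀ᶠ t in 𝓝 t₀, t ∈ side (-τ) t₀ → κ (pt Φ t (k' t)) ∈ E) : False := by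
  have := t2Space_of_chart Φ
  have hn₁ := neBot_side hτ t₀
  have hn₂ := neBot_side (τ := -τ) (by rcases hτ with rfl | rfl <;> simp) t₀
  obtain ⟨q, hq, rfl⟩ := hE
  obtain ⟨c, hc, hcE, hcp⟩ := (h.graph_fibredCurve hκ).exists_section q
  set E := connectedComponentIn (G \ crit Φ D G S) q with hEdef
  have hord : (xc Φ '' E).OrdConnected :=
    (isPreconnected_connectedComponentIn.image _ (continuous_xc Φ).continuousOn).ordConnected
  -- An edge containing paths on both sides of `t₀` also lies over `t₀`. By continuity of its
  -- section, its point there is the limit of the paths, which is a vertex and so not on an edge.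
  have ht₀ : t₀ ∈ xc Φ '' E := by
    obtain ⟨t₁, ⟨h1, h1'⟩, ht₁⟩ := ((hE₁.and hD).filter_mono nhdsWithin_le_nhds |>.and
      (self_mem_nhdsWithin (s := side τ t₀))).exists
    obtain ⟨t₂, ⟨h2, h2'⟩, ht₂⟩ := ((hE₂.and hD').filter_mono nhdsWithin_le_nhds |>.and
      (self_mem_nhdsWithin (s := side (-τ) t₀))).exists
    have m1 : t₁ ∈ xc Φ '' E := ⟨_, h1 ht₁, by rw [hκ.xc_eq (h1' ht₁), xc_pt]⟩
    have m2 : t₂ ∈ xc Φ '' E := ⟨_, h2 ht₂, by rw [hκ.xc_eq (h2' ht₂), xc_pt]⟩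
    refine hord.uIcc_subset m1 m2 (mem_uIcc.2 ?_)
    have h3 : 0 < τ * (t₁ - t₀) := ht₁
    have h4 : 0 < -τ * (t₂ - t₀) := ht₂
    rcases hτ with rfl | rfl
    · exact Or.inr ⟨by linarith, by linarith⟩
    · exact Or.inl ⟨by linarith, by linarith⟩
  have hlim₁ : Filter.Tendsto c (𝓝[side τ t₀] t₀) (𝓝 (c t₀)) :=
    ((hc.continuousAt (((h.graph_fibredCurve hκ).isOpen_image q).mem_nhds ht₀)).tendsto).mono_left
      nhdsWithin_le_nhds
  have hkc : Continuous fun t => pt Φ t (k t) := Continuous.pt Φ continuous_id hk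
  have hlim₂ : Filter.Tendsto c (𝓝[side τ t₀] t₀) (𝓝 (κ (pt Φ t₀ (k t₀)))) := by
    have : Filter.Tendsto (fun t => κ (pt Φ t (k t))) (𝓝[side τ t₀] t₀)
        (𝓝 (κ (pt Φ t₀ (k t₀)))) := by
      refine (hκ.continuousOn _ hD₀).tendsto.comp (tendsto_nhdsWithin_iff.2
        ⟨(hkc.tendsto t₀).mono_left nhdsWithin_le_nhds, ?_⟩)
      filter_upwards [nhdsWithin_le_nhds hD, self_mem_nhdsWithin] with t ht hts using ht hts
    refine this.congr' ?_
    filter_upwards [nhdsWithin_le_nhds hE₁, nhdsWithin_le_nhds hD, self_mem_nhdsWithin]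
      with t h1 h2 hts
    rw [← hcp _ (h1 hts), hκ.xc_eq (h2 hts), xc_pt]
  have heq := tendsto_nhds_unique hlim₁ hlim₂
  have hmem := (connectedComponentIn_subset _ _ (hcE t₀ ht₀).1).2
  rw [heq] at hmem
  exact hmem hcrit

/-- This supplies a point of the edge so close to the vertex that local information identifies the
edge with one of the known branches. -/
theorem eventually_of_mem_closure (hκ : Collapse Φ D G κ) (hs : s ∈ S) {E : Set P}
    (hE : E ∈ components (G \ crit Φ D G S)) (hv : κ s ∈ closure E) {Q : P → Prop} {R : ℝ → Prop}
    (hQ : ∀ᶠ q in 𝓝[D] (κ s), Q q) (hR : ∀ᶠ t in 𝓝 (xc Φ s), R t) :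
    ∃ q ∈ E, q ∈ D ∧ κ q = q ∧ (∀ s ∈ S, ¬ Rel Φ D q s) ∧ Q q ∧ R (xc Φ q) := by
  have hsD := h.critical_subset_domain hs
  have hR' : ∀ᶠ q in 𝓝 (κ s), R (xc Φ q) := by
    rw [← hκ.xc_eq hsD] at hR
    exact (continuous_xc Φ).continuousAt.eventually hR
  obtain ⟨q, hqE, hq1, hq2⟩ := ((mem_closure_iff_frequently.1 hv).and_eventually
    ((eventually_nhdsWithin_iff.1 hQ).and hR')).exists
  have hqG := component_subset hE hqE
  have hqD := hκ.subset hqG.1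
  exact ⟨q, hqE, hqD, hκ.eq_self hqG.1, rel_crit_of_notMem hqG, hq1 hqD, hq2⟩

/-- The edge at a leaf. -/
theorem exists_leaf_edge (hκ : Collapse Φ D G κ) (hs : s ∈ S) (hb : LeafBox Φ D C s σ f g m n δ) :
    ∃ E₀ ∈ components (G \ crit Φ D G S),
      (∀ᶠ t in 𝓝 (xc Φ s), t ∈ side σ (xc Φ s) → κ (pt Φ t (g t)) ∈ E₀) ∧
      ∀ E ∈ components (G \ crit Φ D G S), κ s ∈ closure E ↔ E = E₀ := by
  have hsD := h.critical_subset_domain hs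
  obtain ⟨E₀, hE₀, hcl, hev⟩ := h.exists_branch (t₀ := xc Φ s) (k := g) hκ hb.sign
    hb.continuous_right (by
      filter_upwards [hb.eventually_abs] with t ht hσ
      exact h.curve_subset (hb.right_mem_curve ht hσ)) (by rwa [hb.right_eq, pt_xc_yc])
  rw [hb.right_eq, pt_xc_yc] at hcl
  refine ⟨E₀, hE₀, hev, fun E hE => ⟨fun hv => ?_, ?_⟩⟩
  · have hks : κ s = s := hb.eq_of_rel (hκ.rel s hsD)
    have hnhds : 𝓝[D] (κ s) = 𝓝[D] s := by rw [hks]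
    have hnear := hb.eventually_mem
    rw [← hnhds] at hnear
    obtain ⟨q, hqE, hqD, hκq, hqS, ⟨h1, h2, h3⟩, h4⟩ :=
      h.eventually_of_mem_closure hκ hs hE hv hnear hev
    have hσ : xc Φ q ∈ side σ (xc Φ s) := by
      refine (mem_side_or hb.sign fun hx => hqS s hs ?_).resolve_right fun hσ => ?_
      · rw [hx, hb.left_eq, hb.right_eq, Icc_self] at h3
        rw [ext_coords (Φ := Φ) hx h3]
        exact Rel.refl hsD
      · have : 0 < -σ * (xc Φ q - xc Φ s) := hσ
        linarith
    have hr := hb.rel h1 h2 h3 (right_mem_Icc.2 (h3.1.trans h3.2))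
    rw [pt_xc_yc] at hr
    have := h4 hσ
    rw [← hκ.eq_of_rel _ _ hr, hκq] at this
    exact components_eq_of_mem hE hE₀ hqE this
  · rintro rfl
    exact hcl

/-- The three edges at a split. -/
theorem exists_split_edges (hκ : Collapse Φ D G κ) (hs : s ∈ S)
    (hb : SplitBox Φ D C s σ f g m n δ) :
    ∃ E₁ ∈ components (G \ crit Φ D G S), ∃ E₂ ∈ components (G \ crit Φ D G S),
    ∃ E₃ ∈ components (G \ crit Φ D G S), E₁ ≠ E₂ ∧ E₁ ≠ E₃ ∧ E₂ ≠ E₃ ∧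
      (∀ᶠ t in 𝓝 (xc Φ s), t ∈ side (-σ) (xc Φ s) → κ (pt Φ t m) ∈ E₁) ∧
      (∀ᶠ t in 𝓝 (xc Φ s), t ∈ side σ (xc Φ s) → κ (pt Φ t n) ∈ E₂) ∧
      (∀ᶠ t in 𝓝 (xc Φ s), t ∈ side σ (xc Φ s) → κ (pt Φ t m) ∈ E₃) ∧
      ∀ E ∈ components (G \ crit Φ D G S), κ s ∈ closure E ↔ E = E₁ ∨ E = E₂ ∨ E = E₃ := by
  have hsD := h.critical_subset_domain hs
  have hmn := (hb.lower.trans hb.upper).le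
  have h0 : |xc Φ s - xc Φ s| < δ := by simpa using hb.pos
  have hm₀ := hb.lower_mem h0
  have hn₀ := hb.upper_mem h0
  have hκm : κ (pt Φ (xc Φ s) m) = κ s := (hκ.eq_of_rel _ _ (hb.rel_center (left_mem_Icc.2 hmn))).symm
  have hκn : κ (pt Φ (xc Φ s) n) = κ s :=
    (hκ.eq_of_rel _ _ (hb.rel_center (right_mem_Icc.2 hmn))).symm
  have hcrit : κ s ∈ crit Φ D G S := by
    rw [hκ.crit_eq h.critical_subset_domain]
    exact ⟨s, hs, rfl⟩
  have hm : ∀ τ, ∀ᶠ t in 𝓝 (xc Φ s), t ∈ side τ (xc Φ s) → pt Φ t m ∈ D := fun τ => by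
    filter_upwards [hb.eventually_abs] with t ht _ using hb.lower_mem ht
  have hn : ∀ τ, ∀ᶠ t in 𝓝 (xc Φ s), t ∈ side τ (xc Φ s) → pt Φ t n ∈ D := fun τ => by
    filter_upwards [hb.eventually_abs] with t ht _ using hb.upper_mem ht
  obtain ⟨E₁, hE₁, hcl₁, hev₁⟩ := h.exists_branch (t₀ := xc Φ s) (k := fun _ => m) (τ := -σ) hκ
    (by rcases hb.sign with rfl | rfl <;> simp) continuous_const (hm _) hm₀
  obtain ⟨E₂, hE₂, hcl₂, hev₂⟩ := h.exists_branch (t₀ := xc Φ s) (k := fun _ => n) hκ hb.sign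
    continuous_const (hn _) hn₀
  obtain ⟨E₃, hE₃, hcl₃, hev₃⟩ := h.exists_branch (t₀ := xc Φ s) (k := fun _ => m) hκ hb.sign
    continuous_const (hm _) hm₀
  rw [hκm] at hcl₁ hcl₃
  rw [hκn] at hcl₂
  refine ⟨E₁, hE₁, E₂, hE₂, E₃, hE₃, ?_, ?_, ?_, hev₁, hev₂, hev₃, fun E hE => ⟨fun hv => ?_, ?_⟩⟩
  · rintro rfl
    exact h.branch_ne hκ hb.sign (k := fun _ => n) (k' := fun _ => m) continuous_const (hn _) hn₀
      (hκn ▸ hcrit) (hm _) hE₁ hev₂ hev₁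
  · rintro rfl
    exact h.branch_ne hκ hb.sign (k := fun _ => m) (k' := fun _ => m) continuous_const (hm _) hm₀
      (hκm ▸ hcrit) (hm _) hE₁ hev₃ hev₁
  · rintro rfl
    -- `E₂` and `E₃` lie over the same side. If they were equal, injectivity of the projection on an
    -- edge would join the upper and lower sides of the rectangle across the gap between the
    -- branches.
    have := neBot_side hb.sign (xc Φ s)
    obtain ⟨t, ⟨⟨h2, h3⟩, ht⟩, hσ⟩ := (((hev₂.and hev₃).and hb.eventually_abs).filter_mono
      nhdsWithin_le_nhds |>.and (self_mem_nhdsWithin (s := side σ (xc Φ s)))).exists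
    obtain ⟨q, hq, rfl⟩ := hE₂
    have heq := (h.graph_fibredCurve hκ).injOn_component q (h3 hσ) (h2 hσ)
      (by rw [hκ.xc_eq (hb.lower_mem ht), hκ.xc_eq (hb.upper_mem ht), xc_pt, xc_pt])
    exact hb.not_rel ht hσ (hκ.rel_of_eq (hb.lower_mem ht) (hb.upper_mem ht) heq)
  · obtain ⟨q, hqE, hqD, hκq, hqS, ⟨h1, h2⟩, h3, h4, h5⟩ :=
      h.eventually_of_mem_closure hκ hs hE hv
        (h.eventually_rel_or hs hb (hκ.rel s hsD).symm) (hev₁.and (hev₂.and hev₃))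
    have hne : xc Φ q ≠ xc Φ s := fun hx => hqS s hs (by
      rw [hx] at h2
      rcases h2 with h2 | h2
      · exact h2.trans (hb.rel_center (right_mem_Icc.2 hmn)).symm
      · exact h2.trans (hb.rel_center (left_mem_Icc.2 hmn)).symm)
    rcases mem_side_or hb.sign hne with hσ | hσ
    · rcases h2 with h2 | h2
      · have := h4 hσ
        rw [← hκ.eq_of_rel _ _ h2, hκq] at this
        exact Or.inr (Or.inl (components_eq_of_mem hE hE₂ hqE this))
      · have := h5 hσ
        rw [← hκ.eq_of_rel _ _ h2, hκq] at this
        exact Or.inr (Or.inr (components_eq_of_mem hE hE₃ hqE this))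
    · have hσ' : xc Φ q ∉ side σ (xc Φ s) := fun hc => by
        have h6 : 0 < -σ * (xc Φ q - xc Φ s) := hσ
        have h7 : 0 < σ * (xc Φ q - xc Φ s) := hc
        linarith
      have h2' : Rel Φ D q (pt Φ (xc Φ q) m) := h2.elim (fun h2 => h2.trans
        (hb.rel_across h1 hσ' (right_mem_Icc.2 hmn) (left_mem_Icc.2 hmn))) id
      have := h3 hσ
      rw [← hκ.eq_of_rel _ _ h2', hκq] at this
      exact Or.inl (components_eq_of_mem hE hE₁ hqE this)
  · rintro (rfl | rfl | rfl) <;> assumption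

end Geometry

end

/-! ### Weights subject to the conservation law, and cycles of the graph. -/

section

variable {P : Type*} [TopologicalSpace P] (Φ : P ≃ₜ ℝ × ℝ) (D C S : Set P)

/-- Mod 2 edge weights, as functions on `D`, that satisfy the conservation law at the vertices and
vanish on the unbounded edges. -/
structure Cocycle (ζ : P → ZMod 2) : Prop where
  congr : ∀ p q, Rel Φ D p q → ζ p = ζ q
  locConst : ∀ p ∈ D, (∀ s ∈ S, ¬ Rel Φ D p s) → ∀ᶠ q in 𝓝[D] p, ζ q = ζ p
  far : ∀ p ∈ D, (∀ s ∈ S, |xc Φ s| < |xc Φ p|) → ζ p = 0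
  leaf : ∀ s ∈ S, ∀ σ f g m n δ, LeafBox Φ D C s σ f g m n δ →
    ∀ᶠ t in 𝓝 (xc Φ s), t ∈ side σ (xc Φ s) → ζ (pt Φ t (g t)) = 0
  split : ∀ s ∈ S, ∀ σ f g m n δ, SplitBox Φ D C s σ f g m n δ →
    ∃ a b c, a + b + c = 0 ∧ ∀ᶠ t in 𝓝 (xc Φ s), (t ∈ side (-σ) (xc Φ s) → ζ (pt Φ t m) = a) ∧
      (t ∈ side σ (xc Φ s) → ζ (pt Φ t n) = b ∧ ζ (pt Φ t m) = c)

end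

end PoincareReeb

namespace PoincareReeb

open Set Topology

section

variable {P : Type*} [TopologicalSpace P] {Φ : P ≃ₜ ℝ × ℝ} {D C S G : Set P} {κ : P → P}

open Classical in
theorem boundaryMap_apply [Fintype (openEdges (xc Φ) D G)] (z : openEdges (xc Φ) D G →₀ ZMod 2)
    (x : EnrichedVertex (xc Φ) D G) : boundaryMap (xc Φ) D G z x =
      ∑ E ∈ Finset.univ.filter fun E => Incident (xc Φ) D G x E, z E := by
  rw [boundaryMap, Finsupp.linearCombination_apply, Finsupp.sum_fintype _ _ (by simp),
    Finset.sum_apply, Finset.sum_filter]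
  exact Finset.sum_congr rfl fun E _ => by simp

theorem boundaryMap_apply_arrow [Finite (openEdges (xc Φ) D G)]
    (z : openEdges (xc Φ) D G →₀ ZMod 2) (a : arrows (xc Φ) D G) :
    boundaryMap (xc Φ) D G z (Sum.inr a) = z ⟨a.1.1, a.2.1⟩ := by
  classical
  have := Fintype.ofFinite (openEdges (xc Φ) D G)
  rw [boundaryMap_apply]
  have : (Finset.univ.filter fun E => Incident (xc Φ) D G (Sum.inr a) E) = {⟨a.1.1, a.2.1⟩} := by
    ext E
    simp only [Finset.mem_filter, Finset.mem_univ, true_and, Finset.mem_singleton]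
    exact ⟨fun hE => Subtype.ext (Eq.symm hE), fun hE => hE ▸ rfl⟩
  rw [this, Finset.sum_singleton]

theorem boundaryMap_apply_leaf [Finite (openEdges (xc Φ) D G)]
    (z : openEdges (xc Φ) D G →₀ ZMod 2) (v : vertices (xc Φ) D G) (E₀ : openEdges (xc Φ) D G)
    (hE : ∀ E ∈ openEdges (xc Φ) D G, (v : P) ∈ closure E ↔ E = E₀) :
    boundaryMap (xc Φ) D G z (Sum.inl v) = z E₀ := by
  classical
  have := Fintype.ofFinite (openEdges (xc Φ) D G)
  rw [boundaryMap_apply]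
  have : (Finset.univ.filter fun E => Incident (xc Φ) D G (Sum.inl v) E) = {E₀} := by
    ext E
    simp only [Finset.mem_filter, Finset.mem_univ, true_and, Finset.mem_singleton]
    exact (hE E E.2).trans Subtype.ext_iff.symm
  rw [this, Finset.sum_singleton]

theorem boundaryMap_apply_split [Finite (openEdges (xc Φ) D G)]
    (z : openEdges (xc Φ) D G →₀ ZMod 2) (v : vertices (xc Φ) D G)
    (E₁ E₂ E₃ : openEdges (xc Φ) D G) (h₁₂ : E₁ ≠ E₂) (h₁₃ : E₁ ≠ E₃) (h₂₃ : E₂ ≠ E₃)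
    (hE : ∀ E ∈ openEdges (xc Φ) D G, (v : P) ∈ closure E ↔ E = E₁ ∨ E = E₂ ∨ E = E₃) :
    boundaryMap (xc Φ) D G z (Sum.inl v) = z E₁ + z E₂ + z E₃ := by
  classical
  have := Fintype.ofFinite (openEdges (xc Φ) D G)
  rw [boundaryMap_apply]
  have : (Finset.univ.filter fun E => Incident (xc Φ) D G (Sum.inl v) E) = {E₁, E₂, E₃} := by
    ext E
    simp only [Finset.mem_filter, Finset.mem_univ, true_and, Finset.mem_insert,
      Finset.mem_singleton, Subtype.ext_iff]
    exact hE E E.2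
  rw [this, Finset.sum_insert (by simp [h₁₂, h₁₃]), Finset.sum_insert (by simp [h₂₃]),
    Finset.sum_singleton, add_assoc]

open Classical in
/-- Edge weights as functions on `D`. -/
noncomputable def edgeVal (κ : P → P) (z : openEdges (xc Φ) D G → ZMod 2) (p : P) : ZMod 2 :=
  if hp : ∃ E : openEdges (xc Φ) D G, κ p ∈ E.1 then z hp.choose else 0

theorem edgeVal_of_mem (z : openEdges (xc Φ) D G → ZMod 2) {p : P} (E : openEdges (xc Φ) D G)
    (hp : κ p ∈ E.1) : edgeVal κ z p = z E := by
  have hex : ∃ E : openEdges (xc Φ) D G, κ p ∈ E.1 := ⟨E, hp⟩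
  rw [edgeVal, dif_pos hex]
  congr 1
  exact Subtype.ext (components_eq_of_mem hex.choose.2 E.2 hex.choose_spec hp)

namespace Geometry

variable (h : Geometry Φ D C S)
include h

omit h in
theorem _root_.PoincareReeb.openEdges_eq (hV : vertices (xc Φ) D G = crit Φ D G S) :
    openEdges (xc Φ) D G = components (G \ crit Φ D G S) := by
  rw [openEdges, hV]

theorem finite_openEdges (hκ : Collapse Φ D G κ) (hV : vertices (xc Φ) D G = crit Φ D G S) :
    (openEdges (xc Φ) D G).Finite :=
  openEdges_eq hV ▸ (h.graph_fibredCurve hκ).finite_components_diff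

/-- Edge weights that satisfy the local conditions are cycles. -/
theorem mem_ker_boundaryMap (hκ : Collapse Φ D G κ) (hV : vertices (xc Φ) D G = crit Φ D G S)
    {ζ : P → ZMod 2} {B : ℝ} (hfar : ∀ p ∈ D, B < |xc Φ p| → ζ p = 0)
    (hleaf : ∀ s ∈ S, ∀ σ f g m n δ, LeafBox Φ D C s σ f g m n δ →
      ∀ᶠ t in 𝓝 (xc Φ s), t ∈ side σ (xc Φ s) → ζ (pt Φ t (g t)) = 0)
    (hsplit : ∀ s ∈ S, ∀ σ f g m n δ, SplitBox Φ D C s σ f g m n δ →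
      ∃ a b c, a + b + c = 0 ∧ ∀ᶠ t in 𝓝 (xc Φ s), (t ∈ side (-σ) (xc Φ s) → ζ (pt Φ t m) = a) ∧
        (t ∈ side σ (xc Φ s) → ζ (pt Φ t n) = b ∧ ζ (pt Φ t m) = c))
    (z : openEdges (xc Φ) D G →₀ ZMod 2)
    (hz : ∀ (E : openEdges (xc Φ) D G) (p : P), p ∈ D → κ p ∈ E.1 → z E = ζ p) :
    boundaryMap (xc Φ) D G z = 0 := by
  have := (h.finite_openEdges hκ hV).to_subtype
  have hedge := openEdges_eq hV
  ext x
  rcases x with ⟨v, hv⟩ | ⟨⟨E, d⟩, hE, hd⟩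
  · have hv' := hv
    rw [hV, hκ.crit_eq h.critical_subset_domain] at hv'
    obtain ⟨s, hs, rfl⟩ := hv'
    obtain ⟨σ, f, g, m, n, δ, hb | hb⟩ := h.exists_fold_box hs
    · have := neBot_side hb.sign (xc Φ s)
      obtain ⟨E₀, hE₀, hev, hcl⟩ := h.exists_leaf_edge hκ hs hb
      rw [← hedge] at hE₀ hcl
      rw [boundaryMap_apply_leaf z _ ⟨E₀, hE₀⟩ hcl]
      obtain ⟨t, ⟨⟨h1, h2⟩, h3⟩, hσ⟩ := (((hev.and (hleaf s hs _ _ _ _ _ _ hb)).and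
        hb.eventually_abs).filter_mono nhdsWithin_le_nhds |>.and
          (self_mem_nhdsWithin (s := side σ (xc Φ s)))).exists
      rw [hz _ _ (h.curve_subset (hb.right_mem_curve h3 hσ)) (h1 hσ), h2 hσ]
      rfl
    · have := neBot_side hb.sign (xc Φ s)
      have := neBot_side (τ := -σ) (by rcases hb.sign with h1 | h1 <;> simp [h1]) (xc Φ s)
      obtain ⟨E₁, hE₁, E₂, hE₂, E₃, hE₃, h₁₂, h₁₃, h₂₃, hev₁, hev₂, hev₃, hcl⟩ :=
        h.exists_split_edges hκ hs hb
      rw [← hedge] at hE₁ hE₂ hE₃ hcl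
      rw [boundaryMap_apply_split z _ ⟨E₁, hE₁⟩ ⟨E₂, hE₂⟩ ⟨E₃, hE₃⟩ (by simpa) (by simpa) (by simpa)
        hcl]
      obtain ⟨a, b, c, habc, hev⟩ := hsplit s hs _ _ _ _ _ _ hb
      obtain ⟨t₁, ⟨⟨h1, h2⟩, h3⟩, hσ₁⟩ := (((hev₁.and hev).and hb.eventually_abs).filter_mono
        nhdsWithin_le_nhds |>.and (self_mem_nhdsWithin (s := side (-σ) (xc Φ s)))).exists
      obtain ⟨t₂, ⟨⟨⟨h4, h4'⟩, h5⟩, h6⟩, hσ₂⟩ := ((((hev₂.and hev₃).and hev).and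
        hb.eventually_abs).filter_mono nhdsWithin_le_nhds |>.and
          (self_mem_nhdsWithin (s := side σ (xc Φ s)))).exists
      rw [hz ⟨E₁, hE₁⟩ _ (hb.lower_mem h3) (h1 hσ₁), h2.1 hσ₁,
        hz ⟨E₂, hE₂⟩ _ (hb.upper_mem h6) (h4 hσ₂), (h5.2 hσ₂).1,
        hz ⟨E₃, hE₃⟩ _ (hb.lower_mem h6) (h4' hσ₂), (h5.2 hσ₂).2, habc]
      rfl
  · rw [boundaryMap_apply_arrow]
    have hE' := hE
    rw [hedge] at hE'
    have hEs := component_subset hE'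
    obtain ⟨p, hp, hpB⟩ : ∃ p ∈ E, B < |xc Φ p| := by
      cases d with
      | right =>
        obtain ⟨_, ⟨p, hp, rfl⟩, hpB⟩ := not_bddAbove_iff.1 hd B
        exact ⟨p, hp, hpB.trans_le (le_abs_self _)⟩
      | left =>
        obtain ⟨_, ⟨p, hp, rfl⟩, hpB⟩ := not_bddBelow_iff.1 hd (-B)
        exact ⟨p, hp, by linarith [neg_abs_le (xc Φ p)]⟩
    have hpD := hκ.subset (hEs hp).1
    rw [hz ⟨E, hE⟩ p hpD (by rwa [hκ.eq_self (hEs hp).1]),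
      hfar p hpD hpB]
    rfl

/-- Cycles satisfy the local conditions. -/
theorem cocycle_edgeVal (hκ : Collapse Φ D G κ) (hV : vertices (xc Φ) D G = crit Φ D G S)
    (z : openEdges (xc Φ) D G →₀ ZMod 2) (hz : boundaryMap (xc Φ) D G z = 0) :
    Cocycle Φ D C S (edgeVal κ z) := by
  have := (h.finite_openEdges hκ hV).to_subtype
  have hedge := openEdges_eq hV
  have hG := h.graph_fibredCurve hκ
  have hv : ∀ s ∈ S, κ s ∈ vertices (xc Φ) D G := fun s hs => by
    rw [hV, hκ.crit_eq h.critical_subset_domain]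
    exact ⟨s, hs, rfl⟩
  refine ⟨?_, ?_, ?_, ?_, ?_⟩
  · intro p q hpq
    have heq := hκ.eq_of_rel p q hpq
    unfold edgeVal
    generalize κ p = a, κ q = b at heq
    rw [heq]
  · intro p hp hpS
    have hp' := hκ.mem_diff_crit hp hpS
    have hE : connectedComponentIn (G \ crit Φ D G S) (κ p) ∈ openEdges (xc Φ) D G :=
      hedge ▸ component_mem_components hp'
    filter_upwards [h.eventually_mem_edge hκ hp hpS] with q hq
    rw [edgeVal_of_mem _ ⟨_, hE⟩ hq, edgeVal_of_mem _ ⟨_, hE⟩ (mem_connectedComponentIn hp')]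
  · intro p hp hpS
    have hp' := hκ.mem_diff_crit hp fun s hs hr => by
      have := hpS s hs
      rw [hr.1] at this
      exact this.false
    have hE := component_mem_components hp'
    have hpE := mem_connectedComponentIn hp'
    have hcrit : ∀ v ∈ crit Φ D G S, |xc Φ v| < |xc Φ p| := by
      rintro v ⟨-, s, hs, hvs⟩
      rw [hvs.1]
      exact hpS s hs
    -- Beyond all critical abscissas the edge carries an arrow, and the boundary at the arrowhead
    -- vertex is the weight of that edge alone.
    have harrow : ∃ d, (connectedComponentIn (G \ crit Φ D G S) (κ p), d) ∈ arrows (xc Φ) D G := by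
      rcases le_total 0 (xc Φ p) with h0 | h0
      · refine ⟨Side.right, hedge ▸ hE, (hG.escapes_right_iff (M := xc Φ p) (fun v hv => ?_) hE).2
          ⟨_, hpE, hκ.xc_eq hp⟩⟩
        have := hcrit v hv
        rw [abs_of_nonneg h0] at this
        exact (abs_lt.1 this).2
      · refine ⟨Side.left, hedge ▸ hE, (hG.escapes_left_iff (M := xc Φ p) (fun v hv => ?_) hE).2
          ⟨_, hpE, hκ.xc_eq hp⟩⟩
        have := hcrit v hv
        rw [abs_of_nonpos h0] at this
        linarith [(abs_lt.1 this).1]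
    obtain ⟨d, hd⟩ := harrow
    have := boundaryMap_apply_arrow z ⟨_, hd⟩
    rw [hz] at this
    rw [edgeVal_of_mem _ ⟨_, hd.1⟩ hpE]
    exact this.symm
  · intro s hs σ f g m n δ hb
    obtain ⟨E₀, hE₀, hev, hcl⟩ := h.exists_leaf_edge hκ hs hb
    rw [← hedge] at hE₀ hcl
    have hz0 := boundaryMap_apply_leaf z ⟨κ s, hv s hs⟩ ⟨E₀, hE₀⟩ hcl
    rw [hz] at hz0
    filter_upwards [hev] with t ht hσ
    rw [edgeVal_of_mem _ ⟨E₀, hE₀⟩ (ht hσ)]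
    exact hz0.symm
  · intro s hs σ f g m n δ hb
    obtain ⟨E₁, hE₁, E₂, hE₂, E₃, hE₃, h₁₂, h₁₃, h₂₃, hev₁, hev₂, hev₃, hcl⟩ :=
      h.exists_split_edges hκ hs hb
    rw [← hedge] at hE₁ hE₂ hE₃ hcl
    have hz0 := boundaryMap_apply_split z ⟨κ s, hv s hs⟩ ⟨E₁, hE₁⟩ ⟨E₂, hE₂⟩ ⟨E₃, hE₃⟩ (by simpa)
      (by simpa) (by simpa) hcl
    rw [hz] at hz0
    refine ⟨z ⟨E₁, hE₁⟩, z ⟨E₂, hE₂⟩, z ⟨E₃, hE₃⟩, hz0.symm, ?_⟩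
    filter_upwards [hev₁, hev₂, hev₃] with t h1 h2 h3
    exact ⟨fun hσ => edgeVal_of_mem _ ⟨E₁, hE₁⟩ (h1 hσ), fun hσ =>
      ⟨edgeVal_of_mem _ ⟨E₂, hE₂⟩ (h2 hσ), edgeVal_of_mem _ ⟨E₃, hE₃⟩ (h3 hσ)⟩⟩

theorem topVal_eq_zero {M : ℝ} (w : locConst Φ C M) {p : P} (hp : M ≤ |xc Φ p|) :
    topVal Φ D w.1 p = 0 := by
  by_cases hex : ∃ q, IsTop Φ D p q
  · obtain ⟨q, hq⟩ := hex
    rw [topVal_of_isTop _ hq]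
    exact w.2.2.2 q (h.mem_curve_of_isTop hq) (by rwa [← hq.1.1])
  · exact topVal_of_not_exists _ hex

/-- The sums of the values at both ends are cycles. -/
theorem boundaryMap_edgeSum {M : ℝ} (hκ : Collapse Φ D G κ)
    (hV : vertices (xc Φ) D G = crit Φ D G S) (w : locConst Φ C M)
    (z : openEdges (xc Φ) D G →₀ ZMod 2) (hz : ⇑z = h.edgeSum G M w) :
    boundaryMap (xc Φ) D G z = 0 := by
  have hw := w.2.2.1
  refine h.mem_ker_boundaryMap hκ hV (ζ := endSum Φ D w.1) (B := M) ?_ ?_ ?_ z fun E p hp hpE => by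
    rw [hz, h.edgeSum_apply hκ hV w E hp hpE]
  · exact fun p _ hpM => by
      rw [endSum, h.topVal_eq_zero w hpM.le, h.flip.topVal_eq_zero (M := M) ⟨w.1, w.2⟩ hpM.le,
        add_zero]
  · intro s hs σ f g m n δ hb
    filter_upwards [hb.eventually_branches hw (h.critical_subset hs), hb.eventually_abs]
      with t h1 h2 hσ
    have hy : g t ∈ Icc (f t) (g t) := ⟨(hb.lt t h2 hσ).le, le_rfl⟩
    rw [endSum, topVal_of_isTop _ (hb.isTop h2 (le_of_lt hσ) hy),
      topVal_of_isTop _ (hb.isTop_flip h2 (le_of_lt hσ) hy), (h1 hσ).1, (h1 hσ).2]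
    exact CharTwo.add_self_eq_zero _
  · intro s hs σ f g m n δ hb
    have hmn := (hb.lower.trans hb.upper).le
    -- The interval before the fork keeps the two ends of the critical interval. After the fork, the
    -- upper and the lower interval each keep one of them and acquire an end on a branch, with value
    -- `w s`. Each term occurs twice in the sum.
    refine ⟨topVal Φ D w.1 s + topVal (PoincareReeb.flip Φ) D w.1 s,
      topVal Φ D w.1 s + w.1 s, w.1 s + topVal (PoincareReeb.flip Φ) D w.1 s, ?_, ?_⟩
    · have := CharTwo.add_self_eq_zero (topVal Φ D w.1 s)
      have := CharTwo.add_self_eq_zero (topVal (PoincareReeb.flip Φ) D w.1 s)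
      have := CharTwo.add_self_eq_zero (w.1 s)
      grind
    · filter_upwards [h.eventually_topVal_upper hs hb hw, h.eventually_topVal_lower hs hb hw,
        h.flip.eventually_topVal_upper hs hb.flip hw, h.flip.eventually_topVal_lower hs hb.flip hw,
        hb.eventually_abs] with t h1 h2 h3 h4 h5
      simp only [pt_flip, neg_neg, xc_flip] at h3 h4
      refine ⟨fun hσ => ?_, fun hσ => ⟨?_, ?_⟩⟩
      · have hσ' : t ∉ side σ (xc Φ s) := fun hc => by
          have h6 : 0 < -σ * (t - xc Φ s) := hσ
          have h7 : 0 < σ * (t - xc Φ s) := hc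
          linarith
        rw [endSum, h3, topVal_congr _ (hb.rel_across h5 hσ' (left_mem_Icc.2 hmn)
          (right_mem_Icc.2 hmn)), h1]
      · rw [endSum, h1, h4 hσ]
      · rw [endSum, h2 hσ, h3]

end Geometry

end

end PoincareReeb

namespace PoincareReeb

open Set Topology

/-! ### Sums of weights over the tops on a vertical line. -/

section

variable {P : Type*} [TopologicalSpace P] {Φ : P ≃ₜ ℝ × ℝ} {D C S : Set P} {ζ : P → ZMod 2}
variable {t y : ℝ} {J J' : Set ℝ}

variable (Φ D) in
/-- The heights of the tops of the vertical intervals over `t`. -/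
def tops (t : ℝ) : Set ℝ := {y | IsTop Φ D (pt Φ t y) (pt Φ t y)}

variable (Φ D ζ) in
/-- The sum of `ζ` over the tops with height in `J`. -/
noncomputable def topSum (t : ℝ) (J : Set ℝ) : ZMod 2 := ∑ᶠ y ∈ tops Φ D t ∩ J, ζ (pt Φ t y)

theorem topSum_eq (hJ : J ⊆ J') (hn : ∀ y ∈ J', y ∉ J → y ∈ tops Φ D t → ζ (pt Φ t y) = 0) :
    topSum Φ D ζ t J' = topSum Φ D ζ t J := by
  refine finsum_mem_inter_support_eq _ _ _ ?_
  ext y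
  refine ⟨fun hy => ⟨⟨hy.1.1, ?_⟩, hy.2⟩, fun hy => ⟨⟨hy.1.1, hJ hy.1.2⟩, hy.2⟩⟩
  by_contra hyJ
  exact hy.2 (hn y hy.1.2 hyJ hy.1.1)

theorem topSum_eq_add (hfin : (tops Φ D t).Finite) (hJ : J ⊆ J') (hy : y ∈ J') (hyJ : y ∉ J)
    (hyT : y ∈ tops Φ D t) (hn : ∀ z ∈ J', z ∉ J → z ∈ tops Φ D t → z = y) :
    topSum Φ D ζ t J' = topSum Φ D ζ t J + ζ (pt Φ t y) := by
  have : tops Φ D t ∩ J' = insert y (tops Φ D t ∩ J) := by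
    ext z
    rw [mem_insert_iff]
    refine ⟨fun hz => ?_, ?_⟩
    · by_cases hzJ : z ∈ J
      · exact Or.inr ⟨hz.1, hzJ⟩
      · exact Or.inl (hn z hz.2 hzJ hz.1)
    · rintro (rfl | hz)
      · exact ⟨hyT, hy⟩
      · exact ⟨hz.1, hJ hz.2⟩
  rw [topSum, this, finsum_mem_insert _ (fun hy' => hyJ hy'.2) (hfin.subset inter_subset_left),
    add_comm, topSum]

theorem topSum_zero (hn : ∀ y ∈ J, y ∈ tops Φ D t → ζ (pt Φ t y) = 0) : topSum Φ D ζ t J = 0 :=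
  finsum_mem_eq_zero_of_forall_eq_zero fun y hy => hn y hy.2 hy.1

/-- A function that is constant near every point on a dense set of good points extends to a locally
constant function. -/
theorem exists_locally_constant_extension {X α : Type*} [TopologicalSpace X] [Nonempty α]
    {A R : Set X}
    (hR : ∀ x ∈ A, (𝓝[R] x).NeBot) {F : X → α} (hF : ∀ x ∈ A, ∃ e, ∀ᶠ r in 𝓝[R] x, F r = e) :
    ∃ w : X → α, (∀ x ∈ A, ∀ᶠ r in 𝓝[A] x, w r = w x) ∧ ∀ x ∈ A ∩ R, w x = F x := by
  classical
  choose! w hw using hF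
  refine ⟨w, fun x hx => ?_, fun x hx => ?_⟩
  -- The extension takes at each point the eventual value of `F`. Two nearby eventual values are
  -- compared at a common good point.
  · have h1 := eventually_eventually_nhds.2 (eventually_nhdsWithin_iff.1 (hw x hx))
    filter_upwards [nhdsWithin_le_nhds h1, self_mem_nhdsWithin] with r hr hrA
    have := hR r hrA
    obtain ⟨z, hz1, hz2⟩ := ((eventually_nhdsWithin_iff.2 hr).and (hw r hrA)).exists
    exact hz2.symm.trans hz1
  · exact (mem_of_mem_nhdsWithin hx.2 (hw x hx.1)).symm

variable (Φ D S ζ) in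
/-- The sum over the tops below the height `m` is constant near `t`, with a correction if the
vertical interval at height `m` contains a critical point. -/
def IsStable (t₀ m : ℝ) : Prop :=
  ((∀ s ∈ S, Rel Φ D (pt Φ t₀ m) s → m ≤ yc Φ s) →
    ∃ e, ∀ᶠ t in 𝓝[regVals Φ S] t₀, topSum Φ D ζ t (Iio m) = e) ∧
  ((∀ s ∈ S, Rel Φ D (pt Φ t₀ m) s → yc Φ s ≤ m) →
    ∃ e, ∀ᶠ t in 𝓝[regVals Φ S] t₀, topSum Φ D ζ t (Iio m) + ζ (pt Φ t m) = e)

namespace Geometry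

variable (h : Geometry Φ D C S)
include h

theorem finite_tops (ht : t ∈ regVals Φ S) : (tops Φ D t).Finite := by
  have := (h.fibredCurve.finite_fibre (t := t) ht).image (yc Φ)
  refine this.subset fun y hy => ⟨pt Φ t y, ⟨h.mem_curve_of_isTop hy, by simp⟩, by simp⟩

theorem mem_curve_of_mem_tops (hy : y ∈ tops Φ D t) : pt Φ t y ∈ C := h.mem_curve_of_isTop hy

omit h in
theorem _root_.PoincareReeb.tendsto_regular (q : P) : Filter.Tendsto (xc Φ) (𝓝[C ∩ xc Φ ⁻¹' regVals Φ S] q)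
    (𝓝[regVals Φ S] (xc Φ q)) :=
  tendsto_nhdsWithin_iff.2 ⟨(continuous_xc Φ).continuousAt.tendsto.mono_left nhdsWithin_le_nhds,
    eventually_nhdsWithin_of_forall fun _ hr => hr.2⟩

end Geometry

namespace Cocycle

variable (hζ : Cocycle Φ D C S ζ)
include hζ

-- Extending the weight by zero off `D` gives it a meaning at every height of a vertical line, as
-- the sums below need.
open Classical in
theorem indicator : Cocycle Φ D C S (D.indicator ζ) := by
  have hD : ∀ p ∈ D, D.indicator ζ p = ζ p := fun p hp => indicator_of_mem hp ζ
  refine ⟨fun p q hpq => ?_, fun p hp hpS => ?_, fun p hp hpS => ?_, ?_, ?_⟩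
  · rw [hD p hpq.left_mem, hD q hpq.right_mem, hζ.congr p q hpq]
  · filter_upwards [hζ.locConst p hp hpS, self_mem_nhdsWithin] with q hq hqD
    rw [hD q hqD, hD p hp, hq]
  · rw [hD p hp, hζ.far p hp hpS]
  · intro s hs σ f g m n δ hb
    filter_upwards [hζ.leaf s hs σ f g m n δ hb] with t ht hσ
    by_cases hmem : pt Φ t (g t) ∈ D
    · rw [hD _ hmem, ht hσ]
    · exact indicator_of_notMem hmem ζ
  · intro s hs σ f g m n δ hb
    obtain ⟨a, b, c, habc, hev⟩ := hζ.split s hs σ f g m n δ hb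
    refine ⟨a, b, c, habc, ?_⟩
    filter_upwards [hev, hb.eventually_abs] with t ht hδ
    rwa [hD _ (hb.lower_mem hδ), hD _ (hb.upper_mem hδ)]

variable (h : Geometry Φ D C S) (hoff : ∀ p ∉ D, ζ p = 0) {t₀ m n : ℝ}
include h hoff

theorem eventually_pt (hm : pt Φ t₀ m ∉ C) (hS : ∀ s ∈ S, ¬ Rel Φ D (pt Φ t₀ m) s) :
    ∀ᶠ t in 𝓝 t₀, ζ (pt Φ t m) = ζ (pt Φ t₀ m) := by
  have hlim : Filter.Tendsto (fun t => pt Φ t m) (𝓝 t₀) (𝓝 (pt Φ t₀ m)) :=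
    Continuous.tendsto (by fun_prop) t₀
  by_cases hD : pt Φ t₀ m ∈ D
  · have := hζ.locConst _ hD hS
    rw [nhdsWithin_eq_nhds.2 (h.mem_nhds hD hm)] at this
    exact hlim.eventually this
  · filter_upwards [hlim.eventually (h.isClosed.isOpen_compl.mem_nhds hD)] with t ht
    rw [hoff _ ht, hoff _ hD]

/-- Stability is transported along segments that do not meet the curve. -/
theorem isStable_of_segment (hseg : ∀ z ∈ uIcc m n, pt Φ t₀ z ∉ C)
    (hm : IsStable Φ D S ζ t₀ m) : IsStable Φ D S ζ t₀ n := by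
  have htube := eventually_forall_pt_mem (Φ := Φ) isCompact_uIcc h.isClosed_curve.isOpen_compl
    (K := uIcc m n) hseg
  have hsum : ∀ᶠ t in 𝓝 t₀, topSum Φ D ζ t (Iio n) = topSum Φ D ζ t (Iio m) := by
    filter_upwards [htube] with t ht
    have hn : ∀ y ∈ uIcc m n, y ∉ tops Φ D t := fun y hy hyT => ht y hy (h.mem_curve_of_mem_tops hyT)
    rcases le_total m n with hmn | hmn
    · exact topSum_eq (Iio_subset_Iio hmn) fun y hy hy' =>
        fun hT => absurd hT (hn y (mem_uIcc.2 (Or.inl ⟨not_lt.1 hy', le_of_lt hy⟩)))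
    · exact (topSum_eq (Iio_subset_Iio hmn) fun y hy hy' =>
        fun hT => absurd hT (hn y (mem_uIcc.2 (Or.inr ⟨not_lt.1 hy', le_of_lt hy⟩)))).symm
  have hpre : IsPreconnected (pt Φ t₀ '' uIcc m n) :=
    isPreconnected_uIcc.image _ (by fun_prop)
  have hout : ∀ s ∈ S, xc Φ s = t₀ → yc Φ s ∉ uIcc m n := fun s hs hst hy => by
    have := hseg _ hy
    rw [← hst, pt_xc_yc] at this
    exact this (h.critical_subset hs)
  have hval : (∀ᶠ t in 𝓝 t₀, ζ (pt Φ t n) = ζ (pt Φ t m)) ∧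
      (∀ s, Rel Φ D (pt Φ t₀ m) s → Rel Φ D (pt Φ t₀ n) s) := by
    -- If the segment is in `D`, its ends belong to one vertical interval and have the same weight.
    -- If it is outside, both weights are zero. The tube lemma extends this to nearby lines.
    rcases subset_interior_or_subset_compl h.isClosed h.curve_eq hpre
      (by rw [disjoint_left]; rintro _ ⟨z, hz, rfl⟩; exact hseg z hz) with h1 | h1
    · refine ⟨?_, fun s hs => (Rel.symm (rel_pt.2 fun z hz => interior_subset (h1 ⟨z, hz, rfl⟩))).trans hs⟩
      filter_upwards [eventually_forall_pt_mem (Φ := Φ) isCompact_uIcc isOpen_interior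
        (K := uIcc m n) fun z hz => h1 ⟨z, hz, rfl⟩] with t ht
      exact (hζ.congr _ _ (rel_pt.2 fun z hz => interior_subset (ht z hz))).symm
    · refine ⟨?_, fun s hs => absurd hs.left_mem (h1 ⟨m, left_mem_uIcc, rfl⟩)⟩
      filter_upwards [eventually_forall_pt_mem (Φ := Φ) isCompact_uIcc h.isClosed.isOpen_compl
        (K := uIcc m n) fun z hz => h1 ⟨z, hz, rfl⟩] with t ht
      rw [hoff _ (ht n right_mem_uIcc), hoff _ (ht m left_mem_uIcc)]
  refine ⟨fun hS => ?_, fun hS => ?_⟩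
  · obtain ⟨e, he⟩ := hm.1 fun s hs hr => by
      by_contra! hlt
      have h1 := hS s hs (hval.2 s hr)
      exact hout s hs (by simpa using hr.1.symm) (mem_uIcc.2 (Or.inr ⟨h1, hlt.le⟩))
    refine ⟨e, ?_⟩
    filter_upwards [he, nhdsWithin_le_nhds hsum] with t h1 h2
    rw [h2, h1]
  · obtain ⟨e, he⟩ := hm.2 fun s hs hr => by
      by_contra! hlt
      have h1 := hS s hs (hval.2 s hr)
      exact hout s hs (by simpa using hr.1.symm) (mem_uIcc.2 (Or.inl ⟨hlt.le, h1⟩))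
    refine ⟨e, ?_⟩
    filter_upwards [he, nhdsWithin_le_nhds hsum, nhdsWithin_le_nhds hval.1] with t h1 h2 h3
    rw [h2, h3, h1]

end Cocycle

end

end PoincareReeb

namespace PoincareReeb

open Set Topology

/-! ### Propagation of stability upwards across the curve. -/

section

variable {P : Type*} [TopologicalSpace P] {Φ : P ≃ₜ ℝ × ℝ} {D C S : Set P} {ζ : P → ZMod 2}
variable {q : P} {f : ℝ → ℝ} {t a m n : ℝ}

variable (Φ D C S ζ) in
/-- A rectangle around the point `q` of the curve through which stability propagates upwards. -/
def IsCrossing (q : P) (m n : ℝ) : Prop :=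
  m < yc Φ q ∧ yc Φ q < n ∧ (∀ y ∈ Icc m n, pt Φ (xc Φ q) y ∈ C → y = yc Φ q) ∧
  (IsStable Φ D S ζ (xc Φ q) m → IsStable Φ D S ζ (xc Φ q) n ∧
    ∃ e, ∀ᶠ r in 𝓝[C ∩ xc Φ ⁻¹' regVals Φ S] q, topSum Φ D ζ (xc Φ r) (Iic (yc Φ r)) = e)

theorem isTop_of_domain (ha : a ∈ Icc m n) (han : a < n)
    (hD : ∀ y ∈ Icc m n, pt Φ t y ∈ D ↔ y ≤ a) : IsTop Φ D (pt Φ t m) (pt Φ t a) := by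
  refine isTop_of_frequently (rel_pt_of_Icc (fun z hz => (hD z ⟨hz.1, hz.2.trans ha.2⟩).2 hz.2)
    ⟨le_rfl, ha.1⟩ ⟨ha.1, le_rfl⟩) fun y hy => ?_
  rw [yc_pt] at hy ⊢
  rw [xc_pt]
  have h1 := lt_min hy han
  have h2 := min_le_left y n
  have h3 := min_le_right y n
  have h4 := ha.1
  refine ⟨(a + min y n) / 2, by linarith, by linarith, fun hmem => ?_⟩
  have := (hD _ ⟨by linarith, by linarith⟩).1 hmem
  linarith

theorem notMem_tops_of_segment (han : a < n) (hD : ∀ y ∈ Icc a n, pt Φ t y ∈ D) :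
    a ∉ tops Φ D t := fun ha => by
  have := ha.2 _ (rel_pt_of_Icc hD (left_mem_Icc.2 han.le) (right_mem_Icc.2 han.le))
  simp only [yc_pt] at this
  linarith

theorem pt_yc_of_rel {s : P} (hr : Rel Φ D (pt Φ t m) s) : pt Φ t (yc Φ s) = s := by
  have := hr.1
  rw [xc_pt] at this
  rw [this, pt_xc_yc]

namespace Cocycle

variable (hζ : Cocycle Φ D C S ζ) (h : Geometry Φ D C S) (hoff : ∀ p ∉ D, ζ p = 0)
include hζ h hoff

/-- When a top is crossed, the weight of the interval at height `m` turns into the summand of that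
top, and the weight just above is zero. The critical points of this interval lie below `m`, so the
second clause at `m` applies and yields both clauses at `n`. -/
theorem exists_crossing_of_top (hqS : q ∉ S) (hf : IsGraphPoint Φ D C q 1 f) :
    ∃ m n, IsCrossing Φ D C S ζ q m n := by
  obtain ⟨ε, hε, -, δ, hδ, hbox⟩ := hf.exists_box one_pos
  set t₀ := xc Φ q with ht₀
  set m := yc Φ q - ε / 2 with hm
  set n := yc Φ q + ε / 2 with hn
  have hin : ∀ y ∈ Icc m n, |y - yc Φ q| < ε := fun y hy =>
    abs_lt.2 ⟨by linarith [hy.1], by linarith [hy.2]⟩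
  have habs : ∀ᶠ t in 𝓝 t₀, |t - t₀| < δ := Metric.ball_mem_nhds _ hδ
  have hft : ∀ t, |t - t₀| < δ → m < f t ∧ f t < n := fun t ht => by
    have := abs_lt.1 (hbox t ht).1
    constructor <;> linarith
  have hC : ∀ t, |t - t₀| < δ → ∀ y ∈ Icc m n, pt Φ t y ∈ C ↔ y = f t := fun t ht y hy =>
    ((hbox t ht).2 y (hin y hy)).1
  have hD : ∀ t, |t - t₀| < δ → ∀ y ∈ Icc m n, pt Φ t y ∈ D ↔ y ≤ f t := fun t ht y hy => by
    simpa using ((hbox t ht).2 y (hin y hy)).2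
  have htop : ∀ t, |t - t₀| < δ → IsTop Φ D (pt Φ t m) (pt Φ t (f t)) := fun t ht =>
    isTop_of_domain ⟨(hft t ht).1.le, (hft t ht).2.le⟩ (hft t ht).2 (hD t ht)
  have hadd : ∀ t, |t - t₀| < δ → t ∈ regVals Φ S → ∀ J, Iio m ⊆ J → f t ∈ J → J ⊆ Iic n →
      topSum Φ D ζ t J = topSum Φ D ζ t (Iio m) + ζ (pt Φ t m) := fun t ht htR J hJ hfJ hJn => by
    rw [hζ.congr _ _ (htop t ht).1]
    refine topSum_eq_add (h.finite_tops htR) hJ hfJ (not_lt.2 (hft t ht).1.le) (htop t ht).self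
      fun z hz hzm hzT => (hC t ht z ⟨not_lt.1 hzm, hJn hz⟩).1 (h.mem_curve_of_mem_tops hzT)
  have h0 : |t₀ - t₀| < δ := by simpa
  refine ⟨m, n, by linarith, by linarith, fun y hy hyC => ((hC t₀ h0 y hy).1 hyC).trans hf.2.1,
    fun hst => ?_⟩
  obtain ⟨e, he⟩ := hst.2 fun s hs hr => by
    have := (htop t₀ h0).2 s hr
    rw [hf.2.1, yc_pt] at this
    refine le_of_not_gt fun hlt => hqS ?_
    have hsC := pt_yc_of_rel hr
    have hs' := h.critical_subset hs
    rw [← hsC] at hs'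
    have h1 := (hC t₀ h0 (yc Φ s) ⟨hlt.le, by linarith⟩).1 hs'
    rw [hf.2.1] at h1
    rw [h1, pt_xc_yc] at hsC
    rwa [hsC]
  have hnD : ∀ t, |t - t₀| < δ → pt Φ t n ∉ D := fun t ht hmem => by
    have := (hD t ht n ⟨by linarith, le_rfl⟩).1 hmem
    linarith [(hft t ht).2]
  have hsum : ∀ᶠ t in 𝓝[regVals Φ S] t₀, topSum Φ D ζ t (Iio n) = e := by
    filter_upwards [he, nhdsWithin_le_nhds habs, self_mem_nhdsWithin] with t h1 h2 h3
    rw [hadd t h2 h3 (Iio n) (Iio_subset_Iio (by linarith)) (hft t h2).2 Iio_subset_Iic_self, h1]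
  refine ⟨⟨fun _ => ⟨e, hsum⟩, fun _ => ⟨e, ?_⟩⟩, e, ?_⟩
  · filter_upwards [hsum, nhdsWithin_le_nhds habs] with t h1 h2
    rw [h1, hoff _ (hnD t h2), add_zero]
  · filter_upwards [(tendsto_regular q).eventually he, self_mem_nhdsWithin,
      (tendsto_regular q).eventually (nhdsWithin_le_nhds habs),
      nhdsWithin_le_nhds (eventually_box (Φ := Φ) q (half_pos hε))] with r h1 h2 h3 h4
    have h5 := abs_lt.1 h4.2
    have h6 := (hC _ h3 (yc Φ r) ⟨by linarith, by linarith⟩).1 (by rw [pt_xc_yc]; exact h2.1)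
    have h7 := hft _ h3
    rw [hadd _ h3 h2.2 (Iic (yc Φ r)) (fun z hz => by
        rw [mem_Iic, h6]; exact (hz.trans h7.1).le) h6.ge (Iic_subset_Iic.2 (by linarith)), h1]

/-- No top is crossed. At height `m` the line is outside `D`, so the first clause there is available
without condition. The new interval begins at the noncritical point `q`; if its critical points are
not above `n`, it has none, and its weight is locally constant. -/
theorem exists_crossing_of_bottom (hqS : q ∉ S) (hf : IsGraphPoint Φ D C q (-1) f) :
    ∃ m n, IsCrossing Φ D C S ζ q m n := by
  obtain ⟨ε, hε, -, δ, hδ, hbox⟩ := hf.exists_box one_pos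
  set t₀ := xc Φ q with ht₀
  set m := yc Φ q - ε / 2 with hm
  set n := yc Φ q + ε / 2 with hn
  have hin : ∀ y ∈ Icc m n, |y - yc Φ q| < ε := fun y hy =>
    abs_lt.2 ⟨by linarith [hy.1], by linarith [hy.2]⟩
  have habs : ∀ᶠ t in 𝓝 t₀, |t - t₀| < δ := Metric.ball_mem_nhds _ hδ
  have hft : ∀ t, |t - t₀| < δ → m < f t ∧ f t < n := fun t ht => by
    have := abs_lt.1 (hbox t ht).1
    constructor <;> linarith
  have hC : ∀ t, |t - t₀| < δ → ∀ y ∈ Icc m n, pt Φ t y ∈ C ↔ y = f t := fun t ht y hy =>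
    ((hbox t ht).2 y (hin y hy)).1
  have hD : ∀ t, |t - t₀| < δ → ∀ y ∈ Icc m n, pt Φ t y ∈ D ↔ f t ≤ y := fun t ht y hy => by
    simpa using ((hbox t ht).2 y (hin y hy)).2
  have heq : ∀ t, |t - t₀| < δ → ∀ J, Iio m ⊆ J → J ⊆ Iic n →
      topSum Φ D ζ t J = topSum Φ D ζ t (Iio m) := fun t ht J hJ hJn => by
    refine topSum_eq hJ fun z hz hzm hzT => absurd hzT fun hzT => ?_
    rw [(hC t ht z ⟨not_lt.1 hzm, hJn hz⟩).1 (h.mem_curve_of_mem_tops hzT)] at hzT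
    exact notMem_tops_of_segment (hft t ht).2
      (fun y hy => (hD t ht y ⟨(hft t ht).1.le.trans hy.1, hy.2⟩).2 hy.1) hzT
  have h0 : |t₀ - t₀| < δ := by simpa
  refine ⟨m, n, by linarith, by linarith, fun y hy hyC => ((hC t₀ h0 y hy).1 hyC).trans hf.2.1,
    fun hst => ?_⟩
  have hmn : m ≤ n := by linarith
  obtain ⟨e, he⟩ := hst.1 fun s hs hr => by
    have := (hD t₀ h0 m ⟨le_rfl, hmn⟩).1 hr.left_mem
    linarith [(hft t₀ h0).1]
  have hsum : ∀ᶠ t in 𝓝[regVals Φ S] t₀, topSum Φ D ζ t (Iio n) = e := by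
    filter_upwards [he, nhdsWithin_le_nhds habs] with t h1 h2
    rw [heq t h2 (Iio n) (Iio_subset_Iio hmn) Iio_subset_Iic_self, h1]
  refine ⟨⟨fun _ => ⟨e, hsum⟩, fun hS => ?_⟩, e, ?_⟩
  · have hnC : pt Φ t₀ n ∉ C := fun hmem => by
      have := (hC t₀ h0 n ⟨hmn, le_rfl⟩).1 hmem
      linarith [(hft t₀ h0).2]
    have hbot : ∀ r, Rel Φ D (pt Φ t₀ n) r → yc Φ q ≤ yc Φ r := fun r hr => by
      by_contra! hlt
      have h1 := (rel_pt_right.1 hr.symm).2 (max m (yc Φ r)) (mem_uIcc.2 (Or.inl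
        ⟨le_max_right _ _, max_le hmn (by linarith)⟩))
      rw [hD t₀ h0 _ ⟨le_max_left _ _, max_le hmn (by linarith)⟩, hf.2.1] at h1
      rcases le_max_iff.1 h1 with h3 | h3 <;> linarith
    refine ⟨e + ζ (pt Φ t₀ n), ?_⟩
    have hnS : ∀ s ∈ S, ¬ Rel Φ D (pt Φ t₀ n) s := fun s hs hr => by
      have hsC := pt_yc_of_rel hr
      have hs' := h.critical_subset hs
      rw [← hsC] at hs'
      have h1 := (hC t₀ h0 (yc Φ s) ⟨by linarith [hbot s hr], hS s hs hr⟩).1 hs'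
      rw [hf.2.1] at h1
      rw [h1, pt_xc_yc] at hsC
      exact hqS (hsC ▸ hs)
    filter_upwards [hsum, nhdsWithin_le_nhds (hζ.eventually_pt h hoff hnC hnS)] with t h1 h2
    rw [h1, h2]
  · filter_upwards [(tendsto_regular q).eventually he, self_mem_nhdsWithin,
      (tendsto_regular q).eventually (nhdsWithin_le_nhds habs),
      nhdsWithin_le_nhds (eventually_box (Φ := Φ) q (half_pos hε))] with r h1 h2 h3 h4
    have h5 := abs_lt.1 h4.2
    rw [heq _ h3 (Iic (yc Φ r)) (fun z hz => by rw [mem_Iio] at hz; rw [mem_Iic]; linarith)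
      (Iic_subset_Iic.2 (by linarith)), h1]

-- Over regular values the only tops in the rectangle are on the upper branch, and their weight is
-- zero by the conservation law at a leaf.
omit hoff in
theorem isCrossing_of_leaf (hoff : ∀ p ∉ D, ζ p = 0) {σ : ℝ} {g : ℝ → ℝ} {δ : ℝ} (hqS : q ∈ S)
    (hb : LeafBox Φ D C q σ f g m n δ) : IsCrossing Φ D C S ζ q m n := by
  have hmn := (hb.lower.trans hb.upper).le
  have h0 : |xc Φ q - xc Φ q| < δ := by simpa using hb.pos
  have heq : ∀ᶠ t in 𝓝[regVals Φ S] (xc Φ q), ∀ J, Iio m ⊆ J → J ⊆ Iic n →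
      topSum Φ D ζ t J = topSum Φ D ζ t (Iio m) := by
    filter_upwards [nhdsWithin_le_nhds hb.eventually_abs, self_mem_nhdsWithin,
      nhdsWithin_le_nhds (hζ.leaf q hqS _ _ _ _ _ _ hb)] with t h1 h2 h3 J hJ hJn
    refine topSum_eq hJ fun z hz hzm hzT => ?_
    obtain ⟨h4, h5⟩ := (hb.curve t h1 z ⟨not_lt.1 hzm, hJn hz⟩).1 (h.mem_curve_of_mem_tops hzT)
    have hσ : t ∈ side σ (xc Φ q) := (mem_side_or hb.sign (h2 q hqS).symm).resolve_right fun hc => by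
      have : 0 < -σ * (t - xc Φ q) := hc
      linarith
    rcases h5 with rfl | rfl
    · have hlt := hb.lt t h1 hσ
      have := hzT.2 _ (hb.rel h1 h4 (left_mem_Icc.2 hlt.le) (right_mem_Icc.2 hlt.le))
      rw [yc_pt, yc_pt] at this
      linarith
    · exact h3 hσ
  refine ⟨hb.lower, hb.upper, fun y hy hyC => ?_, fun hst => ?_⟩
  · have := ((hb.curve _ h0 y hy).1 hyC).2
    rwa [hb.left_eq, hb.right_eq, or_self] at this
  obtain ⟨e, he⟩ := hst.1 fun s hs hr => by
    have := ((hb.domain _ h0 m ⟨le_rfl, hmn⟩).1 hr.left_mem).2.1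
    linarith [(hb.left_mem _ h0).1]
  have hsum : ∀ᶠ t in 𝓝[regVals Φ S] (xc Φ q), topSum Φ D ζ t (Iio n) = e := by
    filter_upwards [he, heq] with t h1 h2
    rw [h2 (Iio n) (Iio_subset_Iio hmn) Iio_subset_Iic_self, h1]
  refine ⟨⟨fun _ => ⟨e, hsum⟩, fun hS => ⟨e, ?_⟩⟩, e, ?_⟩
  · filter_upwards [hsum, nhdsWithin_le_nhds hb.eventually_abs] with t h1 h2
    rw [h1, hoff, add_zero]
    intro hmem
    have := ((hb.domain t h2 n ⟨hmn, le_rfl⟩).1 hmem).2.2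
    linarith [(hb.right_mem t h2).2]
  · filter_upwards [(tendsto_regular q).eventually he, (tendsto_regular q).eventually heq,
      nhdsWithin_le_nhds hb.eventually_near] with r h1 h2 h3
    rw [h2 (Iic (yc Φ r)) (fun z hz => (le_of_lt hz).trans h3.2.1) (Iic_subset_Iic.2 h3.2.2), h1]

-- On the forked side the sum gains `c` at the lower branch and the interval at height `n` has
-- weight `b`. On the other side nothing is crossed and the interval has weight `a`. As `a + b + c =
-- 0`, the corrected sum at `n` is the same on both sides. The uncorrected clause at `n` is vacuous,
-- because `q` belongs to the interval and is lower than `n`.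
omit hoff in
theorem isCrossing_of_split {σ : ℝ} {g : ℝ → ℝ} {δ : ℝ} (hqS : q ∈ S)
    (hb : SplitBox Φ D C q σ f g m n δ) : IsCrossing Φ D C S ζ q m n := by
  have hmn := (hb.lower.trans hb.upper).le
  have h0 : |xc Φ q - xc Φ q| < δ := by simpa using hb.pos
  obtain ⟨a, b, c, habc, hev⟩ := hζ.split q hqS _ _ _ _ _ _ hb
  have hcurve : ∀ t, |t - xc Φ q| < δ → t ∈ regVals Φ S → ∀ z ∈ Icc m n, pt Φ t z ∈ C →
      t ∈ side σ (xc Φ q) ∧ (z = f t ∨ z = g t) := fun t ht htR z hz hzC => by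
    obtain ⟨h4, h5⟩ := (hb.curve t ht z hz).1 hzC
    refine ⟨(mem_side_or hb.sign (htR q hqS).symm).resolve_right fun hc => ?_, h5⟩
    have : 0 < -σ * (t - xc Φ q) := hc
    linarith
  have hoff : ∀ᶠ t in 𝓝[regVals Φ S] (xc Φ q), t ∉ side σ (xc Φ q) →
      topSum Φ D ζ t (Iio n) = topSum Φ D ζ t (Iio m) := by
    filter_upwards [nhdsWithin_le_nhds hb.eventually_abs, self_mem_nhdsWithin] with t h1 h2 h3
    exact topSum_eq (Iio_subset_Iio hmn) fun z hz hzm hzT => absurd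
      (hcurve t h1 h2 z ⟨not_lt.1 hzm, le_of_lt hz⟩ (h.mem_curve_of_mem_tops hzT)).1 h3
  have hon : ∀ᶠ t in 𝓝[regVals Φ S] (xc Φ q), t ∈ side σ (xc Φ q) → ∀ J, Iio m ⊆ J → f t ∈ J →
      J ⊆ Iic n → topSum Φ D ζ t J = topSum Φ D ζ t (Iio m) + c := by
    filter_upwards [nhdsWithin_le_nhds hb.eventually_abs, self_mem_nhdsWithin,
      nhdsWithin_le_nhds hev] with t h1 h2 h3 hσ J hJ hfJ hJn
    have htop := hb.isTop_left h1 hσ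
    rw [← (h3.2 hσ).2, hζ.congr _ _ htop.1]
    refine topSum_eq_add (h.finite_tops h2) hJ hfJ (not_lt.2 (hb.left_mem t h1).1.le) htop.self
      fun z hz hzm hzT => ?_
    refine (hcurve t h1 h2 z ⟨not_lt.1 hzm, hJn hz⟩ (h.mem_curve_of_mem_tops hzT)).2.resolve_right ?_
    rintro rfl
    have hlt := (hb.right_mem t h1).2
    have := hzT.2 _ (hb.rel_upper h1 (left_mem_Icc.2 hlt.le) (right_mem_Icc.2 hlt.le))
    rw [yc_pt, yc_pt] at this
    linarith
  refine ⟨hb.lower, hb.upper, fun y hy hyC => ?_, fun hst => ?_⟩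
  · have := ((hb.curve _ h0 y hy).1 hyC).2
    rwa [hb.left_eq, hb.right_eq, or_self] at this
  obtain ⟨e, he⟩ := hst.1 fun s hs hr => by
    rw [← h.injOn_critical hqS hs (by simpa using hr.1)]
    exact hb.lower.le
  refine ⟨⟨fun hS => ?_, fun _ => ⟨e + a, ?_⟩⟩, e + c, ?_⟩
  · have := hS q hqS (hb.rel_center (right_mem_Icc.2 hmn)).symm
    exact absurd hb.upper (not_lt.2 this)
  · filter_upwards [he, hoff, hon, nhdsWithin_le_nhds hev, nhdsWithin_le_nhds hb.eventually_abs,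
      self_mem_nhdsWithin] with t h1 h2 h3 h4 h5 h6
    by_cases hσ : t ∈ side σ (xc Φ q)
    · rw [h3 hσ _ (Iio_subset_Iio hmn) (hb.left_mem t h5).2 Iio_subset_Iic_self, (h4.2 hσ).1, h1]
      have := CharTwo.add_self_eq_zero b
      have := CharTwo.add_self_eq_zero c
      grind
    · have hσ' := (mem_side_or hb.sign (h6 q hqS).symm).resolve_left hσ
      rw [h2 hσ, h1]
      have hrel := hb.rel_across h5 hσ (left_mem_Icc.2 hmn) (right_mem_Icc.2 hmn)
      rw [← hζ.congr _ _ hrel, h4.1 hσ']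
  · filter_upwards [(tendsto_regular q).eventually he, (tendsto_regular q).eventually hon,
      nhdsWithin_le_nhds hb.eventually_near, self_mem_nhdsWithin] with r h1 h2 h3 h4
    obtain ⟨hσ, h5⟩ := hcurve _ h3.1 h4.2 _ h3.2 (by rw [pt_xc_yc]; exact h4.1)
    have hle : f (xc Φ r) ≤ yc Φ r := by
      rcases h5 with h5 | h5
      · exact h5.ge
      · rw [h5]
        exact (hb.lt _ h3.1 hσ).le
    rw [h2 hσ (Iic (yc Φ r)) (fun z hz => (le_of_lt hz).trans h3.2.1) hle (Iic_subset_Iic.2 h3.2.2), h1]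

theorem exists_crossing (hq : q ∈ C) : ∃ m n, IsCrossing Φ D C S ζ q m n := by
  by_cases hqS : q ∈ S
  · obtain ⟨σ, f, g, m, n, δ, hb | hb⟩ := h.exists_fold_box hqS
    · exact ⟨m, n, hζ.isCrossing_of_leaf h hoff hqS hb⟩
    · exact ⟨m, n, hζ.isCrossing_of_split h hqS hb⟩
  · obtain ⟨s, f, rfl | rfl, hf⟩ := h.graph q hq hqS
    · exact hζ.exists_crossing_of_top h hoff hqS hf
    · exact hζ.exists_crossing_of_bottom h hoff hqS hf

/-- Stability holds at all heights outside the curve. -/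
theorem isStable {t₀ : ℝ} (hm : pt Φ t₀ m ∉ C) : IsStable Φ D S ζ t₀ m := by
  set K := {y | pt Φ t₀ y ∈ C} with hK
  have hfin : K.Finite := by
    obtain ⟨B, hB⟩ := h.bounded t₀ t₀
    have hcpt : IsCompact K := (isCompact_Icc (a := -B) (b := B)).of_isClosed_subset
      (h.isClosed_curve.preimage (f := fun y => pt Φ t₀ y) (by fun_prop)) fun y hy =>
        abs_le.1 (hB t₀ (by simp) y hy).le
    refine hcpt.finite ?_
    rw [isDiscrete_iff_forall_mem_exists_isOpen]
    intro y hy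
    obtain ⟨a, b, hab⟩ := hζ.exists_crossing h hoff (q := pt Φ t₀ y) hy
    obtain ⟨ha, hb, hun, -⟩ := hab
    rw [yc_pt] at ha hb hun
    rw [xc_pt] at hun
    refine ⟨Ioo a b, isOpen_Ioo, ?_⟩
    ext z
    constructor
    · rintro ⟨hz1, hz2⟩
      exact hun z (Ioo_subset_Icc_self hz1) hz2
    · rintro rfl
      exact ⟨⟨ha, hb⟩, hy⟩
  -- Induction on the number of curve points below height `m`: the highest of them is crossed, and
  -- the rest of the way up to `m` misses the curve.
  induction hN : (K ∩ Iio m).ncard using Nat.strong_induction_on generalizing m with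
  | _ N ih =>
    have hfin' : (K ∩ Iio m).Finite := hfin.subset inter_subset_left
    rcases (K ∩ Iio m).eq_empty_or_nonempty with hemp | hne
    · have hbelow : ∀ y ≤ m, pt Φ t₀ y ∉ C := fun y hy hyC => by
        rcases hy.lt_or_eq with h1 | rfl
        · exact (hemp ▸ (⟨hyC, h1⟩ : y ∈ K ∩ Iio m) : y ∈ (∅ : Set ℝ))
        · exact hm hyC
      -- With no curve below `m`, nearby lines have no tops there either: the tube lemma covers the
      -- heights above `-B`, and boundedness of the curve the others.
      obtain ⟨B, hB⟩ := h.bounded (t₀ - 1) (t₀ + 1)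
      have hsum : ∀ᶠ t in 𝓝 t₀, topSum Φ D ζ t (Iio m) = 0 := by
        filter_upwards [eventually_forall_pt_mem (Φ := Φ) isCompact_Icc
          h.isClosed_curve.isOpen_compl (K := Icc (-B) m) fun y hy => hbelow y hy.2,
          Icc_mem_nhds (a := t₀ - 1) (b := t₀ + 1) (by linarith) (by linarith)] with t h1 h2
        refine topSum_zero fun y hy hyT => absurd (h.mem_curve_of_mem_tops hyT) fun hyC => ?_
        exact h1 y ⟨(abs_lt.1 (hB t h2 y hyC)).1.le, le_of_lt hy⟩ hyC
      refine ⟨fun _ => ⟨0, nhdsWithin_le_nhds hsum⟩, fun hS => ⟨ζ (pt Φ t₀ m), ?_⟩⟩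
      have hmS : ∀ s ∈ S, ¬ Rel Φ D (pt Φ t₀ m) s := fun s hs hr => by
        refine hbelow _ (hS s hs hr) ?_
        rw [pt_yc_of_rel hr]
        exact h.critical_subset hs
      filter_upwards [nhdsWithin_le_nhds hsum, nhdsWithin_le_nhds (hζ.eventually_pt h hoff hm hmS)]
        with t h1 h2
      rw [h1, h2, zero_add]
    · obtain ⟨y, ⟨hyC, hym⟩, hmax⟩ := exists_max_image _ id hfin' hne
      obtain ⟨a, b, hab⟩ := hζ.exists_crossing h hoff (q := pt Φ t₀ y) hyC
      obtain ⟨ha, hb, hun, hst⟩ := hab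
      simp only [yc_pt, xc_pt] at ha hb hun hst
      rw [mem_Iio] at hym
      refine hζ.isStable_of_segment h hoff (m := b) (fun z hz hzC => ?_) (hst (ih _ ?_ ?_ rfl)).1
      · rcases le_or_gt z b with hzb | hzb
        · have hyz : y < z := (lt_min hb hym).trans_le hz.1
          exact hyz.ne' (hun z ⟨by linarith, hzb⟩ hzC)
        · have h1 : z ≤ m := by
            rcases mem_uIcc.1 hz with h1 | h1
            · exact h1.2
            · linarith [h1.2]
          rcases h1.lt_or_eq with h2 | rfl
          · have := hmax z ⟨hzC, h2⟩
            simp only [id] at this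
            linarith
          · exact hm hzC
      · rw [← hN]
        refine ncard_lt_ncard ⟨?_, fun hsub => ?_⟩ hfin'
        · exact fun z hz => ⟨hz.1, lt_trans hz.2 (ha.trans hym)⟩
        · exact absurd (hsub ⟨hyC, hym⟩).2 (not_lt.2 ha.le)
      · exact fun haC => ha.ne (hun a ⟨le_rfl, by linarith⟩ haC)

end Cocycle

end

end PoincareReeb

namespace PoincareReeb

open Set Topology

/-! ### Every weight satisfying the conservation law is an end sum. -/

section

variable {P : Type*} [TopologicalSpace P] {Φ : P ≃ₜ ℝ × ℝ} {D C S : Set P} {ζ : P → ZMod 2} {M : ℝ}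

namespace Cocycle

variable (hζ : Cocycle Φ D C S ζ) (h : Geometry Φ D C S) (hoff : ∀ p ∉ D, ζ p = 0)
include hζ h hoff

/-- The sum over all vertical intervals over a regular value that are bounded above, together with
the one that is not, vanishes. -/
theorem exists_total_eq_zero {a : ℝ} (ha : a ∈ regVals Φ S) (m : ℝ) :
    ∃ n ≥ m, topSum Φ D ζ a (Iio n) + ζ (pt Φ a n) = 0 := by
  obtain ⟨M, hM⟩ := (h.finite_critical.image fun p => |xc Φ p|).bddAbove
  have hM' : ∀ s ∈ S, |xc Φ s| < M + 1 := fun s hs => (hM ⟨s, hs, rfl⟩).trans_lt (lt_add_one M)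
  -- Over `b` all weights vanish, so the total there is zero. At a height above the curve the total
  -- extends to a locally constant function on `[a, b]`, hence it is also zero over `a`.
  set b := max a (M + 1) with hb
  have hab : a ≤ b := le_max_left _ _
  have hbS : ∀ s ∈ S, |xc Φ s| < |b| := fun s hs =>
    (hM' s hs).trans_le ((le_max_right _ _).trans (le_abs_self _))
  have hbR : b ∈ regVals Φ S := fun s hs hsb => by
    have := hbS s hs
    rw [hsb] at this
    exact this.false
  obtain ⟨B, hB⟩ := h.bounded a b
  set n := max m B with hn
  have hnC : ∀ t ∈ Icc a b, ∀ y, pt Φ t y ∈ C → y < n := fun t ht y hy =>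
    (abs_lt.1 (hB t ht y hy)).2.trans_le (le_max_right _ _)
  obtain ⟨w, hw, hwF⟩ := exists_locally_constant_extension (A := Icc a b) (R := regVals Φ S)
    (fun t _ => h.neBot_regVals t) (F := fun t => topSum Φ D ζ t (Iio n) + ζ (pt Φ t n))
    fun t ht => (hζ.isStable h hoff fun hC => (hnC t ht n hC).false).2 fun s hs hr => by
      refine (hnC t ht _ ?_).le
      rw [pt_yc_of_rel hr]
      exact h.critical_subset hs
  refine ⟨n, le_max_left _ _, ?_⟩
  rw [← hwF a ⟨left_mem_Icc.2 hab, ha⟩, eq_of_isPreconnected isPreconnected_Icc hw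
    (left_mem_Icc.2 hab) (right_mem_Icc.2 hab), hwF b ⟨right_mem_Icc.2 hab, hbR⟩]
  have hfar : ∀ y, ζ (pt Φ b y) = 0 := fun y => by
    by_cases hy : pt Φ b y ∈ D
    · exact hζ.far _ hy (by rwa [xc_pt])
    · exact hoff _ hy
  rw [hfar, topSum_zero fun y _ _ => hfar y, add_zero]

/-- The value of `w` at a regular curve point is the sum of the weights of the intervals whose top
is at most as high. From the bottom to the top of an interval the sum grows by its own weight. For
an interval unbounded above, `exists_total_eq_zero` replaces the missing top value. -/
theorem exists_endSum_eq_of_off (hM : ∀ s ∈ S, |xc Φ s| < M) : ∃ w : PoincareReeb.locConst Φ C M,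
    ∀ p ∈ D, xc Φ p ∈ regVals Φ S → endSum Φ D w.1 p = ζ p := by
  classical
  obtain ⟨w, hw, hwF⟩ := exists_locally_constant_extension (A := C)
    (R := C ∩ xc Φ ⁻¹' regVals Φ S) (fun q hq => h.neBot_regular_curve hq)
    (F := fun r => topSum Φ D ζ (xc Φ r) (Iic (yc Φ r))) fun q hq => by
      obtain ⟨m, n, h1, h2, h3, h4⟩ := hζ.exists_crossing h hoff hq
      exact (h4 (hζ.isStable h hoff fun hmC => h1.ne (h3 m ⟨le_rfl, by linarith⟩ hmC))).2
  have hval : ∀ q ∈ C, xc Φ q ∈ regVals Φ S →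
      C.indicator w q = topSum Φ D ζ (xc Φ q) (Iic (yc Φ q)) := fun q hq hqR => by
    rw [indicator_of_mem hq, hwF q ⟨hq, hq, hqR⟩]
  refine ⟨⟨C.indicator w, fun q hq => indicator_of_notMem hq w, fun q hq => ?_,
    fun q hq hqM => ?_⟩, ?_⟩
  · filter_upwards [hw q hq, self_mem_nhdsWithin] with r hr hrC
    rw [indicator_of_mem hq, indicator_of_mem hrC, hr]
  · have hqS : ∀ s ∈ S, |xc Φ s| < |xc Φ q| := fun s hs => (hM s hs).trans_le hqM
    rw [hval q hq fun s hs hsq => by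
      have := hqS s hs
      rw [hsq] at this
      exact this.false]
    exact topSum_zero fun y _ hy => hζ.far _ (h.curve_subset (h.mem_curve_of_mem_tops hy))
      (by rwa [xc_pt])
  · intro p hp hpR
    set t := xc Φ p with ht
    have hpt : ∀ q, Rel Φ D p q → pt Φ t (yc Φ q) = q := fun q hq => by
      rw [ht, hq.1, pt_xc_yc]
    -- `J` consists of the heights up to the bottom of the interval, and is empty if there is no
    -- bottom. In both cases the sum over `J` is the bottom value, including the default `0`.
    obtain ⟨J, hJ1, hJ2, hJ3, hJ4⟩ : ∃ J, topVal (PoincareReeb.flip Φ) D (C.indicator w) p =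
        topSum Φ D ζ t J ∧ J ⊆ Iic (yc Φ p) ∧ (∀ z ≤ yc Φ p, z ∉ J → Rel Φ D p (pt Φ t z)) ∧
        ∀ q, IsTop Φ D p q → yc Φ q ∉ J := by
      rcases exists_isTop_or (Φ := PoincareReeb.flip Φ) h.isClosed hp with ⟨b, hb⟩ | hray
      · have hb1 := rel_flip.1 hb.1
        have hbC := h.flip.mem_curve_of_isTop hb
        have hbR : xc Φ b ∈ regVals Φ S := by rwa [← hb1.1]
        have hbp := hb.2 p (rel_flip.2 (Rel.refl hp))
        rw [yc_flip, yc_flip, neg_le_neg_iff] at hbp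
        refine ⟨Iic (yc Φ b), ?_, Iic_subset_Iic.2 hbp, fun z hz hzb => ?_, fun q hq hqb => ?_⟩
        · rw [topVal_of_isTop _ hb, hval b hbC hbR, ← hb1.1]
        · exact hb1.of_mem (mem_uIcc.2 (Or.inr ⟨(not_le.1 hzb).le, hz⟩))
        · have hpq := hq.2 b hb1
          obtain rfl : q = b := ext_coords (Φ := Φ) (hq.1.1.symm.trans hb1.1) (le_antisymm hqb hpq)
          exact h.not_isTop_flip (notMem_of_regVals hbR) hq.self hb.self
      · refine ⟨∅, ?_, empty_subset _, fun z hz _ => rel_pt_right.2 ⟨rfl, fun y hy => ?_⟩,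
          fun _ _ => notMem_empty _⟩
        · rw [topVal_of_not_exists _ (not_exists_isTop hray), topSum_zero fun y hy => absurd hy
            (notMem_empty y)]
        · rw [uIcc_of_ge hz] at hy
          have := hray (-y) (by rw [yc_flip]; linarith [hy.2])
          rwa [pt_flip, neg_neg] at this
    change topVal Φ D (C.indicator w) p + _ = _
    rw [hJ1]
    rcases exists_isTop_or (Φ := Φ) h.isClosed hp with ⟨q, hq⟩ | hray
    · have hqC := h.mem_curve_of_isTop hq
      have hqR : xc Φ q ∈ regVals Φ S := by rwa [← hq.1.1]
      have hpq := hq.2 p (Rel.refl hp)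
      have hqT : yc Φ q ∈ tops Φ D t := by
        change IsTop Φ D _ _
        rw [hpt q hq.1]
        exact hq.self
      have hadd : topSum Φ D ζ t (Iic (yc Φ q)) = topSum Φ D ζ t J + ζ (pt Φ t (yc Φ q)) := by
        refine topSum_eq_add (h.finite_tops hpR) (fun z hz => (hJ2 hz).trans hpq) self_mem_Iic
          (hJ4 q hq) hqT fun z hz hzJ hzT => ?_
        have hr : Rel Φ D p (pt Φ t z) := by
          rcases le_total z (yc Φ p) with h1 | h1
          · exact hJ3 z h1 hzJ
          · exact hq.1.of_mem (mem_uIcc.2 (Or.inl ⟨h1, hz⟩))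
        have := hzT.2 q (hr.symm.trans hq.1)
        rw [yc_pt] at this
        exact le_antisymm hz this
      rw [topVal_of_isTop _ hq, hval q hqC hqR, ← hq.1.1, ← ht, hadd, hpt q hq.1,
        ← hζ.congr _ _ hq.1, add_right_comm, CharTwo.add_self_eq_zero, zero_add]
    · obtain ⟨n, hn, htot⟩ := hζ.exists_total_eq_zero h hoff hpR (yc Φ p + 1)
      rw [topVal_of_not_exists _ (not_exists_isTop hray), zero_add]
      have hpn : Rel Φ D p (pt Φ t n) := rel_pt_right.2 ⟨rfl, fun z hz => by
        rw [uIcc_of_le (by linarith)] at hz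
        exact hray z hz.1⟩
      have hsum : topSum Φ D ζ t (Iio n) = topSum Φ D ζ t J := by
        refine topSum_eq (fun z hz => ?_) fun z _ hzJ hzT => absurd hzT ?_
        · have := hJ2 hz
          rw [mem_Iic] at this
          rw [mem_Iio]
          linarith
        · have hzr : ∀ y, z ≤ y → pt Φ t y ∈ D := fun y hy => by
            rcases le_total y (yc Φ p) with h1 | h1
            · exact (rel_pt_right.1 (hJ3 z (hy.trans h1) hzJ)).2 y (mem_uIcc.2 (Or.inr ⟨hy, h1⟩))
            · exact hray y h1
          exact notMem_tops_of_segment (lt_add_one z) fun y hy => hzr y hy.1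
      rw [hsum, ← hζ.congr _ _ hpn] at htot
      exact CharTwo.add_eq_zero.1 htot

omit hoff in
theorem exists_endSum_eq (hM : ∀ s ∈ S, |xc Φ s| < M) : ∃ w : PoincareReeb.locConst Φ C M,
    ∀ p ∈ D, xc Φ p ∈ regVals Φ S → endSum Φ D w.1 p = ζ p := by
  obtain ⟨w, hw⟩ := hζ.indicator.exists_endSum_eq_of_off h
    (fun p hp => indicator_of_notMem hp ζ) hM
  exact ⟨w, fun p hp hpR => (hw p hp hpR).trans (indicator_of_mem hp ζ)⟩

end Cocycle

end

end PoincareReeb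

namespace PoincareReeb

open Set Topology

/-! ### Rank and nullity: the number of ovals. -/

namespace Geometry

variable {P : Type*} [TopologicalSpace P] {Φ : P ≃ₜ ℝ × ℝ} {D C S G : Set P} {κ : P → P} {M : ℝ}
variable (h : Geometry Φ D C S)
include h

/-- Regular abscissas are dense, and a horizontal path at a regular height is collapsed into the
edge near any of its points. -/
theorem exists_regular_mem_edge (hκ : Collapse Φ D G κ) {E : Set P}
    (hE : E ∈ components (G \ crit Φ D G S)) :
    ∃ p ∈ D, xc Φ p ∈ regVals Φ S ∧ κ p ∈ E := by
  obtain ⟨g, hg, rfl⟩ := hE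
  have hgD := hκ.subset hg.1
  have hgS := rel_crit_of_notMem hg
  obtain ⟨m, hm, hr, -⟩ := h.exists_regular_height hgD fun hS => hgS g hS (Rel.refl hgD)
  have hlim : Filter.Tendsto (fun t => pt Φ t m) (𝓝[regVals Φ S] (xc Φ g)) (𝓝 (pt Φ (xc Φ g) m)) :=
    (Continuous.tendsto (by fun_prop) _).mono_left nhdsWithin_le_nhds
  have hnhds := h.mem_nhds hr.right_mem hm
  have hev := h.eventually_mem_edge hκ hr.right_mem fun s hs hrs => hgS s hs (hr.trans hrs)
  rw [nhdsWithin_eq_nhds.2 hnhds, ← hκ.eq_of_rel _ _ hr, hκ.eq_self hg.1] at hev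
  have := h.neBot_regVals (xc Φ g)
  obtain ⟨t, ⟨ht1, ht2⟩, ht3⟩ :=
    (((hlim.eventually hnhds).and (hlim.eventually hev)).and self_mem_nhdsWithin).exists
  exact ⟨_, ht1, by rwa [xc_pt], ht2⟩

/-- The cycles are the sums of the values at both ends. -/
theorem map_ker_boundaryMap (hM : ∀ s ∈ S, |xc Φ s| < M) (hκ : Collapse Φ D G κ)
    (hV : vertices (xc Φ) D G = crit Φ D G S) [Finite (openEdges (xc Φ) D G)] :
    (LinearMap.ker (boundaryMap (xc Φ) D G)).map
      (Finsupp.linearEquivFunOnFinite (ZMod 2) (ZMod 2) (openEdges (xc Φ) D G)).toLinearMap =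
      LinearMap.range (h.edgeSum G M) := by
  ext z
  rw [Submodule.mem_map, LinearMap.mem_range]
  constructor
  · rintro ⟨z, hz, rfl⟩
    obtain ⟨w, hw⟩ := (h.cocycle_edgeVal hκ hV z hz).exists_endSum_eq h hM
    refine ⟨w, funext fun E => ?_⟩
    obtain ⟨p, hp, hpR, hpE⟩ := h.exists_regular_mem_edge hκ ((openEdges_eq hV).subset E.2)
    rw [h.edgeSum_apply hκ hV w E hp hpE, hw p hp hpR]
    exact edgeVal_of_mem _ E hpE
  · rintro ⟨w, rfl⟩
    refine ⟨(Finsupp.linearEquivFunOnFinite (ZMod 2) (ZMod 2) _).symm (h.edgeSum G M w),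
      h.boundaryMap_edgeSum hκ hV w _ ?_, ?_⟩
    · ext E
      simp
    · exact LinearEquiv.apply_symm_apply _ _

/-- A component of `G` has an arrowhead exactly when it leaves the strip, since it then meets `|x| =
M`, where each point lies on an arrow-carrying edge. -/
theorem ncard_components (hM0 : 0 < M) (hM : ∀ s ∈ S, |xc Φ s| < M) (hκ : Collapse Φ D G κ)
    (hV : vertices (xc Φ) D G = crit Φ D G S) :
    b0 G = (nearComponents Φ G M).ncard + (arrowComponents (xc Φ) D G).ncard := by
  have hG := h.graph_fibredCurve hκ
  have hMV : ∀ p ∈ crit Φ D G S, |xc Φ p| < M := by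
    rintro p ⟨-, s, hs, hps⟩
    rw [hps.1]
    exact hM s hs
  have hiff : ∀ K ∈ components G, (∃ a ∈ arrows (xc Φ) D G, a.1 ⊆ K) ↔ ¬ ∀ p ∈ K, |xc Φ p| < M := by
    intro K hK
    push Not
    constructor
    · rintro ⟨⟨E, d⟩, ⟨-, hd⟩, hEK⟩
      cases d with
      | right =>
        obtain ⟨_, ⟨p, hp, rfl⟩, hpM⟩ := not_bddAbove_iff.1 hd M
        exact ⟨p, hEK hp, hpM.le.trans (le_abs_self _)⟩
      | left =>
        obtain ⟨_, ⟨p, hp, rfl⟩, hpM⟩ := not_bddBelow_iff.1 hd (-M)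
        exact ⟨p, hEK hp, by linarith [neg_abs_le (xc Φ p)]⟩
    · rintro ⟨p, hp, hpM⟩
      obtain ⟨q, hq, hqM⟩ := hG.exists_abs_eq hM0 hMV (component_subset hK hp) hpM
      have hqK := smooth_component_subset hK hp hq
      exact ⟨_, (h.bijOn_arrows hκ hV hM0 hM).mapsTo ⟨component_subset hK hqK, hqM⟩,
        smooth_component_subset hK hqK⟩
  have hsplit : components G = nearComponents Φ G M ∪ arrowComponents (xc Φ) D G := by
    ext K
    refine ⟨fun hK => ?_, fun hK => hK.elim (fun h1 => h1.1) fun h1 => h1.1⟩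
    by_cases hn : ∀ p ∈ K, |xc Φ p| < M
    · exact Or.inl ⟨hK, hn⟩
    · exact Or.inr ⟨hK, (hiff K hK).2 hn⟩
  have hfin := hG.finite_components
  rw [b0, hsplit, ncard_union_eq (disjoint_left.2 fun K h1 h2 => (hiff K h1.1).1 h2.2 h1.2)
    (hfin.subset fun K hK => hK.1) (hfin.subset fun K hK => hK.1)]

/-- The number of ovals in terms of the graph. -/
theorem ncard_ovals_add (hκ : Collapse Φ D G κ) (hV : vertices (xc Φ) D G = crit Φ D G S)
    (hloc : ∀ p : C, ∃ e : ℝ → C, IsOpenEmbedding e ∧ p ∈ range e) :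
    (ovals C).ncard + (arrowComponents (xc Φ) D G).ncard = b0 G + b1 (xc Φ) D G := by
  obtain ⟨M, hM0, hM⟩ : ∃ M : ℝ, 0 < M ∧ ∀ p ∈ S, |xc Φ p| < M := by
    obtain ⟨M, hM⟩ := (h.finite_critical.image fun p => |xc Φ p|).bddAbove
    refine ⟨max M 0 + 1, by positivity, fun p hp => ?_⟩
    have := hM ⟨p, hp, rfl⟩
    change |xc Φ p| ≤ M at this
    linarith [le_max_left M 0]
  have := (h.finite_openEdges hκ hV).to_subtype
  have := finite_locConst (M := M) h.fibredCurve
  have hovals : ovals C = nearComponents Φ C M := by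
    ext K
    exact ⟨fun hK => ⟨hK.1, (h.fibredCurve.oval_iff hloc hM hK.1).1 hK⟩,
      fun hK => (h.fibredCurve.oval_iff hloc hM hK.1).2 hK.2⟩
  have hb1 : b1 (xc Φ) D G = Module.finrank (ZMod 2) (LinearMap.range (h.edgeSum G M)) := by
    rw [b1, ← h.map_ker_boundaryMap hM hκ hV]
    exact (LinearEquiv.finrank_map_eq _ _).symm
  have hker : Module.finrank (ZMod 2) (LinearMap.ker (h.edgeSum G M)) =
      (nearComponents Φ G M).ncard := by
    rw [← h.range_lift hκ hV, LinearMap.finrank_range_of_inj (h.injective_lift hκ),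
      finrank_locConst (h.graph_fibredCurve hκ)]
  -- The range has dimension `b₁`, the kernel that of the functions on `G`, and the source as many
  -- dimensions as there are ovals.
  have hrank := LinearMap.finrank_range_add_finrank_ker (h.edgeSum G M)
  rw [finrank_locConst h.fibredCurve, ← hovals, ← hb1, hker] at hrank
  rw [h.ncard_components hM0 hM hκ hV]
  omega

end Geometry

end PoincareReeb

/-! ### Conclusion. -/

theorem mainTheorem10 {P : Type*} [TopologicalSpace P] (π : P → ℝ)
    (hπ : PoincareReeb.IsVerticalPlane π) (D : Set P)
    (hD : PoincareReeb.IsWeaklyFiniteType π D) (hgen : PoincareReeb.IsGenericDomain π D)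
    (G : Set P) (hG : PoincareReeb.IsReebGraph π D G) :
    ((PoincareReeb.components (PoincareReeb.boundary D)).Finite ∧
      (PoincareReeb.openEdges π D G).Finite ∧
      (PoincareReeb.components G).Finite) ∧
    ((PoincareReeb.lines (PoincareReeb.boundary D)).ncard : ℚ) =
      (PoincareReeb.arrowsWithoutFeathers π D G).ncard +
        (1 / 2) * (PoincareReeb.arrowsWithSimpleFeathers π D G).ncard ∧
    ((PoincareReeb.ovals (PoincareReeb.boundary D)).ncard : ℤ) =
      PoincareReeb.b0 G + PoincareReeb.b1 π D G -
        (PoincareReeb.arrowComponents π D G).ncard := by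
  obtain ⟨Φ, hΦ⟩ := PoincareReeb.exists_homeomorph_of_trivializations hπ.2
  obtain rfl : π = PoincareReeb.xc Φ := funext fun p => (hΦ p).symm
  have hgeom := PoincareReeb.geometry_of_isWeaklyFiniteType hD hgen
  have : Nonempty P := hD.boundary_nonempty.nonempty
  obtain ⟨κ, hκ⟩ := PoincareReeb.exists_collapse hG
  have hV := PoincareReeb.vertices_eq_crit (Φ := Φ) hκ.subset
  have hloc := PoincareReeb.exists_isOpenEmbedding_boundary (D := D)
    (Φ.trans Complex.equivRealProdCLM.symm.toHomeomorph)
  refine ⟨⟨hgeom.fibredCurve.finite_components, hgeom.finite_openEdges hκ hV,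
    (hgeom.graph_fibredCurve hκ).finite_components⟩, ?_, ?_⟩
  · have hlines := hgeom.two_mul_ncard_lines hκ hV hloc
    have hlines' : (2 : ℚ) * (PoincareReeb.lines (PoincareReeb.boundary D)).ncard =
        2 * (PoincareReeb.arrowsWithoutFeathers (PoincareReeb.xc Φ) D G).ncard +
          (PoincareReeb.arrowsWithSimpleFeathers (PoincareReeb.xc Φ) D G).ncard := by
      exact_mod_cast hlines
    linarith
  · have hovals := hgeom.ncard_ovals_add hκ hV hloc
    omega
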